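/- **Setup.** Let $p$ be a prime, $K/\mathbb{Q}_p$ a finite unramified extension, $O$ its ring of integers, and let $\sigma$ be the Frobenius of $K$ (so $\sigma(a)\equiv a^p \bmod pO$ for $a\in O$). Let $\mathcal{G}$ be a compact pro-$p$ $p$-adic Lie group of dimension one with a finite normal subgroup $H$ and $\mathcal{G}/H=\Gamma\cong\mathbb{Z}_p$. Fix a splitting $\Gamma\hookrightarrow\mathcal{G}$ and a topological generator $\gamma$ of $\Gamma$, so $\mathcal{G}\cong H\rtimes\Gamma$, and fix $e\ge 0$ such that $\Gamma^{p^e}$ acts trivially on $H$; then $\Gamma^{p^e}$ is central. Put $G=\mathcal{G}/\Gamma^{p^e}$ and let $C(G)$ be the set of cyclic subgroups of $G$. For $g\in G$ let $\tilde g=h\gamma^a$ ($h\in H$, $0\le a<p^e$) be its distinguished lift to $\mathcal{G}$. For a commutative ring $R$ with a homomorphism $\Gamma^{p^e}\to R^\times$ and a subgroup $P\le G$, let $R[P]^\tau$ be the free $R$-module on symbols $\bar g$ ($g\in P$), with $R$ central and $\bar g\,\bar h=\tau(g,h)\,\overline{gh}$, where $\tau(g,h)$ is the image of $\tilde g\tilde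 h(\widetilde{gh})^{-1}\in\Gamma^{p^e}$. It is commutative for $P$ cyclic. Let $R$ be one of the rings (a) $R=\Lambda_O(\Gamma^{p^e})$, for which $R[G]^\tau=\Lambda_O(\mathcal{G})$, or (b) $R=\widehat{\Lambda_O(\Gamma^{p^e})_{(p)}}$, the $p$-adic completion of the localisation at $(p)$, for which $R[G]^\tau=\widehat{\Lambda_O(\mathcal{G})_S}$ is the $p$-adic completion of the localisation of $\Lambda_O(\mathcal{G})$ at the canonical Ore set. Let $\varphi:R\to R$ be induced by $\sigma$ on $O$ and by $z\mapsto z^p$ on $\Gamma^{p^e}$. **Additive side.** Let $R'$ be $\varprojlim_U K[\Gamma^{p^e}/U]$ in case (a), with the topology of coefficientwise $p$-adic convergence, and $R'=R[\frac1p]$ with the $p$-adic topology in case (b). Let $R'[\mathrm{Conj}(G)]^\tau$ be the free $R'$-module on symbols $[\bar g]$, one for each conjugacy class of $G$; it receives $R[G]^\tau$ via $r\bar g\mapsto r[\bar g]$ (note $\bar x^{-1}\bar g\bar x=\overline{x^{-1}gx}$), and $\varphi$ acts on it by $r[\bar g]\mapsto\varphi(r)[\bar g^p]$. For $P\in C(G)$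 put $t^G_P([\bar g])=\sum_{x\in G/P,\ x^{-1}gx\in P}\overline{x^{-1}gx}\in R'[P]^\tau$. Let $\eta_P$ be the $R'$-linear endomorphism of $R'[P]^\tau$ which fixes $\bar g$ if $g$ generates $P$ and kills it otherwise, and put $\beta^G_P=\eta_P\circ t^G_P$. **Integral logarithm.** Let $\log u$ denote the class in $R'[\mathrm{Conj}(G)]^\tau$ of the trace of $\sum_{i\ge1}(-1)^{i+1}(u-1)^i/i$. In case (a), $\log:K_1(\Lambda_O(\mathcal{G}))\to R'[\mathrm{Conj}(G)]^\tau$ is the homomorphism given by this formula on classes of matrices congruent to $1$ modulo the Jacobson radical (every $x\in K_1$ has a positive power which is such a class), and $L(x)=\log(x)-\frac{\varphi}{p}\log(x)$. In case (b), write $x=uy$ with $u$ the class of a matrix congruent to $1$ modulo $J=\ker(R[G]^\tau\to R[\Gamma/\Gamma^{p^e}]^\tau)$ and $y\in(R[\Gamma/\Gamma^{p^e}]^\tau)^\times$, where $\Gamma\subset\mathcal{G}$ via the splitting, and put $L(x)=\log(u)-\frac{\varphi}{p}\log(u)+\frac1p\log\big(y^p/\varphi(y)\big)$. **Multiplicative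 side.** For $P\in C(G)$ let $\theta^G_P:K_1(R[G]^\tau)\to(R[P]^\tau)^\times$ be the norm, i.e. the determinant of the action on the free $R[P]^\tau$-module $R[G]^\tau$, and put $\theta^G=(\theta^G_P)_P$. For $P\ne1$ fix a non-trivial character $\omega_P:P\to\mu_p$ of order $p$, and write $\omega_P(r\bar g)=r\,\omega_P(g)\bar g$, with values in $R[\zeta_p][P]^\tau$, where $R[\zeta_p]=R[X]/\Phi_p(X)$. Define $\alpha_P:(R[P]^\tau)^\times\to(R[P]^\tau)^\times$ by $$\alpha_P(x)=\frac{x^p}{\prod_{k=0}^{p-1}\omega_P^k(x)}\quad(P\neq1),\qquad \alpha_{\{1\}}(x)=\frac{x^p}{\varphi(x)}.$$ Put $\alpha=(\alpha_P)_P$. For cyclic $P',P$ with $P'^p=P$ let $\mathrm{ver}^{P'}_P:R[P']^\tau\to R[P]^\tau$ be the ring homomorphism $r\bar g\mapsto\varphi(r)\bar g^p$, and put $$u^G_P\big((x_C)_{C\in C(G)}\big)=\prod_{P'\in C(G),\ P'^p=P,\ P'\ne P}\mathrm{ver}^{P'}_P(x_{P'}).$$ **Proposition.** In both cases (a) and (b),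 the maps $\alpha_P$ (with values in $(R[P]^\tau)^\times$) and $L$ are well defined, and for every cyclic subgroup $P$ of $G$ and every $x\in K_1(\Lambda_O(\mathcal{G}))$ (case (a)), respectively $x\in K_1(\widehat{\Lambda_O(\mathcal{G})_S})$ (case (b)), the logarithmic series on the right converges and $$\beta^G_P(L(x))=\frac1p\log\left(\frac{\alpha_P(\theta^G_P(x))}{u^G_P(\alpha(\theta^G(x)))}\right).$$ -/

import Mathlib

open scoped Classical

set_option linter.unusedSectionVars false

noncomputable section

namespace Iwasawa

/-! ### `K₁` of a ring -/

section KOne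

variable {A : Type*} [Ring A]

/-- The `m × n` matrix with ones at the places `(i, i)` and zeros elsewhere. -/
def incl (A : Type*) [Ring A] (m n : ℕ) : Matrix (Fin m) (Fin n) A :=
  Matrix.of fun i j => if (i : ℕ) = j then 1 else 0

theorem incl_mul_incl {k m n : ℕ} (h : k ≤ m ∨ n ≤ m) :
    incl A k m * incl A m n = incl A k n := by
  ext i j
  simp only [incl, Matrix.mul_apply, Matrix.of_apply, ite_mul, one_mul, zero_mul]
  by_cases hi : (i : ℕ) < m
  · rw [Finset.sum_eq_single ⟨i, hi⟩]
    · simp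
    · intro b _ hb
      rw [if_neg]
      intro h'; exact hb (Fin.ext h'.symm)
    · simp
  · rw [Finset.sum_eq_zero]
    · rw [if_neg]; intro h'; have := i.2; have := j.2; omega
    · intro b _; rw [if_neg]; have := b.2; omega

theorem incl_self (n : ℕ) : incl A n n = 1 := by
  ext i j
  simp [incl, Matrix.one_apply, Fin.ext_iff]

/-- The block matrix `diag (a, 1)` of size `m`, where `a` has size `n ≤ m`. -/
def stabMat (n m : ℕ) (a : Matrix (Fin n) (Fin n) A) : Matrix (Fin m) (Fin m) A :=
  1 + incl A m n * (a - 1) * incl A n m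

theorem stabMat_mul {n m : ℕ} (h : n ≤ m) (a b : Matrix (Fin n) (Fin n) A) :
    stabMat n m (a * b) = stabMat n m a * stabMat n m b := by
  have key : incl A n m * incl A m n = 1 := by rw [incl_mul_incl (Or.inl h), incl_self]
  have e : a * b - 1 = (a - 1) + (b - 1) + (a - 1) * (b - 1) := by noncomm_ring
  have e2 : incl A m n * (a - 1) * incl A n m * (incl A m n * (b - 1) * incl A n m)
      = incl A m n * ((a - 1) * (b - 1)) * incl A n m := by
    calc _ = incl A m n * (a - 1) * (incl A n m * incl A m n) * (b - 1) * incl A n m := by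
          simp only [Matrix.mul_assoc]
      _ = _ := by rw [key]; simp only [Matrix.mul_assoc, Matrix.one_mul]
  unfold stabMat
  rw [e, mul_add, mul_one, add_mul, e2]
  simp only [Matrix.mul_add, Matrix.add_mul, Matrix.one_mul]
  abel

/-- The embedding `GLₙ(A) → GLₘ(A)`, `a ↦ diag (a, 1)`, for `n ≤ m`. -/
def stab (A : Type*) [Ring A] (n m : ℕ) (h : n ≤ m) :
    GL (Fin n) A →* GL (Fin m) A :=
  Units.map
    { toFun := stabMat n m
      map_one' := by simp [stabMat]
      map_mul' := stabMat_mul h }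

instance : DirectedSystem (fun n : ℕ => GL (Fin n) A) (fun n m h => stab A n m h) where
  map_self n x := by
    ext1
    simp [stab, stabMat, incl_self]
  map_map k j i hij hjk x := by
    ext1
    have e : stabMat j k (stabMat i j x.1) = stabMat i k x.1 := by
      unfold stabMat
      rw [add_sub_cancel_left, Matrix.mul_assoc (incl A j i), ← Matrix.mul_assoc (incl A k j),
        incl_mul_incl (Or.inr hij), ← Matrix.mul_assoc, Matrix.mul_assoc,
        Matrix.mul_assoc, incl_mul_incl (Or.inl hij), ← Matrix.mul_assoc]
    exact e

/-- The stable general linear group `GL(A) = ⋃ₙ GLₙ(A)`. -/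
abbrev GLStable (A : Type*) [Ring A] : Type _ :=
  DirectLimit (fun n : ℕ => GL (Fin n) A) (fun n m h => stab A n m h)

/-- `K₁(A)`, the quotient of `GL(A)` by its commutator subgroup (which, by Whitehead's lemma, is the
subgroup `E(A)` generated by the elementary matrices). -/
abbrev K1 (A : Type*) [Ring A] : Type _ := Abelianization (GLStable A)

/-- The class in `K₁(A)` of an invertible matrix. -/
def K1.mk {n : ℕ} (g : GL (Fin n) A) : K1 A :=
  Abelianization.of (⟦⟨n, g⟩⟧ : GLStable A)

/-- The class in `K₁(A)` of a unit. -/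
def K1.ofUnit (a : Aˣ) : K1 A :=
  K1.mk (Units.map (Matrix.scalar (Fin 1) : A →+* Matrix (Fin 1) (Fin 1) A).toMonoidHom a)

theorem det_comp_stabMat {C I : Type*} [CommRing C] [Fintype I] [DecidableEq I] (ρ : A →+* Matrix I I C)
    {n m : ℕ} (h : n ≤ m) (a : Matrix (Fin n) (Fin n) A) :
    (Matrix.comp _ _ _ _ C ((stabMat n m a).map ρ)).det =
      (Matrix.comp _ _ _ _ C (a.map ρ)).det := by
  have hc : ∀ {k l r : ℕ} (x : Matrix (Fin k) (Fin l) A) (y : Matrix (Fin l) (Fin r) A),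
      Matrix.comp _ _ _ _ C ((x * y).map ρ) =
        Matrix.comp _ _ _ _ C (x.map ρ) * Matrix.comp _ _ _ _ C (y.map ρ) := by
    intro k l r x y
    ext ⟨i, i'⟩ ⟨j, j'⟩
    simp only [Matrix.comp_apply, Matrix.map_apply, Matrix.mul_apply, map_sum, map_mul,
      Matrix.sum_apply, Fintype.sum_prod_type]
  have h1 : ∀ k : ℕ, Matrix.comp _ _ _ _ C ((1 : Matrix (Fin k) (Fin k) A).map ρ) = 1 := by
    intro k
    rw [← RingHom.mapMatrix_apply, map_one]
    exact map_one (Matrix.compRingEquiv (Fin k) I C)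
  have ha : ∀ {k : ℕ} (x y : Matrix (Fin k) (Fin k) A),
      Matrix.comp _ _ _ _ C ((x + y).map ρ) =
        Matrix.comp _ _ _ _ C (x.map ρ) + Matrix.comp _ _ _ _ C (y.map ρ) := by
    intro k x y
    ext ⟨i, i'⟩ ⟨j, j'⟩
    simp [Matrix.comp_apply]
  have key : incl A n m * incl A m n = 1 := by rw [incl_mul_incl (Or.inl h), incl_self]
  unfold stabMat
  rw [ha, h1, hc, Matrix.det_one_add_mul_comm, ← hc, ← Matrix.mul_assoc, key, Matrix.one_mul,
    ← h1, ← ha, add_sub_cancel]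

/-- The homomorphism `K₁(A) → Cˣ`, `[g] ↦ det (ρ(g))`, attached to a matrix representation
`ρ : A → M_I(C)` over a commutative ring `C`; here `ρ(g)` is the block matrix `(ρ(g i j))`. -/
def K1.detHom {C I : Type*} [CommRing C] [Fintype I] [DecidableEq I] (ρ : A →+* Matrix I I C) :
    K1 A →* Cˣ :=
  Abelianization.lift
    { toFun := DirectLimit.lift _
        (fun n g => Units.map
          ((Matrix.detMonoidHom (n := Fin n × I) (R := C)).comp
            ((Matrix.compRingEquiv (Fin n) I C).toRingHom.comp ρ.mapMatrix).toMonoidHom) g)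
        (by
          intro n m h g
          ext1
          exact (det_comp_stabMat ρ h g.1).symm)
      map_one' := by
        rw [DirectLimit.one_def 0]; simp
      map_mul' := by
        apply DirectLimit.induction₂
        intro i x y
        rw [DirectLimit.mul_def]; simp }

end KOne

/-! ### Twisted group rings -/

/-- A normalised two-cocycle of a group `G` with values in `Rˣ` (trivial action). -/
structure Cocycle (G R : Type*) [Group G] [CommRing R] where
  toFun : G → G → Rˣ
  assoc : ∀ x y z, toFun x y * toFun (x * y) z = toFun y z * toFun x (y * z)
  one_left : ∀ x, toFun 1 x = 1
  one_right : ∀ x, toFun x 1 = 1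

namespace Cocycle

variable {G R : Type*} [Group G] [CommRing R]

instance : CoeFun (Cocycle G R) (fun _ => G → G → Rˣ) := ⟨toFun⟩

/-- The restriction of a cocycle to a subgroup. -/
def restrict (τ : Cocycle G R) (P : Subgroup G) : Cocycle P R where
  toFun x y := τ x y
  assoc x y z := τ.assoc x y z
  one_left x := τ.one_left x
  one_right x := τ.one_right x

end Cocycle

/-- The twisted group ring `R[G]^τ` of a finite group `G`: the free `R`-module on symbols `ḡ`,
`g ∈ G`, with `ḡ * h̄ = τ(g, h) (gh)‾`.  An element is given by its coefficients. -/
def TwGrp {G R : Type*} [Group G] [CommRing R] (_τ : Cocycle G R) : Type _ := G → R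

namespace TwGrp

variable {G R : Type*} [Group G] [CommRing R] {τ : Cocycle G R}

@[ext] theorem ext {a b : TwGrp τ} (h : ∀ g, a g = b g) : a = b := funext h

instance : AddCommGroup (TwGrp τ) := inferInstanceAs (AddCommGroup (G → R))

/-- The element `r ḡ`. -/
def single (τ : Cocycle G R) (g : G) (r : R) : TwGrp τ := Pi.single g r

instance : One (TwGrp τ) := ⟨single τ 1 1⟩

instance : Mul (TwGrp τ) :=
  ⟨fun a b g => ∑ᶠ x : G, a x * b (x⁻¹ * g) * (τ x (x⁻¹ * g) : R)⟩

theorem add_apply (a b : TwGrp τ) (g : G) : (a + b) g = a g + b g := rfl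
theorem zero_apply (g : G) : (0 : TwGrp τ) g = 0 := rfl
theorem single_apply (g h : G) (r : R) : single τ g r h = if h = g then r else 0 :=
  Pi.single_apply g r h
theorem one_apply (g : G) : (1 : TwGrp τ) g = if g = 1 then 1 else 0 := Pi.single_apply 1 1 g

variable [Finite G]

theorem mul_apply [Fintype G] (a b : TwGrp τ) (g : G) :
    (a * b) g = ∑ x : G, a x * b (x⁻¹ * g) * (τ x (x⁻¹ * g) : R) :=
  finsum_eq_sum_of_fintype _

instance : Ring (TwGrp τ) where
  __ := (inferInstance : AddCommGroup (TwGrp τ))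
  left_distrib a b c := by
    have := Fintype.ofFinite G
    ext g
    simp only [mul_apply, add_apply, mul_add, add_mul, Finset.sum_add_distrib]
  right_distrib a b c := by
    have := Fintype.ofFinite G
    ext g
    simp only [mul_apply, add_apply, add_mul, Finset.sum_add_distrib]
  zero_mul a := by
    have := Fintype.ofFinite G
    ext g
    simp [mul_apply, zero_apply]
  mul_zero a := by
    have := Fintype.ofFinite G
    ext g
    simp [mul_apply, zero_apply]
  one_mul a := by
    have := Fintype.ofFinite G
    ext g
    rw [mul_apply, Finset.sum_eq_single 1]
    · simp [one_apply, τ.one_left]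
    · intro b _ hb; simp [one_apply, hb]
    · simp
  mul_one a := by
    have := Fintype.ofFinite G
    ext g
    rw [mul_apply, Finset.sum_eq_single g]
    · simp [one_apply, τ.one_right]
    · intro b _ hb
      rw [one_apply, if_neg]
      · simp
      · intro h; exact hb (inv_mul_eq_one.mp h)
    · simp
  mul_assoc a b c := by
    have := Fintype.ofFinite G
    ext g
    simp only [mul_apply, Finset.sum_mul, Finset.mul_sum]
    rw [Finset.sum_comm]
    refine Finset.sum_congr rfl fun x _ => ?_
    rw [← Equiv.sum_comp (Equiv.mulLeft x)]
    refine Finset.sum_congr rfl fun z _ => ?_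
    have h := congrArg (Units.val) (τ.assoc x z (z⁻¹ * (x⁻¹ * g)))
    simp only [Equiv.coe_mulLeft, inv_mul_cancel_left, mul_inv_rev, mul_assoc, Units.val_mul,
      mul_inv_cancel_left] at h ⊢
    linear_combination (a x * (b z * c (z⁻¹ * (x⁻¹ * g)))) * h

theorem single_mul_single (g h : G) (r s : R) :
    single τ g r * single τ h s = single τ (g * h) (r * s * τ g h) := by
  have := Fintype.ofFinite G
  ext k
  rw [mul_apply, Finset.sum_eq_single g]
  · simp only [single_apply, if_true]
    by_cases hk : k = g * h
    · subst hk; simp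
    · rw [if_neg hk, if_neg]
      · simp
      · intro h'; exact hk (by rw [← h']; group)
  · intro b _ hb; simp [single_apply, hb]
  · simp

theorem eq_sum_single [Fintype G] (a : TwGrp τ) : a = ∑ g : G, single τ g (a g) := by
  change (a : G → R) = ∑ g : G, Pi.single g (a g)
  exact (Finset.univ_sum_single (a : G → R)).symm

/-- The homomorphism `R[G]^τ → A`, `∑ r_g ḡ ↦ ∑ f(r_g) u(g)`. -/
def liftHom {A : Type*} [Ring A] (f : R →+* A) (u : G → A) (hc : ∀ r g, u g * f r = f r * u g)
    (h1 : u 1 = 1) (hm : ∀ g h, u g * u h = f (τ g h) * u (g * h)) : TwGrp τ →+* A where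
  toFun a := ∑ᶠ g : G, f (a g) * u g
  map_one' := by
    have := Fintype.ofFinite G
    rw [finsum_eq_sum_of_fintype, Finset.sum_eq_single 1]
    · simp [one_apply, h1]
    · intro b _ hb; simp [one_apply, hb]
    · simp
  map_zero' := by simp [zero_apply]
  map_add' a b := by
    have := Fintype.ofFinite G
    simp only [finsum_eq_sum_of_fintype, add_apply, map_add, add_mul, Finset.sum_add_distrib]
  map_mul' a b := by
    have := Fintype.ofFinite G
    simp only [finsum_eq_sum_of_fintype, mul_apply, map_sum, Finset.sum_mul, Finset.mul_sum,
      map_mul]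
    rw [Finset.sum_comm]
    conv_rhs => rw [Finset.sum_comm]
    refine Finset.sum_congr rfl fun x _ => ?_
    rw [← Equiv.sum_comp (Equiv.mulLeft x)]
    refine Finset.sum_congr rfl fun z _ => ?_
    simp only [Equiv.coe_mulLeft, inv_mul_cancel_left]
    calc _ = f (a x) * f (b z) * (f (τ x z) * u (x * z)) := by simp only [mul_assoc]
      _ = f (a x) * f (b z) * (u x * u z) := by rw [hm]
      _ = f (a x) * (f (b z) * u x) * u z := by simp only [mul_assoc]
      _ = f (a x) * (u x * f (b z)) * u z := by rw [hc]
      _ = _ := by simp only [mul_assoc]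

theorem liftHom_single {A : Type*} [Ring A] (f : R →+* A) (u : G → A)
    (hc : ∀ r g, u g * f r = f r * u g) (h1 : u 1 = 1)
    (hm : ∀ g h, u g * u h = f (τ g h) * u (g * h)) (g : G) (r : R) :
    liftHom f u hc h1 hm (single τ g r) = f r * u g := by
  have := Fintype.ofFinite G
  change ∑ᶠ h : G, f (single τ g r h) * u h = _
  rw [finsum_eq_sum_of_fintype, Finset.sum_eq_single g]
  · simp [single_apply]
  · intro b _ hb; simp [single_apply, hb]
  · simp

theorem single_mul_apply (g h : G) (r : R) (a : TwGrp τ) :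
    (single τ g r * a) h = r * a (g⁻¹ * h) * τ g (g⁻¹ * h) := by
  have := Fintype.ofFinite G
  rw [mul_apply, Finset.sum_eq_single g]
  · simp [single_apply]
  · intro b _ hb; simp [single_apply, hb]
  · simp

theorem mul_single_apply (g h : G) (r : R) (a : TwGrp τ) :
    (a * single τ g r) h = a (h * g⁻¹) * r * τ (h * g⁻¹) g := by
  have := Fintype.ofFinite G
  rw [mul_apply, Finset.sum_eq_single (h * g⁻¹)]
  · simp [single_apply]
  · intro b _ hb
    rw [single_apply, if_neg]
    · simp
    · intro h'; exact hb (by rw [← h']; group)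
  · simp

theorem single_add (g : G) (r s : R) : single τ g (r + s) = single τ g r + single τ g s :=
  Pi.single_add (f := fun _ : G => R) g r s

theorem single_zero (g : G) : single τ g (0 : R) = 0 := Pi.single_zero (M := fun _ : G => R) g

theorem sum_apply {ι : Type*} (s : Finset ι) (f : ι → TwGrp τ) (g : G) :
    (∑ i ∈ s, f i) g = ∑ i ∈ s, f i g := Finset.sum_apply g s f

/-- The central embedding of the coefficients, `r ↦ r 1̄`. -/
def C (τ : Cocycle G R) : R →+* TwGrp τ where
  toFun r := single τ 1 r
  map_one' := rfl
  map_zero' := single_zero 1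
  map_add' := single_add 1
  map_mul' r s := by rw [single_mul_single, τ.one_left]; simp

theorem C_mul_single (g : G) (r s : R) : C τ r * single τ g s = single τ g (r * s) := by
  change single τ 1 r * single τ g s = _
  rw [single_mul_single, τ.one_left]; simp

theorem single_mul_C (g : G) (r s : R) : single τ g s * C τ r = single τ g (s * r) := by
  change single τ g s * single τ 1 r = _
  rw [single_mul_single, τ.one_right]; simp

/-- The inclusion `R[P]^τ → R[G]^τ` for a subgroup `P` of `G`. -/
def ofSubgroup (τ : Cocycle G R) (P : Subgroup G) : TwGrp (τ.restrict P) →+* TwGrp τ :=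
  liftHom (C τ) (fun g : P => single τ g 1)
    (fun r g => by rw [C_mul_single, single_mul_C, mul_comm])
    rfl
    (fun g h => by rw [single_mul_single, C_mul_single]; simp [Cocycle.restrict])

theorem ofSubgroup_single (P : Subgroup G) (g : P) (r : R) :
    ofSubgroup τ P (single _ g r) = single τ g r := by
  rw [ofSubgroup, liftHom_single, C_mul_single, mul_one]

theorem ofSubgroup_apply (P : Subgroup G) (b : TwGrp (τ.restrict P)) (g : G) :
    ofSubgroup τ P b g = if h : g ∈ P then b ⟨g, h⟩ else 0 := by
  have := Fintype.ofFinite P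
  conv_lhs => rw [eq_sum_single b]
  rw [map_sum, sum_apply]
  simp only [ofSubgroup_single, single_apply]
  split_ifs with h
  · rw [Finset.sum_eq_single ⟨g, h⟩]
    · simp
    · intro c _ hc; rw [if_neg]; intro h'; exact hc (Subtype.ext h'.symm)
    · simp
  · refine Finset.sum_eq_zero fun c _ => if_neg ?_
    rintro rfl; exact h c.2

/-- Representatives of the right cosets of `P` in `G`, namely the inverses of
representatives of the left cosets. -/
def rep (P : Subgroup G) (q : G ⧸ P) : G := q.out⁻¹

theorem mul_rep_inv_mem (P : Subgroup G) (q : G ⧸ P) (g : G) :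
    g * (rep P q)⁻¹ ∈ P ↔ q = QuotientGroup.mk g⁻¹ := by
  rw [rep, inv_inv]
  conv_rhs => rw [← QuotientGroup.out_eq' q, eq_comm, QuotientGroup.eq, inv_inv]

/-- The coefficients `(b_q)` in the expansion `a = ∑_q b_q * (rep q)‾`, `b_q ∈ R[P]^τ`, of an
element of the free left `R[P]^τ`-module `R[G]^τ`. -/
def coord (P : Subgroup G) (a : TwGrp τ) (q : G ⧸ P) : TwGrp (τ.restrict P) :=
  fun h => a (h * rep P q) * (↑(τ h (rep P q))⁻¹ : R)

theorem sum_coord (P : Subgroup G) [Fintype (G ⧸ P)] (a : TwGrp τ) :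
    a = ∑ q, ofSubgroup τ P (coord P a q) * single τ (rep P q) 1 := by
  ext g
  rw [sum_apply, Finset.sum_eq_single (QuotientGroup.mk g⁻¹)]
  · have h := (mul_rep_inv_mem P _ g).2 rfl
    rw [mul_single_apply, ofSubgroup_apply, dif_pos h, coord]
    simp
  · intro q _ hq
    rw [mul_single_apply, ofSubgroup_apply, dif_neg]
    · simp
    · intro h; exact hq ((mul_rep_inv_mem P q g).1 h)
  · simp

theorem coord_add (P : Subgroup G) (a b : TwGrp τ) (q : G ⧸ P) :
    coord P (a + b) q = coord P a q + coord P b q := by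
  ext h
  simp only [coord, add_apply, add_mul]

theorem coord_zero (P : Subgroup G) (q : G ⧸ P) : coord P (0 : TwGrp τ) q = 0 := by
  ext h
  simp only [coord, zero_apply, zero_mul]

theorem coord_sum (P : Subgroup G) {ι : Type*} (s : Finset ι) (f : ι → TwGrp τ) (q : G ⧸ P) :
    coord P (∑ i ∈ s, f i) q = ∑ i ∈ s, coord P (f i) q := by
  induction s using Finset.induction_on with
  | empty => simp [coord_zero]
  | insert i s hi ih => rw [Finset.sum_insert hi, Finset.sum_insert hi, coord_add, ih]

theorem coord_mul (P : Subgroup G) (b : TwGrp (τ.restrict P)) (a : TwGrp τ) (q : G ⧸ P) :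
    coord P (ofSubgroup τ P b * a) q = b * coord P a q := by
  have := Fintype.ofFinite P
  conv_lhs => rw [eq_sum_single b]
  conv_rhs => rw [eq_sum_single b]
  rw [map_sum, Finset.sum_mul, Finset.sum_mul, coord_sum]
  refine Finset.sum_congr rfl fun y _ => ?_
  ext h
  rw [ofSubgroup_single, coord, single_mul_apply, single_mul_apply, coord]
  have e := τ.assoc (y : G) ((y : G)⁻¹ * h) (rep P q)
  rw [mul_inv_cancel_left] at e
  have e2 : τ (y : G) ((y : G)⁻¹ * h * rep P q) * (τ (h : G) (rep P q))⁻¹ =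
      τ (y : G) ((y : G)⁻¹ * h) * (τ ((y : G)⁻¹ * h) (rep P q))⁻¹ := by
    rw [mul_inv_eq_iff_eq_mul, mul_right_comm, ← div_eq_mul_inv, eq_div_iff_mul_eq', e, mul_comm]
  have e3 := congrArg Units.val e2
  simp only [Units.val_mul] at e3
  simp only [Cocycle.restrict, Subgroup.coe_mul, Subgroup.coe_inv, ← mul_assoc] at e3 ⊢
  linear_combination (b y * a ((y : G)⁻¹ * h * rep P q)) * e3

theorem coord_single_rep (P : Subgroup G) (q r : G ⧸ P) :
    coord P (single τ (rep P q) 1) r = if q = r then 1 else 0 := by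
  ext h
  rw [coord, single_apply]
  by_cases hq : q = r
  · subst hq
    rw [if_pos rfl, one_apply]
    by_cases hh : h = 1
    · subst hh; simp [τ.one_left]
    · rw [if_neg hh, if_neg, zero_mul]
      intro h'; exact hh (Subtype.ext (by simpa using h'))
  · rw [if_neg hq, if_neg, zero_mul]; rfl
    intro h'
    apply hq
    have h1 := (mul_rep_inv_mem P q ((h : G) * rep P r)).1 (by rw [h']; simp)
    have h2 := (mul_rep_inv_mem P r ((h : G) * rep P r)).1 (by simp)
    exact h1.trans h2.symm

/-- The matrix, with entries in `R[P]^τ`, of right multiplication by an element of `R[G]^τ`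
with respect to the basis `(rep q)‾` of the left `R[P]^τ`-module `R[G]^τ`. -/
def regRep (τ : Cocycle G R) (P : Subgroup G) [Fintype (G ⧸ P)] :
    TwGrp τ →+* Matrix (G ⧸ P) (G ⧸ P) (TwGrp (τ.restrict P)) where
  toFun a := Matrix.of fun i j => coord P (single τ (rep P i) 1 * a) j
  map_one' := by
    ext1 i j
    rw [Matrix.of_apply, mul_one, coord_single_rep, Matrix.one_apply]
  map_zero' := by
    ext1 i j
    rw [Matrix.of_apply, mul_zero, coord_zero]; rfl
  map_add' a b := by
    ext1 i j
    rw [Matrix.of_apply, mul_add, coord_add]; rfl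
  map_mul' a b := by
    ext1 i j
    rw [Matrix.of_apply, Matrix.mul_apply, ← mul_assoc]
    conv_lhs => rw [sum_coord P (single τ (rep P i) 1 * a)]
    rw [Finset.sum_mul, coord_sum]
    refine Finset.sum_congr rfl fun k _ => ?_
    rw [mul_assoc, coord_mul]; rfl

end TwGrp

/-! ### The group `𝒢 ≅ H ⋊ Γ` -/

/-- A compact pro-`p` `p`-adic Lie group `𝒢` of dimension one with a quotient `Γ ≅ ℤ_p`, together
with the choices made once and for all: the surjection `π : 𝒢 → Γ ≅ ℤ_p` with finite kernel `H`,
a lift `s` of `Γ` to `𝒢` (so that `𝒢 ≅ H ⋊ Γ`), and an open subgroup `Γ^(p^e)` of `Γ` which acts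
trivially on `H`.  The group `ℤ_p` is written multiplicatively. -/
structure Setup (p : ℕ) [Fact p.Prime] (𝒢 : Type*) [Group 𝒢] [TopologicalSpace 𝒢] where
  π : 𝒢 →* Multiplicative ℤ_[p]
  continuous_π : Continuous π
  finite_ker : Finite π.ker
  isPGroup_ker : IsPGroup p π.ker
  s : Multiplicative ℤ_[p] →* 𝒢
  continuous_s : Continuous s
  π_s : ∀ z, π (s z) = z
  e : ℕ
  trivial_action : ∀ (z : Multiplicative ℤ_[p]) (h : 𝒢), h ∈ π.ker →
    s (z ^ p ^ e) * h * (s (z ^ p ^ e))⁻¹ = h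

namespace Setup

variable {p : ℕ} [Fact p.Prime] {𝒢 : Type*} [Group 𝒢] [TopologicalSpace 𝒢] (S : Setup p 𝒢)

/-- The subgroup `Γ^(p^e)` of `𝒢`. -/
def Z : Subgroup 𝒢 := (powMonoidHom (p ^ S.e) : Multiplicative ℤ_[p] →* _).range.map S.s

theorem mem_Z {x : 𝒢} : x ∈ S.Z ↔ ∃ z, S.s (z ^ p ^ S.e) = x := by
  simp [Z, Subgroup.mem_map]

theorem s_π_of_mem_Z {x : 𝒢} (hx : x ∈ S.Z) : S.s (S.π x) = x := by
  obtain ⟨z, rfl⟩ := S.mem_Z.1 hx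
  rw [S.π_s]

theorem Z_central {x : 𝒢} (hx : x ∈ S.Z) (g : 𝒢) : x * g = g * x := by
  obtain ⟨z, rfl⟩ := S.mem_Z.1 hx
  have h1 : S.s (z ^ p ^ S.e) * (g * (S.s (S.π g))⁻¹) = (g * (S.s (S.π g))⁻¹) * S.s (z ^ p ^ S.e) :=
    mul_inv_eq_iff_eq_mul.1 (S.trivial_action z _ (by simp [MonoidHom.mem_ker, S.π_s]))
  have h2 : S.s (z ^ p ^ S.e) * S.s (S.π g) = S.s (S.π g) * S.s (z ^ p ^ S.e) := by
    rw [← map_mul, mul_comm, map_mul]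
  calc S.s (z ^ p ^ S.e) * g
      = (S.s (z ^ p ^ S.e) * (g * (S.s (S.π g))⁻¹)) * S.s (S.π g) := by group
    _ = g * (S.s (S.π g))⁻¹ * (S.s (z ^ p ^ S.e) * S.s (S.π g)) := by rw [h1]; group
    _ = g * S.s (z ^ p ^ S.e) := by rw [h2]; group

instance : S.Z.Normal where
  conj_mem x hx g := by
    rw [← S.Z_central hx, mul_inv_cancel_right]
    exact hx

instance : IsMulCommutative S.Z where
  is_comm := ⟨fun a b => Subtype.ext (S.Z_central a.2 b)⟩

/-- The finite group `G = 𝒢 / Γ^(p^e)`. -/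
abbrev G : Type _ := 𝒢 ⧸ S.Z

theorem exists_residue (z : Multiplicative ℤ_[p]) :
    ∃ w : Multiplicative ℤ_[p], w ^ p ^ S.e = Multiplicative.ofAdd
      ((((PadicInt.toZModPow S.e z.toAdd).val : ℕ) : ℤ_[p]) - z.toAdd) := by
  have h : (((PadicInt.toZModPow S.e z.toAdd).val : ℕ) : ℤ_[p]) - z.toAdd ∈
      RingHom.ker (PadicInt.toZModPow (p := p) S.e) := by
    rw [RingHom.mem_ker, map_sub, map_natCast, ZMod.natCast_zmod_val, sub_self]
  rw [PadicInt.ker_toZModPow, Ideal.mem_span_singleton] at h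
  obtain ⟨w, hw⟩ := h
  refine ⟨Multiplicative.ofAdd w, ?_⟩
  rw [hw, ← ofAdd_nsmul, nsmul_eq_mul]
  simp

/-- The distinguished lift to `𝒢` of an element of `G`: the element `h γ^a` with `h ∈ H` and
`0 ≤ a < p^e`, where `γ = s(1)` is the chosen generator of `Γ`. -/
def lift (g : S.G) : 𝒢 :=
  g.out * S.s (Multiplicative.ofAdd
    ((((PadicInt.toZModPow S.e (S.π g.out).toAdd).val : ℕ) : ℤ_[p]) - (S.π g.out).toAdd))

theorem π_lift (g : S.G) : (S.π (S.lift g)).toAdd =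
    ((PadicInt.toZModPow S.e (S.π g.out).toAdd).val : ℕ) := by
  rw [lift, map_mul, S.π_s, toAdd_mul, toAdd_ofAdd]
  ring

theorem mk_lift (g : S.G) : (QuotientGroup.mk (S.lift g) : S.G) = g := by
  conv_rhs => rw [← QuotientGroup.out_eq' g]
  rw [eq_comm, QuotientGroup.eq, lift, inv_mul_cancel_left]
  obtain ⟨w, hw⟩ := S.exists_residue (S.π g.out)
  exact S.mem_Z.2 ⟨w, congrArg S.s hw⟩

theorem lift_one : S.lift 1 = 1 := by
  have hZ : (1 : S.G).out ∈ S.Z := by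
    rw [← QuotientGroup.eq_one_iff]; exact QuotientGroup.out_eq' _
  have h0 : PadicInt.toZModPow S.e (S.π (1 : S.G).out).toAdd = 0 := by
    obtain ⟨z, hz⟩ := S.mem_Z.1 hZ
    rw [← hz, S.π_s, toAdd_pow, map_nsmul, nsmul_eq_mul, ZMod.natCast_self, zero_mul]
  rw [lift, h0, ZMod.val_zero, Nat.cast_zero, zero_sub, ofAdd_neg, ofAdd_toAdd, map_inv,
    S.s_π_of_mem_Z hZ, mul_inv_cancel]

theorem mem_Z_of_mk_eq {x y : 𝒢} (h : (QuotientGroup.mk x : S.G) = QuotientGroup.mk y) :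
    x * y⁻¹ ∈ S.Z := by
  rw [← QuotientGroup.eq_one_iff, QuotientGroup.mk_mul, QuotientGroup.mk_inv, h, mul_inv_cancel]

instance : Finite S.G := by
  have := S.finite_ker
  refine Finite.of_surjective
    (fun x : S.π.ker × Fin (p ^ S.e) =>
      (QuotientGroup.mk ((x.1 : 𝒢) * S.s (Multiplicative.ofAdd ((x.2 : ℕ) : ℤ_[p]))) : S.G)) ?_
  intro g
  refine ⟨⟨⟨S.lift g * (S.s (S.π (S.lift g)))⁻¹, by simp [MonoidHom.mem_ker, S.π_s]⟩,
    ⟨(PadicInt.toZModPow S.e (S.π g.out).toAdd).val, ZMod.val_lt _⟩⟩, ?_⟩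
  dsimp only
  rw [← S.π_lift, ofAdd_toAdd, inv_mul_cancel_right, S.mk_lift]

/-- The element `g̃ h̃ (gh)~⁻¹` of `Γ^(p^e)`, where `~` is the distinguished lift. -/
def factorSet (g h : S.G) : S.Z :=
  ⟨S.lift g * S.lift h * (S.lift (g * h))⁻¹,
    S.mem_Z_of_mk_eq (by rw [QuotientGroup.mk_mul, S.mk_lift, S.mk_lift, S.mk_lift])⟩

variable {R : Type*} [CommRing R]

/-- The twisting map `τ` of `R[G]^τ`; here `ι : Γ^(p^e) → Rˣ` is the structure map. -/
def cocycle (ι : S.Z →* Rˣ) : Cocycle S.G R where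
  toFun g h := ι (S.factorSet g h)
  assoc x y z := by
    rw [← map_mul, ← map_mul]
    congr 1
    ext1
    have h := S.Z_central (S.factorSet y z).2 (S.lift x)
    simp only [factorSet, Subgroup.coe_mul] at h ⊢
    calc _ = S.lift x * (S.lift y * S.lift z * (S.lift (y * z))⁻¹) *
          S.lift (y * z) * (S.lift (x * y * z))⁻¹ := by group
      _ = _ := by rw [← h, mul_assoc x y z]; group
  one_left x := by
    have : S.factorSet 1 x = 1 := by ext1; simp [factorSet, S.lift_one]
    rw [this, map_one]
  one_right x := by
    have : S.factorSet x 1 = 1 := by ext1; simp [factorSet, S.lift_one]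
    rw [this, map_one]

/-- The ring `R[G]^τ`. -/
abbrev RG (ι : S.Z →* Rˣ) : Type _ := TwGrp (S.cocycle ι)

/-- The set `C(G)` of cyclic subgroups of `G`. -/
abbrev Cyc : Type _ := {P : Subgroup S.G // IsCyclic P}

/-- The ring `R[P]^τ` for a cyclic subgroup `P` of `G`. -/
abbrev RP (ι : S.Z →* Rˣ) (P : S.Cyc) : Type _ := TwGrp ((S.cocycle ι).restrict P.1)

/-- Lifts of elements of a cyclic subgroup commute. -/
theorem lift_comm (P : S.Cyc) (g h : P.1) :
    S.lift g * S.lift h = S.lift h * S.lift g := by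
  obtain ⟨c, hc⟩ := P.2.exists_generator
  have key : ∀ g : P.1, ∃ (n : ℤ) (z : S.Z), S.lift g = S.lift c ^ n * z := by
    intro g
    obtain ⟨n, hn⟩ := hc g
    refine ⟨n, ⟨(S.lift c ^ n)⁻¹ * S.lift g, ?_⟩, by simp⟩
    rw [← QuotientGroup.eq, QuotientGroup.mk_zpow, S.mk_lift, S.mk_lift, ← hn]
    rfl
  obtain ⟨m, y, hy⟩ := key g
  obtain ⟨n, z, hz⟩ := key h
  rw [hy, hz]
  have h1 := S.Z_central y.2 (S.lift c ^ n * z)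
  have h2 := S.Z_central z.2 (S.lift c ^ m)
  calc S.lift c ^ m * y * (S.lift c ^ n * z) = S.lift c ^ m * (y * (S.lift c ^ n * z)) := by group
    _ = S.lift c ^ (m + n) * (z * y) := by rw [h1, zpow_add]; group
    _ = S.lift c ^ n * (S.lift c ^ m * z) * y := by rw [add_comm, zpow_add]; group
    _ = S.lift c ^ n * z * (S.lift c ^ m * y) := by rw [← h2]; group

theorem mul_comm_of_cyc (P : S.Cyc) (g h : P.1) : g * h = h * g := by
  have := P.2
  let _ := IsCyclic.commGroup (α := P.1)
  exact mul_comm g h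

instance (ι : S.Z →* Rˣ) (P : S.Cyc) : CommRing (S.RP ι P) where
  __ := (inferInstance : Ring (S.RP ι P))
  mul_comm a b := by
    have := Fintype.ofFinite P.1
    rw [TwGrp.eq_sum_single a, TwGrp.eq_sum_single b, Finset.sum_mul_sum, Finset.sum_mul_sum,
      Finset.sum_comm]
    refine Finset.sum_congr rfl fun h _ => Finset.sum_congr rfl fun g _ => ?_
    rw [TwGrp.single_mul_single, TwGrp.single_mul_single, S.mul_comm_of_cyc P g h,
      mul_comm (a g)]
    congr 2
    simp only [Cocycle.restrict, cocycle, factorSet]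
    congr 3
    rw [S.lift_comm P g h, ← Subgroup.coe_mul, ← Subgroup.coe_mul, S.mul_comm_of_cyc P g h]

end Setup

/-! ### Iwasawa algebras -/

section IwasawaAlgebra

/-- The Iwasawa algebra `Λ_O(𝒢) = lim_U O[𝒢/U]`, where `U` runs over the open normal subgroups
of `𝒢`, as a subring of the product of all the group rings `O[𝒢/U]`. -/
def iwSubring (O 𝒢 : Type*) [CommRing O] [Group 𝒢] [TopologicalSpace 𝒢] :
    Subring (∀ U : OpenNormalSubgroup 𝒢, MonoidAlgebra O (𝒢 ⧸ U.toSubgroup)) where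
  carrier := {f | ∀ (U V : OpenNormalSubgroup 𝒢) (h : U.toSubgroup ≤ V.toSubgroup),
    MonoidAlgebra.mapDomainRingHom O
      (QuotientGroup.map U.toSubgroup V.toSubgroup (MonoidHom.id 𝒢) h) (f U) = f V}
  mul_mem' ha hb U V h := by rw [Pi.mul_apply, map_mul, ha U V h, hb U V h]; rfl
  one_mem' U V h := by rw [Pi.one_apply, map_one]; rfl
  add_mem' ha hb U V h := by rw [Pi.add_apply, map_add, ha U V h, hb U V h]; rfl
  zero_mem' U V h := by rw [Pi.zero_apply, map_zero]; rfl
  neg_mem' ha U V h := by rw [Pi.neg_apply, map_neg, ha U V h]; rfl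

/-- The Iwasawa algebra `Λ_O(𝒢)`. -/
def Iw (O 𝒢 : Type*) [CommRing O] [Group 𝒢] [TopologicalSpace 𝒢] : Type _ := iwSubring O 𝒢

namespace Iw

variable {O O' 𝒢 𝒢' : Type*} [CommRing O] [CommRing O'] [Group 𝒢] [TopologicalSpace 𝒢]
  [Group 𝒢'] [TopologicalSpace 𝒢']

instance : Ring (Iw O 𝒢) := inferInstanceAs (Ring (iwSubring O 𝒢))

/-- The projection `Λ_O(𝒢) → O[𝒢/U]`. -/
def proj (U : OpenNormalSubgroup 𝒢) : Iw O 𝒢 →+* MonoidAlgebra O (𝒢 ⧸ U.toSubgroup) :=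
  (Pi.evalRingHom _ U).comp (iwSubring O 𝒢).subtype

@[ext] theorem ext {x y : Iw O 𝒢} (h : ∀ U, proj U x = proj U y) : x = y :=
  Subtype.ext (funext h)

theorem proj_compat (x : Iw O 𝒢) (U V : OpenNormalSubgroup 𝒢)
    (h : U.toSubgroup ≤ V.toSubgroup) :
    MonoidAlgebra.mapDomainRingHom O
      (QuotientGroup.map U.toSubgroup V.toSubgroup (MonoidHom.id 𝒢) h) (proj U x) = proj V x :=
  x.2 U V h

/-- A compatible family of ring homomorphisms to the `O[𝒢/U]` gives one to `Λ_O(𝒢)`. -/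
def lift {A : Type*} [Ring A]
    (f : ∀ U : OpenNormalSubgroup 𝒢, A →+* MonoidAlgebra O (𝒢 ⧸ U.toSubgroup))
    (hf : ∀ (U V : OpenNormalSubgroup 𝒢) (h : U.toSubgroup ≤ V.toSubgroup) (a : A),
      MonoidAlgebra.mapDomainRingHom O
        (QuotientGroup.map U.toSubgroup V.toSubgroup (MonoidHom.id 𝒢) h) (f U a) = f V a) :
    A →+* Iw O 𝒢 :=
  (RingHom.pi f).codRestrict (iwSubring O 𝒢) fun a U V h => hf U V h a

theorem proj_lift {A : Type*} [Ring A]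
    (f : ∀ U : OpenNormalSubgroup 𝒢, A →+* MonoidAlgebra O (𝒢 ⧸ U.toSubgroup)) (hf) (a : A)
    (U : OpenNormalSubgroup 𝒢) : proj U (lift f hf a) = f U a := rfl

instance [IsMulCommutative 𝒢] : CommRing (Iw O 𝒢) where
  __ := (inferInstance : Ring (Iw O 𝒢))
  mul_comm x y := by
    ext1 U
    rw [map_mul, map_mul]
    have hq : ∀ a b : 𝒢 ⧸ U.toSubgroup, a * b = b * a := by
      intro a b
      induction a using QuotientGroup.induction_on with | H a => ?_
      induction b using QuotientGroup.induction_on with | H b => ?_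
      rw [← QuotientGroup.mk_mul, mul_comm', QuotientGroup.mk_mul]
    let _ : CommGroup (𝒢 ⧸ U.toSubgroup) := { mul_comm := hq }
    exact mul_comm (proj U x) (proj U y)

/-- The group element `g`, as a unit of `Λ_O(𝒢)`. -/
def of (O : Type*) [CommRing O] : 𝒢 →* (Iw O 𝒢)ˣ :=
  MonoidHom.toHomUnits
    { toFun := fun g => (⟨fun U => MonoidAlgebra.of O _ (QuotientGroup.mk g), fun U V h => by
        simp [MonoidAlgebra.of_apply]; rfl⟩ : iwSubring O 𝒢)
      map_one' := by
        refine Subtype.ext (funext fun U => ?_)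
        exact map_one (MonoidAlgebra.of O _)
      map_mul' := fun g h => by
        refine Subtype.ext (funext fun U => ?_)
        exact map_mul (MonoidAlgebra.of O _) (QuotientGroup.mk g) (QuotientGroup.mk h) }

theorem proj_of (g : 𝒢) (U : OpenNormalSubgroup 𝒢) :
    proj U (of O g : Iw O 𝒢) = MonoidAlgebra.single (QuotientGroup.mk g) 1 := rfl

/-- The preimage of an open normal subgroup under a continuous homomorphism. -/
def comap (h : 𝒢 →* 𝒢') (hc : Continuous h) (V : OpenNormalSubgroup 𝒢') : OpenNormalSubgroup 𝒢 where
  toOpenSubgroup := V.toOpenSubgroup.comap h hc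
  isNormal' := V.isNormal'.comap h

/-- The homomorphism `Λ_O(𝒢) → Λ_O'(𝒢')` induced by `f : O → O'` and by a continuous
homomorphism `h : 𝒢 → 𝒢'`. -/
def map (f : O →+* O') (h : 𝒢 →* 𝒢') (hc : Continuous h) : Iw O 𝒢 →+* Iw O' 𝒢' :=
  lift (fun V => (MonoidAlgebra.mapDomainRingHom O'
      (QuotientGroup.map (comap h hc V).toSubgroup V.toSubgroup h le_rfl)).comp
      ((MonoidAlgebra.mapRingHom _ f).comp (proj (comap h hc V))))
    (by
      intro U V hUV a
      have hle : (comap h hc U).toSubgroup ≤ (comap h hc V).toSubgroup := fun x hx => hUV hx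
      rw [RingHom.comp_apply, RingHom.comp_apply, RingHom.comp_apply, RingHom.comp_apply,
        ← proj_compat a _ _ hle]
      generalize proj (comap h hc U) a = x
      simp only [← RingHom.comp_apply]
      revert x
      rw [← RingHom.ext_iff]
      apply MonoidAlgebra.ringHom_ext
      · intro r; simp
      · intro g
        induction g using QuotientGroup.induction_on with | H g => ?_
        simp
        rfl)

theorem proj_map (f : O →+* O') (h : 𝒢 →* 𝒢') (hc : Continuous h) (x : Iw O 𝒢)
    (V : OpenNormalSubgroup 𝒢') : proj V (map f h hc x) =
      MonoidAlgebra.mapDomainRingHom O'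
        (QuotientGroup.map (comap h hc V).toSubgroup V.toSubgroup h le_rfl)
        (MonoidAlgebra.mapRingHom _ f (proj (comap h hc V) x)) := rfl

theorem map_of (f : O →+* O') (h : 𝒢 →* 𝒢') (hc : Continuous h) (g : 𝒢) :
    map f h hc (of O g : Iw O 𝒢) = of O' (h g) := by
  ext1 V
  rw [proj_map, proj_of, proj_of]
  simp
  rfl

theorem map_congr {f f' : O →+* O'} {h h' : 𝒢 →* 𝒢'} (hf : f = f') (hh : h = h')
    (hc : Continuous h) (hc' : Continuous h') : map f h hc = map f' h' hc' := by
  subst hf hh; rfl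

theorem map_map {O'' 𝒢'' : Type*} [CommRing O''] [Group 𝒢''] [TopologicalSpace 𝒢'']
    (f : O →+* O') (h : 𝒢 →* 𝒢') (hc : Continuous h) (f' : O' →+* O'') (h' : 𝒢' →* 𝒢'')
    (hc' : Continuous h') (x : Iw O 𝒢) :
    map f' h' hc' (map f h hc x) = map (f'.comp f) (h'.comp h) (hc'.comp hc) x := by
  ext1 V
  rw [proj_map, proj_map, proj_map]
  change _ = MonoidAlgebra.mapDomainRingHom O''
    (QuotientGroup.map (comap h hc (comap h' hc' V)).toSubgroup V.toSubgroup (h'.comp h) le_rfl)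
    (MonoidAlgebra.mapRingHom _ (f'.comp f) (proj (comap h hc (comap h' hc' V)) x))
  generalize proj (comap h hc (comap h' hc' V)) x = y
  simp only [← RingHom.comp_apply]
  revert y
  rw [← RingHom.ext_iff]
  apply MonoidAlgebra.ringHom_ext
  · intro r; simp
  · intro g
    induction g using QuotientGroup.induction_on with | H g => ?_
    simp
    rfl

/-- The inclusion of the constants. -/
def const (O 𝒢 : Type*) [CommRing O] [Group 𝒢] [TopologicalSpace 𝒢] : O →+* Iw O 𝒢 :=
  lift (fun _ => MonoidAlgebra.singleOneRingHom) (by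
    intro U V h a
    simp)

instance [IsMulCommutative 𝒢] [Algebra ℚ O] : Algebra ℚ (Iw O 𝒢) :=
  ((const O 𝒢).comp (algebraMap ℚ O)).toAlgebra

end Iw

end IwasawaAlgebra

namespace Setup

variable {p : ℕ} [Fact p.Prime] {𝒢 : Type*} [Group 𝒢] [TopologicalSpace 𝒢] (S : Setup p 𝒢)

/-- A coefficient ring `R` for the rings `R[G]^τ`: a commutative ring with a structure map
`ι : Γ^(p^e) → Rˣ` and an endomorphism `φ` which is the `p`-power map on `Γ^(p^e)`. -/
structure Coef (R : Type*) [CommRing R] where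
  ι : S.Z →* Rˣ
  φ : R →+* R
  φ_ι : ∀ z, φ (ι z) = ι (z ^ p)

/-- The element `g̃ ^ p * (g ^ p)~⁻¹` of `Γ^(p^e)`, where `~` is the distinguished lift.  Thus
`ḡ ^ p = ι (powZ g) (g ^ p)‾` in `R[G]^τ`. -/
def powZ (g : S.G) : S.Z :=
  ⟨S.lift g ^ p * (S.lift (g ^ p))⁻¹,
    S.mem_Z_of_mk_eq (by rw [QuotientGroup.mk_pow, S.mk_lift, S.mk_lift])⟩

/-! ### The additive side -/

section Additive

variable {R : Type*} [CommRing R]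

/-- The `R`-module `R[Conj(G)]^τ`; an element `∑ r_c [ḡ_c]` is given by its coefficients. -/
abbrev ConjMod (R : Type*) : Type _ := ConjClasses S.G → R

/-- The map `t^G_P : R[Conj(G)]^τ → R[P]^τ`,
`[ḡ] ↦ ∑_x { x̄⁻¹ ḡ x̄ | x⁻¹ g x ∈ P }`, where `x` runs over representatives of `G/P`
(recall that `x̄⁻¹ ḡ x̄ = (x⁻¹ g x)‾`). -/
def tr (ι : S.Z →* Rˣ) (P : S.Cyc) (a : S.ConjMod R) : S.RP ι P :=
  fun h => ∑ᶠ (c : ConjClasses S.G) (q : S.G ⧸ P.1),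
    if q.out⁻¹ * Quotient.out c * q.out = (h : S.G) then a c else 0

/-- The map `η_P : R[P]^τ → R[P]^τ` which keeps the `ḡ` with `g` a generator of `P` and kills the
others. -/
def eta (ι : S.Z →* Rˣ) (P : S.Cyc) (a : S.RP ι P) : S.RP ι P :=
  fun h => if Subgroup.zpowers h = ⊤ then a h else 0

/-- The map `β^G_P = η_P ∘ t^G_P`. -/
def beta (ι : S.Z →* Rˣ) (P : S.Cyc) (a : S.ConjMod R) : S.RP ι P :=
  S.eta ι P (S.tr ι P a)

/-- The map `φ` on `R[Conj(G)]^τ`, `r [ḡ] ↦ φ(r) [ḡ ^ p]`. -/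
def frobConj (c : S.Coef R) (a : S.ConjMod R) : S.ConjMod R :=
  fun d => ∑ᶠ k : ConjClasses S.G,
    if ConjClasses.mk ((Quotient.out k : S.G) ^ p) = d then
      c.φ (a k) * (c.ι (S.powZ (Quotient.out k)) : R) else 0

/-- The projection `R[G]^τ → R[Conj(G)]^τ`, `r ḡ ↦ r [ḡ]`. -/
def toConj {τ : Cocycle S.G R} (a : TwGrp τ) : S.ConjMod R :=
  fun c => ∑ᶠ g : S.G, if ConjClasses.mk g = c then a g else 0

/-- The composite map `R[P]^τ → R[G]^τ → R[Conj(G)]^τ`. -/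
def cycToConj {ι : S.Z →* Rˣ} (P : S.Cyc) (a : S.RP ι P) : S.ConjMod R :=
  S.toConj (TwGrp.ofSubgroup (S.cocycle ι) P.1 a)

end Additive

/-! ### The multiplicative side -/

section Multiplicative

variable {S}
variable {R : Type*} [CommRing R] (c : S.Coef R)

theorem powZ_one : S.powZ 1 = 1 := by
  ext1; simp [powZ, S.lift_one]

theorem factorSet_mul_lift (g h : S.G) :
    (S.factorSet g h : 𝒢) * S.lift (g * h) = S.lift g * S.lift h := by
  simp [factorSet]

theorem powZ_mul_lift (g : S.G) : (S.powZ g : 𝒢) * S.lift (g ^ p) = S.lift g ^ p := by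
  simp [powZ]

theorem powZ_mul (P : S.Cyc) (g h : P.1) :
    S.powZ g * S.powZ h * S.factorSet (g ^ p) (h ^ p) =
      S.factorSet g h ^ p * S.powZ (g * h) := by
  ext1
  have hgh : ((g : S.G) * h) ^ p = (g : S.G) ^ p * (h : S.G) ^ p := by
    have : Commute g h := S.mul_comm_of_cyc P g h
    exact congrArg Subtype.val (this.mul_pow p)
  have hl : Commute (S.lift g) (S.lift h) := S.lift_comm P g h
  apply mul_right_cancel (b := S.lift ((g : S.G) ^ p * (h : S.G) ^ p))
  simp only [Subgroup.coe_mul, Subgroup.coe_pow]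
  have e1 := S.Z_central (S.powZ (h : S.G)).2 (S.lift ((g : S.G) ^ p))
  have e2 : Commute (S.factorSet (g : S.G) h : 𝒢) (S.lift ((g : S.G) * h)) :=
    S.Z_central (S.factorSet _ _).2 _
  calc _ = (S.powZ (g : S.G) : 𝒢) * (S.powZ (h : S.G) * S.lift ((g : S.G) ^ p)) *
          S.lift ((h : S.G) ^ p) := by
        rw [mul_assoc, factorSet_mul_lift]; group
    _ = ((S.powZ (g : S.G) : 𝒢) * S.lift ((g : S.G) ^ p)) *
          (S.powZ (h : S.G) * S.lift ((h : S.G) ^ p)) := by rw [e1]; group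
    _ = (S.lift g * S.lift h) ^ p := by rw [powZ_mul_lift, powZ_mul_lift, hl.mul_pow]
    _ = _ := by
        rw [← factorSet_mul_lift, e2.mul_pow, ← powZ_mul_lift, hgh, mul_assoc]

/-- The homomorphism `ver^{P'}_P : R[P']^τ → R[P]^τ`, `r ḡ ↦ φ(r) ḡ ^ p`, induced by the `p`-power
map `U_{P'} → U_P` (and by the Frobenius on the coefficients), for cyclic subgroups such that the
`p`-th powers of elements of `P'` lie in `P`. For `P' = P` this is the endomorphism `φ` of
`R[P]^τ`. -/
def Coef.ver (P' P : S.Cyc) (h : ∀ g ∈ P'.1, g ^ p ∈ P.1) : S.RP c.ι P' →+* S.RP c.ι P :=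
  TwGrp.liftHom ((TwGrp.C _).comp c.φ)
    (fun g => TwGrp.single _ ⟨(g : S.G) ^ p, h g g.2⟩ (c.ι (S.powZ g) : R))
    (fun r g => mul_comm _ _)
    (by
      have h1 : (⟨((1 : P'.1) : S.G) ^ p, h _ (1 : P'.1).2⟩ : P.1) = 1 :=
        Subtype.ext (one_pow p)
      have h2 : S.powZ ((1 : P'.1) : S.G) = 1 := powZ_one
      rw [h1, h2, map_one]
      rfl)
    (fun g h => by
      have hgh : ((g : S.G) * h) ^ p = (g : S.G) ^ p * (h : S.G) ^ p := by
        have : Commute g h := S.mul_comm_of_cyc P' g h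
        exact congrArg Subtype.val (this.mul_pow p)
      rw [TwGrp.single_mul_single, RingHom.comp_apply, TwGrp.C_mul_single]
      congr 1
      · exact Subtype.ext hgh.symm
      · change _ = c.φ (c.ι (S.factorSet g h)) * _
        rw [c.φ_ι]
        change _ * _ * (c.ι (S.factorSet _ _) : R) = _
        rw [← Units.val_mul, ← Units.val_mul, ← Units.val_mul, ← map_mul, ← map_mul, ← map_mul]
        congr 2
        exact powZ_mul P' g h)

/-- The endomorphism `φ` of `R[P]^τ`. -/
def Coef.frob (P : S.Cyc) : S.RP c.ι P →+* S.RP c.ι P :=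
  c.ver P P fun _ hg => pow_mem hg p

/-- The norm map `θ^G_P : K₁(A) → (R[P]^τ)ˣ` for a ring `A` identified with `R[G]^τ`. -/
def Coef.theta {A : Type*} [Ring A] (ε : A ≃+* S.RG c.ι) (P : S.Cyc) :
    K1 A →* (S.RP c.ι P)ˣ :=
  letI := Fintype.ofFinite (S.G ⧸ P.1)
  K1.detHom ((TwGrp.regRep (S.cocycle c.ι) P.1).comp ε.toRingHom)

/-- The coefficient ring `R[ζ]`, where `ζ` is a primitive `p`-th root of unity. -/
abbrev ZetaRing (p : ℕ) (R : Type*) [CommRing R] : Type _ :=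
  AdjoinRoot (Polynomial.cyclotomic p R)

/-- The structure map of `R[ζ]`. -/
def Coef.zetaι : S.Z →* (ZetaRing p R)ˣ :=
  (Units.map (algebraMap R (ZetaRing p R)).toMonoidHom).comp c.ι

/-- For a character `ω : P → μ_p`, `g ↦ ζ ^ ω(g)`, the map
`ω^k : R[P]^τ → R[ζ][P]^τ`, `r ḡ ↦ r ω(g)^k ḡ`. -/
def Coef.twist {P : S.Cyc} (ω : P.1 →* Multiplicative (ZMod p)) (k : ℕ) (x : S.RP c.ι P) :
    S.RP c.zetaι P :=
  fun g => algebraMap R (ZetaRing p R) (x g) *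
    AdjoinRoot.root (Polynomial.cyclotomic p R) ^ (k * (ω g).toAdd.val)

/-- The graph of `α_P : (R[P]^τ)ˣ → (R[P]^τ)ˣ`.  For `P = 1` we have `α_P(x) = x^p / φ(x)`.
For `P ≠ 1` we have `α_P(x) = x^p / ∏_{0 ≤ k < p} ω^k(x)`, a quotient formed in `R[ζ][P]^τ` but
which lies in `R[P]^τ`; note that `ω^0 : R[P]^τ → R[ζ][P]^τ` is the inclusion. -/
def Coef.IsAlpha {P : S.Cyc} (ω : P.1 →* Multiplicative (ZMod p)) (x y : (S.RP c.ι P)ˣ) : Prop :=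
  if P.1 = ⊥ then (y : S.RP c.ι P) * c.frob P x = x ^ p
  else c.twist ω 0 y * ∏ k ∈ Finset.range p, c.twist ω k x = (c.twist ω 0 x) ^ p

/-- The map `α_P : (R[P]^τ)ˣ → (R[P]^τ)ˣ`. -/
def Coef.alpha {P : S.Cyc} (ω : P.1 →* Multiplicative (ZMod p)) (x : (S.RP c.ι P)ˣ) :
    (S.RP c.ι P)ˣ :=
  if h : ∃ y, c.IsAlpha ω x y then h.choose else 1

theorem Coef.pow_mem_of_image_eq {P' P : S.Cyc}
    (h : (fun g : S.G => g ^ p) '' (P'.1 : Set S.G) = (P.1 : Set S.G)) :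
    ∀ g ∈ P'.1, g ^ p ∈ P.1 := fun g hg => by
  have : g ^ p ∈ (fun g : S.G => g ^ p) '' (P'.1 : Set S.G) := ⟨g, hg, rfl⟩
  rw [h] at this
  exact this

/-- The map `u^G_P : ∏_C (R[C]^τ)ˣ → (R[P]^τ)ˣ`, `(x_C) ↦ ∏_{P'} ver^{P'}_P(x_{P'})`, where `P'`
runs over the cyclic subgroups of `G` such that `P'^p = P` and `P' ≠ P`. -/
def Coef.u (x : ∀ C : S.Cyc, (S.RP c.ι C)ˣ) (P : S.Cyc) : (S.RP c.ι P)ˣ :=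
  ∏ᶠ P' : {P' : S.Cyc //
      (fun g : S.G => g ^ p) '' (P'.1 : Set S.G) = (P.1 : Set S.G) ∧ P' ≠ P},
    Units.map (c.ver P'.1 P (Coef.pow_mem_of_image_eq P'.2.1)).toMonoidHom (x P'.1)

end Multiplicative

/-! ### Logarithms -/

section Log

variable {S}
variable {R R' : Type*} [CommRing R] [CommRing R'] [Algebra ℚ R']

/-- A coefficient ring `R'` of characteristic zero in which logarithms take their values:
`R'` is an extension `j : R → R'` of `R` to which `φ` extends, with a set of
subgroups `L` of `R'` such that the `p ^ n L` are the basic neighbourhoods of zero. -/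
structure LogRing (c : S.Coef R) (R' : Type*) [CommRing R'] [Algebra ℚ R'] where
  j : R →+* R'
  φ : R' →+* R'
  φ_j : ∀ r, φ (j r) = j (c.φ r)
  lattices : Set (AddSubgroup R')

variable {c : S.Coef R} (E : LogRing c R')

/-- `R'` as a coefficient ring. -/
def LogRing.coef : S.Coef R' where
  ι := (Units.map E.j.toMonoidHom).comp c.ι
  φ := E.φ
  φ_ι z := by
    change E.φ (E.j (c.ι z)) = E.j (c.ι (z ^ p))
    rw [E.φ_j, c.φ_ι]

/-- Convergence of a sequence in `R'`. -/
def LogRing.TendsTo (s : ℕ → R') (ℓ : R') : Prop :=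
  ∀ L ∈ E.lattices, ∀ n : ℕ, ∃ N, ∀ m ≥ N, ∃ r ∈ L, ℓ - s m = (p : R') ^ n * r

/-- The logarithmic series `∑_{i ≥ 1} (-1)^(i+1) (x-1)^i / i` of `x ∈ R[P]^τ` converges to
`ℓ ∈ R'[P]^τ`. -/
def LogRing.HasLog {P : S.Cyc} (x : S.RP c.ι P) (ℓ : S.RP E.coef.ι P) : Prop :=
  ∀ g, E.TendsTo
    (fun m => ∑ i ∈ Finset.Icc 1 m, ((-1) ^ (i + 1) / (i : ℚ)) • E.j (((x - 1) ^ i) g)) (ℓ g)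

/-- The logarithmic series `∑_{i ≥ 1} (-1)^(i+1) Tr((x-1)^i) / i` of a matrix `x` with entries in
`R[G]^τ` converges to `ℓ` in `R'[Conj(G)]^τ`. -/
def LogRing.HasTrLog {n : ℕ} (x : Matrix (Fin n) (Fin n) (S.RG c.ι)) (ℓ : S.ConjMod R') : Prop :=
  ∀ d, E.TendsTo
    (fun m => ∑ i ∈ Finset.Icc 1 m,
      ((-1) ^ (i + 1) / (i : ℚ)) • E.j (S.toConj (Matrix.trace ((x - 1) ^ i)) d)) (ℓ d)

/-- The graph of `log : K₁(A) → R'[Conj(G)]^τ` for a ring `A` identified with `R[G]^τ`: the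
homomorphism which sends the class of a matrix `u` congruent to `1` modulo the Jacobson radical of
`A` to the trace of `Log(u)`.  Every `x ∈ K₁(A)` has a power `x ^ m` which is
represented by such a matrix. -/
def LogRing.IsLog {A : Type*} [Ring A] (ε : A ≃+* S.RG c.ι) (x : K1 A) (ℓ : S.ConjMod R') :
    Prop :=
  ∃ m : ℕ, 0 < m ∧ ∃ (n : ℕ) (u : GL (Fin n) A),
    (∀ i j, (u.1 - 1) i j ∈ Ring.jacobson A) ∧ K1.mk u = x ^ m ∧
      E.HasTrLog (u.1.map ε) (m • ℓ)

/-- The graph of the integral logarithm `L(x) = log(x) - (φ/p) log(x)` on `K₁(A)`. -/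
def LogRing.IsIntegralLog {A : Type*} [Ring A] (ε : A ≃+* S.RG c.ι) (x : K1 A)
    (L : S.ConjMod R') : Prop :=
  ∃ ℓ, E.IsLog ε x ℓ ∧ L = ℓ - (1 / p : ℚ) • S.frobConj E.coef ℓ

variable (S) in
/-- The image of `Γ` in `G`. -/
def gammaBar : S.Cyc :=
  ⟨((QuotientGroup.mk' S.Z).comp S.s).range, by
    refine ⟨⟨⟨_, MonoidHom.mem_range.2 ⟨Multiplicative.ofAdd 1, rfl⟩⟩, ?_⟩⟩
    rintro ⟨_, ⟨z, rfl⟩⟩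
    obtain ⟨w, hw⟩ := S.exists_residue z
    refine ⟨((PadicInt.toZModPow S.e z.toAdd).val : ℕ), Subtype.ext ?_⟩
    refine (congrArg Subtype.val (zpow_natCast _ _)).trans ?_
    change (QuotientGroup.mk (S.s (Multiplicative.ofAdd 1)) : S.G) ^ _ =
      QuotientGroup.mk (S.s z)
    rw [← QuotientGroup.mk_pow, ← map_pow, ← ofAdd_nsmul, nsmul_one, eq_comm, QuotientGroup.eq,
      ← map_inv, ← map_mul]
    refine S.mem_Z.2 ⟨w, ?_⟩
    rw [hw, sub_eq_neg_add, ofAdd_add, ofAdd_neg, ofAdd_toAdd]⟩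

variable (S) in
/-- The endomorphism of `G` induced by the projection `𝒢 → Γ ⊆ 𝒢`. -/
def projGamma : S.G →* S.G :=
  QuotientGroup.map S.Z S.Z (S.s.comp S.π) fun x hx => by
    change S.s (S.π x) ∈ S.Z
    rw [S.s_π_of_mem_Z hx]; exact hx

variable (S) in
/-- The kernel `J` of the map `R[G]^τ → R[Γ / Γ^(p^e)]^τ` induced by the projection `𝒢 → Γ`. -/
def augKer (ι : S.Z →* Rˣ) : Set (S.RG ι) :=
  {a | ∀ k : S.G, (∑ᶠ g : S.G, if S.projGamma g = k then a g else 0) = 0}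

/-- The graph of the integral logarithm on `K₁(R[G]^τ)` when `R` is the `p`-adic completion of
`Λ_O(Γ^(p^e))_(p)`: write `x = u y` with `y` coming from the units of
`R[Γ / Γ^(p^e)]^τ` and `u` represented by a matrix congruent to `1` modulo `J`; then
`L(x) = log(u) - (φ/p) log(u) + (1/p) log(y^p / φ(y))`. -/
def LogRing.IsIntegralLog' (x : K1 (S.RG c.ι)) (L : S.ConjMod R') : Prop :=
  ∃ (n : ℕ) (u : GL (Fin n) (S.RG c.ι)) (y : (S.RP c.ι S.gammaBar)ˣ) (ℓ : S.ConjMod R')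
    (μ : S.RP E.coef.ι S.gammaBar),
    (∀ i j, (u.1 - 1) i j ∈ S.augKer c.ι) ∧
    K1.mk u * K1.ofUnit
      (Units.map (TwGrp.ofSubgroup (S.cocycle c.ι) S.gammaBar.1).toMonoidHom y) = x ∧
    E.HasTrLog u.1 ℓ ∧
    E.HasLog ((y ^ p / Units.map (c.frob S.gammaBar).toMonoidHom y : (S.RP c.ι S.gammaBar)ˣ) :
      S.RP c.ι S.gammaBar) μ ∧
    L = ℓ - (1 / p : ℚ) • S.frobConj E.coef ℓ + (1 / p : ℚ) • S.cycToConj S.gammaBar μ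

end Log

end Setup

/-! ### The coefficient rings `Λ_O(Γ^(p^e))` and its localised completion -/

section Completion

variable (p : ℕ) (B : Type*) [CommRing B]

/-- The `p`-adic completion `B^ = lim_n B / p ^ n B`. -/
abbrev PComp : Type _ := AdicCompletion (Ideal.span {(p : B)}) B

variable {B}

theorem PComp.le_comap (f : B →+* B) (n : ℕ) :
    Ideal.span {(p : B)} ^ n ≤ (Ideal.span {(p : B)} ^ n).comap f := by
  rw [Ideal.span_singleton_pow, Ideal.span_le, Set.singleton_subset_iff]
  simp

theorem PComp.map_compat (f : B →+* B) {m n : ℕ} (hmn : m ≤ n) :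
    (Ideal.Quotient.factorPow (Ideal.span {(p : B)}) hmn).comp
      ((Ideal.quotientMap (Ideal.span {(p : B)} ^ n) f (PComp.le_comap p f n)).comp
        (AdicCompletion.evalₐ (Ideal.span {(p : B)}) n : PComp p B →+* _)) =
      (Ideal.quotientMap (Ideal.span {(p : B)} ^ m) f (PComp.le_comap p f m)).comp
        (AdicCompletion.evalₐ (Ideal.span {(p : B)}) m : PComp p B →+* _) := by
  ext x
  obtain ⟨r, rfl⟩ := AdicCompletion.mk_surjective (Ideal.span {(p : B)}) B x
  have e := congrArg (Ideal.quotientMap (Ideal.span {(p : B)} ^ m) f (PComp.le_comap p f m))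
    (AdicCompletion.Ideal.mk_eq_mk (Ideal.span {(p : B)}) hmn r)
  simpa [AdicCompletion.evalₐ_mk] using e

/-- The endomorphism of the `p`-adic completion induced by an endomorphism of `B`. -/
def PComp.map (f : B →+* B) : PComp p B →+* PComp p B :=
  AdicCompletion.liftRingHom (Ideal.span {(p : B)})
    (fun n => (Ideal.quotientMap (Ideal.span {(p : B)} ^ n) f (PComp.le_comap p f n)).comp
      (AdicCompletion.evalₐ (Ideal.span {(p : B)}) n : PComp p B →+* _))
    (PComp.map_compat p f)

theorem PComp.map_of (f : B →+* B) (b : B) :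
    PComp.map p f (algebraMap B (PComp p B) b) = algebraMap B (PComp p B) (f b) := by
  apply AdicCompletion.ext_evalₐ
  intro n
  refine (AdicCompletion.evalₐ_liftRingHom _ _ (PComp.map_compat p f) n _).trans ?_
  simp only [RingHom.comp_apply, RingHom.coe_coe,
    AlgHom.commutes, Ideal.Quotient.algebraMap_eq, Ideal.quotientMap_mk]

/-- The localisation `B_(p)` of `B` at the submonoid generated by the elements which are not
divisible by `p` (these elements are themselves closed under multiplication if `p` is prime). -/
abbrev PLoc (p : ℕ) (B : Type*) [CommRing B] : Type _ :=
  Localization (Submonoid.closure {t : B | ¬ (p : B) ∣ t})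

/-- The endomorphism of `B_(p)` induced by an endomorphism of `B` which preserves
non-divisibility by `p`. -/
def PLoc.map (f : B →+* B) (hf : ∀ t, ¬ (p : B) ∣ t → ¬ (p : B) ∣ f t) :
    PLoc p B →+* PLoc p B :=
  IsLocalization.map (M := Submonoid.closure {t : B | ¬ (p : B) ∣ t}) (PLoc p B)
    (T := Submonoid.closure {t : B | ¬ (p : B) ∣ t}) f
    (by
      rw [Submonoid.closure_le]
      exact fun t ht => Submonoid.subset_closure (hf t ht))

end Completion

namespace Iw

variable {O : Type*} [CommRing O] [IsDomain O]

theorem natCast_mul_coeff {M : Type*} [Monoid M] (n : ℕ) (a : MonoidAlgebra O M) (x : M) :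
    ((n : MonoidAlgebra O M) * a).coeff x = n * a.coeff x := by
  rw [← nsmul_eq_mul, ← nsmul_eq_mul]; rfl

theorem natCast_dvd {M : Type*} [Monoid M] (n : ℕ) (a : MonoidAlgebra O M)
    (h : ∀ x, (n : O) ∣ a.coeff x) : (n : MonoidAlgebra O M) ∣ a := by
  rw [← MonoidAlgebra.sum_coeff_single a]
  refine Finset.dvd_sum fun x _ => ?_
  obtain ⟨c, hc⟩ := h x
  refine ⟨MonoidAlgebra.single x c, ?_⟩
  rw [hc, ← nsmul_eq_mul, ← nsmul_eq_mul, MonoidAlgebra.smul_single]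

variable {𝒢 : Type*} [Group 𝒢] [TopologicalSpace 𝒢]

theorem natCast_dvd_of_proj {n : ℕ} (hn : (n : O) ≠ 0) (t : Iw O 𝒢)
    (h : ∀ U, (n : MonoidAlgebra O _) ∣ proj U t) : (n : Iw O 𝒢) ∣ t := by
  choose y hy using h
  have hc : y ∈ iwSubring O 𝒢 := by
    intro U V hUV
    have e := proj_compat t U V hUV
    rw [hy, hy, map_mul, map_natCast] at e
    ext x
    have e2 := congrArg (fun a => a.coeff x) e
    simp only [natCast_mul_coeff] at e2
    exact mul_left_cancel₀ hn e2
  refine ⟨(show Iw O 𝒢 from ⟨y, hc⟩), ?_⟩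
  ext1 U
  rw [map_mul, map_natCast]
  exact hy U

end Iw

namespace Setup

variable {p : ℕ} [Fact p.Prime] {𝒢 : Type*} [Group 𝒢] [TopologicalSpace 𝒢]
  [IsTopologicalGroup 𝒢] (S : Setup p 𝒢)

/-- The `p`-power map on `Γ^(p^e)`. -/
def powHom : S.Z →* S.Z where
  toFun z := z ^ p
  map_one' := one_pow p
  map_mul' a b := (show Commute a b from mul_comm' a b).mul_pow p

theorem continuous_powHom : Continuous S.powHom := continuous_pow p

variable {O K : Type*} [CommRing O] [CommRing K]

/-- The coefficient ring `Λ_O(Γ^(p^e))`, with `φ` induced by `σ` on `O` and by the `p`-power map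
on `Γ^(p^e)`. -/
def iwCoef (σ : O →+* O) : S.Coef (Iw O S.Z) where
  ι := Iw.of O
  φ := Iw.map σ S.powHom S.continuous_powHom
  φ_ι _ := Iw.map_of _ _ _ _

/-- The ring `lim_U K[Γ^(p^e)/U]`, with the topology of the coefficientwise `p`-adic
convergence, in which logarithms of elements of `K₁(Λ_O(𝒢))` have their coefficients. -/
def iwLog [Algebra ℚ K] (σ : O →+* O) (σK : K →+* K) (i : O →+* K)
    (hi : ∀ a, σK (i a) = i (σ a)) : LogRing (S.iwCoef σ) (Iw K S.Z) where
  j := Iw.map i (MonoidHom.id _) continuous_id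
  φ := Iw.map σK S.powHom S.continuous_powHom
  φ_j r := by
    refine (Iw.map_map _ _ _ _ _ _ r).trans (Eq.trans ?_ (Iw.map_map _ _ _ _ _ _ r).symm)
    have h : σK.comp i = i.comp σ := RingHom.ext hi
    exact congrArg (fun f : Iw O S.Z →+* Iw K S.Z => f r) (Iw.map_congr h rfl _ _)
  lattices := Set.range fun U : OpenNormalSubgroup S.Z =>
    (MonoidAlgebra.mapRingHom (S.Z ⧸ U.toSubgroup) i).range.toAddSubgroup.comap
      (Iw.proj U).toAddMonoidHom

theorem exists_openNormal (U : OpenNormalSubgroup S.Z) : ∃ V : OpenNormalSubgroup S.Z,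
    ∀ z : S.Z, z ^ p ∈ V.toSubgroup → z ∈ U.toSubgroup := by
  have hdiv : ∀ (n : ℕ) (x : ℤ_[p]), (p : ℤ_[p]) ^ n ∣ x ↔ ‖x‖ ≤ (p : ℝ) ^ (-n : ℤ) := fun n x => by
    rw [PadicInt.norm_le_pow_iff_mem_span_pow, Ideal.mem_span_singleton]
  have hp0 : (p : ℤ_[p]) ≠ 0 := by exact_mod_cast (Fact.out : p.Prime).ne_zero
  let ψ : ℤ_[p] → S.Z := fun w => ⟨S.s (Multiplicative.ofAdd w ^ p ^ S.e), S.mem_Z.2 ⟨_, rfl⟩⟩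
  have hψ : Continuous ψ := by
    refine Continuous.subtype_mk (S.continuous_s.comp ?_) _
    exact (continuous_ofAdd).pow _
  have hψ0 : ψ 0 = 1 := by ext1; simp [ψ]
  have hn : ψ ⁻¹' (U : Set S.Z) ∈ nhds (0 : ℤ_[p]) :=
    hψ.continuousAt.preimage_mem_nhds (by rw [hψ0]; exact U.toOpenSubgroup.mem_nhds_one)
  obtain ⟨δ, hδ, hball⟩ := Metric.mem_nhds_iff.1 hn
  obtain ⟨N, hN⟩ := PadicInt.exists_pow_neg_lt p hδ
  have hU : ∀ w : ℤ_[p], (p : ℤ_[p]) ^ N ∣ w → ψ w ∈ U.toSubgroup := fun w hw =>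
    hball (by rw [mem_ball_zero_iff]; exact ((hdiv N w).1 hw).trans_lt hN)
  let V0 : Subgroup S.Z :=
    { carrier := {z | (p : ℤ_[p]) ^ (S.e + N + 1) ∣ (S.π z).toAdd}
      mul_mem' := fun {a b} ha hb => by
        rw [Set.mem_ofPred_eq, Subgroup.coe_mul, map_mul, toAdd_mul]; exact dvd_add ha hb
      one_mem' := by simp
      inv_mem' := fun {a} ha => by
        rw [Set.mem_ofPred_eq, Subgroup.coe_inv, map_inv, toAdd_inv]; exact (dvd_neg).2 ha }
  have hV0 : IsOpen (V0 : Set S.Z) := by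
    have hc : Continuous fun z : S.Z => (S.π z).toAdd :=
      continuous_toAdd.comp (S.continuous_π.comp continuous_subtype_val)
    have := (IsUltrametricDist.isOpen_closedBall (0 : ℤ_[p])
      (r := (p : ℝ) ^ (-(S.e + N + 1 : ℕ) : ℤ)) (zpow_pos (by
        exact_mod_cast (Fact.out : p.Prime).pos) _).ne').preimage hc
    convert this using 1
    ext z
    simp only [Set.mem_preimage, mem_closedBall_zero_iff]
    exact hdiv _ _
  refine ⟨{ toSubgroup := V0, isOpen' := hV0,
            isNormal' := ⟨fun n hn g => by rwa [mul_comm' g n, mul_inv_cancel_right]⟩ }, ?_⟩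
  intro z hz
  change (p : ℤ_[p]) ^ (S.e + N + 1) ∣ (S.π ((z ^ p : S.Z) : 𝒢)).toAdd at hz
  rw [Subgroup.coe_pow, map_pow, toAdd_pow, nsmul_eq_mul, pow_succ',
    mul_dvd_mul_iff_left hp0, pow_add] at hz
  obtain ⟨w, hw⟩ := hz
  rw [mul_assoc] at hw
  have : z = ψ (p ^ N * w) := by
    ext1
    simp only [ψ]
    rw [← ofAdd_nsmul, nsmul_eq_mul, Nat.cast_pow, ← hw, ofAdd_toAdd, S.s_π_of_mem_Z z.2]
  rw [this]
  exact hU _ (dvd_mul_right _ _)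

theorem not_dvd_φ [IsDomain O] (σ : O →+* O) (hp : Prime (p : O))
    (hσ : ∀ a, (p : O) ∣ σ a - a ^ p) (t : Iw O S.Z) (ht : ¬ (p : Iw O S.Z) ∣ t) :
    ¬ (p : Iw O S.Z) ∣ (S.iwCoef σ).φ t := by
  have hp' : ∀ a, (p : O) ∣ σ a → (p : O) ∣ a := fun a ha =>
    hp.dvd_of_dvd_pow ((dvd_sub_right ha).1 (hσ a))
  rintro ⟨r, hr⟩
  refine ht (Iw.natCast_dvd_of_proj hp.ne_zero t fun U => ?_)
  obtain ⟨V, hV⟩ := S.exists_openNormal U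
  let W := Iw.comap S.powHom S.continuous_powHom V
  have hW : W.toSubgroup ≤ U.toSubgroup := fun z hz => hV z hz
  rw [← Iw.proj_compat t W U hW]
  have hinj : Function.Injective
      (QuotientGroup.map W.toSubgroup V.toSubgroup S.powHom le_rfl) := by
    rw [injective_iff_map_eq_one]
    intro a
    induction a using QuotientGroup.induction_on with | H a => ?_
    intro ha
    replace ha := (QuotientGroup.eq_one_iff _).1 ha
    exact (QuotientGroup.eq_one_iff a).2 ha
  have e := congrArg (Iw.proj V) hr
  change Iw.proj V (Iw.map σ S.powHom S.continuous_powHom t) = _ at e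
  rw [Iw.proj_map, map_mul, map_natCast] at e
  have hdvd : (p : MonoidAlgebra O (S.Z ⧸ W.toSubgroup)) ∣ Iw.proj W t := by
    refine Iw.natCast_dvd p _ fun x => hp' _ ?_
    have e2 := congrArg (fun a => a.coeff
      (QuotientGroup.map W.toSubgroup V.toSubgroup S.powHom le_rfl x)) e
    simp only [Iw.natCast_mul_coeff] at e2
    refine ⟨_, Eq.trans ?_ e2⟩
    exact (Finsupp.mapDomain_apply hinj
      (MonoidAlgebra.mapRingHom _ σ (Iw.proj W t)).coeff x).symm
  obtain ⟨q, hq⟩ := hdvd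
  rw [hq, map_mul, map_natCast]
  exact dvd_mul_right _ _

/-- The `p`-adic completion of `Λ_O(Γ^(p^e))_(p)`. -/
def HatRing (O : Type*) [CommRing O] : Type _ := PComp p (PLoc p (Iw O S.Z))

instance (O : Type*) [CommRing O] : CommRing (S.HatRing O) :=
  inferInstanceAs (CommRing (PComp p (PLoc p (Iw O S.Z))))

/-- The canonical map from `Λ_O(Γ^(p^e))` to the `p`-adic completion of its localisation. -/
def toHat (O : Type*) [CommRing O] : Iw O S.Z →+* S.HatRing O :=
  (algebraMap (PLoc p (Iw O S.Z)) (PComp p (PLoc p (Iw O S.Z)))).comp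
    (algebraMap (Iw O S.Z) (PLoc p (Iw O S.Z)))

/-- The `p`-adic completion of `Λ_O(Γ^(p^e))_(p)` as a coefficient ring. -/
def hatCoef [IsDomain O] (σ : O →+* O) (hp : Prime (p : O)) (hσ : ∀ a, (p : O) ∣ σ a - a ^ p) :
    S.Coef (S.HatRing O) where
  ι := (Units.map (S.toHat O).toMonoidHom).comp (Iw.of O)
  φ := PComp.map p (PLoc.map p (S.iwCoef σ).φ (S.not_dvd_φ σ hp hσ))
  φ_ι z := by
    refine (PComp.map_of p _ (algebraMap (Iw O S.Z) (PLoc p (Iw O S.Z)) (Iw.of O z))).trans ?_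
    refine congrArg (algebraMap (PLoc p (Iw O S.Z)) (PComp p (PLoc p (Iw O S.Z)))) ?_
    refine (IsLocalization.map_eq _ _).trans ?_
    exact congrArg _ ((S.iwCoef σ).φ_ι z)

/-- The ring `R^ ⊗ ℚ`, where `R^` is the `p`-adic completion of `Λ_O(Γ^(p^e))_(p)`, with its
`p`-adic topology. -/
def hatLog [IsDomain O] (σ : O →+* O) (hp : Prime (p : O)) (hσ : ∀ a, (p : O) ∣ σ a - a ^ p) :
    LogRing (S.hatCoef σ hp hσ) (TensorProduct ℤ ℚ (S.HatRing O)) where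
  j := (Algebra.TensorProduct.includeRight : S.HatRing O →ₐ[ℤ] TensorProduct ℤ ℚ (S.HatRing O))
  φ := (Algebra.TensorProduct.map (AlgHom.id ℤ ℚ) (S.hatCoef σ hp hσ).φ.toIntAlgHom).toRingHom
  φ_j r := by
    simp
  lattices := {(Algebra.TensorProduct.includeRight :
    S.HatRing O →ₐ[ℤ] TensorProduct ℤ ℚ (S.HatRing O)).range.toSubring.toAddSubgroup}

end Setup

/-! ### `Λ_O(𝒢)` as a twisted group ring -/

namespace Setup

variable {p : ℕ} [Fact p.Prime] {𝒢 : Type*} [Group 𝒢] [TopologicalSpace 𝒢] (S : Setup p 𝒢)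
variable (O : Type*) [CommRing O]

theorem continuous_subtype_Z : Continuous S.Z.subtype := continuous_subtype_val

/-- The canonical map `Λ_O(Γ^(p^e))[G]^τ → Λ_O(𝒢)`, `∑ r_g ḡ ↦ ∑ r_g g̃`, where `g̃` is the
distinguished lift of `g`. -/
def fromTw : S.RG (Iw.of O : S.Z →* (Iw O S.Z)ˣ) →+* Iw O 𝒢 :=
  TwGrp.liftHom (Iw.map (RingHom.id O) S.Z.subtype S.continuous_subtype_Z)
    (fun g => (Iw.of O (S.lift g) : Iw O 𝒢))
    (fun r g => by
      ext1 V
      rw [map_mul, map_mul, Iw.proj_map, Iw.proj_of]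
      generalize Iw.proj (Iw.comap S.Z.subtype S.continuous_subtype_Z V) r = y
      induction y using MonoidAlgebra.induction_linear with
      | zero => simp
      | add a b ha hb => rw [map_add, map_add, mul_add, add_mul, ha, hb]
      | single q r =>
        induction q using QuotientGroup.induction_on with | H z => ?_
        rw [MonoidAlgebra.mapRingHom_single, MonoidAlgebra.mapDomainRingHom_apply,
          MonoidAlgebra.mapDomain_single, MonoidAlgebra.single_mul_single,
          MonoidAlgebra.single_mul_single, mul_comm]
        congr 1
        exact congrArg (QuotientGroup.mk : 𝒢 → 𝒢 ⧸ V.toSubgroup) (S.Z_central z.2 _).symm)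
    (by rw [S.lift_one, map_one]; rfl)
    (fun g h => by
      change _ = Iw.map _ _ _ (Iw.of O (S.factorSet g h) : Iw O S.Z) * _
      rw [Iw.map_of, ← Units.val_mul, ← Units.val_mul, ← map_mul, ← map_mul]
      congr 2
      exact (factorSet_mul_lift g h).symm)

theorem proj_fromTw_coeff (a : S.RG (Iw.of O : S.Z →* (Iw O S.Z)ˣ)) (V : OpenNormalSubgroup 𝒢)
    (hV : V.toSubgroup ≤ S.Z) (z : S.Z) (g : S.G) :
    (Iw.proj V (S.fromTw O a)).coeff (QuotientGroup.mk ((z : 𝒢) * S.lift g)) =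
      (Iw.proj (Iw.comap S.Z.subtype S.continuous_subtype_Z V) (a g)).coeff
        (QuotientGroup.mk z) := by
  have := Fintype.ofFinite S.G
  let W := Iw.comap S.Z.subtype S.continuous_subtype_Z V
  let q : S.Z ⧸ W.toSubgroup →* 𝒢 ⧸ V.toSubgroup :=
    QuotientGroup.map W.toSubgroup V.toSubgroup S.Z.subtype le_rfl
  have key : ∀ (y : MonoidAlgebra O (S.Z ⧸ W.toSubgroup)) (h : S.G),
      (MonoidAlgebra.mapDomainRingHom O q (MonoidAlgebra.mapRingHom _ (RingHom.id O) y) *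
        MonoidAlgebra.single (QuotientGroup.mk (S.lift h)) 1).coeff
          (QuotientGroup.mk ((z : 𝒢) * S.lift g)) =
        if h = g then y.coeff (QuotientGroup.mk z) else 0 := by
    intro y h
    induction y using MonoidAlgebra.induction_linear with
    | zero => simp
    | add a b ha hb =>
      rw [map_add, map_add, add_mul, MonoidAlgebra.coeff_add, Finsupp.add_apply, ha, hb]
      split_ifs <;> simp
    | single k r =>
      induction k using QuotientGroup.induction_on with | H w => ?_
      rw [MonoidAlgebra.mapRingHom_single, MonoidAlgebra.mapDomainRingHom_apply,
        MonoidAlgebra.mapDomain_single, MonoidAlgebra.single_mul_single, mul_one]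
      change (MonoidAlgebra.single (QuotientGroup.mk ((w : 𝒢) * S.lift h) : 𝒢 ⧸ V.toSubgroup)
        r).coeff _ = _
      rw [MonoidAlgebra.coeff_single, MonoidAlgebra.coeff_single, Finsupp.single_apply,
        Finsupp.single_apply]
      by_cases hh : h = g
      · subst hh
        rw [if_pos rfl]
        refine if_congr ?_ rfl rfl
        rw [QuotientGroup.eq, QuotientGroup.eq]
        change _ ↔ (w : 𝒢)⁻¹ * z ∈ V.toSubgroup
        have hz : ((w : 𝒢) * S.lift h)⁻¹ * (z * S.lift h) = (w : 𝒢)⁻¹ * z := by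
          have := S.Z_central (S.Z.mul_mem (S.Z.inv_mem w.2) z.2) (S.lift h)
          rw [mul_inv_rev, mul_assoc, ← mul_assoc _ _ (S.lift h), this]
          group
        rw [hz]
      · rw [if_neg hh, if_neg]
        intro e
        apply hh
        have e1 := hV (QuotientGroup.eq.1 e)
        have e2 : (QuotientGroup.mk ((w : 𝒢) * S.lift h) : S.G) =
            QuotientGroup.mk ((z : 𝒢) * S.lift g) := QuotientGroup.eq.2 e1
        rw [QuotientGroup.mk_mul, QuotientGroup.mk_mul, S.mk_lift, S.mk_lift,
          (QuotientGroup.eq_one_iff _).2 w.2, (QuotientGroup.eq_one_iff _).2 z.2, one_mul,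
          one_mul] at e2
        exact e2
  have e : S.fromTw O a = ∑ h, Iw.map (RingHom.id O) S.Z.subtype S.continuous_subtype_Z (a h) *
      (Iw.of O (S.lift h) : Iw O 𝒢) := finsum_eq_sum_of_fintype _
  rw [e, map_sum, MonoidAlgebra.coeff_sum, Finsupp.finsetSum_apply]
  rw [Finset.sum_eq_single g]
  · rw [map_mul, Iw.proj_map, Iw.proj_of]
    exact (key _ g).trans (if_pos rfl)
  · intro h _ hh
    rw [map_mul, Iw.proj_map, Iw.proj_of]
    exact (key _ h).trans (if_neg hh)
  · simp

variable [IsTopologicalGroup 𝒢] [T2Space 𝒢]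

theorem isOpen_Z : IsOpen (S.Z : Set 𝒢) := by
  have hf : S.Z.FiniteIndex := Subgroup.finiteIndex_of_finite_quotient
  refine S.Z.isOpen_of_isClosed_of_finiteIndex (IsCompact.isClosed ?_)
  have : CompactSpace (Multiplicative ℤ_[p]) := inferInstanceAs (CompactSpace ℤ_[p])
  have h := isCompact_range (S.continuous_s.comp
    ((continuous_pow (M := Multiplicative ℤ_[p]) (p ^ S.e))))
  convert h using 1
  ext x
  exact S.mem_Z

/-- An open subgroup of `Γ^(p^e)` as an open normal subgroup of `𝒢`. -/
def mapZ (U : OpenNormalSubgroup S.Z) : OpenNormalSubgroup 𝒢 where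
  toSubgroup := U.toSubgroup.map S.Z.subtype
  isOpen' := S.isOpen_Z.isOpenMap_subtype_val _ U.isOpen'
  isNormal' := ⟨by
    rintro _ ⟨z, hz, rfl⟩ g
    refine ⟨z, hz, ?_⟩
    change (z : 𝒢) = g * z * g⁻¹
    rw [← S.Z_central z.2 g, mul_inv_cancel_right]⟩

theorem mem_mapZ (U : OpenNormalSubgroup S.Z) (z : S.Z) :
    (z : 𝒢) ∈ (S.mapZ U).toSubgroup ↔ z ∈ U.toSubgroup := by
  constructor
  · rintro ⟨w, hw, e⟩
    have : w = z := Subtype.ext e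
    exact this ▸ hw
  · exact fun h => ⟨z, h, rfl⟩

/-- The injection `Γ^(p^e)/U → 𝒢/U`, `z ↦ z g̃`. -/
def transl (g : S.G) (U : OpenNormalSubgroup S.Z) (q : S.Z ⧸ U.toSubgroup) :
    𝒢 ⧸ (S.mapZ U).toSubgroup := QuotientGroup.mk ((q.out : 𝒢) * S.lift g)

theorem mk_mul_lift_eq (g : S.G) (U : OpenNormalSubgroup S.Z) (w z : S.Z) :
    (QuotientGroup.mk ((w : 𝒢) * S.lift g) : 𝒢 ⧸ (S.mapZ U).toSubgroup) =
      QuotientGroup.mk ((z : 𝒢) * S.lift g) ↔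
      (QuotientGroup.mk w : S.Z ⧸ U.toSubgroup) = QuotientGroup.mk z := by
  rw [QuotientGroup.eq, QuotientGroup.eq, ← S.mem_mapZ U]
  have hz : ((w : 𝒢) * S.lift g)⁻¹ * (z * S.lift g) = ((w⁻¹ * z : S.Z) : 𝒢) := by
    have := S.Z_central (w⁻¹ * z).2 (S.lift g)
    rw [Subgroup.coe_mul, Subgroup.coe_inv] at this ⊢
    rw [mul_inv_rev, mul_assoc, ← mul_assoc _ _ (S.lift g), this]
    group
  rw [hz]

theorem transl_mk (g : S.G) (U : OpenNormalSubgroup S.Z) (z : S.Z) :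
    S.transl g U (QuotientGroup.mk z) = QuotientGroup.mk ((z : 𝒢) * S.lift g) :=
  (S.mk_mul_lift_eq g U _ _).2 (QuotientGroup.out_eq' _)

theorem transl_injective (g : S.G) (U : OpenNormalSubgroup S.Z) :
    Function.Injective (S.transl g U) := by
  intro a b hab
  induction a using QuotientGroup.induction_on with | H w => ?_
  induction b using QuotientGroup.induction_on with | H z => ?_
  rw [S.transl_mk, S.transl_mk] at hab
  exact (S.mk_mul_lift_eq g U _ _).1 hab

theorem comapDomain_single {M N : Type*} (f : M → N) (hf : Function.Injective f) (m : M) (r : O) :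
    MonoidAlgebra.comapDomain f hf (MonoidAlgebra.single (f m) r) =
      MonoidAlgebra.single m r := by
  ext a
  simp [Finsupp.single_apply]

theorem comapDomain_single' {M N : Type*} (f : M → N) (hf : Function.Injective f) (n : N)
    (hn : ∀ m, f m ≠ n) (r : O) :
    MonoidAlgebra.comapDomain f hf (MonoidAlgebra.single n r) = 0 := by
  ext a
  simp [(hn a).symm]

theorem comapDomain_compat (g : S.G) (U U' : OpenNormalSubgroup S.Z)
    (hU : U.toSubgroup ≤ U'.toSubgroup) (hle : (S.mapZ U).toSubgroup ≤ (S.mapZ U').toSubgroup)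
    (y : MonoidAlgebra O (𝒢 ⧸ (S.mapZ U).toSubgroup)) :
    MonoidAlgebra.mapDomainRingHom O
      (QuotientGroup.map U.toSubgroup U'.toSubgroup (MonoidHom.id S.Z) hU)
      (MonoidAlgebra.comapDomain (S.transl g U) (S.transl_injective g U) y) =
    MonoidAlgebra.comapDomain (S.transl g U') (S.transl_injective g U')
      (MonoidAlgebra.mapDomainRingHom O
        (QuotientGroup.map (S.mapZ U).toSubgroup (S.mapZ U').toSubgroup (MonoidHom.id 𝒢) hle)
        y) := by
  induction y using MonoidAlgebra.induction_linear with
  | zero => simp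
  | add a b ha hb =>
    rw [MonoidAlgebra.comapDomain_add, map_add, map_add,
      MonoidAlgebra.comapDomain_add, ha, hb]
  | single k r =>
    induction k using QuotientGroup.induction_on with | H y => ?_
    rw [MonoidAlgebra.mapDomainRingHom_apply, MonoidAlgebra.mapDomainRingHom_apply,
      MonoidAlgebra.mapDomain_single]
    change _ = MonoidAlgebra.comapDomain _ _ (MonoidAlgebra.single (QuotientGroup.mk y) r)
    by_cases hy : (QuotientGroup.mk y : S.G) = g
    · obtain ⟨z, rfl⟩ : ∃ z : S.Z, (z : 𝒢) * S.lift g = y :=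
        ⟨⟨y * (S.lift g)⁻¹, S.mem_Z_of_mk_eq (by rw [hy, S.mk_lift])⟩, by simp⟩
      rw [← S.transl_mk, ← S.transl_mk, comapDomain_single, comapDomain_single,
        MonoidAlgebra.mapDomain_single]
      rfl
    · have hne : ∀ (U : OpenNormalSubgroup S.Z) q, S.transl g U q ≠ QuotientGroup.mk y := by
        intro U q e
        apply hy
        have e1 := QuotientGroup.eq.1 e
        obtain ⟨w, -, hw⟩ := e1
        have e2 : (q.out : 𝒢) * S.lift g * w = y := by rw [eq_comm, ← inv_mul_eq_iff_eq_mul]; exact hw.symm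
        rw [← e2, QuotientGroup.mk_mul, QuotientGroup.mk_mul, S.mk_lift,
          (QuotientGroup.eq_one_iff _).2 q.out.2, (QuotientGroup.eq_one_iff _).2 w.2, one_mul,
          mul_one]
      rw [comapDomain_single' _ _ _ _ (hne U), comapDomain_single' _ _ _ _ (hne U'),
        MonoidAlgebra.mapDomain_zero]

/-- The coefficients of an element of `Λ_O(𝒢)`. -/
def coeffTw (x : Iw O 𝒢) : S.RG (Iw.of O : S.Z →* (Iw O S.Z)ˣ) := fun g =>
  (⟨fun U => MonoidAlgebra.comapDomain (S.transl g U) (S.transl_injective g U)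
      (Iw.proj (S.mapZ U) x), fun U U' hU =>
    have hle : (S.mapZ U).toSubgroup ≤ (S.mapZ U').toSubgroup := Subgroup.map_mono hU
    (S.comapDomain_compat O g U U' hU hle _).trans
      (congrArg (MonoidAlgebra.comapDomain (S.transl g U') (S.transl_injective g U'))
        (Iw.proj_compat x _ _ hle))⟩ : iwSubring O S.Z)

theorem fromTw_bijective : Function.Bijective (S.fromTw O) := by
  constructor
  · rw [injective_iff_map_eq_zero]
    intro a ha
    ext1 g
    ext1 U
    let W := Iw.comap S.Z.subtype S.continuous_subtype_Z (S.mapZ U)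
    have hle : W.toSubgroup ≤ U.toSubgroup := fun z hz => (S.mem_mapZ U z).1 hz
    have hle' : (S.mapZ U).toSubgroup ≤ S.Z := by
      rintro _ ⟨w, -, rfl⟩; exact w.2
    rw [← Iw.proj_compat (a g) W U hle]
    have : Iw.proj W (a g) = 0 := by
      ext k
      induction k using QuotientGroup.induction_on with | H z => ?_
      rw [← S.proj_fromTw_coeff O a (S.mapZ U) hle' z g, ha, map_zero]
      rfl
    rw [this, map_zero]
    exact (map_zero (Iw.proj U)).symm
  · intro x
    refine ⟨S.coeffTw O x, ?_⟩
    ext1 V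
    let W : OpenNormalSubgroup 𝒢 :=
      { toSubgroup := V.toSubgroup ⊓ S.Z
        isOpen' := V.isOpen'.inter S.isOpen_Z
        isNormal' := inferInstance }
    have hW : W.toSubgroup ≤ S.Z := inf_le_right
    rw [← Iw.proj_compat _ W V inf_le_left, ← Iw.proj_compat x W V inf_le_left]
    congr 1
    ext k
    induction k using QuotientGroup.induction_on with | H y => ?_
    obtain ⟨z, hz⟩ : ∃ z : S.Z, (z : 𝒢) * S.lift (QuotientGroup.mk y) = y :=
      ⟨⟨y * (S.lift (QuotientGroup.mk y))⁻¹, S.mem_Z_of_mk_eq (by rw [S.mk_lift])⟩, by simp⟩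
    conv_lhs => rw [← hz]
    rw [S.proj_fromTw_coeff O _ W hW]
    change (MonoidAlgebra.comapDomain _ (S.transl_injective _ _) (Iw.proj _ x)).coeff _ = _
    rw [MonoidAlgebra.coeff_comapDomain, Finsupp.comapDomain_apply, S.transl_mk, hz]
    have aux : ∀ W' : OpenNormalSubgroup 𝒢, W' = W →
        (Iw.proj W' x).coeff (QuotientGroup.mk y) = (Iw.proj W x).coeff (QuotientGroup.mk y) := by
      rintro _ rfl; rfl
    apply aux
    ext g
    constructor
    · rintro ⟨w, hw, rfl⟩; exact hw
    · intro hg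
      exact ⟨⟨g, hW hg⟩, hg, rfl⟩

/-- The identification of `Λ_O(𝒢)` with the twisted group ring `Λ_O(Γ^(p^e))[G]^τ`. -/
def iwasawaEquiv : Iw O 𝒢 ≃+* S.RG (Iw.of O : S.Z →* (Iw O S.Z)ˣ) :=
  (RingEquiv.ofBijective (S.fromTw O) (S.fromTw_bijective O)).symm

end Setup

/-! ### The coefficients -/

/-- The ring of integers `O` of a finite extension `K` of `ℚ_p`. -/
abbrev IntRing (p : ℕ) [Fact p.Prime] (K : Type*) [Field K] [Algebra ℤ_[p] K] : Type _ :=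
  integralClosure ℤ_[p] K

/-- The restriction to `O` of an endomorphism of the extension `K` of `ℚ_p`. -/
def frobInt {p : ℕ} [Fact p.Prime] {K : Type*} [Field K] [Algebra ℚ_[p] K] [Algebra ℤ_[p] K]
    [IsScalarTower ℤ_[p] ℚ_[p] K] (σ : K →ₐ[ℚ_[p]] K) : IntRing p K →+* IntRing p K :=
  ((σ.restrictScalars ℤ_[p]).mapIntegralClosure : IntRing p K →ₐ[ℤ_[p]] IntRing p K)

end Iwasawa

end

noncomputable section

namespace Iwasawa

/-! ### The logarithm of a determinant, formally -/

section FormalLog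

open Polynomial

/-! The proposition is linear algebra seen through the logarithm. Suppose that `x` has a logarithm
`ℓ` in `R'[Conj(G)]^τ`, and write `ξ_P(x)` for the quotient `α_P(θ_P(x)) / u_P(α(θ(x)))`.

The norm: `θ_P` is the determinant of a representation of `R[G]^τ` over `R[P]^τ`, and the logarithm
of a determinant is the trace of the logarithm. The trace of that representation is `t_P`
(`trace_regRep`), so `log θ_P(x) = t_P(ℓ)` (`logTo_theta`). The identity `log det = tr log` is first
proved for `det (1 + t A)` by comparing derivatives of polynomials in `t`, then specialised to `t =
1` by `p`-adic estimates (`logSum_det_sub_mem`). For diagonal matrices it gives the functional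
equation of the logarithm.

The map `α_P`: for `P ≠ 1` the product of the twists by the powers of `ω_P` is again a determinant,
namely that of the representation attached to the grading of `R[P]^τ` by `ω_P` (`toZeta_gradNorm`).
Its trace is `p` times the degree zero part. Since `P` is a cyclic `p`-group, the elements of
nonzero degree are exactly the generators, so that `log α_P = p η_P log`; for `P = 1` one finds `p -
φ` (`logTo_alpha`). All twists become equal under `ζ ↦ 1` into characteristic `p`, hence `α_P` takes
values congruent to `1` modulo `p` (`alphaHom_congr`), which is why the right hand side of the
formula converges.

The map `u_P`: a count of centralisers gives `β_P(φ ℓ) = ∑ p ver(β_{P'}(ℓ))`, with the extra term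
`φ(t_P(ℓ))` when `P = 1` (`beta_frobConj`). Subtraction yields `log ξ_P(x) = p β_P(ℓ - φ(ℓ)/p)`.

In case (a) some power `x ^ m` is represented by a matrix congruent to `1` modulo the Jacobson
radical, which is the kernel of the augmentation onto the residue field; such matrices are nilpotent
modulo `p` at every finite level. Since `ξ_P(x)` is congruent to `1` modulo `p`, the formula for `x
^ m` can be divided by `m` (`hasLog_xi_of_pow`).

In case (b) the decomposition `x = u y` comes from Gaussian elimination over the local ring
`R[Γ/Γ^(p^e)]^τ` (`exists_decomposition`), and `J` is nilpotent modulo `p`, so `u` has a logarithm.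
A `p`-power of `y` is a scalar times a unit congruent to `1` modulo `p`; for scalars both sides are
computed directly (`xi_C`, `beta_toConj_C`).

That `L` is well defined follows from the formula itself: the maps `β_P` are jointly injective
(`beta_injective`) and limits are unique, so two candidates for `L(x)` coincide (`eq_of_hasLog_xi`).
-/

theorem derivative_det {R n : Type*} [CommRing R] [Fintype n] [DecidableEq n] (M : Matrix n n R[X]) :
    derivative M.det = (M.adjugate * M.map derivative).trace := by
  -- Cramer's rule: the diagonal entries are the determinants with one column differentiated, so
  -- their sum is the Leibniz rule for the determinant.
  have h : ∀ i, (M.adjugate * M.map derivative) i i =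
      (M.updateCol i fun j => derivative (M j i)).det := by
    intro i
    rw [← Matrix.cramer_apply, Matrix.cramer_eq_adjugate_mulVec]
    rfl
  simp only [Matrix.trace, Matrix.diag, h, Matrix.det_apply']
  rw [derivative_sum, Finset.sum_comm]
  refine Finset.sum_congr rfl fun σ _ => ?_
  rw [← Finset.mul_sum, derivative_mul, derivative_intCast, zero_mul, zero_add, derivative_prod_finset]
  congr 1
  refine Finset.sum_congr rfl fun i _ => ?_
  rw [← Finset.mul_prod_erase Finset.univ _ (Finset.mem_univ i), Matrix.updateCol_self, mul_comm]
  congr 1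
  refine Finset.prod_congr rfl fun k hk => ?_
  rw [Matrix.updateCol_ne (Finset.ne_of_mem_erase hk)]

variable {B : Type*} [CommRing B] [Algebra ℚ B]

/-- The partial sum `∑_{1 ≤ i ≤ m} (-1)^(i+1) (x-1)^i / i` of the logarithmic series. -/
def logSum {A : Type*} [Ring A] [Module ℚ A] (m : ℕ) (x : A) : A :=
  ∑ i ∈ Finset.Icc 1 m, ((-1) ^ (i + 1) / (i : ℚ)) • (x - 1) ^ i

theorem logSum_succ {A : Type*} [Ring A] [Module ℚ A] (m : ℕ) (x : A) :
    logSum (m + 1) x = logSum m x + ((-1) ^ (m + 2) / ((m + 1 : ℕ) : ℚ)) • (x - 1) ^ (m + 1) := by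
  rw [logSum, Finset.sum_Icc_succ_top (by omega)]; rfl

theorem rat_aux (m : ℕ) : ((-1) ^ (m + 2) / ((m + 1 : ℕ) : ℚ)) * ((m + 1 : ℕ) : ℚ) = (-1) ^ m := by
  rw [div_mul_cancel₀ _ (by positivity), pow_add]; simp

/-- The truncated form of `d (log d)' = d'`: the partial sum differentiates to `d'` times a
geometric sum in `1 - d`. The factor `d` makes inverses unnecessary. -/
theorem mul_derivative_logSum (m : ℕ) (d : B[X]) :
    d * derivative (logSum m d) = derivative d * (1 - (1 - d) ^ m) := by
  induction m with
  | zero => simp [logSum]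
  | succ m ih =>
    have h : derivative (((-1) ^ (m + 2) / ((m + 1 : ℕ) : ℚ)) • (d - 1) ^ (m + 1)) =
        (1 - d) ^ m * derivative d := by
      rw [derivative_smul, derivative_pow, Nat.add_sub_cancel, derivative_sub, derivative_one,
        sub_zero, map_natCast, ← nsmul_eq_mul, ← Nat.cast_smul_eq_nsmul ℚ, smul_mul_assoc, smul_smul,
        rat_aux]
      have : (1 - d) ^ m = (-1) ^ m * (d - 1) ^ m := by rw [← mul_pow]; ring
      rw [this, mul_assoc, Algebra.smul_def]
      simp
    rw [logSum_succ, derivative_add, mul_add, ih, h]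
    ring

/-- Over a `ℚ`-algebra the factors `d + 1` introduced by differentiation are units, so vanishing of
coefficients can be integrated. -/
theorem X_pow_dvd_of_derivative (m : ℕ) (g : B[X]) (h0 : g.coeff 0 = 0)
    (h : X ^ m ∣ derivative g) : X ^ (m + 1) ∣ g := by
  rw [X_pow_dvd_iff] at h ⊢
  rintro (_ | d) hd
  · exact h0
  · have := h d (by omega)
    rw [coeff_derivative] at this
    have hu : IsUnit ((d : B) + 1) := by
      have : IsUnit (((d + 1 : ℕ) : ℚ)) := by
        rw [isUnit_iff_ne_zero]; positivity
      have h2 := this.map (algebraMap ℚ B)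
      simpa using h2
    exact hu.mul_left_eq_zero.1 this

variable {n : Type*} [Fintype n] [DecidableEq n]

/-- The polynomial `det (1 + t A)`. -/
def detPoly {B : Type*} [CommRing B] (A : Matrix n n B) : B[X] := (1 + (X : B[X]) • A.map C).det

theorem X_dvd_detPoly_sub_one {B : Type*} [CommRing B] (A : Matrix n n B) :
    (X : B[X]) ∣ detPoly A - 1 := by
  rw [X_dvd_iff, coeff_zero_eq_eval_zero, eval_sub, eval_one, detPoly, ← coe_evalRingHom,
    RingHom.map_det]
  have : (evalRingHom (0 : B)).mapMatrix (1 + (X : B[X]) • A.map C) = 1 := by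
    ext i j
    by_cases h : i = j <;> simp [Matrix.one_apply, h]
  rw [this]; simp

/-- The polynomial `∑_{1 ≤ i ≤ m} (-1)^(i+1) Tr (A^i) t^i / i`. -/
def trPoly (m : ℕ) (A : Matrix n n B) : B[X] :=
  ∑ i ∈ Finset.Icc 1 m, ((-1) ^ (i + 1) / (i : ℚ)) • (C ((A ^ i).trace) * X ^ i)

/-- The derivative of `trPoly` is a truncation of `tr ((1 + X A)⁻¹ A)`, and multiplication by the
determinant turns the inverse into the adjugate. The first term on the right is Jacobi's formula,
the second is the remainder of the truncation. -/
theorem detPoly_mul_derivative_trPoly (m : ℕ) (A : Matrix n n B) :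
    detPoly A * derivative (trPoly m A) = derivative (detPoly A) -
      (-1) ^ m * X ^ m *
        ((1 + (X : B[X]) • A.map C).adjugate * (A.map C) ^ (m + 1)).trace := by
  have hd : (1 + (X : B[X]) • A.map C).map derivative = A.map C := by
    ext i j : 1
    simp [Matrix.one_apply, apply_ite, derivative_mul]
  induction m with
  | zero =>
    rw [detPoly, derivative_det, hd]
    simp [trPoly]
  | succ m ih =>
    have h : derivative (((-1) ^ (m + 2) / ((m + 1 : ℕ) : ℚ)) •
        (C ((A ^ (m + 1)).trace) * X ^ (m + 1))) =
          (-1) ^ m * X ^ m * (((A.map C) ^ (m + 1)).trace) := by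
      rw [derivative_smul, derivative_C_mul, derivative_X_pow, Nat.add_sub_cancel, map_natCast,
        mul_left_comm, ← nsmul_eq_mul, ← Nat.cast_smul_eq_nsmul ℚ, smul_smul, rat_aux]
      have : C ((A ^ (m + 1)).trace) = ((A.map C) ^ (m + 1)).trace := by
        have e : (A.map C) ^ (m + 1) = (A ^ (m + 1)).map C := by
          rw [← RingHom.mapMatrix_apply, ← map_pow, RingHom.mapMatrix_apply]
        rw [e, Matrix.trace, Matrix.trace, map_sum]; rfl
      rw [this, Algebra.smul_def, map_pow, map_neg, map_one]
      ring
    -- From `det • 1 = adj * (1 + X A)`; this splits the new term into the remainders of orders `m`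
    -- and `m + 1`.
    have h2 : detPoly A * ((A.map C) ^ (m + 1)).trace =
        ((1 + (X : B[X]) • A.map C).adjugate * (A.map C) ^ (m + 1)).trace +
        X * ((1 + (X : B[X]) • A.map C).adjugate * (A.map C) ^ (m + 2)).trace := by
      rw [← smul_eq_mul, ← Matrix.trace_smul, detPoly, ← Matrix.one_mul ((A.map C) ^ (m + 1)),
        ← Matrix.smul_mul, ← Matrix.adjugate_mul, Matrix.mul_add, Matrix.mul_one, Matrix.add_mul,
        Matrix.one_mul, Matrix.trace_add, Matrix.mul_smul, Matrix.smul_mul, Matrix.trace_smul,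
        Matrix.mul_assoc, ← pow_succ', smul_eq_mul]
    rw [trPoly, Finset.sum_Icc_succ_top (by omega), derivative_add, mul_add]
    change detPoly A * derivative (trPoly m A) + _ = _
    rw [ih, h]
    linear_combination ((-1) ^ m * X ^ m) * h2

/-- After multiplication by `detPoly A` both derivatives equal that of `detPoly A` modulo `X ^ m`.
As `detPoly A` has constant term `1` it is coprime to `X ^ m` and can be cancelled. -/
theorem X_pow_dvd_logSum_detPoly_sub (m : ℕ) (A : Matrix n n B) :
    (X : B[X]) ^ (m + 1) ∣ logSum m (detPoly A) - trPoly m A := by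
  have hX := X_dvd_detPoly_sub_one A
  apply X_pow_dvd_of_derivative
  · rw [coeff_sub, sub_eq_zero.2]
    have h1 : (X : B[X]) ∣ logSum m (detPoly A) := Finset.dvd_sum fun i hi => by
      rw [Algebra.smul_def]
      exact Dvd.dvd.mul_left (dvd_pow hX (by simp at hi; omega)) _
    have h2 : (X : B[X]) ∣ trPoly m A := Finset.dvd_sum fun i hi => by
      rw [Algebra.smul_def]
      exact Dvd.dvd.mul_left (Dvd.dvd.mul_left (dvd_pow_self _ (by simp at hi; omega)) _) _
    rw [X_dvd_iff.1 h1, X_dvd_iff.1 h2]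
  · have hc : IsCoprime ((X : B[X]) ^ m) (detPoly A) := by
      apply IsCoprime.pow_left
      obtain ⟨h, hh⟩ := hX
      exact ⟨-h, 1, by linear_combination hh⟩
    refine hc.dvd_of_dvd_mul_left ?_
    rw [derivative_sub, mul_sub, mul_derivative_logSum, detPoly_mul_derivative_trPoly]
    have h3 : (X : B[X]) ^ m ∣ (1 - detPoly A) ^ m := by
      apply pow_dvd_pow_of_dvd
      rw [← neg_sub]; exact (dvd_neg).2 hX
    have e : ∀ a b c d e : B[X], a * (1 - b) - (a - c * d * e) = c * e * d - a * b := by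
      intros; ring
    rw [e]
    exact dvd_sub (dvd_mul_left _ _) (Dvd.dvd.mul_left h3 _)

end FormalLog

/-! ### `p`-adic convergence of logarithmic series -/

section PAdicLog

variable {A : Type*} [Ring A]

/-- The subgroup `p ^ n B` for a subring `B`. -/
def powSub (p : ℕ) (B : Subring A) (n : ℕ) : AddSubgroup A where
  carrier := {z | ∃ r ∈ B, z = (p : A) ^ n * r}
  add_mem' := by
    rintro _ _ ⟨r, hr, rfl⟩ ⟨s, hs, rfl⟩
    exact ⟨r + s, B.add_mem hr hs, (mul_add _ _ _).symm⟩
  zero_mem' := ⟨0, B.zero_mem, (mul_zero _).symm⟩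
  neg_mem' := by
    rintro _ ⟨r, hr, rfl⟩
    exact ⟨-r, B.neg_mem hr, (mul_neg _ _).symm⟩

variable {p : ℕ} {B : Subring A}

theorem mem_powSub {n : ℕ} {z : A} : z ∈ powSub p B n ↔ ∃ r ∈ B, z = (p : A) ^ n * r := Iff.rfl

theorem powSub_zero {z : A} : z ∈ powSub p B 0 ↔ z ∈ B := by
  simp [mem_powSub]

theorem powSub_mul {m n : ℕ} {x y : A} (hx : x ∈ powSub p B m) (hy : y ∈ powSub p B n) :
    x * y ∈ powSub p B (m + n) := by
  obtain ⟨r, hr, rfl⟩ := hx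
  obtain ⟨s, hs, rfl⟩ := hy
  refine ⟨r * s, B.mul_mem hr hs, ?_⟩
  have := ((Nat.cast_commute p r).pow_left n).eq
  rw [pow_add, mul_assoc, ← mul_assoc r, ← this]
  simp only [mul_assoc]

theorem powSub_mono {m n : ℕ} (h : m ≤ n) : powSub p B n ≤ powSub p B m := by
  rintro _ ⟨r, hr, rfl⟩
  refine ⟨(p : A) ^ (n - m) * r, B.mul_mem (pow_mem (natCast_mem B p) _) hr, ?_⟩
  rw [← mul_assoc, ← pow_add, Nat.add_sub_cancel' h]

theorem powSub_le {n : ℕ} {z : A} (h : z ∈ powSub p B n) : z ∈ B :=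
  powSub_zero.1 (powSub_mono (Nat.zero_le n) h)

theorem powSub_mul_left {n : ℕ} {x y : A} (hx : x ∈ B) (hy : y ∈ powSub p B n) :
    x * y ∈ powSub p B n := by
  simpa using powSub_mul (powSub_zero.2 hx) hy

/-- Applied with `v` the `p`-adic valuation of `k`. A `k`-th power divisible by `p ^ (k / (N + 1))`
loses only `v ≤ log₂ k` factors of `p` on division by `k`, so the terms of a logarithmic series tend
to zero. -/
theorem exists_add_le_div (N n : ℕ) : ∃ K, 0 < K ∧ ∀ k ≥ K, ∀ v, 2 ^ v ≤ k → n + v ≤ k / (N + 1) := by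
  obtain ⟨v₀, h₀⟩ : ∃ v₀, ∀ v ≥ v₀, (n + v) * (N + 1) ≤ 2 ^ v := by
    have h := tendsto_pow_const_div_const_pow_of_one_lt 1 (one_lt_two : (1 : ℝ) < 2)
    have h2 := h.eventually (gt_mem_nhds (show (0 : ℝ) < 1 / ((n + 1) * (N + 1)) by positivity))
    obtain ⟨v₀, hv⟩ := Filter.eventually_atTop.1 h2
    refine ⟨v₀ + 1, fun v hv' => ?_⟩
    have h3 := hv v (by omega)
    rw [pow_one, div_lt_div_iff₀ (by positivity) (by positivity), one_mul] at h3
    have h4 : v * ((n + 1) * (N + 1)) < 2 ^ v := by exact_mod_cast h3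
    have h5 : n + v ≤ v * (n + 1) := by nlinarith
    calc (n + v) * (N + 1) ≤ (v * (n + 1)) * (N + 1) := Nat.mul_le_mul_right _ h5
      _ ≤ 2 ^ v := by rw [mul_assoc]; exact h4.le
  refine ⟨(n + v₀) * (N + 1) + 1, by omega, fun k hk v hv => ?_⟩
  rw [Nat.le_div_iff_mul_le (by omega)]
  rcases le_total v v₀ with h | h
  · have : (n + v) * (N + 1) ≤ (n + v₀) * (N + 1) := Nat.mul_le_mul_right _ (by omega)
    omega
  · exact (h₀ v h).trans hv

/-- The integers prime to `p` are invertible in `B`. -/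
def PInv {A : Type*} [Ring A] [Algebra ℚ A] (p : ℕ) (B : Subring A) : Prop :=
  ∀ m : ℕ, p.Coprime m → algebraMap ℚ A (1 / m) ∈ B

/-- Only the `p`-part of a denominator costs divisibility; its part prime to `p` is invertible in
`B`. -/
theorem PInv.smul_mem [Fact p.Prime] [Algebra ℚ A] (hB : PInv p B) {k n v : ℕ} (hk : k ≠ 0)
    (hv : p ^ v ∣ k) (hv' : ¬ p ^ (v + 1) ∣ k) (q : ℤ) {z : A} (hz : z ∈ powSub p B (n + v)) :
    ((q : ℚ) / (k : ℚ)) • z ∈ powSub p B n := by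
  have hp : p.Prime := Fact.out
  obtain ⟨l, rfl⟩ := hv
  have hl : p.Coprime l := by
    rw [Nat.Prime.coprime_iff_not_dvd hp]
    rintro ⟨m, rfl⟩
    exact hv' ⟨m, by ring⟩
  obtain ⟨r, hr, rfl⟩ := hz
  refine ⟨(q : A) * (algebraMap ℚ A (1 / l) * r),
    B.mul_mem (intCast_mem B q) (B.mul_mem (hB l hl) hr), ?_⟩
  have hp0 : (p : ℚ) ≠ 0 := by exact_mod_cast hp.ne_zero
  have hl0 : (l : ℚ) ≠ 0 := by
    rintro h; simp at h; subst h; simp at hk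
  have e : algebraMap ℚ A ((q : ℚ) / ((p ^ v * l : ℕ) : ℚ)) * (p : A) ^ (n + v) =
      (p : A) ^ n * ((q : A) * algebraMap ℚ A (1 / l)) := by
    have e1 : (p : A) = algebraMap ℚ A p := by simp
    have e2 : (q : A) = algebraMap ℚ A q := by simp
    rw [e1, e2, ← map_pow, ← map_pow, ← map_mul, ← map_mul, ← map_mul]
    congr 1
    push_cast
    rw [pow_add]
    field_simp
  rw [Algebra.smul_def, ← mul_assoc, e]
  simp only [mul_assoc]

theorem exists_smul_mem [Fact p.Prime] [Algebra ℚ A] (hB : PInv p B) (N n : ℕ) :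
    ∃ K, 0 < K ∧ ∀ k ≥ K, ∀ z ∈ powSub p B (k / (N + 1)),
      ((-1) ^ (k + 1) / (k : ℚ)) • z ∈ powSub p B n := by
  have hp : p.Prime := Fact.out
  obtain ⟨K, hK0, hK⟩ := exists_add_le_div N n
  refine ⟨K, hK0, fun k hk z hz => ?_⟩
  have hk0 : k ≠ 0 := by omega
  have h1 : p ^ padicValNat p k ∣ k := pow_padicValNat_dvd
  have h2 : ¬ p ^ (padicValNat p k + 1) ∣ k := pow_succ_padicValNat_not_dvd hk0
  have h3 : 2 ^ padicValNat p k ≤ k :=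
    (Nat.pow_le_pow_left hp.two_le _).trans (Nat.le_of_dvd (by omega) h1)
  have := hB.smul_mem hk0 h1 h2 ((-1) ^ (k + 1)) (powSub_mono (hK k hk _ h3) hz)
  simpa using this

end PAdicLog

/-! ### The logarithm of a determinant, `p`-adically -/

section DetLog

universe u

open Polynomial

variable {p : ℕ} [Fact p.Prime] {A : Type*} [CommRing A] {B : Subring A}

/-- `x` is congruent to `1` modulo a topologically nilpotent element of `B`. -/
def TopUni {A : Type*} [Ring A] (p : ℕ) (B : Subring A) (x : A) : Prop :=
  x - 1 ∈ B ∧ ∃ N, (x - 1) ^ N ∈ powSub p B 1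

variable {n : Type*} [Fintype n] [DecidableEq n]

/-- Modulo `p` the matrix is nilpotent, so `det (1 + X M)` is a unit of a polynomial ring and its
nonconstant coefficients are nilpotent; the constant one is `1`. Hence `p` divides a power of
`detPoly M - 1`, and the exponent of `p` in further powers grows linearly. -/
theorem exists_detPoly_pow {A : Type u} [CommRing A] {B : Subring A} (M : Matrix n n A) (hM : ∀ i j, M i j ∈ B) (N : ℕ)
    (hN : ∀ i j, (M ^ N) i j ∈ powSub p B 1) :
    (∀ i, (detPoly M - 1).coeff i ∈ B) ∧
    ∃ N', ∀ k i, ((detPoly M - 1) ^ k).coeff i ∈ powSub p B (k / (N' + 1)) := by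
  have hmap : ∀ {S T : Type u} [CommRing S] [CommRing T] (f : S →+* T) (M : Matrix n n S),
      (detPoly M - 1).map f = detPoly (f.mapMatrix M) - 1 := by
    intro S T _ _ f M
    rw [Polynomial.map_sub, Polynomial.map_one, detPoly, detPoly, ← coe_mapRingHom,
      RingHom.map_det, map_add, map_one]
    congr 3
    ext i j : 1
    simp
  let M₀ : Matrix n n B := Matrix.of fun i j => ⟨M i j, hM i j⟩
  have hM₀ : B.subtype.mapMatrix M₀ = M := rfl
  have hd : (detPoly M₀ - 1).map B.subtype = detPoly M - 1 := hmap _ _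
  let q := Ideal.Quotient.mk (Ideal.span {(p : B)})
  have hnil : IsNilpotent (q.mapMatrix M₀) := by
    refine ⟨N, ?_⟩
    rw [← map_pow]
    ext i j
    change q ((M₀ ^ N) i j) = 0
    rw [Ideal.Quotient.eq_zero_iff_mem, Ideal.mem_span_singleton]
    obtain ⟨r, hr, e⟩ := hN i j
    refine ⟨⟨r, hr⟩, Subtype.ext ?_⟩
    rw [← hM₀, ← map_pow] at e
    simpa using e
  have hd2 : (detPoly M₀ - 1).map q = detPoly (q.mapMatrix M₀) - 1 := hmap _ _
  -- The reverse characteristic polynomial of `-M` is `det (1 + X M)`.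
  have hu : IsUnit (detPoly (q.mapMatrix M₀)) := by
    have := Matrix.isUnit_charpolyRev_of_isNilpotent hnil.neg
    convert this using 1
    rw [detPoly, Matrix.charpolyRev, sub_eq_add_neg, ← smul_neg]
    congr 3
    ext i j : 1
    simp
  have hnil2 : IsNilpotent ((detPoly M₀ - 1).map q) := by
    rw [hd2, Polynomial.isNilpotent_iff]
    intro i
    rcases Nat.eq_zero_or_pos i with rfl | hi
    · rw [X_dvd_iff.1 (X_dvd_detPoly_sub_one _)]; exact IsNilpotent.zero
    · have := (isUnit_iff_coeff_isUnit_isNilpotent.1 hu).2 i hi.ne'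
      rwa [coeff_sub, coeff_one, if_neg hi.ne', sub_zero]
  have hcoeff : ∀ i, (detPoly M - 1).coeff i ∈ B := fun i => by
    rw [← hd, coeff_map]; exact ((detPoly M₀ - 1).coeff i).2
  refine ⟨hcoeff, ?_⟩
  obtain ⟨N', hN'⟩ := hnil2
  have key : ∃ g : B[X], (detPoly M₀ - 1) ^ (N' + 1) = C (p : B) * g := by
    have : C (p : B) ∣ (detPoly M₀ - 1) ^ (N' + 1) := by
      rw [C_dvd_iff_dvd_coeff]
      intro i
      rw [← Ideal.mem_span_singleton, ← Ideal.Quotient.eq_zero_iff_mem]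
      change q _ = 0
      rw [← coeff_map, Polynomial.map_pow, pow_succ, hN', zero_mul, coeff_zero]
    exact this
  obtain ⟨g, hg⟩ := key
  refine ⟨N', fun k i => ?_⟩
  have e : (detPoly M - 1) ^ k = C ((p : A) ^ (k / (N' + 1))) *
      ((detPoly M₀ - 1) ^ (k % (N' + 1)) * g ^ (k / (N' + 1))).map B.subtype := by
    conv_lhs => rw [← hd, ← Polynomial.map_pow, ← Nat.mod_add_div k (N' + 1), pow_add, pow_mul,
      hg, mul_pow, mul_left_comm, Polynomial.map_mul, ← map_pow, Polynomial.map_C]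
    simp
  rw [e, coeff_C_mul, coeff_map]
  exact ⟨_, Subtype.prop _, rfl⟩

theorem eval_one_detPoly (M : Matrix n n A) : (detPoly M).eval 1 = (1 + M).det := by
  rw [detPoly, ← coe_evalRingHom, RingHom.map_det]
  congr 1
  ext i j
  by_cases h : i = j <;> simp [h]

theorem topUni_det (M : Matrix n n A) (hM : ∀ i j, M i j ∈ B) (N : ℕ)
    (hN : ∀ i j, (M ^ N) i j ∈ powSub p B 1) : TopUni p B (1 + M).det := by
  obtain ⟨h1, N', h2⟩ := exists_detPoly_pow M hM N hN
  have e : (1 + M).det - 1 = (detPoly M - 1).eval 1 := by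
    rw [eval_sub, eval_one_detPoly, eval_one]
  rw [TopUni, e]
  refine ⟨?_, N' + 1, ?_⟩
  · rw [eval_eq_sum_range]
    exact sum_mem fun i _ => by simpa using h1 i
  · rw [← eval_pow, eval_eq_sum_range]
    refine sum_mem fun i _ => ?_
    have := h2 (N' + 1) i
    rw [Nat.div_self (by omega)] at this
    simpa using this

theorem mem_pow_div_of_matrix {A : Type*} [Ring A] {B : Subring A} (M : Matrix n n A) (hM : ∀ i j, M i j ∈ B) (N : ℕ)
    (hN : ∀ i j, (M ^ N) i j ∈ powSub p B 1) (k : ℕ) (i j : n) :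
    (M ^ k) i j ∈ powSub p B (k / N) := by
  have h1 : ∀ q i j, ((M ^ N) ^ q) i j ∈ powSub p B q := by
    intro q
    induction q with
    | zero =>
      intro i j
      rw [pow_zero, Matrix.one_apply, powSub_zero]
      split_ifs
      · exact B.one_mem
      · exact B.zero_mem
    | succ q ih =>
      intro i j
      rw [pow_succ, Matrix.mul_apply]
      exact sum_mem fun l _ => powSub_mul (ih i l) (hN l j)
  have h2 : ∀ q i j, (M ^ q) i j ∈ B := by
    intro q
    induction q with
    | zero =>
      intro i j
      rw [pow_zero, Matrix.one_apply]
      split_ifs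
      · exact B.one_mem
      · exact B.zero_mem
    | succ q ih =>
      intro i j
      rw [pow_succ, Matrix.mul_apply]
      exact sum_mem fun l _ => B.mul_mem (ih i l) (hM l j)
  have ek := Nat.mod_add_div k N
  generalize k / N = q at ek ⊢
  rw [← ek, pow_add, pow_mul, Matrix.mul_apply]
  exact sum_mem fun l _ => powSub_mul_left (h2 _ _ _) (h1 _ _ _)

variable [Algebra ℚ A]

/-- The logarithm of a determinant is the trace of the logarithm. -/
theorem logSum_det_sub_mem (hB : PInv p B) (M : Matrix n n A) (hM : ∀ i j, M i j ∈ B) (N : ℕ)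
    (hN : ∀ i j, (M ^ N) i j ∈ powSub p B 1) (e : ℕ) :
    ∃ K, ∀ m ≥ K, logSum m (1 + M).det -
      ∑ i ∈ Finset.Icc 1 m, ((-1) ^ (i + 1) / (i : ℚ)) • (M ^ i).trace ∈ powSub p B e := by
  obtain ⟨h1, N', h2⟩ := exists_detPoly_pow M hM N hN
  obtain ⟨K₁, hK₁, hK₁'⟩ := exists_smul_mem hB N' e
  obtain ⟨K₂, hK₂, hK₂'⟩ := exists_smul_mem hB N e
  have hN2 : ∀ i j, (M ^ (N + 1)) i j ∈ powSub p B 1 := fun i j => by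
    rw [pow_succ', Matrix.mul_apply]
    exact sum_mem fun l _ => powSub_mul_left (hM i l) (hN l j)
  refine ⟨K₁ + K₂, fun m hm => ?_⟩
  have htr : ∀ k, (trPoly k M).coeff k ∈ powSub p B e ∨ k < K₂ := by
    intro k
    rcases lt_or_ge k K₂ with h | h
    · exact Or.inr h
    left
    rw [trPoly, finsetSum_coeff, Finset.sum_eq_single k]
    · rw [coeff_smul, coeff_C_mul, coeff_X_pow_self, mul_one]
      exact hK₂' k h _ (sum_mem fun l _ => mem_pow_div_of_matrix M hM _ hN2 k l l)
    · intro i _ hi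
      rw [coeff_smul, coeff_C_mul, coeff_X_pow, if_neg (Ne.symm hi), mul_zero, smul_zero]
    · intro h'; exfalso; apply h'; rw [Finset.mem_Icc]; omega
  have htr0 : ∀ k i, k < i → (trPoly k M).coeff i = 0 := by
    intro k i hi
    rw [trPoly, finsetSum_coeff]
    refine Finset.sum_eq_zero fun l hl => ?_
    rw [Finset.mem_Icc] at hl
    rw [coeff_smul, coeff_C_mul, coeff_X_pow, if_neg (by omega), mul_zero, smul_zero]
  -- From the index `m` on, lengthening the partial sum changes every coefficient only by elements
  -- of `p ^ e B`.
  have hlog : ∀ i ≥ m, ∀ l, (logSum i (detPoly M)).coeff l - (logSum m (detPoly M)).coeff l ∈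
      powSub p B e := by
    intro i hi l
    induction i, hi using Nat.le_induction with
    | base => rw [sub_self]; exact zero_mem _
    | succ i hi ih =>
      rw [logSum_succ, coeff_add, coeff_smul, add_sub_right_comm]
      exact add_mem ih (hK₁' (i + 1) (by omega) _ (h2 _ _))
  -- In degrees up to `m` the formal identity is exact. In a degree `i > m` it is used with
  -- truncation at `i` instead: there the `i`-th trace term is small, and so is the difference
  -- between the two partial sums.
  have hc : ∀ i, (logSum m (detPoly M) - trPoly m M).coeff i ∈ powSub p B e := by
    intro i
    rcases Nat.lt_or_ge m i with hi | hi
    · have e1 := X_pow_dvd_iff.1 (X_pow_dvd_logSum_detPoly_sub i M) i (by omega)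
      rw [coeff_sub, sub_eq_zero] at e1
      have e2 := hlog i hi.le i
      rw [e1] at e2
      rw [coeff_sub, htr0 m i hi, sub_zero]
      have e3 := (htr i).resolve_right (by omega)
      have := sub_mem e3 e2
      rwa [sub_sub_cancel] at this
    · rw [X_pow_dvd_iff.1 (X_pow_dvd_logSum_detPoly_sub m M) i (by omega)]
      exact zero_mem _
  have hev : (logSum m (detPoly M) - trPoly m M).eval 1 = logSum m (1 + M).det -
      ∑ i ∈ Finset.Icc 1 m, ((-1) ^ (i + 1) / (i : ℚ)) • (M ^ i).trace := by
    rw [eval_sub, logSum, trPoly, eval_finsetSum, eval_finsetSum, logSum]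
    simp only [Polynomial.eval_smul, eval_pow, eval_sub, eval_one, eval_one_detPoly, eval_mul, eval_C, eval_X,
      one_pow, mul_one]
  rw [← hev, eval_eq_sum_range]
  exact sum_mem fun i _ => by simpa using hc i

end DetLog

/-! ### Values of the logarithm -/

section LogTo

variable {p : ℕ} [Fact p.Prime] {A : Type*} [CommRing A] [Algebra ℚ A] {B : Subring A}

/-- The logarithmic series of `x` converges to `a` with respect to the subgroups `p ^ n B`. -/
def LogTo {A : Type*} [Ring A] [Module ℚ A] (p : ℕ) (B : Subring A) (x a : A) : Prop :=
  ∀ e, ∃ K, ∀ m ≥ K, logSum m x - a ∈ powSub p B e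

theorem topUni_of_sub_mem {A : Type*} [Ring A] {B : Subring A} {x : A}
    (h : x - 1 ∈ powSub p B 1) : TopUni p B x :=
  ⟨powSub_le h, 1, by rwa [pow_one]⟩

theorem topUni_one {A : Type*} [Ring A] {B : Subring A} : TopUni p B (1 : A) :=
  topUni_of_sub_mem (by rw [sub_self]; exact zero_mem _)

theorem powSub_map {A A' F : Type*} [Ring A] [Ring A'] [FunLike F A A']
    [AddMonoidHomClass F A A'] {B : Subring A} {B' : Subring A'}
    (f : F) (hf : ∀ x ∈ B, f x ∈ B') {n : ℕ} {z : A} (hz : z ∈ powSub p B n) :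
    f z ∈ powSub p B' n := by
  obtain ⟨r, hr, rfl⟩ := hz
  refine ⟨f r, hf r hr, ?_⟩
  rw [← Nat.cast_pow, ← nsmul_eq_mul, map_nsmul, nsmul_eq_mul, Nat.cast_pow]

theorem TopUni.map {A A' : Type*} [Ring A] [Ring A'] {B : Subring A} {B' : Subring A'}
    (f : A →+* A') (hf : ∀ x ∈ B, f x ∈ B') {x : A} (hx : TopUni p B x) : TopUni p B' (f x) := by
  obtain ⟨h1, N, h2⟩ := hx
  refine ⟨by rw [← map_one f, ← map_sub]; exact hf _ h1, N, ?_⟩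
  rw [← map_one f, ← map_sub, ← map_pow]
  exact powSub_map f hf h2

theorem map_logSum {A A' : Type*} [Ring A] [Ring A'] [Module ℚ A] [Module ℚ A'] (f : A →+* A')
    (m : ℕ) (x : A) : f (logSum m x) = logSum m (f x) := by
  simp only [logSum, map_sum, map_rat_smul, map_pow, map_sub, map_one]

theorem LogTo.map {A A' : Type*} [Ring A] [Ring A'] [Module ℚ A] [Module ℚ A'] {B : Subring A}
    {B' : Subring A'} (f : A →+* A') (hf : ∀ x ∈ B, f x ∈ B') {x a : A} (hx : LogTo p B x a) :
    LogTo p B' (f x) (f a) := by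
  intro e
  obtain ⟨K, hK⟩ := hx e
  refine ⟨K, fun m hm => ?_⟩
  rw [← map_logSum, ← map_sub]
  exact powSub_map f hf (hK m hm)

theorem logTo_one {A : Type*} [Ring A] [Module ℚ A] {B : Subring A} : LogTo p B (1 : A) 0 := by
  refine fun e => ⟨0, fun m _ => ?_⟩
  have : logSum m (1 : A) = 0 := Finset.sum_eq_zero fun i hi => by
    rw [sub_self, zero_pow (by simp at hi; omega), smul_zero]
  rw [this, sub_zero]
  exact zero_mem _

section Mul

/-- A product `x y` is the determinant of `diag (x, y)`; applying `logSum_det_sub_mem` to this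
matrix gives the functional equation of the logarithm. -/
theorem diag_aux {x y : A} (hx : TopUni p B x) (hy : TopUni p B y) :
    ∃ N, ∀ i j, ((Matrix.diagonal ![x - 1, y - 1]) ^ N) i j ∈ powSub p B 1 := by
  obtain ⟨hx1, N₁, hx2⟩ := hx
  obtain ⟨hy1, N₂, hy2⟩ := hy
  refine ⟨N₁ + N₂, fun i j => ?_⟩
  rw [Matrix.diagonal_pow, Matrix.diagonal_apply]
  split_ifs
  · fin_cases i
    · change (x - 1) ^ (N₁ + N₂) ∈ _
      rw [add_comm, pow_add]
      exact powSub_mul_left (pow_mem hx1 _) hx2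
    · change (y - 1) ^ (N₁ + N₂) ∈ _
      rw [pow_add]
      exact powSub_mul_left (pow_mem hy1 _) hy2
  · exact zero_mem _

theorem diag_aux' {x y : A} (hx : TopUni p B x) (hy : TopUni p B y) (i j : Fin 2) :
    (Matrix.diagonal ![x - 1, y - 1]) i j ∈ B := by
  rw [Matrix.diagonal_apply]
  split_ifs
  · fin_cases i
    · exact hx.1
    · exact hy.1
  · exact zero_mem _

theorem det_one_add_diag (x y : A) : (1 + Matrix.diagonal ![x - 1, y - 1]).det = x * y := by
  rw [← Matrix.diagonal_one, Matrix.diagonal_add, Matrix.det_diagonal]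
  simp

theorem TopUni.mul {x y : A} (hx : TopUni p B x) (hy : TopUni p B y) : TopUni p B (x * y) := by
  obtain ⟨N, hN⟩ := diag_aux hx hy
  have := topUni_det _ (diag_aux' hx hy) N hN
  rwa [det_one_add_diag] at this

theorem logSum_mul_sub (hB : PInv p B) {x y : A} (hx : TopUni p B x) (hy : TopUni p B y) (e : ℕ) :
    ∃ K, ∀ m ≥ K, logSum m (x * y) - (logSum m x + logSum m y) ∈ powSub p B e := by
  obtain ⟨N, hN⟩ := diag_aux hx hy
  obtain ⟨K, hK⟩ := logSum_det_sub_mem hB _ (diag_aux' hx hy) N hN e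
  refine ⟨K, fun m hm => ?_⟩
  have := hK m hm
  rw [det_one_add_diag] at this
  convert this using 2
  rw [logSum, logSum, ← Finset.sum_add_distrib]
  refine Finset.sum_congr rfl fun i _ => ?_
  rw [Matrix.diagonal_pow, Matrix.trace_diagonal, Fin.sum_univ_two, ← smul_add]
  rfl

theorem LogTo.mul (hB : PInv p B) {x y a b : A} (hx : TopUni p B x) (hy : TopUni p B y)
    (hxa : LogTo p B x a) (hyb : LogTo p B y b) : LogTo p B (x * y) (a + b) := by
  intro e
  obtain ⟨K₁, h₁⟩ := logSum_mul_sub hB hx hy e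
  obtain ⟨K₂, h₂⟩ := hxa e
  obtain ⟨K₃, h₃⟩ := hyb e
  refine ⟨K₁ + K₂ + K₃, fun m hm => ?_⟩
  convert add_mem (add_mem (h₁ m (by omega)) (h₂ m (by omega))) (h₃ m (by omega)) using 1
  ring

/-- This form of the functional equation treats quotients without the logarithm of an inverse: only
the quotient itself has to be known to be topologically unipotent. -/
theorem LogTo.of_mul (hB : PInv p B) {x y a b : A} (hx : TopUni p B x) (hy : TopUni p B y)
    (hxa : LogTo p B x a) (hxy : LogTo p B (x * y) b) : LogTo p B y (b - a) := by
  intro e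
  obtain ⟨K₁, h₁⟩ := logSum_mul_sub hB hx hy e
  obtain ⟨K₂, h₂⟩ := hxa e
  obtain ⟨K₃, h₃⟩ := hxy e
  refine ⟨K₁ + K₂ + K₃, fun m hm => ?_⟩
  convert sub_mem (sub_mem (h₃ m (by omega)) (h₁ m (by omega))) (h₂ m (by omega)) using 1
  ring

theorem TopUni.prod {ι : Type*} (s : Finset ι) {x : ι → A} (hx : ∀ i ∈ s, TopUni p B (x i)) :
    TopUni p B (∏ i ∈ s, x i) :=
  Finset.prod_induction _ (TopUni p B) (fun _ _ => TopUni.mul) topUni_one hx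

theorem LogTo.prod (hB : PInv p B) {ι : Type*} (s : Finset ι) {x a : ι → A}
    (hx : ∀ i ∈ s, TopUni p B (x i)) (hxa : ∀ i ∈ s, LogTo p B (x i) (a i)) :
    LogTo p B (∏ i ∈ s, x i) (∑ i ∈ s, a i) := by
  induction s using Finset.induction_on with
  | empty => simpa using logTo_one
  | insert i s hi ih =>
    rw [Finset.prod_insert hi, Finset.sum_insert hi]
    exact LogTo.mul hB (hx i (by simp)) (TopUni.prod s fun j hj => hx j (by simp [hj]))
      (hxa i (by simp))
      (ih (fun j hj => hx j (by simp [hj])) fun j hj => hxa j (by simp [hj]))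

theorem TopUni.pow {x : A} (hx : TopUni p B x) (k : ℕ) : TopUni p B (x ^ k) := by
  have := TopUni.prod (Finset.range k) (x := fun _ => x) fun _ _ => hx
  simpa using this

theorem logSum_pow_sub (hB : PInv p B) {x : A} (hx : TopUni p B x) (k e : ℕ) :
    ∃ K, ∀ m ≥ K, logSum m (x ^ k) - k • logSum m x ∈ powSub p B e := by
  induction k with
  | zero =>
    obtain ⟨K, hK⟩ := (logTo_one (p := p) (B := B)) e
    exact ⟨K, by simpa using hK⟩
  | succ k ih =>
    obtain ⟨K₁, h₁⟩ := ih
    obtain ⟨K₂, h₂⟩ := logSum_mul_sub hB (hx.pow k) hx e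
    refine ⟨K₁ + K₂, fun m hm => ?_⟩
    convert add_mem (h₁ m (by omega)) (h₂ m (by omega)) using 1
    rw [pow_succ, succ_nsmul]
    ring

theorem LogTo.pow (hB : PInv p B) {x a : A} (hx : TopUni p B x) (hxa : LogTo p B x a) (k : ℕ) :
    LogTo p B (x ^ k) (k • a) := by
  have := LogTo.prod hB (Finset.range k) (x := fun _ => x) (a := fun _ => a) (fun _ _ => hx)
    (fun _ _ => hxa)
  simpa using this

theorem PInv.exists_of_nsmul (hB : PInv p B) {k : ℕ} (hk : k ≠ 0) (e : ℕ) :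
    ∃ e', ∀ z, k • z ∈ powSub p B e' → z ∈ powSub p B e := by
  refine ⟨e + padicValNat p k, fun z hz => ?_⟩
  have := hB.smul_mem hk pow_padicValNat_dvd (pow_succ_padicValNat_not_dvd hk) 1 hz
  rwa [← Nat.cast_smul_eq_nsmul ℚ, smul_smul, Int.cast_one, one_div,
    inv_mul_cancel₀ (by exact_mod_cast hk), one_smul] at this

/-- Here `p` may divide `k`. Division by `k` costs a fixed power of `p`, which a larger precision
`e'` absorbs. -/
theorem LogTo.root (hB : PInv p B) {x a : A} {k : ℕ} (hk : k ≠ 0) (hx : TopUni p B x)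
    (hxa : LogTo p B (x ^ k) (k • a)) : LogTo p B x a := by
  intro e
  obtain ⟨e', he'⟩ := hB.exists_of_nsmul hk e
  obtain ⟨K₁, h₁⟩ := logSum_pow_sub hB hx k e'
  obtain ⟨K₂, h₂⟩ := hxa e'
  refine ⟨K₁ + K₂, fun m hm => he' _ ?_⟩
  convert sub_mem (h₂ m (by omega)) (h₁ m (by omega)) using 1
  rw [nsmul_sub]
  ring

end Mul

section Rep

variable {n : Type*} [Fintype n] [DecidableEq n] {A' : Type*} [CommRing A'] [Algebra ℚ A'] {B' : Subring A'}

theorem logTo_det (hB : PInv p B) (M : Matrix n n A) (hM : ∀ i j, M i j ∈ B) (N : ℕ)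
    (hN : ∀ i j, (M ^ N) i j ∈ powSub p B 1) {a : A}
    (ha : ∀ e, ∃ K : ℕ, ∀ m ≥ K, (∑ i ∈ Finset.Icc 1 m,
      ((-1) ^ (i + 1) / (i : ℚ)) • (M ^ i).trace) - a ∈ powSub p B e) :
    LogTo p B (1 + M).det a := by
  intro e
  obtain ⟨K₁, h₁⟩ := logSum_det_sub_mem hB M hM N hN e
  obtain ⟨K₂, h₂⟩ := ha e
  refine ⟨K₁ + K₂, fun m hm => ?_⟩
  convert add_mem (h₁ m (by omega)) (h₂ m (by omega)) using 1
  ring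

theorem powSub_rep {A A' : Type*} [Ring A] [Ring A'] {B : Subring A} {B' : Subring A'}
    (ρ : A →+* Matrix n n A') (hρ : ∀ x ∈ B, ∀ i j, ρ x i j ∈ B') {k : ℕ} {x : A} (hx : x ∈ powSub p B k) (i j : n) :
    ρ x i j ∈ powSub p B' k := by
  obtain ⟨r, hr, rfl⟩ := hx
  refine ⟨ρ r i j, hρ r hr i j, ?_⟩
  rw [← Nat.cast_pow, ← nsmul_eq_mul, map_nsmul, Matrix.smul_apply, nsmul_eq_mul, Nat.cast_pow]

variable (ρ : A →+* Matrix n n A') (hρ : ∀ x ∈ B, ∀ i j, ρ x i j ∈ B')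
include hρ

theorem TopUni.det_rep {x : A} (hx : TopUni p B x) : TopUni p B' (ρ x).det := by
  obtain ⟨h1, N, h2⟩ := hx
  have := topUni_det (p := p) (ρ (x - 1)) (hρ _ h1) N fun i j => by
    rw [← map_pow]; exact powSub_rep ρ hρ h2 i j
  rwa [map_sub, map_one, add_sub_cancel] at this

/-- Since `ρ` is a ring homomorphism, the partial logarithms of the matrix `ρ x` are the images of
those of `x`. This computes the effect on logarithms of the norm along a character. -/
theorem LogTo.det_rep (hB' : PInv p B') {x a : A} (hx : TopUni p B x) (hxa : LogTo p B x a) :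
    LogTo p B' (ρ x).det (ρ a).trace := by
  obtain ⟨h1, N, h2⟩ := hx
  have := logTo_det (p := p) hB' (ρ (x - 1)) (hρ _ h1) N (a := (ρ a).trace) (fun i j => by
    rw [← map_pow]; exact powSub_rep ρ hρ h2 i j) (by
    intro e
    obtain ⟨K, hK⟩ := hxa e
    refine ⟨K, fun m hm => ?_⟩
    have e1 : (∑ i ∈ Finset.Icc 1 m, ((-1) ^ (i + 1) / (i : ℚ)) • (ρ (x - 1) ^ i).trace) =
        (ρ (logSum m x)).trace := by
      rw [logSum, map_sum, Matrix.trace_sum]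
      refine Finset.sum_congr rfl fun i _ => ?_
      rw [map_rat_smul, Matrix.trace_smul, map_pow]
    rw [e1, ← Matrix.trace_sub, ← map_sub]
    exact sum_mem fun i _ => powSub_rep ρ hρ (hK m hm) i i)
  rwa [map_sub, map_one, add_sub_cancel] at this

end Rep

end LogTo

/-! ### Change of coefficients -/

namespace TwGrp

variable {G R R' : Type*} [Group G] [CommRing R] [CommRing R'] {τ : Cocycle G R} {τ' : Cocycle G R'}

theorem nsmul_apply (k : ℕ) (a : TwGrp τ) (g : G) : (k • a) g = k • a g := rfl
theorem sub_apply (a b : TwGrp τ) (g : G) : (a - b) g = a g - b g := rfl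

variable [Finite G]

theorem C_apply (r : R) (g : G) : C τ r g = if g = 1 then r else 0 :=
  single_apply (τ := τ) 1 g r

theorem C_mul_apply (r : R) (a : TwGrp τ) (g : G) : (C τ r * a) g = r * a g := by
  change (single τ 1 r * a) g = _
  rw [single_mul_apply, inv_one, one_mul, τ.one_left]; simp

theorem mul_C_apply (r : R) (a : TwGrp τ) (g : G) : (a * C τ r) g = a g * r := by
  change (a * single τ 1 r) g = _
  rw [mul_single_apply, inv_one, mul_one, τ.one_right]; simp

theorem natCast_mul_apply (k : ℕ) (a : TwGrp τ) (g : G) : ((k : TwGrp τ) * a) g = k * a g := by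
  rw [← nsmul_eq_mul, nsmul_apply, nsmul_eq_mul]

instance [Algebra ℚ R] : Algebra ℚ (TwGrp τ) where
  smul q a := fun g => q • a g
  algebraMap := (C τ).comp (algebraMap ℚ R)
  commutes' q a := by
    ext g
    rw [RingHom.comp_apply, C_mul_apply, mul_C_apply, mul_comm]
  smul_def' q a := by
    ext g
    rw [RingHom.comp_apply, C_mul_apply]
    exact Algebra.smul_def q (a g)

/-- The homomorphism `R[G]^τ → R'[G]^τ` induced by a homomorphism `R → R'`. -/
def mapCoef (f : R →+* R') (h : ∀ x y, τ' x y = Units.map f.toMonoidHom (τ x y)) :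
    TwGrp τ →+* TwGrp τ' where
  toFun a g := f (a g)
  map_one' := by ext g; rw [one_apply, one_apply]; split_ifs <;> simp
  map_zero' := by ext g; exact map_zero f
  map_add' a b := by ext g; exact map_add f _ _
  map_mul' a b := by
    have := Fintype.ofFinite G
    ext g
    refine Eq.trans ?_ (mul_apply (τ := τ') (fun g => f (a g)) (fun g => f (b g)) g).symm
    simp only [mul_apply, map_sum, map_mul, h]
    rfl

section mapCoef

variable (f : R →+* R') (h : ∀ x y, τ' x y = Units.map f.toMonoidHom (τ x y))

theorem mapCoef_apply (a : TwGrp τ) (g : G) : mapCoef f h a g = f (a g) := rfl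

theorem mapCoef_single (g : G) (r : R) : mapCoef f h (single τ g r) = single τ' g (f r) := by
  ext k
  rw [mapCoef_apply, single_apply, single_apply]
  split_ifs <;> simp

theorem mapCoef_coord (P : Subgroup G) (a : TwGrp τ) (q : G ⧸ P) :
    coord P (mapCoef f h a) q =
      mapCoef (τ := τ.restrict P) (τ' := τ'.restrict P) f (fun x y => h x y) (coord P a q) := by
  ext k
  change f _ * (↑(τ' _ _)⁻¹ : R') = f (_ * _)
  rw [map_mul, h, ← map_inv]
  rfl

theorem mapCoef_regRep (P : Subgroup G) [Fintype (G ⧸ P)] (a : TwGrp τ) :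
    regRep τ' P (mapCoef f h a) = (regRep τ P a).map
      (mapCoef (τ := τ.restrict P) (τ' := τ'.restrict P) f (fun x y => h x y)) := by
  ext1 i j
  change coord P (single τ' (rep P i) 1 * mapCoef f h a) j =
    mapCoef (τ := τ.restrict P) (τ' := τ'.restrict P) f (fun x y => h x y) (coord P (single τ (rep P i) 1 * a) j)
  rw [← mapCoef_coord f h, map_mul, mapCoef_single, map_one]

end mapCoef

/-- The elements of `R[G]^τ` with coefficients in a subring. -/
def coefSub (τ : Cocycle G R) (B : Subring R) (hτ : ∀ x y, (τ x y : R) ∈ B) :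
    Subring (TwGrp τ) where
  carrier := {a | ∀ g, a g ∈ B}
  mul_mem' {a b} ha hb g := by
    have := Fintype.ofFinite G
    rw [mul_apply]
    exact sum_mem fun x _ => B.mul_mem (B.mul_mem (ha _) (hb _)) (hτ _ _)
  one_mem' g := by rw [one_apply]; split_ifs; exacts [B.one_mem, B.zero_mem]
  add_mem' ha hb g := B.add_mem (ha g) (hb g)
  zero_mem' g := B.zero_mem
  neg_mem' ha g := B.neg_mem (ha g)

variable {B : Subring R} {hτ : ∀ x y, (τ x y : R) ∈ B}

theorem mem_powSub_coefSub {p n : ℕ} {a : TwGrp τ} :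
    a ∈ powSub p (coefSub τ B hτ) n ↔ ∀ g, a g ∈ powSub p B n := by
  constructor
  · rintro ⟨r, hr, rfl⟩ g
    refine ⟨r g, hr g, ?_⟩
    rw [← Nat.cast_pow, natCast_mul_apply, Nat.cast_pow]
  · intro h
    choose r hr e using h
    refine ⟨(r : G → R), hr, ?_⟩
    ext g
    refine (e g).trans ?_
    rw [← Nat.cast_pow, ← Nat.cast_pow]
    exact (natCast_mul_apply (τ := τ) (p ^ n) r g).symm

theorem pInv_coefSub [Algebra ℚ R] {p : ℕ} (hB : PInv p B) : PInv p (coefSub τ B hτ) := by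
  intro m hm g
  change C τ (algebraMap ℚ R _) g ∈ B
  rw [C_apply]
  split_ifs
  exacts [hB m hm, B.zero_mem]

theorem regRep_mem (hτ' : ∀ x y, (↑(τ x y)⁻¹ : R) ∈ B) (P : Subgroup G) [Fintype (G ⧸ P)]
    {a : TwGrp τ} (ha : a ∈ coefSub τ B hτ) (i j : G ⧸ P) :
    regRep τ P a i j ∈ coefSub (τ.restrict P) B (fun x y => hτ x y) := by
  intro k
  refine B.mul_mem ?_ (hτ' _ _)
  refine Subring.mul_mem (coefSub τ B hτ) ?_ ha _
  intro g
  rw [single_apply]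
  split_ifs
  exacts [B.one_mem, B.zero_mem]

end TwGrp

/-! ### Sums over cosets and conjugacy classes -/

section Counting

variable {G M : Type*} [Group G] [Fintype G] [AddCommMonoid M]

theorem sum_eq_sum_quotient (P : Subgroup G) [Fintype P] [Fintype (G ⧸ P)] (F : G → M) :
    ∑ x, F x = ∑ q : G ⧸ P, ∑ y : P, F (q.out * y) := by
  rw [← Fintype.sum_prod_type', eq_comm]
  refine Fintype.sum_bijective (fun x : (G ⧸ P) × P => x.1.out * (x.2 : G)) ⟨?_, fun x => ?_⟩ _ _
    fun _ => rfl
  · rintro ⟨q, y⟩ ⟨r, z⟩ e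
    have e1 := congrArg (QuotientGroup.mk : G → G ⧸ P) e
    simp only [QuotientGroup.mk_mul_of_mem _ y.2, QuotientGroup.mk_mul_of_mem _ z.2,
      QuotientGroup.out_eq'] at e1
    subst e1
    rw [Prod.mk.injEq, and_iff_right rfl]
    exact Subtype.ext (mul_left_cancel e)
  · refine ⟨⟨QuotientGroup.mk x, ⟨(QuotientGroup.mk x : G ⧸ P).out⁻¹ * x, ?_⟩⟩, by simp⟩
    rw [← QuotientGroup.eq, QuotientGroup.out_eq']

/-- Sums over coset representatives are traded for sums over the whole group, at the price of a
factor `|P|`. The coefficients will form a `ℚ`-algebra, where `nsmul_cancel` removes that factor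
again. -/
theorem card_nsmul_sum_quotient (P : Subgroup G) [Fintype P] [Fintype (G ⧸ P)] (F : G → M)
    (hF : ∀ x, ∀ y ∈ P, F (x * y) = F x) :
    Nat.card P • ∑ q : G ⧸ P, F q.out = ∑ x, F x := by
  rw [sum_eq_sum_quotient P, Finset.smul_sum]
  refine Finset.sum_congr rfl fun q _ => ?_
  rw [Finset.sum_congr rfl fun (y : P) _ => hF q.out y y.2, Finset.sum_const, Finset.card_univ,
    Nat.card_eq_fintype_card]

/-- The order of the centraliser of an element. -/
def centCard (h : G) : ℕ := (Finset.univ.filter fun x : G => x * h * x⁻¹ = h).card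

theorem centCard_pos (h : G) : 0 < centCard h :=
  Finset.card_pos.2 ⟨1, by simp⟩

theorem card_conj_filter {g h : G} (hgh : IsConj h g) :
    (Finset.univ.filter fun x : G => x * h * x⁻¹ = g).card = centCard h := by
  obtain ⟨c, rfl⟩ := isConj_iff.1 hgh
  refine (Finset.card_equiv (Equiv.mulLeft c) fun x => ?_).symm
  simp only [Finset.mem_filter, Finset.mem_univ, true_and, Equiv.coe_mulLeft, mul_inv_rev]
  constructor
  · intro h'
    calc _ = c * (x * h * x⁻¹) * c⁻¹ := by group
      _ = _ := by rw [h']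
  · intro h'
    have : c * (x * h * x⁻¹) * c⁻¹ = c * h * c⁻¹ := by rw [← h']; group
    exact mul_left_cancel (mul_right_cancel this)

theorem centCard_eq_of_isConj {g h : G} (hgh : IsConj h g) : centCard g = centCard h := by
  obtain ⟨c, rfl⟩ := isConj_iff.1 hgh
  refine (Finset.card_equiv (MulAut.conj c).toEquiv fun x => ?_).symm
  rw [Finset.mem_filter, Finset.mem_filter, and_iff_right (Finset.mem_univ _),
    and_iff_right (Finset.mem_univ _), ← MulAut.conj_apply c h]
  change _ ↔ MulAut.conj c x * _ * (MulAut.conj c x)⁻¹ = _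
  rw [← map_inv, ← map_mul, ← map_mul]
  exact (MulAut.conj c).injective.eq_iff.symm

theorem sum_conj (h : G) [DecidablePred (IsConj h)] (F : G → M) :
    ∑ x, F (x * h * x⁻¹) = centCard h • ∑ g, if IsConj h g then F g else 0 := by
  have e : ∀ x, F (x * h * x⁻¹) = ∑ g, if x * h * x⁻¹ = g then F g else 0 := by simp
  rw [Finset.sum_congr rfl fun x _ => e x, Finset.sum_comm, Finset.smul_sum]
  refine Finset.sum_congr rfl fun g _ => ?_
  split_ifs with hg
  · rw [← card_conj_filter hg, Finset.sum_ite, Finset.sum_const, Finset.sum_const_zero, add_zero]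
  · rw [smul_zero]
    refine Finset.sum_eq_zero fun x _ => if_neg ?_
    intro h'; exact hg (isConj_iff.2 ⟨x, h'⟩)

end Counting

/-! ### Distinguished lifts, conjugation, and the trace of `R[G]^τ` over `R[P]^τ` -/

namespace Setup

variable {p : ℕ} [Fact p.Prime] {𝒢 : Type*} [Group 𝒢] [TopologicalSpace 𝒢] (S : Setup p 𝒢)

/-- A distinguished lift is recognised by its image in `ℤ_p` being an integer in `[0, p ^ e)`. Two
such lifts of one class have the same image, and they differ by an element of `Γ^(p^e)`, on which
`π` is injective. -/
theorem lift_mk {x : 𝒢} {k : ℕ} (hk : k < p ^ S.e) (hx : (S.π x).toAdd = k) :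
    S.lift (QuotientGroup.mk x) = x := by
  have hZ := S.mem_Z_of_mk_eq (S.mk_lift (QuotientGroup.mk x))
  have e1 := S.s_π_of_mem_Z hZ
  have hπ : (S.π (S.lift (QuotientGroup.mk x))).toAdd = k := by
    obtain ⟨w, hw⟩ := S.mem_Z.1 hZ
    have e2 := congrArg (fun y => PadicInt.toZModPow S.e (S.π y).toAdd) hw
    simp only [S.π_s, toAdd_pow, nsmul_eq_mul, ZMod.natCast_self, zero_mul,
      map_mul, map_inv, toAdd_mul, toAdd_inv, map_add, map_neg, S.π_lift, hx,
      map_natCast] at e2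
    rw [eq_comm, add_neg_eq_zero] at e2
    rw [S.π_lift]
    have e3 := congrArg ZMod.val e2
    rw [ZMod.val_natCast, ZMod.val_natCast, Nat.mod_eq_of_lt hk, Nat.mod_eq_of_lt (ZMod.val_lt _)]
      at e3
    rw [e3]
  have : S.π (S.lift (QuotientGroup.mk x) * x⁻¹) = 1 := by
    rw [map_mul, map_inv, mul_inv_eq_one]
    exact Multiplicative.toAdd.injective (hπ.trans hx.symm)
  rw [this, map_one] at e1
  exact mul_inv_eq_one.1 e1.symm

theorem π_lift_lt (g : S.G) : ∃ k < p ^ S.e, (S.π (S.lift g)).toAdd = (k : ℕ) :=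
  ⟨_, ZMod.val_lt _, S.π_lift g⟩

/-- As `ℤ_p` is commutative, conjugation does not change `π`, so a conjugate of a distinguished lift
is distinguished. This is why no factor `τ` appears in `x̄⁻¹ ḡ x̄`. -/
theorem lift_conj (y : 𝒢) (g : S.G) :
    S.lift ((QuotientGroup.mk y : S.G)⁻¹ * g * QuotientGroup.mk y) = y⁻¹ * S.lift g * y := by
  obtain ⟨k, hk, e⟩ := S.π_lift_lt g
  have : (QuotientGroup.mk y : S.G)⁻¹ * g * QuotientGroup.mk y =
      QuotientGroup.mk (y⁻¹ * S.lift g * y) := by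
    rw [QuotientGroup.mk_mul, QuotientGroup.mk_mul, S.mk_lift, QuotientGroup.mk_inv]
  rw [this]
  refine S.lift_mk hk ?_
  rw [← e]
  simp only [map_mul, map_inv, toAdd_mul, toAdd_inv]
  ring

theorem lift_conj' (x g : S.G) : S.lift (x⁻¹ * g * x) = (S.lift x)⁻¹ * S.lift g * S.lift x := by
  have := S.lift_conj (S.lift x) g
  rwa [S.mk_lift] at this

theorem factorSet_conj (x h : S.G) : S.factorSet x (x⁻¹ * h * x) = S.factorSet h x := by
  ext1
  have e : x * (x⁻¹ * h * x) = h * x := by group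
  simp only [factorSet, S.lift_conj', e]
  group

theorem powZ_conj (x g : S.G) : S.powZ (x⁻¹ * g * x) = S.powZ g := by
  ext1
  have e : (x⁻¹ * g * x) ^ p = x⁻¹ * g ^ p * x := by
    have := conj_pow (a := x⁻¹) (b := g) (i := p)
    rwa [inv_inv] at this
  have e2 : ((S.lift x)⁻¹ * S.lift g * S.lift x) ^ p = (S.lift x)⁻¹ * S.lift g ^ p * S.lift x := by
    have := conj_pow (a := (S.lift x)⁻¹) (b := S.lift g) (i := p)
    rwa [inv_inv] at this
  have hz := S.Z_central (S.powZ g).2 (S.lift x)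
  simp only [powZ] at hz
  simp only [powZ, e, S.lift_conj', e2]
  calc _ = (S.lift x)⁻¹ * (S.lift g ^ p * (S.lift (g ^ p))⁻¹ * S.lift x) := by group
    _ = _ := by rw [hz]; group

theorem powZ_eq_of_isConj {g h : S.G} (hgh : IsConj g h) : S.powZ g = S.powZ h := by
  obtain ⟨c, rfl⟩ := isConj_iff.1 hgh
  have := S.powZ_conj c⁻¹ g
  rw [inv_inv] at this
  exact this.symm

variable {R : Type*} [CommRing R]

/-- The cocycle value from multiplication by the representative cancels against the one in the
definition of `coord`, by `factorSet_conj`. -/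
theorem regRep_diag (ι : S.Z →* Rˣ) (P : S.Cyc) [Fintype (S.G ⧸ P.1)] (a : S.RG ι) (q : S.G ⧸ P.1)
    (h : P.1) : TwGrp.regRep (S.cocycle ι) P.1 a q q h = a (q.out * h * q.out⁻¹) := by
  change (TwGrp.single (S.cocycle ι) (TwGrp.rep P.1 q) 1 * a : S.RG ι) (h * TwGrp.rep P.1 q) *
    (↑(S.cocycle ι h (TwGrp.rep P.1 q))⁻¹ : R) = _
  rw [TwGrp.single_mul_apply, one_mul, mul_assoc]
  have e := S.factorSet_conj (TwGrp.rep P.1 q) h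
  simp only [cocycle]
  rw [← mul_assoc (TwGrp.rep P.1 q)⁻¹, e, Units.mul_inv, mul_one, TwGrp.rep, inv_inv]

section Trace

variable [Algebra ℚ R] [Fintype S.G]

/-- The elements which conjugate the chosen representative of the class of `h` into `h` are as many
as the centraliser of `h` has elements. This closed form of `t_P` is free of coset representatives
and serves in all later counts. -/
theorem tr_apply (ι : S.Z →* Rˣ) (P : S.Cyc) (a : S.ConjMod R) (h : P.1) :
    Nat.card P.1 • S.tr ι P a h = centCard (h : S.G) • a (ConjClasses.mk (h : S.G)) := by
  have := Fintype.ofFinite (ConjClasses S.G)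
  have := Fintype.ofFinite (S.G ⧸ P.1)
  have := Fintype.ofFinite P.1
  rw [tr]
  simp only [finsum_eq_sum_of_fintype]
  rw [Finset.sum_eq_single (ConjClasses.mk (h : S.G))]
  · set k : S.G := Quotient.out (ConjClasses.mk (h : S.G)) with hk
    have hkh : IsConj k (h : S.G) := by
      rw [← ConjClasses.mk_eq_mk_iff_isConj]; exact Quotient.out_eq _
    refine (card_nsmul_sum_quotient P.1 (fun x => if x⁻¹ * k * x = (h : S.G) then
      a (ConjClasses.mk (h : S.G)) else 0) ?_).trans ?_
    · intro x y hy
      have hyc : y * h * y⁻¹ = (h : S.G) := by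
        have := congrArg Subtype.val (S.mul_comm_of_cyc P ⟨y, hy⟩ h)
        simp only [Subgroup.coe_mul] at this
        rw [this, mul_inv_cancel_right]
      refine if_congr ?_ rfl rfl
      rw [mul_inv_rev]
      constructor
      · intro e
        rw [← hyc, ← e]; group
      · intro e
        calc _ = y⁻¹ * (x⁻¹ * k * x) * y := by group
          _ = y⁻¹ * (y * h * y⁻¹) * y := by rw [e, hyc]
          _ = h := by group
    · rw [Finset.sum_ite, Finset.sum_const_zero, add_zero, Finset.sum_const]
      congr 1
      rw [← centCard_eq_of_isConj hkh.symm, ← card_conj_filter hkh]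
      refine Finset.card_equiv (Equiv.inv S.G) fun x => ?_
      simp
  · intro c _ hc
    refine Finset.sum_eq_zero fun q _ => if_neg ?_
    intro e
    apply hc
    rw [← Quotient.out_eq c]
    refine ConjClasses.mk_eq_mk_iff_isConj.2 (isConj_iff.2 ⟨q.out⁻¹, ?_⟩)
    rw [inv_inv]; exact e
  · simp

theorem nsmul_cancel {k : ℕ} (hk : k ≠ 0) {x y : R} (h : k • x = k • y) : x = y := by
  have h1 : IsUnit ((k : ℚ)) := by rw [isUnit_iff_ne_zero]; exact_mod_cast hk
  have h2 := h1.map (algebraMap ℚ R)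
  rw [map_natCast] at h2
  rw [nsmul_eq_mul, nsmul_eq_mul] at h
  exact h2.mul_left_cancel h

/-- Multiplied by `|P|`, both sides have at `h` the sum of the coefficients of `a` over all
conjugates `x h x⁻¹`, `x ∈ G`. This is the link between the norm `θ_P` and the map `t_P`. -/
theorem trace_regRep (ι : S.Z →* Rˣ) (P : S.Cyc) [Fintype (S.G ⧸ P.1)] (a : S.RG ι) :
    (TwGrp.regRep (S.cocycle ι) P.1 a).trace = S.tr ι P (S.toConj a) := by
  have := Fintype.ofFinite P.1
  ext h
  refine nsmul_cancel (Nat.card_pos (α := P.1)).ne' ?_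
  have e0 : (TwGrp.regRep (S.cocycle ι) P.1 a).trace h =
      ∑ q : S.G ⧸ P.1, a (q.out * h * q.out⁻¹) := by
    rw [Matrix.trace, TwGrp.sum_apply]
    exact Finset.sum_congr rfl fun q _ => S.regRep_diag ι P a q h
  have e1 : Nat.card P.1 • ∑ q : S.G ⧸ P.1, a (q.out * h * q.out⁻¹) =
      ∑ x : S.G, a (x * h * x⁻¹) := by
    refine card_nsmul_sum_quotient (M := R) P.1 (fun x : S.G => a (x * h * x⁻¹)) ?_
    intro x y hy
    have := congrArg Subtype.val (S.mul_comm_of_cyc P ⟨y, hy⟩ h)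
    simp only [Subgroup.coe_mul] at this
    have e : x * y * h * (x * y)⁻¹ = x * h * x⁻¹ := by
      rw [mul_inv_rev, mul_assoc x, this]
      group
    exact congrArg a e
  have e2 : ∑ x : S.G, a (x * h * x⁻¹) =
      centCard (h : S.G) • ∑ g : S.G, if IsConj (h : S.G) g then a g else 0 :=
    sum_conj (M := R) (h : S.G) fun g => a g
  have e3 : S.toConj a (ConjClasses.mk (h : S.G)) =
      ∑ g : S.G, if IsConj (h : S.G) g then a g else 0 := by
    refine (finsum_eq_sum_of_fintype _).trans ?_
    refine Finset.sum_congr rfl fun g _ => ?_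
    have hiff : ConjClasses.mk g = ConjClasses.mk (h : S.G) ↔ IsConj (h : S.G) g :=
      ConjClasses.mk_eq_mk_iff_isConj.trans isConj_comm
    simp only [hiff]
  refine (congrArg (Nat.card P.1 • ·) e0).trans (e1.trans (e2.trans ?_))
  refine Eq.trans ?_ (S.tr_apply ι P (S.toConj a) h).symm
  rw [e3]

end Trace

end Setup

/-! ### The ring `R[ζ]` -/

section Zeta

variable (p : ℕ) [Fact p.Prime] (R : Type*) [CommRing R]

/-- The power `ζ ^ a` for `a ∈ ℤ/p`. -/
def zetaPow (a : ZMod p) : Setup.ZetaRing p R :=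
  AdjoinRoot.root (Polynomial.cyclotomic p R) ^ a.val

theorem sum_root_pow :
    ∑ i ∈ Finset.range p, AdjoinRoot.root (Polynomial.cyclotomic p R) ^ i = 0 := by
  have h := AdjoinRoot.eval₂_root (Polynomial.cyclotomic p R)
  rw [Polynomial.cyclotomic_prime, Polynomial.eval₂_finsetSum] at h
  simp only [Polynomial.eval₂_pow, Polynomial.eval₂_X] at h
  rw [Polynomial.cyclotomic_prime]
  exact h

theorem root_pow_prime : AdjoinRoot.root (Polynomial.cyclotomic p R) ^ p = 1 := by
  have := mul_geom_sum (AdjoinRoot.root (Polynomial.cyclotomic p R)) p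
  rw [sum_root_pow, mul_zero] at this
  exact (sub_eq_zero.1 this.symm)

theorem zetaPow_natCast (k : ℕ) :
    zetaPow p R k = AdjoinRoot.root (Polynomial.cyclotomic p R) ^ k := by
  rw [zetaPow, ZMod.val_natCast]
  conv_rhs => rw [← Nat.mod_add_div k p, pow_add, pow_mul, root_pow_prime, one_pow, mul_one]

theorem zetaPow_add (a b : ZMod p) : zetaPow p R (a + b) = zetaPow p R a * zetaPow p R b := by
  have := zetaPow_natCast p R (a.val + b.val)
  rw [pow_add, Nat.cast_add, ZMod.natCast_zmod_val, ZMod.natCast_zmod_val] at this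
  exact this

theorem zetaPow_zero : zetaPow p R 0 = 1 := by simp [zetaPow]

theorem sum_zetaPow : ∑ a, zetaPow p R a = 0 := by
  rw [← sum_root_pow p R]
  exact Finset.sum_nbij' ZMod.val (fun k : ℕ => (k : ZMod p)) (fun a _ => by simp [ZMod.val_lt])
    (fun _ _ => Finset.mem_univ _) (fun a _ => by simp)
    (fun k hk => ZMod.val_cast_of_lt (by simpa using hk)) (fun a _ => rfl)

theorem sum_zetaPow_mul (b : ZMod p) :
    ∑ a, zetaPow p R (a * b) = if b = 0 then (p : Setup.ZetaRing p R) else 0 := by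
  split_ifs with h
  · subst h
    simp [zetaPow_zero, ZMod.card]
  · rw [← sum_zetaPow p R]
    exact Fintype.sum_bijective _ (mulRight_bijective₀ b h) _ _ fun _ => rfl

/-- The homomorphism `R[ζ] → R/p`, `ζ ↦ 1`. -/
def zetaRed : Setup.ZetaRing p R →+* R ⧸ Ideal.span {(p : R)} :=
  -- Well defined because `Φ_p(1) = p`.
  AdjoinRoot.lift (Ideal.Quotient.mk _) 1 (by
    rw [Polynomial.cyclotomic_prime, Polynomial.eval₂_finsetSum]
    simp only [Polynomial.eval₂_pow, Polynomial.eval₂_X, one_pow, Finset.sum_const,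
      Finset.card_range, nsmul_eq_mul, mul_one]
    rw [← map_natCast (Ideal.Quotient.mk (Ideal.span {(p : R)})), Ideal.Quotient.eq_zero_iff_mem]
    exact Ideal.mem_span_singleton_self _)

theorem zetaRed_algebraMap (r : R) :
    zetaRed p R (algebraMap R _ r) = Ideal.Quotient.mk _ r := AdjoinRoot.lift_of _

theorem zetaRed_zetaPow (a : ZMod p) : zetaRed p R (zetaPow p R a) = 1 := by
  rw [zetaPow, map_pow, zetaRed, AdjoinRoot.lift_root, one_pow]

variable {p R}

/-- As `Φ_p` is monic of positive degree, `R[ζ]` is free and nonzero over `R`. -/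
theorem algebraMap_zeta_injective : Function.Injective (algebraMap R (Setup.ZetaRing p R)) := by
  nontriviality R
  have h := (AdjoinRoot.powerBasis' (Polynomial.cyclotomic.monic p R))
  have : Module.Free R (Setup.ZetaRing p R) := Module.Free.of_basis h.basis
  have hp : 0 < h.dim ∨ h.dim = 0 := by omega
  have hn : Nontrivial (Setup.ZetaRing p R) := by
    have hd : (AdjoinRoot.powerBasis' (Polynomial.cyclotomic.monic p R)).dim ≠ 0 := by
      rw [AdjoinRoot.powerBasis'_dim, Polynomial.natDegree_cyclotomic]
      exact (Nat.totient_pos.2 (Fact.out : p.Prime).pos).ne'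
    have := NeZero.mk hd
    let b := (AdjoinRoot.powerBasis' (Polynomial.cyclotomic.monic p R)).basis
    exact ⟨⟨b 0, 0, b.ne_zero 0⟩⟩
  exact FaithfulSMul.algebraMap_injective _ _

theorem zeta_torsionFree (hR : ∀ r : R, (p : R) * r = 0 → r = 0) (x : Setup.ZetaRing p R)
    (hx : (p : Setup.ZetaRing p R) * x = 0) : x = 0 := by
  let b := (AdjoinRoot.powerBasis' (Polynomial.cyclotomic.monic p R)).basis
  refine b.repr.injective (Finsupp.ext fun i => ?_)
  rw [map_zero]
  refine hR _ ?_
  have h1 : (p : R) • x = 0 := by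
    rw [Algebra.smul_def, map_natCast]; exact hx
  have h2 := congrArg (fun y => b.repr y i) h1
  simpa using h2

end Zeta

/-! ### The norm along a character -/

namespace Setup

variable {p : ℕ} [Fact p.Prime] {𝒢 : Type*} [Group 𝒢] [TopologicalSpace 𝒢] {S : Setup p 𝒢}
variable {R : Type*} [CommRing R] {ι : S.Z →* Rˣ} {P : S.Cyc}

/-- The component of degree `k` of an element of `R[P]^τ` for the grading by `ω`. -/
def part (ω : P.1 →* Multiplicative (ZMod p)) (k : ZMod p) (x : S.RP ι P) : S.RP ι P :=
  fun g => if (ω g).toAdd = k then x g else 0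

theorem part_apply (ω : P.1 →* Multiplicative (ZMod p)) (k : ZMod p) (x : S.RP ι P) (g : P.1) :
    part ω k x g = if (ω g).toAdd = k then x g else 0 := rfl

/-- The representation of `R[P]^τ` on `⨁_{k ∈ ℤ/p} R[P]^τ` attached to the grading by `ω`. -/
def gradRep (ι : S.Z →* Rˣ) (ω : P.1 →* Multiplicative (ZMod p)) :
    S.RP ι P →+* Matrix (ZMod p) (ZMod p) (S.RP ι P) where
  toFun x := Matrix.of fun i j => part ω (i - j) x
  map_one' := by
    ext i j g
    rw [Matrix.of_apply, part_apply, Matrix.one_apply, TwGrp.one_apply]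
    by_cases hij : i = j
    · subst hij
      rw [sub_self, if_pos rfl, TwGrp.one_apply]
      split_ifs with h1 h2 h2
      · rfl
      · rfl
      · subst h2; simp at h1
      · rfl
    · rw [if_neg hij]
      split_ifs with h1 h2
      · subst h2; rw [map_one, toAdd_one, eq_comm, sub_eq_zero] at h1; exact absurd h1 hij
      · rfl
      · rfl
  map_zero' := by
    ext i j g
    rw [Matrix.of_apply, part_apply, TwGrp.zero_apply, ite_self]; rfl
  map_add' x y := by
    ext i j g
    rw [Matrix.of_apply, part_apply, Matrix.add_apply, TwGrp.add_apply, TwGrp.add_apply,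
      Matrix.of_apply, Matrix.of_apply, part_apply, part_apply]
    split_ifs <;> simp
  map_mul' x y := by
    have := Fintype.ofFinite P.1
    ext i j g
    rw [Matrix.of_apply, part_apply, Matrix.mul_apply, TwGrp.sum_apply]
    simp only [Matrix.of_apply]
    rw [Finset.sum_congr rfl fun m _ =>
      TwGrp.mul_apply (τ := (S.cocycle ι).restrict P.1) (part ω (i - m) x) (part ω (m - j) y) g,
      Finset.sum_comm, TwGrp.mul_apply]
    have key : ∀ h : P.1, ∑ m, part ω (i - m) x h * part ω (m - j) y (h⁻¹ * g) *
        ((S.cocycle ι).restrict P.1 h (h⁻¹ * g) : R) = if (ω g).toAdd = i - j then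
          x h * y (h⁻¹ * g) * ((S.cocycle ι).restrict P.1 h (h⁻¹ * g) : R) else 0 := by
      intro h
      rw [Finset.sum_eq_single (i - (ω h).toAdd)]
      · rw [part_apply, part_apply, if_pos (by ring), map_mul, map_inv, toAdd_mul, toAdd_inv]
        have : -(ω h).toAdd + (ω g).toAdd = i - (ω h).toAdd - j ↔ (ω g).toAdd = i - j := by
          constructor
          · intro e; linear_combination e
          · intro e; linear_combination e
        simp only [this]
        split_ifs <;> ring
      · intro m _ hm
        rw [part_apply, if_neg, zero_mul, zero_mul]
        intro e; apply hm; rw [e]; ring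
      · simp
    rw [Finset.sum_congr rfl fun h _ => key h]
    split_ifs
    · rfl
    · simp

theorem trace_gradRep (ω : P.1 →* Multiplicative (ZMod p)) (x : S.RP ι P) :
    (gradRep ι ω x).trace = p • part ω 0 x := by
  simp [Matrix.trace, gradRep, ZMod.card]

variable (c : S.Coef R)

/-- The norm of a unit of `R[P]^τ` for the grading by `ω`. -/
def gradNorm (ι : S.Z →* Rˣ) (ω : P.1 →* Multiplicative (ZMod p)) : S.RP ι P →* S.RP ι P :=
  Matrix.detMonoidHom.comp (gradRep ι ω).toMonoidHom

theorem gradNorm_apply (ω : P.1 →* Multiplicative (ZMod p)) (x : S.RP ι P) :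
    gradNorm ι ω x = (gradRep ι ω x).det := rfl

theorem gradNorm_map {R' : Type*} [CommRing R'] {ι' : S.Z →* R'ˣ} (f : R →+* R')
    (h : ∀ x y, (S.cocycle ι').restrict P.1 x y =
      Units.map f.toMonoidHom ((S.cocycle ι).restrict P.1 x y))
    (ω : P.1 →* Multiplicative (ZMod p)) (x : S.RP ι P) :
    gradNorm ι' ω (TwGrp.mapCoef f h x) = TwGrp.mapCoef f h (gradNorm ι ω x) := by
  have h' := RingHom.map_det (TwGrp.mapCoef f h : S.RP ι P →+* S.RP ι' P) (gradRep ι ω x)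
  refine Eq.trans ?_ h'.symm
  rw [gradNorm_apply]
  congr 1
  ext i j g
  change (if _ then _ else _) = f (if _ then _ else _)
  rw [apply_ite f, map_zero]; rfl

/-- The inclusion `R[P]^τ → R[ζ][P]^τ`. -/
def toZeta (P : S.Cyc) : S.RP c.ι P →+* S.RP c.zetaι P :=
  TwGrp.mapCoef (algebraMap R (ZetaRing p R)) fun _ _ => rfl

theorem toZeta_injective : Function.Injective (toZeta c P) := fun x y h => by
  ext g
  exact algebraMap_zeta_injective (congrArg (fun z : S.RP c.zetaι P => z g) h)

theorem twist_zero (ω : P.1 →* Multiplicative (ZMod p)) (x : S.RP c.ι P) :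
    c.twist ω 0 x = toZeta c P x := by
  ext g
  change _ * _ ^ (0 * _) = algebraMap R (ZetaRing p R) (x g)
  rw [zero_mul, pow_zero, mul_one]

theorem twist_apply (ω : P.1 →* Multiplicative (ZMod p)) (k : ℕ) (x : S.RP c.ι P) (g : P.1) :
    c.twist ω k x g = algebraMap R (ZetaRing p R) (x g) * zetaPow p R (k * (ω g).toAdd) := by
  have := zetaPow_natCast p R (k * (ω g).toAdd.val)
  rw [Nat.cast_mul, ZMod.natCast_zmod_val] at this
  rw [this]; rfl

theorem prod_range_zmod {M : Type*} [CommMonoid M] (F : ZMod p → M) :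
    ∏ k ∈ Finset.range p, F k = ∏ a, F a :=
  Finset.prod_nbij' (fun k : ℕ => (k : ZMod p)) ZMod.val
    (fun _ _ => Finset.mem_univ _) (fun a _ => by simp [ZMod.val_lt])
    (fun k hk => ZMod.val_cast_of_lt (by simpa using hk)) (fun a _ => by simp) (fun a _ => rfl)

theorem zeta_sum_part (ω : P.1 →* Multiplicative (ZMod p)) (x : S.RP c.ι P) (k : ℕ) :
    ∑ l, toZeta c P (part ω l x) * TwGrp.C _ (zetaPow p R (l * k)) = c.twist ω k x := by
  ext g
  rw [TwGrp.sum_apply, twist_apply, Finset.sum_eq_single (ω g).toAdd]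
  · rw [TwGrp.mul_C_apply]
    change algebraMap R _ (part ω _ x g) * _ = _
    rw [part_apply, if_pos rfl, mul_comm (k : ZMod p)]
  · intro l _ hl
    rw [TwGrp.mul_C_apply]
    change algebraMap R _ (part ω _ x g) * _ = _
    rw [part_apply, if_neg (Ne.symm hl), map_zero, zero_mul]
  · simp

/-- In `R[ζ][P]^τ` the norm is the product of the twists. -/
theorem toZeta_gradNorm (hR : ∀ r : R, (p : R) * r = 0 → r = 0)
    (ω : P.1 →* Multiplicative (ZMod p)) (x : S.RP c.ι P) :
    toZeta c P (gradNorm c.ι ω x) = ∏ k ∈ Finset.range p, c.twist ω k x := by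
  let T := S.RP c.zetaι P
  let z : ZMod p → T := fun a => TwGrp.C _ (zetaPow p R a)
  have hz : ∀ a b, z (a + b) = z a * z b := fun a b => by
    simp only [z]; rw [zetaPow_add, map_mul]
  have hz0 : ∀ b, ∑ a, z (a * b) = if b = 0 then (p : T) else 0 := fun b => by
    simp only [z]
    rw [← map_sum, sum_zetaPow_mul]
    split_ifs
    · exact map_natCast _ _
    · exact map_zero _
  -- `V` is a character table of `ℤ/p`, whose columns are eigenvectors of `D` with the twists of `x`
  -- as eigenvalues. It need not be invertible, but `V W = p` and there is no `p`-torsion, which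
  -- suffices to compare determinants.
  let V : Matrix (ZMod p) (ZMod p) T := Matrix.of fun j k => z (-j * k)
  let W : Matrix (ZMod p) (ZMod p) T := Matrix.of fun k j => z (k * j)
  let D : Matrix (ZMod p) (ZMod p) T := (toZeta c P).mapMatrix (gradRep c.ι ω x)
  let tw : ZMod p → T := fun k => c.twist ω k.val x
  have hVW : V * W = (p : T) • 1 := by
    ext1 i j
    rw [Matrix.mul_apply, Matrix.smul_apply, Matrix.one_apply]
    simp only [V, W, Matrix.of_apply, ← hz]
    have e : ∀ k, -i * k + k * j = k * (j - i) := fun k => by ring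
    simp only [e, hz0, sub_eq_zero, eq_comm (a := j), smul_eq_mul, mul_ite, mul_one, mul_zero]
  have hDV : D * V = V * Matrix.diagonal tw := by
    ext1 i k
    rw [Matrix.mul_diagonal, Matrix.mul_apply]
    simp only [V, D, Matrix.of_apply, tw]
    rw [← zeta_sum_part, Finset.mul_sum, ← Equiv.sum_comp (Equiv.subLeft i)]
    refine Finset.sum_congr rfl fun l _ => ?_
    rw [ZMod.natCast_zmod_val]
    change toZeta c P (part ω (i - (i - l)) x) * z (-(i - l) * k) =
      z (-i * k) * (toZeta c P (part ω l x) * z (l * k))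
    rw [sub_sub_cancel, show -(i - l) * k = -i * k + l * k by ring, hz]
    ring
  have h1 : D.det * ((p : T) ^ p) = (∏ k, tw k) * (p : T) ^ p := by
    have e1 := congrArg Matrix.det hVW
    rw [Matrix.det_mul, Matrix.det_smul, Matrix.det_one, ZMod.card, mul_one] at e1
    have e2 := congrArg Matrix.det hDV
    rw [Matrix.det_mul, Matrix.det_mul, Matrix.det_diagonal] at e2
    rw [← e1]
    linear_combination W.det * e2
  have h2 : toZeta c P (gradNorm c.ι ω x) = D.det := RingHom.map_det _ _
  have htor : ∀ t : T, (p : T) * t = 0 → t = 0 := fun t ht => by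
    ext g
    refine zeta_torsionFree hR _ ?_
    have := congrArg (fun u : T => u g) ht
    exact (TwGrp.natCast_mul_apply p t g).symm.trans this
  have htor' : ∀ (k : ℕ) (t : T), (p : T) ^ k * t = 0 → t = 0 := by
    intro k
    induction k with
    | zero => intro t ht; simpa using ht
    | succ k ih => intro t ht; rw [pow_succ, mul_assoc] at ht; exact htor _ (ih _ ht)
  have h3 : D.det - ∏ k, tw k = 0 := htor' p _ (by linear_combination h1)
  rw [h2, sub_eq_zero.1 h3, ← prod_range_zmod]
  refine Finset.prod_congr rfl fun k hk => ?_
  simp only [tw]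
  rw [ZMod.val_cast_of_lt (by simpa using hk)]

/-- The norm is congruent to the `p`-th power modulo `p`. -/
theorem gradNorm_congr (hR : ∀ r : R, (p : R) * r = 0 → r = 0)
    (ω : P.1 →* Multiplicative (ZMod p)) (x : S.RP c.ι P) :
    ∃ y, gradNorm c.ι ω x = x ^ p + p * y := by
  let q := Ideal.Quotient.mk (Ideal.span {(p : R)})
  let ι' : S.Z →* (R ⧸ Ideal.span {(p : R)})ˣ := (Units.map q.toMonoidHom).comp c.ι
  let f : S.RP c.ι P →+* S.RP ι' P := TwGrp.mapCoef q fun _ _ => rfl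
  -- Under `ζ ↦ 1` into `R/p` every twist of `x` becomes the reduction of `x`, so the product of the
  -- `p` twists becomes its `p`-th power.
  let f' : S.RP c.zetaι P →+* S.RP ι' P := TwGrp.mapCoef (zetaRed p R) fun x y => by
    ext
    exact (zetaRed_algebraMap p R _).symm
  have hff : ∀ y, f' (toZeta c P y) = f y := fun y => by
    ext g
    exact zetaRed_algebraMap p R (y g)
  have hft : ∀ k, f' (c.twist ω k x) = f x := fun k => by
    ext g
    change zetaRed p R (c.twist ω k x g) = q (x g)
    rw [twist_apply, map_mul, zetaRed_algebraMap, zetaRed_zetaPow, mul_one]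
  have h := congrArg f' (toZeta_gradNorm c hR ω x)
  rw [hff, map_prod, Finset.prod_congr rfl fun k _ => hft k, Finset.prod_const, Finset.card_range,
    ← map_pow] at h
  have h2 : ∀ g, ∃ r, gradNorm c.ι ω x g - (x ^ p) g = p * r := fun g => by
    have e := congrArg (fun u : S.RP ι' P => u g) h
    exact Ideal.mem_span_singleton'.1 (Ideal.Quotient.eq.1 e) |>.imp fun r hr => by
      rw [← hr, mul_comm]
  choose y hy using h2
  refine ⟨(y : P.1 → R), ?_⟩
  ext g
  rw [TwGrp.add_apply]
  refine Eq.trans ?_ (congrArg ((x ^ p) g + ·) (TwGrp.natCast_mul_apply p _ g).symm)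
  rw [← hy]; ring

end Setup

namespace Setup

variable {p : ℕ} [Fact p.Prime] {𝒢 : Type*} [Group 𝒢] [TopologicalSpace 𝒢] (S : Setup p 𝒢)

/-! ### The finite `p`-group `G` and its cyclic subgroups -/

/-- Modulo `Γ^(p^e)` the `p ^ e`-th power of any element comes from the `p`-group `H`. -/
theorem isPGroup_G : IsPGroup p S.G := by
  intro g
  obtain ⟨x, rfl⟩ := QuotientGroup.mk_surjective g
  have hw : S.s (S.π x ^ p ^ S.e) ∈ S.Z := S.mem_Z.2 ⟨_, rfl⟩
  have hk : x ^ p ^ S.e * (S.s (S.π x ^ p ^ S.e))⁻¹ ∈ S.π.ker := by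
    rw [MonoidHom.mem_ker, map_mul, map_pow, map_inv, S.π_s, mul_inv_cancel]
  obtain ⟨k, hk'⟩ := S.isPGroup_ker ⟨_, hk⟩
  refine ⟨S.e + k, ?_⟩
  have := congrArg (fun y : S.π.ker => (QuotientGroup.mk (y : 𝒢) : S.G)) hk'
  simp only [Subgroup.coe_pow, QuotientGroup.mk_pow, QuotientGroup.mk_mul, QuotientGroup.mk_inv,
    (QuotientGroup.eq_one_iff _).2 hw, inv_one, mul_one, Subgroup.coe_one,
    QuotientGroup.mk_one] at this
  rw [pow_add, pow_mul]
  exact this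

/-- For a generator `c` of `P`, the value `ω(c ^ n) = n ω(c)` vanishes exactly when `p ∣ n`; and `c
^ n` is a generator exactly when `p ∤ n`, the order of `c` being a power of `p`. Consequently `η_P`
removes the degree zero part of the grading by `ω`. -/
theorem zpowers_eq_top_iff (P : S.Cyc) (ω : P.1 →* Multiplicative (ZMod p)) (hω : ω ≠ 1)
    (g : P.1) : Subgroup.zpowers g = ⊤ ↔ (ω g).toAdd ≠ 0 := by
  obtain ⟨c, hc⟩ := P.2.exists_generator
  have hωc : (ω c).toAdd ≠ 0 := by
    intro h0
    apply hω
    ext1 x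
    obtain ⟨n, rfl⟩ := hc x
    have : ω c = 1 := Multiplicative.toAdd.injective h0
    change ω (c ^ n) = 1
    rw [map_zpow, this, one_zpow]
  constructor
  · intro ht h0
    have h1 : ω g = 1 := Multiplicative.toAdd.injective h0
    obtain ⟨m, hm⟩ : c ∈ Subgroup.zpowers g := by rw [ht]; trivial
    apply hωc
    rw [← hm]
    change (ω (g ^ m)).toAdd = 0
    rw [map_zpow, h1, one_zpow, toAdd_one]
  · intro h
    obtain ⟨n, rfl⟩ := hc g
    have hn : ¬ (p : ℤ) ∣ n := by
      intro hn
      apply h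
      change (ω (c ^ n)).toAdd = 0
      rw [map_zpow, toAdd_zpow, zsmul_eq_mul, (ZMod.intCast_zmod_eq_zero_iff_dvd n p).2 hn, zero_mul]
    obtain ⟨k, hk⟩ := S.isPGroup_G (c : S.G)
    have hk' : c ^ (p ^ k : ℕ) = 1 := Subtype.ext hk
    have hcop : IsCoprime n ((p : ℤ) ^ k) :=
      ((Int.isCoprime_iff_gcd_eq_one.2 (by
        rw [← Int.isCoprime_iff_gcd_eq_one]
        exact (Nat.prime_iff_prime_int.1 Fact.out).irreducible.coprime_iff_not_dvd.2 hn)).symm).pow_right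
    obtain ⟨u, v, huv⟩ := hcop
    rw [eq_top_iff]
    intro x _
    obtain ⟨m, rfl⟩ := hc x
    have : c ∈ Subgroup.zpowers (c ^ n) := by
      refine ⟨u, ?_⟩
      change (c ^ n) ^ u = c
      rw [← zpow_mul]
      have e : n * u = 1 - v * (p : ℤ) ^ k := by linarith
      rw [e, zpow_sub, zpow_one, mul_comm v, zpow_mul]
      have : c ^ ((p : ℤ) ^ k) = 1 := by exact_mod_cast hk'
      rw [this, one_zpow, inv_one, mul_one]
    exact Subgroup.zpow_mem _ this m

variable {S}
variable {R : Type*} [CommRing R] {ι : S.Z →* Rˣ} {P : S.Cyc}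

theorem eta_apply (a : S.RP ι P) (g : P.1) :
    S.eta ι P a g = if Subgroup.zpowers g = ⊤ then a g else 0 := rfl

theorem eta_eq_sub (ω : P.1 →* Multiplicative (ZMod p)) (hω : ω ≠ 1) (a : S.RP ι P) :
    S.eta ι P a = a - part ω 0 a := by
  ext g
  rw [TwGrp.sub_apply, eta_apply, part_apply]
  by_cases h : (ω g).toAdd = 0
  · rw [if_pos h, if_neg, sub_self]
    rw [S.zpowers_eq_top_iff P ω hω]; exact not_not.2 h
  · rw [if_neg h, if_pos ((S.zpowers_eq_top_iff P ω hω g).2 h), sub_zero]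

theorem subsingleton_of_eq_bot (hP : P.1 = ⊥) (g : P.1) : g = 1 :=
  Subtype.ext ((Subgroup.mem_bot).1 (hP ▸ g.2))

theorem eta_bot (hP : P.1 = ⊥) (a : S.RP ι P) : S.eta ι P a = a := by
  ext g
  rw [eta_apply, if_pos]
  rw [eq_top_iff]
  intro x _
  rw [subsingleton_of_eq_bot hP x]
  exact Subgroup.one_mem _

/-! ### The homomorphisms `ver` and `φ` -/

variable (c : S.Coef R)

theorem ver_single (P' P : S.Cyc) (h : ∀ g ∈ P'.1, g ^ p ∈ P.1) (g : P'.1) (r : R) :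
    c.ver P' P h (TwGrp.single _ g r) =
      TwGrp.single _ ⟨(g : S.G) ^ p, h g g.2⟩ (c.φ r * (c.ι (S.powZ g) : R)) := by
  refine (TwGrp.liftHom_single _ _ _ _ _ g r).trans ?_
  exact TwGrp.C_mul_single _ _ _

theorem ver_apply (P' P : S.Cyc) (h : ∀ g ∈ P'.1, g ^ p ∈ P.1) [Fintype P'.1] (x : S.RP c.ι P')
    (k : P.1) : c.ver P' P h x k =
      ∑ g : P'.1, if (g : S.G) ^ p = k then c.φ (x g) * (c.ι (S.powZ g) : R) else 0 := by
  conv_lhs => rw [TwGrp.eq_sum_single x, map_sum]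
  rw [TwGrp.sum_apply]
  refine Finset.sum_congr rfl fun g _ => ?_
  rw [ver_single, TwGrp.single_apply]
  by_cases hk : (g : S.G) ^ p = k
  · rw [if_pos hk, if_pos (Subtype.ext hk.symm)]
  · rw [if_neg hk, if_neg fun e => hk (congrArg Subtype.val e).symm]

section LogRing

variable {c} {R' : Type*} [CommRing R'] [Algebra ℚ R'] (E : LogRing c R')

/-- The homomorphism `R[P]^τ → R'[P]^τ`. -/
def LogRing.mapRP (P : S.Cyc) : S.RP c.ι P →+* S.RP E.coef.ι P :=
  TwGrp.mapCoef E.j fun _ _ => rfl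

/-- The homomorphism `R[G]^τ → R'[G]^τ`. -/
def LogRing.mapRG : S.RG c.ι →+* S.RG E.coef.ι := TwGrp.mapCoef E.j fun _ _ => rfl

theorem mapRP_ver (P' P : S.Cyc) (h : ∀ g ∈ P'.1, g ^ p ∈ P.1) (x : S.RP c.ι P') :
    E.mapRP P (c.ver P' P h x) = E.coef.ver P' P h (E.mapRP P' x) := by
  have := Fintype.ofFinite P'.1
  ext k
  rw [ver_apply]
  refine (congrArg E.j (ver_apply c P' P h x k)).trans ?_
  rw [map_sum]
  refine Finset.sum_congr rfl fun g _ => ?_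
  rw [apply_ite E.j, map_zero, map_mul, ← E.φ_j]
  rfl

theorem mapRP_gradNorm (ω : P.1 →* Multiplicative (ZMod p)) (x : S.RP c.ι P) :
    E.mapRP P (gradNorm c.ι ω x) = gradNorm E.coef.ι ω (E.mapRP P x) :=
  (gradNorm_map E.j _ ω x).symm

end LogRing

theorem eq_C_of_eq_bot (hP : P.1 = ⊥) (x : S.RP ι P) : x = TwGrp.C _ (x 1) := by
  ext g
  rw [subsingleton_of_eq_bot hP g, TwGrp.C_apply, if_pos rfl]

theorem frob_C (P : S.Cyc) (r : R) : c.frob P (TwGrp.C _ r) = TwGrp.C _ (c.φ r) := by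
  refine (ver_single c P P _ 1 r).trans ?_
  have h2 : S.powZ ((1 : P.1) : S.G) = 1 := powZ_one
  rw [h2, map_one, Units.val_one, mul_one]
  have h1 : (⟨((1 : P.1) : S.G) ^ p, pow_mem (1 : P.1).2 p⟩ : P.1) = 1 := Subtype.ext (one_pow p)
  rw [h1]; rfl

theorem frob_congr_of_eq_bot (hφ : ∀ r, ∃ s, c.φ r = r ^ p + p * s) (hP : P.1 = ⊥)
    (x : S.RP c.ι P) : ∃ y, c.frob P x = x ^ p + p * y := by
  obtain ⟨s, hs⟩ := hφ (x 1)
  refine ⟨TwGrp.C _ s, ?_⟩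
  conv_lhs => rw [eq_C_of_eq_bot hP x, frob_C, hs]
  conv_rhs => rw [eq_C_of_eq_bot hP x]
  rw [map_add, map_mul, map_pow, map_natCast]

/-! ### The homomorphism `α` -/

/-- The homomorphism whose graph is `IsAlpha`. -/
def Coef.alphaHom {P : S.Cyc} (ω : P.1 →* Multiplicative (ZMod p)) :
    (S.RP c.ι P)ˣ →* (S.RP c.ι P)ˣ :=
  powMonoidHom p / if P.1 = ⊥ then Units.map (c.frob P).toMonoidHom else Units.map (gradNorm c.ι ω)

theorem alphaHom_mul (ω : P.1 →* Multiplicative (ZMod p)) (x : (S.RP c.ι P)ˣ) :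
    (c.alphaHom ω x : S.RP c.ι P) *
      (if P.1 = ⊥ then c.frob P (x : S.RP c.ι P) else gradNorm c.ι ω (x : S.RP c.ι P)) =
      (x : S.RP c.ι P) ^ p := by
  have h : c.alphaHom ω x * (if P.1 = ⊥ then Units.map (c.frob P).toMonoidHom
      else Units.map (gradNorm c.ι ω)) x = x ^ p := by
    rw [Coef.alphaHom, MonoidHom.div_apply, div_mul_cancel]; rfl
  have h2 := congrArg Units.val h
  split_ifs at h2 ⊢ with hP
  · exact h2
  · exact h2

/-- By `toZeta_gradNorm` the product of the twists already lives in `R[P]^τ`, and the inclusion into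
`R[ζ][P]^τ` is injective, so the defining relation descends. The norm of a unit is a unit, hence the
quotient exists and is unique. -/
theorem isAlpha_iff (hR : ∀ r : R, (p : R) * r = 0 → r = 0)
    (ω : P.1 →* Multiplicative (ZMod p)) (x y : (S.RP c.ι P)ˣ) :
    c.IsAlpha ω x y ↔ y = c.alphaHom ω x := by
  have key : c.IsAlpha ω x y ↔ (y : S.RP c.ι P) *
      (if P.1 = ⊥ then c.frob P (x : S.RP c.ι P) else gradNorm c.ι ω (x : S.RP c.ι P)) =
      (x : S.RP c.ι P) ^ p := by
    rw [Coef.IsAlpha]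
    split_ifs with hP
    · rfl
    · rw [← toZeta_gradNorm c hR, twist_zero, twist_zero, ← map_mul, ← map_pow]
      exact (toZeta_injective c).eq_iff
  rw [key, ← alphaHom_mul c ω x]
  have hu : IsUnit (if P.1 = ⊥ then c.frob P (x : S.RP c.ι P)
      else gradNorm c.ι ω (x : S.RP c.ι P)) := by
    split_ifs
    · exact x.isUnit.map _
    · exact x.isUnit.map _
  rw [hu.mul_left_inj, Units.val_inj]

theorem existsUnique_isAlpha (hR : ∀ r : R, (p : R) * r = 0 → r = 0)
    (ω : P.1 →* Multiplicative (ZMod p)) (x : (S.RP c.ι P)ˣ) : ∃! y, c.IsAlpha ω x y :=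
  ⟨c.alphaHom ω x, (isAlpha_iff c hR ω x _).2 rfl, fun _ hy => (isAlpha_iff c hR ω x _).1 hy⟩

theorem alpha_eq_alphaHom (hR : ∀ r : R, (p : R) * r = 0 → r = 0)
    (ω : P.1 →* Multiplicative (ZMod p)) (x : (S.RP c.ι P)ˣ) : c.alpha ω x = c.alphaHom ω x := by
  have h := (existsUnique_isAlpha c hR ω x).exists
  rw [Coef.alpha, dif_pos h]
  exact (isAlpha_iff c hR ω x _).1 h.choose_spec

/-- The denominator of `α_P(x)` is congruent to the unit `x ^ p` modulo `p`: by `gradNorm_congr` for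
`P ≠ 1`, and because `φ` lifts the Frobenius for `P = 1`. -/
theorem alphaHom_congr (hR : ∀ r : R, (p : R) * r = 0 → r = 0)
    (hφ : ∀ r, ∃ s, c.φ r = r ^ p + p * s)
    (ω : P.1 →* Multiplicative (ZMod p)) (x : (S.RP c.ι P)ˣ) :
    ∃ y, (c.alphaHom ω x : S.RP c.ι P) = 1 + p * y := by
  have h := alphaHom_mul c ω x
  obtain ⟨y, hy⟩ : ∃ y, (if P.1 = ⊥ then c.frob P (x : S.RP c.ι P)
      else gradNorm c.ι ω (x : S.RP c.ι P)) = (x : S.RP c.ι P) ^ p + p * y := by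
    split_ifs with hP
    · exact frob_congr_of_eq_bot c hφ hP _
    · exact gradNorm_congr c hR ω _
  rw [hy] at h
  have hx : ((x⁻¹ ^ p : (S.RP c.ι P)ˣ) : S.RP c.ι P) * (x : S.RP c.ι P) ^ p = 1 := by
    rw [← Units.val_pow_eq_pow_val, ← Units.val_mul, inv_pow, inv_mul_cancel]; rfl
  refine ⟨-((x⁻¹ ^ p : (S.RP c.ι P)ˣ) * (c.alphaHom ω x : S.RP c.ι P) * y), ?_⟩
  linear_combination ((x⁻¹ ^ p : (S.RP c.ι P)ˣ) : S.RP c.ι P) * h +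
    (1 - (c.alphaHom ω x : S.RP c.ι P)) * hx

end Setup

/-! ### Additive maps, lattices in `R'`, and the effect of `α_P` on logarithms -/

namespace Setup

variable {p : ℕ} [Fact p.Prime] {𝒢 : Type*} [Group 𝒢] [TopologicalSpace 𝒢] {S : Setup p 𝒢}

section AddHoms

variable {R : Type*} [CommRing R] {ι : S.Z →* Rˣ}

instance : Finite (ConjClasses S.G) := Quotient.finite _

theorem tr_eq_sum (P : S.Cyc) [Fintype (ConjClasses S.G)] [Fintype (S.G ⧸ P.1)] (a : S.ConjMod R)
    (h : P.1) : S.tr ι P a h = ∑ c : ConjClasses S.G, ∑ q : S.G ⧸ P.1,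
      if q.out⁻¹ * Quotient.out c * q.out = (h : S.G) then a c else 0 := by
  rw [tr]
  simp only [finsum_eq_sum_of_fintype]

/-- The map `t^G_P` as an additive homomorphism. -/
def trHom (ι : S.Z →* Rˣ) (P : S.Cyc) : S.ConjMod R →+ S.RP ι P where
  toFun := S.tr ι P
  map_zero' := by ext h; simp [tr, TwGrp.zero_apply]
  map_add' a b := by
    have := Fintype.ofFinite (ConjClasses S.G)
    have := Fintype.ofFinite (S.G ⧸ P.1)
    ext h
    rw [TwGrp.add_apply, tr_eq_sum, tr_eq_sum, tr_eq_sum, ← Finset.sum_add_distrib]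
    refine Finset.sum_congr rfl fun c _ => ?_
    rw [← Finset.sum_add_distrib]
    refine Finset.sum_congr rfl fun q _ => ?_
    split_ifs <;> simp

/-- The map `η_P` as an additive homomorphism. -/
def etaHom (ι : S.Z →* Rˣ) (P : S.Cyc) : S.RP ι P →+ S.RP ι P where
  toFun := S.eta ι P
  map_zero' := by ext h; simp [eta_apply, TwGrp.zero_apply]
  map_add' a b := by
    ext h
    rw [TwGrp.add_apply, eta_apply, eta_apply, eta_apply, TwGrp.add_apply]
    split_ifs <;> simp

/-- The map `β^G_P` as an additive homomorphism. -/
def betaHom (ι : S.Z →* Rˣ) (P : S.Cyc) : S.ConjMod R →+ S.RP ι P :=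
  (etaHom ι P).comp (trHom ι P)

/-- The projection `R[G]^τ → R[Conj(G)]^τ` as an additive homomorphism. -/
def toConjHom (τ : Cocycle S.G R) : TwGrp τ →+ S.ConjMod R where
  toFun := S.toConj
  map_zero' := by ext h; simp [toConj, TwGrp.zero_apply]
  map_add' a b := by
    have := Fintype.ofFinite S.G
    ext d
    simp only [toConj, Pi.add_apply, finsum_eq_sum_of_fintype]
    rw [← Finset.sum_add_distrib]
    refine Finset.sum_congr rfl fun c _ => ?_
    rw [TwGrp.add_apply]
    split_ifs <;> simp

/-- The map `φ` on `R[Conj(G)]^τ` as an additive homomorphism. -/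
def frobConjHom (c : S.Coef R) : S.ConjMod R →+ S.ConjMod R where
  toFun := S.frobConj c
  map_zero' := by ext h; simp [frobConj]
  map_add' a b := by
    have := Fintype.ofFinite (ConjClasses S.G)
    ext d
    simp only [frobConj, Pi.add_apply, finsum_eq_sum_of_fintype]
    rw [← Finset.sum_add_distrib]
    refine Finset.sum_congr rfl fun c _ => ?_
    split_ifs
    · rw [map_add, add_mul]
    · simp

/-- The composite map `R[P]^τ → R[G]^τ → R[Conj(G)]^τ` as an additive homomorphism. -/
def cycHom (ι : S.Z →* Rˣ) (P : S.Cyc) : S.RP ι P →+ S.ConjMod R :=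
  (toConjHom (S.cocycle ι)).comp (TwGrp.ofSubgroup (S.cocycle ι) P.1).toAddMonoidHom

end AddHoms

section Good

variable {R R' : Type*} [CommRing R] [CommRing R'] [Algebra ℚ R'] {c : S.Coef R}
variable (E : LogRing c R')

/-- A subring of `R'` which contains the image of `R`, is stable under `φ`, and in which the
integers prime to `p` are invertible. -/
structure LogRing.Good (B : Subring R') : Prop where
  j_mem : ∀ r, E.j r ∈ B
  φ_mem : ∀ r ∈ B, E.φ r ∈ B
  pinv : PInv p B

variable {E} {B : Subring R'} (hB : E.Good B)
include hB

theorem LogRing.Good.ι_mem (z : S.Z) : (E.coef.ι z : R') ∈ B := hB.j_mem _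

theorem LogRing.Good.ι_inv_mem (z : S.Z) : (↑(E.coef.ι z)⁻¹ : R') ∈ B := hB.j_mem _

/-- The elements of `R'[P]^τ` with coefficients in `B`. -/
def LogRing.Good.sub (P : S.Cyc) : Subring (S.RP E.coef.ι P) :=
  TwGrp.coefSub ((S.cocycle E.coef.ι).restrict P.1) B fun _ _ => hB.ι_mem _

/-- The elements of `R'[G]^τ` with coefficients in `B`. -/
def LogRing.Good.subG : Subring (S.RG E.coef.ι) :=
  TwGrp.coefSub (S.cocycle E.coef.ι) B fun _ _ => hB.ι_mem _

variable {P : S.Cyc}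

theorem LogRing.Good.mem_powSub_sub {n : ℕ} {x : S.RP E.coef.ι P} :
    x ∈ powSub p (hB.sub P) n ↔ ∀ g, x g ∈ powSub p B n := TwGrp.mem_powSub_coefSub

theorem LogRing.Good.pinv_sub (P : S.Cyc) : PInv p (hB.sub P) := TwGrp.pInv_coefSub hB.pinv

theorem LogRing.Good.mapRP_mem (x : S.RP c.ι P) : E.mapRP P x ∈ hB.sub P := fun _ => hB.j_mem _

theorem LogRing.Good.ver_mem (P' P : S.Cyc) (h : ∀ g ∈ P'.1, g ^ p ∈ P.1) :
    ∀ x ∈ hB.sub P', E.coef.ver P' P h x ∈ hB.sub P := by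
  intro x hx k
  have := Fintype.ofFinite P'.1
  rw [ver_apply]
  refine sum_mem fun g _ => ?_
  split_ifs
  · exact B.mul_mem (hB.φ_mem _ (hx g)) (hB.ι_mem _)
  · exact B.zero_mem

theorem LogRing.Good.gradRep_mem (ω : P.1 →* Multiplicative (ZMod p)) :
    ∀ x ∈ hB.sub P, ∀ i j, gradRep E.coef.ι ω x i j ∈ hB.sub P := by
  intro x hx i j g
  change (if _ then _ else _) ∈ B
  split_ifs
  exacts [hx g, B.zero_mem]

theorem LogRing.Good.topUni_of_congr {x : S.RP c.ι P} (hx : ∃ y, x = 1 + p * y) :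
    TopUni p (hB.sub P) (E.mapRP P x) := by
  obtain ⟨y, rfl⟩ := hx
  refine topUni_of_sub_mem ⟨E.mapRP P y, hB.mapRP_mem y, ?_⟩
  rw [map_add, map_one, map_mul, map_natCast, pow_one, add_sub_cancel_left]

omit hB in
/-- The effect of `α_P` on logarithms. -/
def LogRing.dAlpha (E : LogRing c R') (P : S.Cyc) (a : S.RP E.coef.ι P) : S.RP E.coef.ι P :=
  if P.1 = ⊥ then p • a - E.coef.frob P a else p • S.eta E.coef.ι P a

/-- Logarithms are taken in the relation `N(x) α_P(x) = x ^ p`. For `P = 1` the map `N` is `φ`. For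
`P ≠ 1` it is a determinant, so that `log N(x)` is the trace, `p` times the degree zero part of `log
x`; what remains of `p log x` is `p η_P(log x)`. -/
theorem LogRing.Good.logTo_alpha (hR : ∀ r : R, (p : R) * r = 0 → r = 0)
    (hφ : ∀ r, ∃ s, c.φ r = r ^ p + p * s) (ω : P.1 →* Multiplicative (ZMod p))
    (hω : P.1 ≠ ⊥ → ω ≠ 1) (x : (S.RP c.ι P)ˣ) (a : S.RP E.coef.ι P)
    (hx : TopUni p (hB.sub P) (E.mapRP P x)) (hxa : LogTo p (hB.sub P) (E.mapRP P x) a) :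
    LogTo p (hB.sub P) (E.mapRP P (c.alphaHom ω x : (S.RP c.ι P)ˣ)) (E.dAlpha P a) := by
  have hα := hB.topUni_of_congr (alphaHom_congr c hR hφ ω x)
  have h := congrArg (E.mapRP P) (alphaHom_mul c ω x)
  rw [map_mul, map_pow, mul_comm] at h
  have hxp := hxa.pow (hB.pinv_sub P) hx p
  rw [← h] at hxp
  rw [LogRing.dAlpha]
  split_ifs at hxp ⊢ with hP
  · have e : E.mapRP P (c.frob P (x : S.RP c.ι P)) = E.coef.frob P (E.mapRP P x) :=
      mapRP_ver E P P _ _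
    rw [e] at hxp
    exact LogTo.of_mul (hB.pinv_sub P) (hx.map _ (hB.ver_mem P P _)) hα
      (hxa.map _ (hB.ver_mem P P _)) hxp
  · rw [mapRP_gradNorm] at hxp
    have := LogTo.of_mul (hB.pinv_sub P) (hx.det_rep _ (hB.gradRep_mem ω)) hα
      (hxa.det_rep _ (hB.gradRep_mem ω) (hB.pinv_sub P) hx) hxp
    rwa [trace_gradRep, ← smul_sub, ← eta_eq_sub ω (hω hP)] at this

end Good

end Setup

/-! ### The norm `θ_P` and its logarithm -/

namespace Setup

variable {p : ℕ} [Fact p.Prime] {𝒢 : Type*} [Group 𝒢] [TopologicalSpace 𝒢] {S : Setup p 𝒢}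

section Theta

variable {R R' : Type*} [CommRing R] [CommRing R'] [Algebra ℚ R'] {c : S.Coef R}
variable (E : LogRing c R')

theorem toConj_mapRG (a : S.RG c.ι) (d : ConjClasses S.G) :
    S.toConj (E.mapRG a) d = E.j (S.toConj a d) := by
  have := Fintype.ofFinite S.G
  simp only [toConj, finsum_eq_sum_of_fintype, map_sum]
  refine Finset.sum_congr rfl fun g _ => ?_
  split_ifs
  · rfl
  · exact (map_zero _).symm

/-- The representation of the matrix ring over `R[G]^τ` on a power of `R[G]^τ`, viewed as a free
module over `R[P]^τ`. -/
def matRep (ι : S.Z →* Rˣ) (P : S.Cyc) [Fintype (S.G ⧸ P.1)] (n : ℕ) :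
    Matrix (Fin n) (Fin n) (S.RG ι) →+*
      Matrix (Fin n × (S.G ⧸ P.1)) (Fin n × (S.G ⧸ P.1)) (S.RP ι P) :=
  (Matrix.compRingEquiv (Fin n) (S.G ⧸ P.1) (S.RP ι P)).toRingHom.comp
    (TwGrp.regRep (S.cocycle ι) P.1).mapMatrix

theorem matRep_apply (ι : S.Z →* Rˣ) (P : S.Cyc) [Fintype (S.G ⧸ P.1)] (n : ℕ)
    (M : Matrix (Fin n) (Fin n) (S.RG ι)) (i j : Fin n × (S.G ⧸ P.1)) :
    matRep ι P n M i j = TwGrp.regRep (S.cocycle ι) P.1 (M i.1 j.1) i.2 j.2 := rfl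

theorem theta_mk {A : Type*} [Ring A] (ε : A ≃+* S.RG c.ι) (P : S.Cyc) [h : Fintype (S.G ⧸ P.1)]
    {n : ℕ} (u : GL (Fin n) A) :
    (c.theta ε P (K1.mk u) : S.RP c.ι P) = (matRep c.ι P n (u.1.map ε)).det := by
  obtain rfl : h = Fintype.ofFinite _ := Subsingleton.elim _ _
  rfl

theorem trace_matRep [Algebra ℚ R] (ι : S.Z →* Rˣ) (P : S.Cyc) [Fintype (S.G ⧸ P.1)] {n : ℕ}
    (M : Matrix (Fin n) (Fin n) (S.RG ι)) :
    (matRep ι P n M).trace = S.tr ι P (S.toConj M.trace) := by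
  have := Fintype.ofFinite S.G
  rw [← trace_regRep, Matrix.trace, Fintype.sum_prod_type, Matrix.trace, Matrix.trace, map_sum]
  simp only [Matrix.diag_apply, Matrix.sum_apply, matRep_apply]
  exact Finset.sum_comm

theorem mapRP_matRep (P : S.Cyc) [Fintype (S.G ⧸ P.1)] {n : ℕ}
    (M : Matrix (Fin n) (Fin n) (S.RG c.ι)) :
    (matRep c.ι P n M).map (E.mapRP P) = matRep E.coef.ι P n (M.map E.mapRG) := by
  ext1 i j
  have := TwGrp.mapCoef_regRep (τ := S.cocycle c.ι) (τ' := S.cocycle E.coef.ι) E.j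
    (fun _ _ => rfl) P.1 (M i.1 j.1)
  exact (congrFun (congrFun this i.2) j.2).symm

theorem LogRing.TendsTo.mem_powSub {B : Subring R'} (hBl : B.toAddSubgroup ∈ E.lattices)
    {s : ℕ → R'} {ℓ : R'} (h : E.TendsTo s ℓ) (e : ℕ) :
    ∃ N, ∀ m ≥ N, s m - ℓ ∈ powSub p B e := by
  obtain ⟨N, hN⟩ := h _ hBl e
  refine ⟨N, fun m hm => ?_⟩
  rw [← neg_sub]
  exact neg_mem (hN m hm)

variable {E} {B : Subring R'} (hB : E.Good B)
include hB

theorem LogRing.Good.tr_mem (P : S.Cyc) {e : ℕ} {a : S.ConjMod R'} (ha : ∀ d, a d ∈ powSub p B e) :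
    S.tr E.coef.ι P a ∈ powSub p (hB.sub P) e := by
  have := Fintype.ofFinite (ConjClasses S.G)
  have := Fintype.ofFinite (S.G ⧸ P.1)
  rw [hB.mem_powSub_sub]
  intro g
  rw [tr_eq_sum]
  refine sum_mem fun d _ => sum_mem fun q _ => ?_
  split_ifs
  exacts [ha d, zero_mem _]

/-- Instance of `log det = tr log` for the block matrix of `u` over `R'[P]^τ`. The trace of its
`i`-th power term is `t_P` of the class of `Tr ((u - 1) ^ i)`, so only the traced series of `u` has
to converge, not the matrix logarithm. -/
theorem LogRing.Good.logTo_theta (hBl : B.toAddSubgroup ∈ E.lattices) {A : Type*} [Ring A]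
    (ε : A ≃+* S.RG c.ι) {n : ℕ} (u : GL (Fin n) A) (N : ℕ)
    (hN : ∀ i j, E.mapRG (((u.1.map ε - 1) ^ N) i j) ∈ powSub p hB.subG 1) {ℓ : S.ConjMod R'}
    (hu : E.HasTrLog (u.1.map ε) ℓ) (P : S.Cyc) :
    TopUni p (hB.sub P) (E.mapRP P (c.theta ε P (K1.mk u) : S.RP c.ι P)) ∧
      LogTo p (hB.sub P) (E.mapRP P (c.theta ε P (K1.mk u) : S.RP c.ι P))
        (S.tr E.coef.ι P ℓ) := by
  have := Fintype.ofFinite (S.G ⧸ P.1)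
  have := Fintype.ofFinite (ConjClasses S.G)
  set X := u.1.map ε - 1 with hX
  let Ψ : Matrix (Fin n) (Fin n) (S.RG c.ι) →+*
      Matrix (Fin n × (S.G ⧸ P.1)) (Fin n × (S.G ⧸ P.1)) (S.RP E.coef.ι P) :=
    (matRep E.coef.ι P n).comp E.mapRG.mapMatrix
  have hinv : ∀ x y, (↑(S.cocycle E.coef.ι x y)⁻¹ : R') ∈ B := fun _ _ => hB.ι_inv_mem _
  have hρ : ∀ x ∈ hB.subG, ∀ i j, TwGrp.regRep (S.cocycle E.coef.ι) P.1 x i j ∈ hB.sub P :=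
    fun x hx i j => TwGrp.regRep_mem hinv P.1 hx i j
  have hM : ∀ i j, Ψ X i j ∈ hB.sub P := fun i j => hρ _ (fun _ => hB.j_mem _) _ _
  have hMN : ∀ i j, (Ψ X ^ N) i j ∈ powSub p (hB.sub P) 1 := by
    intro i j
    rw [← map_pow]
    exact powSub_rep _ hρ (hN i.1 j.1) _ _
  have hdet : E.mapRP P (c.theta ε P (K1.mk u) : S.RP c.ι P) = (1 + Ψ X).det := by
    rw [theta_mk, RingHom.map_det, RingHom.mapMatrix_apply, mapRP_matRep, ← map_one Ψ, ← map_add,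
      hX, add_sub_cancel]
    rfl
  rw [hdet]
  refine ⟨topUni_det _ hM N hMN, logTo_det (hB.pinv_sub P) _ hM N hMN fun e => ?_⟩
  have h1 : ∀ d, ∃ K : ℕ, ∀ m ≥ K, (∑ i ∈ Finset.Icc 1 m,
      ((-1) ^ (i + 1) / (i : ℚ)) • E.j (S.toConj (Matrix.trace (X ^ i)) d)) - ℓ d ∈
        powSub p B e := fun d => (hu d).mem_powSub E hBl e
  choose K hK using h1
  refine ⟨∑ d, K d, fun m hm => ?_⟩
  have e1 : (∑ i ∈ Finset.Icc 1 m, ((-1) ^ (i + 1) / (i : ℚ)) • (Ψ X ^ i).trace) =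
      trHom E.coef.ι P (∑ i ∈ Finset.Icc 1 m, ((-1) ^ (i + 1) / (i : ℚ)) •
        toConjHom (S.cocycle E.coef.ι) (E.mapRG (Matrix.trace (X ^ i)))) := by
    rw [map_sum]
    refine Finset.sum_congr rfl fun i _ => ?_
    rw [map_rat_smul, ← map_pow]
    congr 1
    refine (trace_matRep _ _ _).trans ?_
    have : Matrix.trace (E.mapRG.mapMatrix (X ^ i)) = E.mapRG (Matrix.trace (X ^ i)) :=
      (AddMonoidHom.map_trace E.mapRG.toAddMonoidHom (X ^ i)).symm
    rw [this]; rfl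
  rw [e1]
  refine Eq.mpr (congrArg (· ∈ _) (map_sub (trHom E.coef.ι P) _ ℓ).symm) (hB.tr_mem P fun d => ?_)
  have := hK d m (le_trans (Finset.single_le_sum (fun _ _ => Nat.zero_le _) (Finset.mem_univ d)) hm)
  have e2 : (∑ i ∈ Finset.Icc 1 m, ((-1) ^ (i + 1) / (i : ℚ)) •
      toConjHom (S.cocycle E.coef.ι) (E.mapRG (Matrix.trace (X ^ i)))) d =
      ∑ i ∈ Finset.Icc 1 m, ((-1) ^ (i + 1) / (i : ℚ)) •
        E.j (S.toConj (Matrix.trace (X ^ i)) d) := by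
    refine (Finset.sum_apply (M := fun _ : ConjClasses S.G => R') d _ _).trans
      (Finset.sum_congr rfl fun i _ => ?_)
    exact congrArg (((-1) ^ (i + 1) / (i : ℚ)) • ·) (toConj_mapRG E _ d)
  rw [← e2] at this
  exact this

end Theta

end Setup

/-! ### How `β_P` commutes with `φ` -/

namespace Setup

variable {p : ℕ} [Fact p.Prime] {𝒢 : Type*} [Group 𝒢] [TopologicalSpace 𝒢] {S : Setup p 𝒢}

section Identity

theorem sum_coe_subgroup {G M : Type*} [Group G] [Fintype G] [AddCommMonoid M] (P : Subgroup G)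
    [Fintype P] (q : G → Prop) [DecidablePred q] (hq : ∀ g, q g → g ∈ P) (f : G → M) :
    ∑ g : P, (if q g then f g else 0) = ∑ g, if q g then f g else 0 := by
  rw [← Finset.sum_filter_add_sum_filter_not Finset.univ (· ∈ P)]
  rw [Finset.sum_subtype (p := (· ∈ P)) (F := inferInstance) _ (by simp)]
  rw [Finset.sum_eq_zero (s := Finset.univ.filter (· ∉ P)), add_zero]
  intro g hg
  rw [if_neg]
  intro h
  exact (Finset.mem_filter.1 hg).2 (hq g h)

/-- For a class representative `k`, the sum of `F` over those `x` with `(x k x⁻¹) ^ p = h` is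
counted twice: there are `|C(h)|` such `x` if `k ^ p` is conjugate to `h` and none otherwise; on the
other side every `g` conjugate to `k` arises from `|C(g)|` of the `x`. -/
theorem sum_conj_pow {G M : Type*} [Group G] [Fintype G] [Fintype (ConjClasses G)]
    [AddCommMonoid M] (p : ℕ) (h : G) [DecidablePred fun g : G => g ^ p = h]
    [DecidablePred fun k : ConjClasses G => ConjClasses.mk ((Quotient.out k : G) ^ p) =
      ConjClasses.mk h] (F : G → M) (hF : ∀ x g, F (x * g * x⁻¹) = F g) :
    centCard h • (∑ k : ConjClasses G, if ConjClasses.mk ((Quotient.out k : G) ^ p) =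
      ConjClasses.mk h then F (Quotient.out k) else 0) =
      ∑ g, if g ^ p = h then centCard g • F g else 0 := by
  have e1 : ∀ k : G, ∑ x, (if (x * k * x⁻¹) ^ p = h then F (x * k * x⁻¹) else 0) =
      if ConjClasses.mk (k ^ p) = ConjClasses.mk h then centCard h • F k else 0 := by
    intro k
    simp only [hF, conj_pow]
    rw [← Finset.sum_filter, Finset.sum_const]
    by_cases hk : ConjClasses.mk (k ^ p) = ConjClasses.mk h
    · rw [if_pos hk]
      have hk' := ConjClasses.mk_eq_mk_iff_isConj.1 hk
      rw [centCard_eq_of_isConj hk', ← card_conj_filter hk']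
    · rw [if_neg hk, Finset.filter_false_of_mem, Finset.card_empty, zero_smul]
      intro x _ hx
      exact hk (ConjClasses.mk_eq_mk_iff_isConj.2 (isConj_iff.2 ⟨x, hx⟩))
  have e2 : ∀ k : G, ∑ x, (if (x * k * x⁻¹) ^ p = h then F (x * k * x⁻¹) else 0) =
      ∑ g, if IsConj k g then (if g ^ p = h then centCard g • F g else 0) else 0 := by
    intro k
    refine (sum_conj k fun g => if g ^ p = h then F g else 0).trans ?_
    rw [Finset.smul_sum]
    refine Finset.sum_congr rfl fun g _ => ?_
    by_cases hg : IsConj k g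
    · rw [if_pos hg, if_pos hg, centCard_eq_of_isConj hg]
      split_ifs
      · rfl
      · exact smul_zero _
    · rw [if_neg hg, if_neg hg, smul_zero]
  rw [Finset.smul_sum]
  have e3 : ∀ k : ConjClasses G, centCard h • (if ConjClasses.mk ((Quotient.out k : G) ^ p) =
      ConjClasses.mk h then F (Quotient.out k) else 0) =
      ∑ g, if IsConj (Quotient.out k : G) g then
        (if g ^ p = h then centCard g • F g else 0) else 0 := by
    intro k
    rw [← e2, e1]
    by_cases hk : ConjClasses.mk ((Quotient.out k : G) ^ p) = ConjClasses.mk h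
    · rw [if_pos hk, if_pos hk]
    · rw [if_neg hk, if_neg hk, smul_zero]
  rw [Finset.sum_congr rfl fun k _ => e3 k, Finset.sum_comm]
  refine Finset.sum_congr rfl fun g _ => ?_
  rw [Finset.sum_eq_single (ConjClasses.mk g)]
  · rw [if_pos]
    exact ConjClasses.mk_eq_mk_iff_isConj.1 (Quotient.out_eq _)
  · intro k _ hk
    rw [if_neg]
    intro h'
    apply hk
    rw [← ConjClasses.mk_eq_mk_iff_isConj.2 h']
    exact (Quotient.out_eq k).symm
  · simp

variable {R : Type*} [CommRing R] [Algebra ℚ R] (c : S.Coef R)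

/-- The class function `g ↦ φ(a(g)) ι(g̃^p (g^p)~⁻¹)`. -/
def Coef.powTerm (a : S.ConjMod R) (g : S.G) : R := c.φ (a (ConjClasses.mk g)) * (c.ι (S.powZ g) : R)

theorem powTerm_conj (a : S.ConjMod R) (x g : S.G) :
    c.powTerm a (x * g * x⁻¹) = c.powTerm a g := by
  have h : IsConj g (x * g * x⁻¹) := isConj_iff.2 ⟨x, rfl⟩
  rw [Coef.powTerm, Coef.powTerm, S.powZ_eq_of_isConj h, ConjClasses.mk_eq_mk_iff_isConj.2 h]

variable [Fintype S.G]

theorem tr_frobConj (P : S.Cyc) (a : S.ConjMod R) (h : P.1) :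
    Nat.card P.1 • S.tr c.ι P (S.frobConj c a) h =
      ∑ g : S.G, if g ^ p = h then centCard g • c.powTerm a g else 0 := by
  have := Fintype.ofFinite (ConjClasses S.G)
  rw [tr_apply]
  refine Eq.trans (congrArg _ ?_) (sum_conj_pow p (h : S.G) (c.powTerm a) (powTerm_conj c a))
  rw [frobConj, finsum_eq_sum_of_fintype]
  refine Finset.sum_congr rfl fun k _ => ?_
  have : ConjClasses.mk (Quotient.out k : S.G) = k := Quotient.out_eq k
  rw [Coef.powTerm, this]
  by_cases hk : ConjClasses.mk ((Quotient.out k : S.G) ^ p) = ConjClasses.mk (h : S.G)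
  · rw [if_pos hk, if_pos hk]
  · rw [if_neg hk, if_neg hk]

theorem zpowers_coe_eq (P : Subgroup S.G) (g : P) :
    Subgroup.zpowers g = ⊤ ↔ Subgroup.zpowers (g : S.G) = P := by
  rw [← (Subgroup.map_injective P.subtype_injective).eq_iff, MonoidHom.map_zpowers]
  simp [← MonoidHom.range_eq_map]

/-- The factor `|P'|` turns `t_{P'}` into values weighted by centralisers (`tr_apply`). What results
is the part of the sum in `tr_frobConj` over those `p`-th roots of `h` which generate `P'`. -/
theorem ver_beta (P' P : S.Cyc) (hP : ∀ g ∈ P'.1, g ^ p ∈ P.1) (a : S.ConjMod R) (h : P.1) :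
    Nat.card P'.1 • c.ver P' P hP (S.beta c.ι P' a) h =
      ∑ g : S.G, if g ^ p = h ∧ Subgroup.zpowers g = P'.1 then
        centCard g • c.powTerm a g else 0 := by
  have := Fintype.ofFinite P'.1
  rw [ver_apply, Finset.smul_sum]
  refine Eq.trans ?_ (sum_coe_subgroup P'.1
    (fun g => g ^ p = h ∧ Subgroup.zpowers g = P'.1) (fun g hg => by
      rw [← hg.2]; exact Subgroup.mem_zpowers g) fun g => centCard g • c.powTerm a g)
  refine Finset.sum_congr rfl fun g _ => ?_
  rw [beta, eta_apply]
  by_cases h1 : (g : S.G) ^ p = h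
  · by_cases h2 : Subgroup.zpowers (g : S.G) = P'.1
    · rw [if_pos h1, if_pos ((zpowers_coe_eq P'.1 g).2 h2), if_pos ⟨h1, h2⟩, Coef.powTerm,
        ← smul_mul_assoc, ← smul_mul_assoc, ← map_nsmul, ← map_nsmul, tr_apply]
    · rw [if_pos h1, if_neg (fun h' => h2 ((zpowers_coe_eq P'.1 g).1 h')),
        if_neg (fun h' => h2 h'.2), map_zero, zero_mul, smul_zero]
  · rw [if_neg h1, if_neg (fun h' => h1 h'.1), smul_zero]

/-- The cyclic subgroups `P' ≠ P` of `G` such that `P'^p = P`. -/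
abbrev Cyc.Above (P : S.Cyc) : Type _ := {P' : S.Cyc //
  (fun g : S.G => g ^ p) '' (P'.1 : Set S.G) = (P.1 : Set S.G) ∧ P' ≠ P}

theorem image_pow_zpowers (g : S.G) :
    (fun g : S.G => g ^ p) '' (Subgroup.zpowers g : Set S.G) = Subgroup.zpowers (g ^ p) := by
  ext x
  simp only [Set.mem_image, SetLike.mem_coe, Subgroup.mem_zpowers_iff]
  constructor
  · rintro ⟨_, ⟨k, rfl⟩, rfl⟩
    exact ⟨k, by rw [← zpow_natCast, ← zpow_natCast, ← zpow_mul, ← zpow_mul, mul_comm]⟩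
  · rintro ⟨k, rfl⟩
    exact ⟨_, ⟨k, rfl⟩, by
      rw [← zpow_natCast, ← zpow_natCast, ← zpow_mul, ← zpow_mul, mul_comm]⟩

theorem card_zpowers_pow {g : S.G} (hg : g ≠ 1) :
    Nat.card (Subgroup.zpowers g) = p * Nat.card (Subgroup.zpowers (g ^ p)) := by
  have hp : p.Prime := Fact.out
  have hd : p ∣ orderOf g := by
    obtain ⟨k, hk⟩ := (IsPGroup.iff_orderOf.1 (isPGroup_G (S := S))) g
    rw [hk]
    refine dvd_pow_self p fun h0 => hg ?_
    rw [h0, pow_zero] at hk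
    exact orderOf_eq_one_iff.1 hk
  rw [Nat.card_zpowers, Nat.card_zpowers, orderOf_pow_of_dvd hp.ne_zero hd, Nat.mul_div_cancel' hd]

theorem zpowers_ne_pow {g : S.G} (hg : g ≠ 1) : Subgroup.zpowers g ≠ Subgroup.zpowers (g ^ p) := by
  intro h
  have h1 := card_zpowers_pow hg
  rw [← h] at h1
  have := Nat.card_pos (α := Subgroup.zpowers g)
  have := (Fact.out : p.Prime).one_lt
  nlinarith

/-- The behaviour of `β_P` with respect to `φ`. -/
theorem beta_frobConj (P : S.Cyc) [Fintype (Cyc.Above P)] (a : S.ConjMod R) :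
    S.beta c.ι P (S.frobConj c a) = (if P.1 = ⊥ then c.frob P (S.tr c.ι P a) else 0) +
      ∑ P' : Cyc.Above P, p • c.ver P'.1 P (Coef.pow_mem_of_image_eq P'.2.1)
        (S.beta c.ι P'.1 a) := by
  have := Fintype.ofFinite P.1
  have hp : p.Prime := Fact.out
  ext h
  rw [TwGrp.add_apply, TwGrp.sum_apply, beta, eta_apply]
  have habove : ∀ (P' : Cyc.Above P) (g : S.G), Subgroup.zpowers g = P'.1.1 →
      Subgroup.zpowers (g ^ p) = P.1 := fun P' g hg => by
    apply SetLike.coe_injective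
    rw [← image_pow_zpowers, hg, P'.2.1]
  -- For a generator `h` of `P`, both sides times `|P|` are sums over the `p`-th roots `g` of `h`. A
  -- root `g ≠ 1` generates exactly one `P'` above `P`, and `|P'| = p |P|` explains the factor `p`.
  -- The root `g = 1` occurs only for `P = 1` and gives the term with `φ`.
  by_cases hh : Subgroup.zpowers h = ⊤
  · rw [if_pos hh]
    have hhP := (zpowers_coe_eq P.1 h).1 hh
    refine nsmul_cancel (Nat.card_pos (α := P.1)).ne' ?_
    rw [smul_add, tr_frobConj, Finset.smul_sum]
    have e1 : ∀ P' : Cyc.Above P, Nat.card P.1 • (p • c.ver P'.1 P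
        (Coef.pow_mem_of_image_eq P'.2.1) (S.beta c.ι P'.1 a) : S.RP c.ι P) h =
        ∑ g : S.G, if g ^ p = h ∧ Subgroup.zpowers g = P'.1.1 then
          centCard g • c.powTerm a g else 0 := by
      intro P'
      rw [← ver_beta c P'.1 P (Coef.pow_mem_of_image_eq P'.2.1), TwGrp.nsmul_apply, smul_smul]
      congr 1
      obtain ⟨g, hg⟩ := (Subgroup.isCyclic_iff_exists_zpowers_eq_top P'.1.1).1 P'.1.2
      have hg1 := habove P' g hg
      have hne : g ≠ 1 := by
        rintro rfl
        apply P'.2.2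
        apply Subtype.ext
        rw [← hg, ← hg1, one_pow]
      rw [← hg, ← hg1, card_zpowers_pow hne, mul_comm]
    rw [Finset.sum_congr rfl fun P' _ => e1 P', Finset.sum_comm]
    have e2 : ∀ g : S.G, (∑ P' : Cyc.Above P, if g ^ p = h ∧ Subgroup.zpowers g = P'.1.1 then
          centCard g • c.powTerm a g else 0) =
        if g ^ p = h ∧ g ≠ 1 then centCard g • c.powTerm a g else 0 := by
      intro g
      by_cases hg : g ^ p = h ∧ g ≠ 1
      · rw [if_pos hg]
        have hz : Subgroup.zpowers (g ^ p) = P.1 := by rw [hg.1, hhP]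
        rw [Finset.sum_eq_single ⟨⟨Subgroup.zpowers g, inferInstance⟩,
          (image_pow_zpowers g).trans (congrArg _ hz), fun h' => zpowers_ne_pow hg.2
            ((congrArg Subtype.val h').trans hz.symm)⟩]
        · rw [if_pos ⟨hg.1, rfl⟩]
        · intro P' _ hP'
          rw [if_neg]
          rintro ⟨-, h2⟩
          exact hP' (Subtype.ext (Subtype.ext h2.symm))
        · simp
      · rw [if_neg hg]
        refine Finset.sum_eq_zero fun P' _ => if_neg ?_
        rintro ⟨h1, h2⟩
        refine hg ⟨h1, ?_⟩
        rintro rfl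
        apply P'.2.2
        apply Subtype.ext
        exact h2.symm.trans ((by rw [one_pow] : Subgroup.zpowers (1 : S.G) = _).trans
          (habove P' 1 h2))
    rw [Finset.sum_congr rfl fun g _ => e2 g]
    have e3 : Nat.card P.1 • (if P.1 = ⊥ then c.frob P (S.tr c.ι P a) else 0 : S.RP c.ι P) h =
        ∑ g : S.G, if g ^ p = h ∧ g = 1 then centCard g • c.powTerm a g else 0 := by
      rw [Finset.sum_eq_single (1 : S.G)]
      · by_cases hP : P.1 = ⊥
        · rw [if_pos hP, subsingleton_of_eq_bot hP h, if_pos ⟨one_pow p, rfl⟩]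
          rw [eq_C_of_eq_bot hP (S.tr c.ι P a), frob_C, TwGrp.C_apply, if_pos rfl, ← map_nsmul,
            tr_apply, Coef.powTerm, powZ_one, map_one, Units.val_one, mul_one, map_nsmul]
          rfl
        · rw [if_neg hP, if_neg, TwGrp.zero_apply, smul_zero]
          rintro ⟨h1, -⟩
          apply hP
          rw [← hhP, ← h1, one_pow, Subgroup.zpowers_one_eq_bot]
      · intro g _ hg
        rw [if_neg fun h' => hg h'.2]
      · simp
    rw [e3, ← Finset.sum_add_distrib]
    refine Finset.sum_congr rfl fun g _ => ?_
    by_cases h1 : g ^ p = h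
    · by_cases h2 : g = 1
      · rw [if_pos h1, if_pos ⟨h1, h2⟩, if_neg (fun h' => h'.2 h2), add_zero]
      · rw [if_pos h1, if_neg (fun h' => h2 h'.2), if_pos ⟨h1, h2⟩, zero_add]
    · rw [if_neg h1, if_neg (fun h' => h1 h'.1), if_neg (fun h' => h1 h'.1), add_zero]
  -- If `h` does not generate `P`, it is not the `p`-th power of a generator of any `P'` with `P'^p
  -- = P`.
  · rw [if_neg hh]
    have hP : P.1 ≠ ⊥ := by
      intro hP
      apply hh
      rw [eq_top_iff]
      intro x _
      rw [subsingleton_of_eq_bot hP x]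
      exact Subgroup.one_mem _
    rw [if_neg hP, TwGrp.zero_apply, zero_add]
    refine (Finset.sum_eq_zero fun P' _ => ?_).symm
    refine nsmul_cancel (Nat.card_pos (α := P'.1.1)).ne' ?_
    rw [TwGrp.nsmul_apply, smul_comm, ver_beta, Finset.sum_eq_zero, smul_zero, smul_zero]
    intro g _
    rw [if_neg]
    rintro ⟨h1, h2⟩
    apply hh
    rw [zpowers_coe_eq, ← h1, habove P' g h2]

end Identity

end Setup

/-! ### The quotient `α_P / u_P` and the formula in the presence of a logarithm -/

namespace Setup

variable {p : ℕ} [Fact p.Prime] {𝒢 : Type*} [Group 𝒢] [TopologicalSpace 𝒢] {S : Setup p 𝒢}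

section Xi

variable {R : Type*} [CommRing R] (c : S.Coef R)

/-- The map `u^G_P` as a homomorphism. -/
def Coef.uHom (P : S.Cyc) : (∀ C : S.Cyc, (S.RP c.ι C)ˣ) →* (S.RP c.ι P)ˣ where
  toFun x := c.u x P
  map_one' := by
    simp only [Coef.u, Pi.one_apply, map_one, finprod_one]
  map_mul' x y := by
    have := Fintype.ofFinite (Cyc.Above P)
    simp only [Coef.u, Pi.mul_apply, map_mul]
    exact finprod_mul_distrib (Set.toFinite _) (Set.toFinite _)

theorem uHom_apply (P : S.Cyc) [Fintype (Cyc.Above P)] (x : ∀ C : S.Cyc, (S.RP c.ι C)ˣ) :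
    c.uHom P x = ∏ P' : Cyc.Above P,
      Units.map (c.ver P'.1 P (Coef.pow_mem_of_image_eq P'.2.1)).toMonoidHom (x P'.1) :=
  finprod_eq_prod_of_fintype _

/-- The homomorphism `(x_C) ↦ α_P(x_P) / u_P((α_C(x_C)))`. -/
def Coef.xi (ω : ∀ P : S.Cyc, P.1 →* Multiplicative (ZMod p)) (P : S.Cyc) :
    (∀ C : S.Cyc, (S.RP c.ι C)ˣ) →* (S.RP c.ι P)ˣ :=
  (c.alphaHom (ω P)).comp (Pi.evalMonoidHom _ P) /
    (c.uHom P).comp (MonoidHom.pi fun C => (c.alphaHom (ω C)).comp (Pi.evalMonoidHom _ C))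

/-- The units congruent to `1` modulo `p`. -/
def oneUnits (p : ℕ) (A : Type*) [CommRing A] : Subgroup Aˣ :=
  (Units.map (Ideal.Quotient.mk (Ideal.span {(p : A)})).toMonoidHom).ker

theorem mem_oneUnits {A : Type*} [CommRing A] {x : Aˣ} :
    x ∈ oneUnits p A ↔ ∃ y, (x : A) = 1 + p * y := by
  rw [oneUnits, MonoidHom.mem_ker, Units.ext_iff]
  change Ideal.Quotient.mk _ (x : A) = Ideal.Quotient.mk _ 1 ↔ _
  rw [Ideal.Quotient.eq, Ideal.mem_span_singleton]
  exact exists_congr fun y => by rw [sub_eq_iff_eq_add']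

/-- The homomorphisms `ver` preserve the congruence `α_C ≡ 1` modulo `p`. This is what makes the
right hand side of the formula converge, even for `x` without a logarithm. -/
theorem xi_congr (hR : ∀ r : R, (p : R) * r = 0 → r = 0) (hφ : ∀ r, ∃ s, c.φ r = r ^ p + p * s)
    (ω : ∀ P : S.Cyc, P.1 →* Multiplicative (ZMod p)) (P : S.Cyc)
    (x : ∀ C : S.Cyc, (S.RP c.ι C)ˣ) :
    ∃ y, (c.xi ω P x : S.RP c.ι P) = 1 + p * y := by
  have := Fintype.ofFinite (Cyc.Above P)
  refine mem_oneUnits.1 (div_mem (mem_oneUnits.2 (alphaHom_congr c hR hφ _ _)) ?_)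
  refine Eq.mpr (congrArg (· ∈ _) (uHom_apply c P _)) (prod_mem fun P' _ => mem_oneUnits.2 ?_)
  obtain ⟨y, hy⟩ := alphaHom_congr c hR hφ (ω P'.1) (x P'.1)
  refine ⟨c.ver P'.1 P (Coef.pow_mem_of_image_eq P'.2.1) y, ?_⟩
  refine (congrArg (c.ver P'.1 P (Coef.pow_mem_of_image_eq P'.2.1)) hy).trans ?_
  rw [map_add, map_one, map_mul, map_natCast]

end Xi

section Log

variable {R R' : Type*} [CommRing R] [CommRing R'] [Algebra ℚ R'] {c : S.Coef R}
variable (E : LogRing c R')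

/-- The conditions on the topology of `R'` which are needed for the formula. -/
structure LogRing.Nice : Prop where
  good : ∀ L ∈ E.lattices, ∃ B : Subring R', B.toAddSubgroup = L ∧ E.Good B
  separated : ∀ r : R', (∀ B : Subring R', B.toAddSubgroup ∈ E.lattices →
    ∀ n, r ∈ powSub p B n) → r = 0

theorem logSum_mapRP_apply {P : S.Cyc} (x : S.RP c.ι P) (m : ℕ) (g : P.1) :
    (logSum m (E.mapRP P x) : S.RP E.coef.ι P) g =
      ∑ i ∈ Finset.Icc 1 m, ((-1) ^ (i + 1) / (i : ℚ)) • E.j (((x - 1) ^ i) g) := by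
  rw [logSum, TwGrp.sum_apply]
  refine Finset.sum_congr rfl fun i _ => ?_
  rw [← map_one (E.mapRP P), ← map_sub, ← map_pow]
  rfl

variable {E}

theorem LogRing.Nice.hasLog_iff (hE : E.Nice) {P : S.Cyc} {x : S.RP c.ι P}
    {a : S.RP E.coef.ι P} : E.HasLog x a ↔ ∀ B : Subring R', B.toAddSubgroup ∈ E.lattices →
      ∀ hB : E.Good B, LogTo p (hB.sub P) (E.mapRP P x) a := by
  constructor
  · intro h B hBl hB e
    have := Fintype.ofFinite P.1
    choose K hK using fun g => (h g).mem_powSub E hBl e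
    refine ⟨∑ g, K g, fun m hm => hB.mem_powSub_sub.2 fun g => ?_⟩
    rw [TwGrp.sub_apply, logSum_mapRP_apply]
    exact hK g m ((Finset.single_le_sum (fun _ _ => Nat.zero_le _) (Finset.mem_univ g)).trans hm)
  · intro h g L hL n
    obtain ⟨B, rfl, hB⟩ := hE.good L hL
    obtain ⟨K, hK⟩ := h B hL hB n
    refine ⟨K, fun m hm => ?_⟩
    have := hB.mem_powSub_sub.1 (hK m hm) g
    rw [TwGrp.sub_apply, logSum_mapRP_apply] at this
    have h2 := neg_mem this
    rwa [neg_sub] at h2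

theorem LogRing.Nice.hasLog_unique (hE : E.Nice) {P : S.Cyc} {x : S.RP c.ι P}
    {a b : S.RP E.coef.ι P} (ha : E.HasLog x a) (hb : E.HasLog x b) : a = b := by
  ext g
  refine sub_eq_zero.1 (hE.separated _ fun B hB n => ?_)
  obtain ⟨K, hK⟩ := (ha g).mem_powSub E hB n
  obtain ⟨K', hK'⟩ := (hb g).mem_powSub E hB n
  have := sub_mem (hK' (K + K') (by omega)) (hK (K + K') (by omega))
  rwa [sub_sub_sub_cancel_left] at this

/-- At the generator `g` of `P = ⟨g⟩`, the value of `β_P(a)` is a nonzero rational multiple of the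
coefficient of `a` at the class of `g`. -/
theorem beta_injective {R : Type*} [CommRing R] [Algebra ℚ R] (ι : S.Z →* Rˣ) {a b : S.ConjMod R}
    (h : ∀ P : S.Cyc, S.beta ι P a = S.beta ι P b) : a = b := by
  have := Fintype.ofFinite S.G
  funext d
  induction d using Quotient.inductionOn with | h g => ?_
  let P : S.Cyc := ⟨Subgroup.zpowers g, inferInstance⟩
  let k : P.1 := ⟨g, Subgroup.mem_zpowers g⟩
  have hk : Subgroup.zpowers k = ⊤ := (zpowers_coe_eq P.1 k).2 rfl
  have e := congrArg (fun y : S.RP ι P => y k) (h P)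
  simp only [beta, eta_apply] at e
  rw [if_pos hk, if_pos hk] at e
  have e1 := S.tr_apply ι P a k
  have e2 := S.tr_apply ι P b k
  rw [e] at e1
  exact nsmul_cancel (centCard_pos g).ne' (e1.symm.trans e2)

/-- This is `beta_frobConj` in the shape produced by logarithms. A subgroup `P' ≠ P` with `P'^p = P`
is never trivial, so each contributes `p β_{P'}`; for `P = 1` the `φ` in `dAlpha` matches the
exceptional term. -/
theorem nsmul_beta_sub (P : S.Cyc) [Fintype (Cyc.Above P)] (ℓ : S.ConjMod R') :
    E.dAlpha P (S.tr E.coef.ι P ℓ) - ∑ P' : Cyc.Above P,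
      E.coef.ver P'.1 P (Coef.pow_mem_of_image_eq P'.2.1) (E.dAlpha P'.1 (S.tr E.coef.ι P'.1 ℓ)) =
      p • S.beta E.coef.ι P (ℓ - (1 / p : ℚ) • S.frobConj E.coef ℓ) := by
  have := Fintype.ofFinite S.G
  have hp : (p : ℚ) ≠ 0 := by exact_mod_cast (Fact.out : p.Prime).ne_zero
  have e1 : p • S.beta E.coef.ι P (ℓ - (1 / p : ℚ) • S.frobConj E.coef ℓ) =
      p • S.beta E.coef.ι P ℓ - S.beta E.coef.ι P (S.frobConj E.coef ℓ) := by
    refine (map_nsmul (betaHom E.coef.ι P) p _).symm.trans ?_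
    have : p • (ℓ - (1 / p : ℚ) • S.frobConj E.coef ℓ) = p • ℓ - S.frobConj E.coef ℓ := by
      rw [smul_sub, ← Nat.cast_smul_eq_nsmul ℚ p ((1 / p : ℚ) • _), smul_smul,
        mul_one_div_cancel hp, one_smul]
    rw [this, map_sub, map_nsmul]
    rfl
  have e2 : ∀ P' : Cyc.Above P, E.dAlpha P'.1 (S.tr E.coef.ι P'.1 ℓ) =
      p • S.beta E.coef.ι P'.1 ℓ := by
    intro P'
    rw [LogRing.dAlpha, if_neg]
    · rfl
    · intro h
      apply P'.2.2
      apply Subtype.ext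
      rw [h]
      apply SetLike.coe_injective
      rw [← P'.2.1, h]
      simp
  rw [e1, beta_frobConj, ← sub_sub]
  refine congrArg₂ _ ?_ (Finset.sum_congr rfl fun P' _ => ?_)
  · rw [LogRing.dAlpha]
    split_ifs with hP
    · rw [beta, eta_bot hP]
    · rw [sub_zero]; rfl
  · rw [e2, map_nsmul]

variable {B : Subring R'} (hB : E.Good B)
include hB

/-- The logarithm of `u_P` is the sum of the images under `ver` of the logarithms of the `α_{P'}`.
Cancelling it in `u_P ξ_P = α_P` leaves the left hand side of `nsmul_beta_sub`. -/
theorem LogRing.Good.logTo_xi (hR : ∀ r : R, (p : R) * r = 0 → r = 0)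
    (hφ : ∀ r, ∃ s, c.φ r = r ^ p + p * s) (ω : ∀ P : S.Cyc, P.1 →* Multiplicative (ZMod p))
    (hω : ∀ P : S.Cyc, P.1 ≠ ⊥ → ω P ≠ 1) (x : ∀ C : S.Cyc, (S.RP c.ι C)ˣ) {ℓ : S.ConjMod R'}
    (hx : ∀ C, TopUni p (hB.sub C) (E.mapRP C (x C)) ∧
      LogTo p (hB.sub C) (E.mapRP C (x C)) (S.tr E.coef.ι C ℓ)) (P : S.Cyc) :
    LogTo p (hB.sub P) (E.mapRP P (c.xi ω P x : S.RP c.ι P))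
      (p • S.beta E.coef.ι P (ℓ - (1 / p : ℚ) • S.frobConj E.coef ℓ)) := by
  have := Fintype.ofFinite (Cyc.Above P)
  rw [← nsmul_beta_sub]
  have hα := fun C => hB.logTo_alpha hR hφ (ω C) (hω C) (x C) _ (hx C).1 (hx C).2
  have hα' := fun C => hB.topUni_of_congr (alphaHom_congr c hR hφ (ω C) (x C))
  set y : ∀ C : S.Cyc, (S.RP c.ι C)ˣ := fun C => c.alphaHom (ω C) (x C) with hy
  have eu : E.mapRP P (c.uHom P y : S.RP c.ι P) = ∏ P' : Cyc.Above P,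
      E.coef.ver P'.1 P (Coef.pow_mem_of_image_eq P'.2.1)
        (E.mapRP P'.1 (y P'.1 : S.RP c.ι P'.1)) := by
    rw [uHom_apply, Units.coe_prod, map_prod]
    exact Finset.prod_congr rfl fun P' _ => mapRP_ver E _ _ _ _
  have hu := LogTo.prod (hB.pinv_sub P) Finset.univ (x := fun P' : Cyc.Above P =>
      E.coef.ver P'.1 P (Coef.pow_mem_of_image_eq P'.2.1) (E.mapRP P'.1 (y P'.1 : S.RP c.ι P'.1)))
    (fun P' _ => (hα' P'.1).map _ (hB.ver_mem _ _ _))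
    (fun P' _ => (hα P'.1).map _ (hB.ver_mem _ _ _))
  have hu' := TopUni.prod (p := p) (B := hB.sub P) Finset.univ (x := fun P' : Cyc.Above P =>
      E.coef.ver P'.1 P (Coef.pow_mem_of_image_eq P'.2.1) (E.mapRP P'.1 (y P'.1 : S.RP c.ι P'.1)))
    (fun P' _ => (hα' P'.1).map _ (hB.ver_mem _ _ _))
  rw [← eu] at hu hu'
  refine LogTo.of_mul (hB.pinv_sub P) hu' (hB.topUni_of_congr (xi_congr c hR hφ ω P x)) hu ?_
  rw [← map_mul, ← Units.val_mul]
  have : c.uHom P y * c.xi ω P x = y P := mul_div_cancel (c.uHom P y) (y P)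
  rw [this]
  exact hα P

end Log

section Formula

variable {R R' : Type*} [CommRing R] [CommRing R'] [Algebra ℚ R'] {c : S.Coef R}
  {E : LogRing c R'}

theorem alpha_div_u (hR : ∀ r : R, (p : R) * r = 0 → r = 0)
    (ω : ∀ P : S.Cyc, P.1 →* Multiplicative (ZMod p)) (x : ∀ C : S.Cyc, (S.RP c.ι C)ˣ)
    (P : S.Cyc) :
    c.alpha (ω P) (x P) / c.u (fun C => c.alpha (ω C) (x C)) P = c.xi ω P x := by
  have e : (fun C => c.alpha (ω C) (x C)) = fun C => c.alphaHom (ω C) (x C) :=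
    funext fun C => alpha_eq_alphaHom c hR (ω C) (x C)
  rw [e, alpha_eq_alphaHom c hR]
  rfl

variable (hE : E.Nice) (hR : ∀ r : R, (p : R) * r = 0 → r = 0)
  (hφ : ∀ r, ∃ s, c.φ r = r ^ p + p * s) (ω : ∀ P : S.Cyc, P.1 →* Multiplicative (ZMod p))
  (hω : ∀ P : S.Cyc, P.1 ≠ ⊥ → ω P ≠ 1)
include hE hR hφ hω

/-- The formula for an element of `K₁` of which a power is the class of a matrix with a
convergent logarithm. -/
theorem hasLog_xi_of_pow {A : Type*} [Ring A] (ε : A ≃+* S.RG c.ι) (x : K1 A) {m : ℕ} (hm : m ≠ 0)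
    {n : ℕ} (u : GL (Fin n) A) (hu : K1.mk u = x ^ m)
    (hN : ∀ B : Subring R', B.toAddSubgroup ∈ E.lattices → ∀ hB : E.Good B,
      ∃ N, ∀ i j, E.mapRG (((u.1.map ε - 1 : Matrix (Fin n) (Fin n) (S.RG c.ι)) ^ N) i j) ∈
        powSub p hB.subG 1)
    {ℓ : S.ConjMod R'} (hℓ : E.HasTrLog (u.1.map ε) (m • ℓ)) (P : S.Cyc) :
    E.HasLog (c.xi ω P (fun C => c.theta ε C x) : S.RP c.ι P)
      (p • S.beta E.coef.ι P (ℓ - (1 / p : ℚ) • S.frobConj E.coef ℓ)) := by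
  rw [hE.hasLog_iff]
  intro B hBl hB
  obtain ⟨N, hN⟩ := hN B hBl hB
  have h1 := hB.logTo_xi hR hφ ω hω (fun C => c.theta ε C (K1.mk u))
    (fun C => hB.logTo_theta hBl ε u N hN hℓ C) P
  -- `ξ_P` is multiplicative, so the formula for `x ^ m` is the `m`-fold of the formula for `x`. The
  -- congruence `ξ_P(x) ≡ 1` modulo `p` then permits dividing by `m`.
  have e1 : c.xi ω P (fun C => c.theta ε C (K1.mk u)) = c.xi ω P (fun C => c.theta ε C x) ^ m := by
    rw [← map_pow, hu]
    congr 1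
    funext C
    exact map_pow (c.theta ε C) x m
  have e2 : p • S.beta E.coef.ι P (m • ℓ - (1 / p : ℚ) • S.frobConj E.coef (m • ℓ)) =
      m • p • S.beta E.coef.ι P (ℓ - (1 / p : ℚ) • S.frobConj E.coef ℓ) := by
    rw [smul_comm m p]
    refine congrArg (p • ·) (Eq.trans ?_ (map_nsmul (betaHom E.coef.ι P) m _))
    have : S.frobConj E.coef (m • ℓ) = m • S.frobConj E.coef ℓ :=
      map_nsmul (frobConjHom E.coef) m ℓ
    rw [this, smul_comm _ m (S.frobConj E.coef ℓ), ← smul_sub]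
    rfl
  rw [e1, e2, Units.val_pow_eq_pow_val, map_pow] at h1
  exact LogTo.root (hB.pinv_sub P) hm (hB.topUni_of_congr (xi_congr c hR hφ ω P _)) h1

omit hR hφ hω in
/-- Elements of `R'[Conj(G)]^τ` are determined by the formula. -/
theorem eq_of_hasLog_xi {x : ∀ C : S.Cyc, (S.RP c.ι C)ˣ} {L L' : S.ConjMod R'}
    (h : ∀ P, E.HasLog (c.xi ω P x : S.RP c.ι P) (p • S.beta E.coef.ι P L))
    (h' : ∀ P, E.HasLog (c.xi ω P x : S.RP c.ι P) (p • S.beta E.coef.ι P L')) : L = L' := by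
  refine beta_injective E.coef.ι fun P => ?_
  have := hE.hasLog_unique (h P) (h' P)
  ext g
  exact nsmul_cancel (Fact.out : p.Prime).ne_zero
    (congrArg (fun y : S.RP E.coef.ι P => y g) this)

end Formula

end Setup

/-! ### Representatives in `K₁` and existence of logarithms -/

namespace Setup

variable {p : ℕ} [Fact p.Prime] {𝒢 : Type*} [Group 𝒢] [TopologicalSpace 𝒢] {S : Setup p 𝒢}

section KOne

variable {A : Type*} [Ring A]

theorem K1.exists_mk (x : K1 A) : ∃ (n : ℕ) (g : GL (Fin n) A), K1.mk g = x := by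
  induction x using QuotientGroup.induction_on with | H y => ?_
  induction y using DirectLimit.induction with | _ n g => ?_
  exact ⟨n, g, rfl⟩

theorem K1.mk_mul {n : ℕ} (g h : GL (Fin n) A) : K1.mk (g * h) = K1.mk g * K1.mk h := by
  rw [K1.mk, K1.mk, K1.mk, ← map_mul, DirectLimit.mul_def]

theorem K1.mk_pow {n : ℕ} (g : GL (Fin n) A) (m : ℕ) : K1.mk (g ^ m) = K1.mk g ^ m := by
  rw [K1.mk, K1.mk, ← map_pow, DirectLimit.npow_def]

end KOne

section Existence

variable {R R' : Type*} [CommRing R] [CommRing R'] [Algebra ℚ R'] {c : S.Coef R}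
variable {E : LogRing c R'}

/-- Convergence of the series whose terms tend to zero. -/
def LogRing.Complete (E : LogRing c R') : Prop :=
  ∀ s : ℕ → R', (∀ B : Subring R', B.toAddSubgroup ∈ E.lattices → ∀ n, ∃ N, ∀ m ≥ N,
    s (m + 1) - s m ∈ powSub p B n) → ∃ ℓ, E.TendsTo s ℓ

/-- The condition on a matrix which ensures the convergence of its logarithm. -/
def LogRing.MatNil (E : LogRing c R') {n : ℕ} (X : Matrix (Fin n) (Fin n) (S.RG c.ι)) : Prop :=
  ∀ B : Subring R', B.toAddSubgroup ∈ E.lattices → ∀ hB : E.Good B,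
    ∃ N, ∀ i j, E.mapRG ((X ^ N) i j) ∈ powSub p hB.subG 1

/-- The entries of `(x - 1) ^ i` are divisible by `p ^ (i / (N + 1))` in each lattice, which
outweighs the denominator `i`. -/
theorem LogRing.Nice.exists_hasTrLog (hE : E.Nice) (hc : E.Complete) {n : ℕ}
    {x : Matrix (Fin n) (Fin n) (S.RG c.ι)} (hx : E.MatNil (x - 1)) :
    ∃ ℓ, E.HasTrLog x ℓ := by
  have := Fintype.ofFinite S.G
  refine Classical.skolem.1 fun d => hc _ fun B hBl e => ?_
  obtain ⟨B, rfl, hB⟩ : ∃ B' : Subring R', B' = B ∧ E.Good B' := by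
    obtain ⟨B', h, hB'⟩ := hE.good _ hBl
    exact ⟨B', Subring.toAddSubgroup_injective h, hB'⟩
  obtain ⟨N, hN⟩ := hx B hBl hB
  obtain ⟨K, -, hK⟩ := exists_smul_mem hB.pinv N e
  refine ⟨K, fun m hm => ?_⟩
  rw [Finset.sum_Icc_succ_top (by omega), add_sub_cancel_left]
  refine hK (m + 1) (by omega) _ ?_
  have h1 : ∀ i j, E.mapRG (((x - 1) ^ (m + 1)) i j) ∈ powSub p hB.subG ((m + 1) / (N + 1)) := by
    intro i j
    have hM : ∀ k, (E.mapRG.mapMatrix (x - 1)) ^ k = E.mapRG.mapMatrix ((x - 1) ^ k) :=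
      fun k => (map_pow _ _ _).symm
    have := mem_pow_div_of_matrix (p := p) (B := hB.subG) (E.mapRG.mapMatrix (x - 1))
      (fun i j => fun _ => hB.j_mem _) (N + 1) (fun i j => by
        rw [pow_succ, hM]
        rw [Matrix.mul_apply]
        refine sum_mem fun k _ => ?_
        have := powSub_mul (p := p) (hN i k) (powSub_zero.2
          (show E.mapRG.mapMatrix (x - 1) k j ∈ hB.subG from fun _ => hB.j_mem _))
        simpa using this) (m + 1) i j
    rw [hM] at this
    exact this
  have h2 : E.mapRG (((x - 1) ^ (m + 1)).trace) ∈ powSub p hB.subG ((m + 1) / (N + 1)) := by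
    rw [Matrix.trace, map_sum]
    exact sum_mem fun i _ => h1 i i
  rw [← toConj_mapRG]
  rw [toConj, finsum_eq_sum_of_fintype]
  refine sum_mem fun g _ => ?_
  split_ifs
  · exact TwGrp.mem_powSub_coefSub.1 h2 g
  · exact zero_mem _

theorem LogRing.Nice.exists_hasLog (hE : E.Nice) (hc : E.Complete) {P : S.Cyc} {x : S.RP c.ι P}
    (hx : ∃ y, x = 1 + p * y) : ∃ a, E.HasLog x a := by
  refine Classical.skolem.1 fun g => hc _ fun B hBl e => ?_
  obtain ⟨B, rfl, hB⟩ : ∃ B' : Subring R', B' = B ∧ E.Good B' := by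
    obtain ⟨B', h, hB'⟩ := hE.good _ hBl
    exact ⟨B', Subring.toAddSubgroup_injective h, hB'⟩
  obtain ⟨y, hy⟩ := hx
  obtain ⟨K, -, hK⟩ := exists_smul_mem hB.pinv 0 e
  refine ⟨K, fun m hm => ?_⟩
  rw [Finset.sum_Icc_succ_top (by omega), add_sub_cancel_left]
  refine hK (m + 1) (by omega) _ ?_
  refine ⟨E.j ((y ^ (m + 1)) g), hB.j_mem _, ?_⟩
  rw [hy, add_sub_cancel_left, mul_pow, zero_add, Nat.div_one, ← Nat.cast_pow,
    TwGrp.natCast_mul_apply, map_mul, map_natCast, Nat.cast_pow]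

/-- The proposition for a ring `A ≅ R[G]^τ` with a suitable Jacobson radical. -/
theorem formula_of_jacobson (hE : E.Nice) (hc : E.Complete)
    (hR : ∀ r : R, (p : R) * r = 0 → r = 0)
    (hφ : ∀ r, ∃ s, c.φ r = r ^ p + p * s) (ω : ∀ P : S.Cyc, P.1 →* Multiplicative (ZMod p))
    (hω : ∀ P : S.Cyc, P.1 ≠ ⊥ → ω P ≠ 1) {A : Type*} [Ring A] (ε : A ≃+* S.RG c.ι)
    (hjac : ∀ {n : ℕ} (u : GL (Fin n) A), (∀ i j, (u.1 - 1) i j ∈ Ring.jacobson A) →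
      E.MatNil (u.1.map ε - 1))
    (hpow : ∀ {n : ℕ} (u : GL (Fin n) A), ∃ m : ℕ, 0 < m ∧
      ∀ i j, ((u ^ m).1 - 1) i j ∈ Ring.jacobson A) (x : K1 A) :
    (∃! L, E.IsIntegralLog ε x L) ∧ ∀ L, E.IsIntegralLog ε x L → ∀ P : S.Cyc,
      E.HasLog (c.alpha (ω P) (c.theta ε P x) / c.u (fun C => c.alpha (ω C) (c.theta ε C x)) P :
        (S.RP c.ι P)ˣ).val (p • S.beta E.coef.ι P L) := by
  have key : ∀ L, E.IsIntegralLog ε x L → ∀ P : S.Cyc,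
      E.HasLog (c.xi ω P (fun C => c.theta ε C x) : S.RP c.ι P)
        (p • S.beta E.coef.ι P L) := by
    rintro _ ⟨ℓ, ⟨m, hm, n, u, hu, hux, hℓ⟩, rfl⟩ P
    exact hasLog_xi_of_pow hE hR hφ ω hω ε x hm.ne' u hux (hjac u hu) hℓ P
  refine ⟨?_, fun L hL P => ?_⟩
  · obtain ⟨L, hL⟩ : ∃ L, E.IsIntegralLog ε x L := by
      obtain ⟨n, g, rfl⟩ := K1.exists_mk x
      obtain ⟨m, hm, hgm⟩ := hpow g
      obtain ⟨ℓ, hℓ⟩ := hE.exists_hasTrLog hc (hjac _ hgm)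
      -- The logarithm being a homomorphism, `log x` can only be `log (x ^ m) / m`.
      refine ⟨_, (1 / m : ℚ) • ℓ, ⟨m, hm, n, g ^ m, hgm, K1.mk_pow g m, ?_⟩, rfl⟩
      have : m • ((1 / m : ℚ) • ℓ) = ℓ := by
        rw [← Nat.cast_smul_eq_nsmul ℚ, smul_smul,
          mul_one_div_cancel (by exact_mod_cast hm.ne'), one_smul]
      rw [this]
      exact hℓ
    -- Independence of the choices of `m` and of the matrix is read off from the formula itself.
    exact ⟨L, hL, fun L' hL' => eq_of_hasLog_xi hE ω (key L' hL') (key L hL)⟩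
  · have e := alpha_div_u (c := c) hR ω (fun C => c.theta ε C x) P
    rw [e]
    exact key L hL P

end Existence

end Setup

/-! ### Nilpotency of augmentation ideals of finite `p`-groups in characteristic `p` -/

section Nilpotent

variable {p : ℕ} [Fact p.Prime] {H : Type*} [Group H] [Finite H]

/-- On a simple module, which is finite of order divisible by `p`, the `p`-group `H` fixes a nonzero
vector besides zero. The fixed vectors form a submodule, hence `H` acts trivially, and `h - 1` lies
in every maximal left ideal. -/
theorem of_sub_one_mem_jacobson (hH : IsPGroup p H) (h : H) :
    MonoidAlgebra.of (ZMod p) H h - 1 ∈ Ring.jacobson (MonoidAlgebra (ZMod p) H) := by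
  rw [Ring.jacobson_eq_sInf_isMaximal, Submodule.mem_sInf]
  intro I hI
  let A := MonoidAlgebra (ZMod p) H
  have hfin : Finite A := Module.finite_of_finite (ZMod p)
  have hs : IsSimpleModule A (A ⧸ I) := isSimpleModule_iff_isCoatom.2 hI.out.out
  let _ : MulAction H (A ⧸ I) := MulAction.compHom _ (MonoidAlgebra.of (ZMod p) H)
  have hsmul : ∀ (h : H) (w : A ⧸ I), h • w = MonoidAlgebra.of (ZMod p) H h • w := fun _ _ => rfl
  let N : Submodule A (A ⧸ I) :=
    { carrier := MulAction.fixedPoints H (A ⧸ I)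
      add_mem' := fun {a b} ha hb h => by
        rw [hsmul, smul_add, ← hsmul, ← hsmul, ha h, hb h]
      zero_mem' := fun h => by rw [hsmul, smul_zero]
      smul_mem' := fun s w hw => by
        induction s using MonoidAlgebra.induction_linear with
        | zero => intro h; rw [zero_smul, hsmul, smul_zero]
        | add a b ha hb =>
          intro h
          rw [add_smul, hsmul, smul_add, ← hsmul, ← hsmul, ha h, hb h]
        | single k r =>
          have key : ∀ k : H, (MonoidAlgebra.single k r : A) • w =
              (MonoidAlgebra.single 1 r : A) • w := by
            intro k
            have : (MonoidAlgebra.single k r : A) =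
                MonoidAlgebra.single 1 r * MonoidAlgebra.of (ZMod p) H k := by
              rw [MonoidAlgebra.of_apply, MonoidAlgebra.single_mul_single, one_mul, mul_one]
            rw [this, mul_smul, ← hsmul, hw k]
          intro h
          rw [hsmul, ← mul_smul, MonoidAlgebra.of_apply, MonoidAlgebra.single_mul_single, one_mul,
            key, key k] }
  have hne : Nontrivial (A ⧸ I) := IsSimpleModule.nontrivial A _
  obtain ⟨w, hw⟩ := exists_ne (0 : A ⧸ I)
  have hcard : p ∣ Nat.card (A ⧸ I) := by
    have hw' : addOrderOf w = p := by
      refine addOrderOf_eq_prime ?_ hw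
      rw [← Nat.cast_smul_eq_nsmul A, ← map_natCast (algebraMap (ZMod p) A), ZMod.natCast_self,
        map_zero, zero_smul]
    exact hw'.symm.dvd.trans (addOrderOf_dvd_natCard w)
  have hfin' : Finite (A ⧸ I) := Finite.of_surjective _ (Submodule.Quotient.mk_surjective I)
  obtain ⟨v, hv, hv0⟩ := hH.exists_fixed_point_of_prime_dvd_card_of_fixed_point (A ⧸ I) hcard
    (a := 0) (fun h => by rw [hsmul, smul_zero])
  have htop : N = ⊤ := by
    refine (eq_bot_or_eq_top N).resolve_left fun hb => hv0 ?_
    exact ((Submodule.mem_bot A).1 (hb ▸ (show v ∈ N from hv))).symm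
  have h1 : (Submodule.Quotient.mk (1 : A) : A ⧸ I) ∈ N := htop ▸ Submodule.mem_top
  have h2 := h1 h
  rw [hsmul, ← Submodule.Quotient.mk_smul, smul_eq_mul, mul_one, Submodule.Quotient.eq] at h2
  exact h2

theorem span_pow_le {k A : Type*} [CommRing k] [Ring A] [Algebra k A] (Y : Submodule k A)
    (I : Ideal A) (h : ∀ y ∈ Y, y ∈ I) (m : ℕ) : ∀ y ∈ Y ^ m, y ∈ I ^ m := by
  induction m with
  | zero =>
    intro x _
    rw [Submodule.pow_zero, Ideal.one_eq_top]
    exact Submodule.mem_top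
  | succ m ih =>
    intro x hx
    rw [pow_succ] at hx
    rw [Submodule.pow_succ]
    induction hx using Submodule.mul_induction_on' with
    | mem_mul_mem x hx y hy => exact Ideal.mul_mem_mul (ih x hx) (h y hy)
    | add x _ y _ hx hy => exact add_mem hx hy

theorem exists_span_pow_eq_bot (hH : IsPGroup p H) : ∃ N : ℕ, Submodule.span (ZMod p)
    (Set.range fun h : H => MonoidAlgebra.of (ZMod p) H h - 1) ^ N = ⊥ := by
  have hfin : Finite (MonoidAlgebra (ZMod p) H) := Module.finite_of_finite (ZMod p)
  obtain ⟨N, hN⟩ := IsSemiprimaryRing.isNilpotent (R := MonoidAlgebra (ZMod p) H)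
  refine ⟨N, le_bot_iff.1 fun x hx => ?_⟩
  have := span_pow_le _ (Ring.jacobson (MonoidAlgebra (ZMod p) H)) (fun y hy => ?_) N x hx
  · rw [hN] at this
    exact this
  · have hle : Submodule.span (ZMod p)
        (Set.range fun h : H => MonoidAlgebra.of (ZMod p) H h - 1) ≤
        (Ring.jacobson (MonoidAlgebra (ZMod p) H)).restrictScalars (ZMod p) := by
      rw [Submodule.span_le]
      rintro _ ⟨h, rfl⟩
      exact of_sub_one_mem_jacobson hH h
    exact hle hy

variable {A : Type*} [Ring A] [Algebra (ZMod p) A]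

/-- The left ideal generated by the `f(h) - 1`. -/
def augSub (f : H →* A) : Submodule (ZMod p) A :=
  ⊤ * Submodule.span (ZMod p) (Set.range fun h => f h - 1)

theorem mul_sub_one_mem_augSub (f : H →* A) (a : A) (h : H) :
    a * (f h - 1) ∈ augSub (p := p) f :=
  Submodule.mul_mem_mul Submodule.mem_top (Submodule.subset_span ⟨h, rfl⟩)

/-- Let `X` be the span of the `f h - 1`. By `hf`, `X A ⊆ A X`, so all factors from `A` can be
collected on the left and `(A X) ^ k ⊆ A X ^ k`. The nilpotency of `X` is inherited from the group
algebra `𝔽_p[H]`, where the radical is nilpotent. -/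
theorem exists_augSub_pow (hH : IsPGroup p H) (f : H →* A)
    (hf : ∀ h a, (f h - 1) * a ∈ augSub (p := p) f) : ∃ N : ℕ, augSub (p := p) f ^ N = ⊥ := by
  obtain ⟨N, hN⟩ := exists_span_pow_eq_bot hH
  set X := Submodule.span (ZMod p) (Set.range fun h => f h - 1) with hX
  have hXN : X ^ N = ⊥ := by
    have : X = (Submodule.span (ZMod p) (Set.range fun h : H =>
        MonoidAlgebra.of (ZMod p) H h - 1)).map (MonoidAlgebra.lift (ZMod p) A H f).toLinearMap := by
      rw [hX, Submodule.map_span, ← Set.range_comp]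
      congr 2
      funext h
      simp
    rw [this, ← Submodule.map_pow, hN, Submodule.map_bot]
  have h1 : X * ⊤ ≤ ⊤ * X := by
    rw [Submodule.mul_le]
    intro x hx a _
    induction hx using Submodule.span_induction with
    | mem x hx => obtain ⟨h, rfl⟩ := hx; exact hf h a
    | zero => rw [zero_mul]; exact zero_mem _
    | add x y _ _ hx hy => rw [add_mul]; exact add_mem hx hy
    | smul r x _ hx => rw [smul_mul_assoc]; exact Submodule.smul_mem _ _ hx
  have h2 : ∀ k : ℕ, X ^ k * ⊤ ≤ ⊤ * X ^ k := by
    intro k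
    induction k with
    | zero => rw [pow_zero, one_mul, mul_one]
    | succ k ih =>
      calc X ^ (k + 1) * ⊤ = X ^ k * (X * ⊤) := by rw [pow_succ, mul_assoc]
        _ ≤ X ^ k * (⊤ * X) := mul_le_mul_right h1 _
        _ = X ^ k * ⊤ * X := (mul_assoc _ _ _).symm
        _ ≤ ⊤ * X ^ k * X := mul_le_mul_left ih _
        _ = ⊤ * X ^ (k + 1) := by rw [mul_assoc, ← pow_succ]
  have h3 : ∀ k : ℕ, (⊤ * X) ^ k ≤ ⊤ * X ^ k := by
    intro k
    induction k with
    | zero => rw [pow_zero, pow_zero, mul_one]; exact le_top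
    | succ k ih =>
      calc (⊤ * X) ^ (k + 1) = (⊤ * X) ^ k * (⊤ * X) := pow_succ _ _
        _ ≤ ⊤ * X ^ k * (⊤ * X) := mul_le_mul_left ih _
        _ = ⊤ * (X ^ k * ⊤) * X := by simp only [mul_assoc]
        _ ≤ ⊤ * (⊤ * X ^ k) * X := mul_le_mul_left (mul_le_mul_right (h2 k) _) _
        _ = (⊤ * ⊤) * X ^ (k + 1) := by rw [pow_succ]; simp only [mul_assoc]
        _ ≤ ⊤ * X ^ (k + 1) := mul_le_mul_left le_top _
  refine ⟨N, le_bot_iff.1 ((h3 N).trans ?_)⟩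
  rw [hXN, Submodule.mul_bot]

theorem matrix_pow_mem (I : Submodule (ZMod p) A) {n : ℕ} (M : Matrix (Fin n) (Fin n) A)
    (hM : ∀ i j, M i j ∈ I) (k : ℕ) (i j : Fin n) : (M ^ k) i j ∈ I ^ k := by
  induction k generalizing i j with
  | zero =>
    rw [pow_zero, pow_zero, Matrix.one_apply]
    split_ifs
    · exact Submodule.one_le.1 le_rfl
    · exact zero_mem _
  | succ k ih =>
    rw [pow_succ, pow_succ, Matrix.mul_apply]
    exact sum_mem fun l _ => Submodule.mul_mem_mul (ih i l) (hM l j)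

/-- Matrices with entries in the augmentation ideal are nilpotent. -/
theorem exists_matrix_pow_eq_zero (hH : IsPGroup p H) (f : H →* A)
    (hf : ∀ h a, (f h - 1) * a ∈ augSub (p := p) f) : ∃ N : ℕ, ∀ {n : ℕ}
      (M : Matrix (Fin n) (Fin n) A), (∀ i j, M i j ∈ augSub (p := p) f) → M ^ N = 0 := by
  obtain ⟨N, hN⟩ := exists_augSub_pow hH f hf
  refine ⟨N, fun M hM => ?_⟩
  ext i j
  have := matrix_pow_mem _ M hM N i j
  rw [hN] at this
  exact this

end Nilpotent

/-! ### `p`-adically complete rings -/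

section PComplete

/-- A ring without `p`-torsion which is separated and complete for the `p`-adic topology. -/
structure PComplete (p : ℕ) (A : Type*) [Ring A] : Prop where
  torsionFree : ∀ r : A, (p : A) * r = 0 → r = 0
  separated : ∀ r : A, (∀ n, (p : A) ^ n ∣ r) → r = 0
  lim : ∀ s : ℕ → A, (∀ n, ∃ N, ∀ m ≥ N, (p : A) ^ n ∣ s (m + 1) - s m) →
    ∃ r, ∀ n, ∃ N, ∀ m ≥ N, (p : A) ^ n ∣ s m - r

theorem natCast_pow_dvd_mul {A : Type*} [Ring A] {p n : ℕ} {b : A} (a : A) (h : (p : A) ^ n ∣ b) :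
    (p : A) ^ n ∣ a * b := by
  obtain ⟨c, rfl⟩ := h
  refine ⟨a * c, ?_⟩
  rw [← mul_assoc, ← mul_assoc, ((Nat.cast_commute p a).pow_left n).eq]

section

variable {p : ℕ} {A : Type*} [Ring A]

theorem dvd_sub_of_le {d : A} {s : ℕ → A} {N : ℕ} (h : ∀ m ≥ N, d ∣ s (m + 1) - s m) {m m' : ℕ}
    (hm : N ≤ m) (hmm' : m ≤ m') : d ∣ s m' - s m := by
  induction m', hmm' using Nat.le_induction with
  | base => simp
  | succ k hk ih =>
    have := dvd_add (h k (hm.trans hk)) ih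
    rwa [sub_add_sub_cancel] at this

theorem mem_span_pow_smul_top {B M : Type*} [CommRing B] [AddCommGroup M] [Module B M] {n : ℕ}
    {x : M} : x ∈ (Ideal.span {(p : B)} ^ n • ⊤ : Submodule B M) ↔ ∃ y : M, x = p ^ n • y := by
  rw [Ideal.span_singleton_pow, Submodule.ideal_span_singleton_smul,
    Submodule.mem_smul_pointwise_iff_exists]
  refine exists_congr fun y => ?_
  rw [and_iff_right Submodule.mem_top, ← Nat.cast_smul_eq_nsmul B, Nat.cast_pow]
  exact eq_comm

theorem PComplete.of_isAdicComplete {B : Type*} [CommRing B] [Algebra B A]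
    (h : IsAdicComplete (Ideal.span {(p : B)}) A) (hA : ∀ r : A, (p : A) * r = 0 → r = 0) :
    PComplete p A := by
  have hmem : ∀ (n : ℕ) (x : A), x ∈ (Ideal.span {(p : B)} ^ n • ⊤ : Submodule B A) ↔
      (p : A) ^ n ∣ x := by
    intro n x
    rw [mem_span_pow_smul_top]
    refine exists_congr fun y => ?_
    rw [nsmul_eq_mul, Nat.cast_pow]
  refine ⟨hA, fun r hr => ?_, fun s hs => ?_⟩
  · refine h.haus' r fun n => ?_
    rw [SModEq.zero, hmem]
    exact hr n
  · choose N hN using hs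
    -- Thresholds made monotone, so that the subsequence `s ∘ N'` is Cauchy with the index itself as
    -- precision.
    let N' : ℕ → ℕ := fun n => ∑ k ∈ Finset.range (n + 1), N k
    have h1 : ∀ n, N n ≤ N' n := fun n =>
      Finset.single_le_sum (fun _ _ => Nat.zero_le _) (Finset.self_mem_range_succ n)
    have h2 : Monotone N' := fun a b hab => Finset.sum_le_sum_of_subset fun k hk => by
      rw [Finset.mem_range] at hk ⊢; omega
    obtain ⟨r, hr⟩ := h.prec' (fun n => s (N' n)) (by
      intro m n hmn
      rw [← SModEq.comm, SModEq.sub_mem, hmem]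
      exact dvd_sub_of_le (hN m) (h1 m) (h2 hmn))
    refine ⟨r, fun n => ⟨N' n, fun m hm => ?_⟩⟩
    have e1 := hr n
    rw [SModEq.sub_mem, hmem] at e1
    have := dvd_add (dvd_sub_of_le (hN n) (h1 n) hm) e1
    rwa [sub_add_sub_cancel] at this

theorem PComplete.of_basis {A O ι : Type*} [CommRing A] [Ring O] [Algebra A O] [Finite ι]
    (b : Module.Basis ι A O) (h : PComplete p A) : PComplete p O := by
  have := Fintype.ofFinite ι
  have hmul : ∀ (n : ℕ) (x : O) (i : ι), b.repr ((p : O) ^ n * x) i = (p : A) ^ n * b.repr x i := by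
    intro n x i
    have : (p : O) ^ n * x = ((p : A) ^ n) • x := by
      rw [Algebra.smul_def, map_pow, map_natCast]
    rw [this, map_smul]
    rfl
  have hdvd : ∀ (n : ℕ) (x : O), (p : O) ^ n ∣ x ↔ ∀ i, (p : A) ^ n ∣ b.repr x i := by
    intro n x
    constructor
    · rintro ⟨y, rfl⟩ i
      rw [hmul]
      exact dvd_mul_right _ _
    · intro hx
      choose y hy using hx
      refine ⟨∑ i, y i • b i, b.repr.injective (Finsupp.ext fun i => ?_)⟩
      rw [hmul, hy, b.repr_sum_self]
  refine ⟨fun r hr => ?_, fun r hr => ?_, fun s hs => ?_⟩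
  · refine b.repr.injective (Finsupp.ext fun i => ?_)
    rw [map_zero]
    refine h.torsionFree _ ?_
    have := hmul 1 r i
    rw [pow_one, hr, map_zero, pow_one] at this
    exact this.symm
  · refine b.repr.injective (Finsupp.ext fun i => ?_)
    rw [map_zero]
    exact h.separated _ fun n => (hdvd n r).1 (hr n) i
  · have h1 : ∀ i, ∃ r, ∀ n, ∃ N, ∀ m ≥ N, (p : A) ^ n ∣ b.repr (s m) i - r := by
      intro i
      refine h.lim (fun m => b.repr (s m) i) fun n => ?_
      obtain ⟨N, hN⟩ := hs n
      refine ⟨N, fun m hm => ?_⟩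
      have := (hdvd n _).1 (hN m hm) i
      rwa [map_sub] at this
    choose r hr using h1
    refine ⟨∑ i, r i • b i, fun n => ?_⟩
    choose N hN using fun i => hr i n
    refine ⟨∑ i, N i, fun m hm => (hdvd n _).2 fun i => ?_⟩
    rw [map_sub, Finsupp.sub_apply, b.repr_sum_self]
    exact hN i m ((Finset.single_le_sum (fun _ _ => Nat.zero_le _) (Finset.mem_univ i)).trans hm)

/-- The inverse is the limit of the geometric series; it is checked on both sides because `A` need
not be commutative. -/
theorem PComplete.isUnit_one_add (h : PComplete p A) (x : A) : IsUnit (1 + p * x) := by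
  obtain ⟨r, hr⟩ := h.lim (fun m => ∑ i ∈ Finset.range m, (-(p * x)) ^ i) fun n =>
    ⟨n, fun m hm => by
      rw [Finset.sum_range_succ, add_sub_cancel_left, neg_pow, (Nat.cast_commute p x).mul_pow]
      exact natCast_pow_dvd_mul _ ((pow_dvd_pow _ hm).mul_right _)⟩
  have h3 : ∀ N n : ℕ, (p : A) ^ n ∣ (-(p * x)) ^ (N + n) := by
    intro N n
    rw [neg_pow, (Nat.cast_commute p x).mul_pow]
    exact natCast_pow_dvd_mul _ ((pow_dvd_pow _ (by omega)).mul_right _)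
  have e1 : (1 + p * x) * r = 1 := sub_eq_zero.1 (h.separated _ fun n => by
    obtain ⟨N, hN⟩ := hr n
    have h1 := natCast_pow_dvd_mul (1 + p * x) (hN (N + n) (by omega))
    have h2 := mul_neg_geom_sum (-(p * x)) (N + n)
    have e : (1 + p * x) * r - 1 =
        -((1 + p * x) * (∑ i ∈ Finset.range (N + n), (-(p * x)) ^ i - r))
        - (-(p * x)) ^ (N + n) := by
      rw [sub_neg_eq_add] at h2
      rw [mul_sub, h2]
      abel
    rw [e]
    exact dvd_sub ((dvd_neg).2 h1) (h3 N n))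
  have e2 : r * (1 + p * x) = 1 := sub_eq_zero.1 (h.separated _ fun n => by
    obtain ⟨N, hN⟩ := hr n
    have h1 := (hN (N + n) (by omega)).mul_right (1 + p * x)
    have h2 := geom_sum_mul_neg (-(p * x)) (N + n)
    have e : r * (1 + p * x) - 1 =
        -((∑ i ∈ Finset.range (N + n), (-(p * x)) ^ i - r) * (1 + p * x))
        - (-(p * x)) ^ (N + n) := by
      rw [sub_neg_eq_add] at h2
      rw [sub_mul, h2]
      abel
    rw [e]
    exact dvd_sub ((dvd_neg).2 h1) (h3 N n))
  exact ⟨⟨_, r, e1, e2⟩, rfl⟩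

end

section

variable {p : ℕ} {A : Type*} [CommRing A]

/-- Bézout gives a multiple of `m` of the form `1 + p x`. -/
theorem PComplete.isUnit_natCast (h : PComplete p A) {m : ℕ} (hm : p.Coprime m) :
    IsUnit (m : A) := by
  have e := Nat.isCoprime_iff_coprime.2 hm
  obtain ⟨a, b, hab⟩ := e
  have h1 : (b : A) * m = 1 + p * (-a : A) := by
    have := congrArg (Int.cast : ℤ → A) hab
    push_cast at this
    linear_combination this
  exact isUnit_of_mul_isUnit_right (h1 ▸ h.isUnit_one_add _)

theorem PComplete.pInv {K : Type*} [CommRing K] {i : A →+* K} [Algebra ℚ K] (h : PComplete p A) : PInv p i.range := by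
  intro m hm
  obtain ⟨u, hu⟩ := h.isUnit_natCast hm
  refine ⟨(↑u⁻¹ : A), ?_⟩
  -- In this case `0` is a unit of `A`, so `K` is the zero ring.
  by_cases hm0 : m = 0
  · subst hm0
    have h0 : (0 : K) = 1 := by
      have := congrArg i (u.mul_inv)
      rw [hu, Nat.cast_zero, zero_mul, map_zero, map_one] at this
      exact this
    exact eq_of_zero_eq_one h0 _ _
  · have h1 : algebraMap ℚ K (1 / m) * m = 1 := by
      rw [← map_natCast (algebraMap ℚ K), ← map_mul, one_div_mul_cancel (by exact_mod_cast hm0),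
        map_one]
    have h2 : (m : K) * i (↑u⁻¹ : A) = 1 := by
      rw [← map_natCast i, ← hu, ← map_mul, u.mul_inv, map_one]
    calc i (↑u⁻¹ : A) = algebraMap ℚ K (1 / m) * m * i (↑u⁻¹ : A) := by rw [h1, one_mul]
      _ = _ := by rw [mul_assoc, h2, mul_one]

end

section

variable {p : ℕ} {A K : Type*} [Ring A] [Ring K] {i : A →+* K}

theorem mem_powSub_range {n : ℕ} {x : K} : x ∈ powSub p i.range n ↔ ∃ a, x = i (p ^ n * a) := by
  constructor
  · rintro ⟨_, ⟨a, rfl⟩, rfl⟩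
    exact ⟨a, by simp⟩
  · rintro ⟨a, rfl⟩
    exact ⟨i a, ⟨a, rfl⟩, by simp⟩

theorem PComplete.range_separated (h : PComplete p A) (hi : Function.Injective i) {x : K}
    (hx : ∀ n, x ∈ powSub p i.range n) : x = 0 := by
  obtain ⟨a, rfl⟩ := powSub_le (hx 0)
  rw [h.separated a fun n => ?_, map_zero]
  obtain ⟨b, hb⟩ := mem_powSub_range.1 (hx n)
  exact ⟨b, hi hb⟩

/-- From some index `N₀` on the increments lie in the image of `A`, so `s - s N₀` is there the image
of a sequence in `A` and converges by completeness. -/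
theorem PComplete.range_lim (h : PComplete p A) (hi : Function.Injective i) (s : ℕ → K)
    (hs : ∀ n, ∃ N, ∀ m ≥ N, s (m + 1) - s m ∈ powSub p i.range n) :
    ∃ ℓ, ∀ n, ∃ N, ∀ m ≥ N, s m - ℓ ∈ powSub p i.range n := by
  obtain ⟨N₀, hN₀⟩ := hs 0
  have h1 : ∀ m, ∃ a, i a = s (N₀ + m) - s N₀ := by
    intro m
    induction m with
    | zero => exact ⟨0, by simp⟩
    | succ m ih =>
      obtain ⟨a, ha⟩ := ih
      obtain ⟨b, hb⟩ := powSub_le (hN₀ (N₀ + m) (by omega))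
      refine ⟨b + a, ?_⟩
      rw [map_add, ha, hb, sub_add_sub_cancel]
      rfl
  choose t ht using h1
  obtain ⟨r, hr⟩ := h.lim t fun n => by
    obtain ⟨N, hN⟩ := hs n
    refine ⟨N, fun m hm => ?_⟩
    obtain ⟨a, ha⟩ := mem_powSub_range.1 (hN (N₀ + m) (by omega))
    refine ⟨a, hi ?_⟩
    rw [← ha, map_sub, ht, ht, sub_sub_sub_cancel_right]
    rfl
  refine ⟨s N₀ + i r, fun n => ?_⟩
  obtain ⟨N, hN⟩ := hr n
  refine ⟨N₀ + N, fun m hm => ?_⟩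
  obtain ⟨k, rfl⟩ : ∃ k, m = N₀ + k := ⟨m - N₀, by omega⟩
  obtain ⟨a, ha⟩ := hN k (by omega)
  refine mem_powSub_range.2 ⟨a, ?_⟩
  rw [← ha, map_sub, ht, sub_sub]

end

end PComplete

/-! ### The ring of integers of `K`: completeness and finite residue ring -/

section IntRing

variable (p : ℕ) [Fact p.Prime] (K : Type*) [Field K] [CharZero K] [Algebra ℚ_[p] K]
  [FiniteDimensional ℚ_[p] K] [Algebra ℤ_[p] K] [IsScalarTower ℤ_[p] ℚ_[p] K]

theorem pComplete_padicInt : PComplete p ℤ_[p] := by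
  have h : IsAdicComplete (IsLocalRing.maximalIdeal ℤ_[p]) ℤ_[p] := inferInstance
  rw [PadicInt.maximalIdeal_eq_span_p] at h
  refine PComplete.of_isAdicComplete h fun r hr => (mul_eq_zero.1 hr).resolve_left ?_
  exact_mod_cast (Fact.out : p.Prime).ne_zero

theorem exists_basis_intRing :
    ∃ (n : ℕ), Nonempty (Module.Basis (Fin n) ℤ_[p] (IntRing p K)) := by
  have h1 : Module.Finite ℤ_[p] (IntRing p K) :=
    IsIntegralClosure.finite ℤ_[p] ℚ_[p] K (IntRing p K)
  have h2 : Module.IsTorsionFree ℤ_[p] (IntRing p K) := by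
    rw [Module.isTorsionFree_iff_algebraMap_injective]
    have h3 : Function.Injective (algebraMap ℤ_[p] K) := by
      rw [IsScalarTower.algebraMap_eq ℤ_[p] ℚ_[p] K]
      exact (algebraMap ℚ_[p] K).injective.comp (IsFractionRing.injective ℤ_[p] ℚ_[p])
    intro a b hab
    exact h3 (congrArg (algebraMap (IntRing p K) K) hab)
  have h4 : Module.Free ℤ_[p] (IntRing p K) := inferInstance
  exact ⟨_, ⟨Module.finBasis ℤ_[p] (IntRing p K)⟩⟩

theorem pComplete_intRing : PComplete p (IntRing p K) := by
  obtain ⟨n, ⟨b⟩⟩ := exists_basis_intRing p K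
  exact PComplete.of_basis b (pComplete_padicInt p)

theorem finite_intRing_quotient :
    Finite (IntRing p K ⧸ Ideal.span {(p : IntRing p K)}) := by
  obtain ⟨n, ⟨b⟩⟩ := exists_basis_intRing p K
  refine Finite.of_surjective (fun c : Fin n → Fin p => Ideal.Quotient.mk
    (Ideal.span {(p : IntRing p K)}) (∑ i, ((c i : ℕ) : ℤ_[p]) • b i)) fun x => ?_
  obtain ⟨x, rfl⟩ := Ideal.Quotient.mk_surjective x
  have h : ∀ i, ∃ c : Fin p, ∃ d : ℤ_[p], ((c : ℕ) : ℤ_[p]) - b.repr x i = p * d := by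
    intro i
    refine ⟨⟨(PadicInt.toZMod (b.repr x i)).val, ZMod.val_lt _⟩, ?_⟩
    have : (((PadicInt.toZMod (b.repr x i)).val : ℕ) : ℤ_[p]) - b.repr x i ∈
        RingHom.ker (PadicInt.toZMod (p := p)) := by
      rw [RingHom.mem_ker, map_sub, map_natCast, ZMod.natCast_zmod_val, sub_self]
    rw [PadicInt.ker_toZMod, PadicInt.maximalIdeal_eq_span_p, Ideal.mem_span_singleton] at this
    exact this
  choose c d hd using h
  refine ⟨c, ?_⟩
  dsimp only
  rw [Ideal.Quotient.eq, Ideal.mem_span_singleton]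
  refine ⟨∑ i, d i • b i, ?_⟩
  conv_lhs => rw [← b.sum_repr x]
  rw [← Finset.sum_sub_distrib, Finset.mul_sum]
  refine Finset.sum_congr rfl fun i _ => ?_
  rw [← sub_smul, hd, Algebra.smul_def, map_mul, map_natCast, mul_assoc, ← Algebra.smul_def]

end IntRing

theorem PComplete.monoidAlgebra {p : ℕ} {O M : Type*} [CommRing O] [Monoid M] [Finite M]
    (h : PComplete p O) : PComplete p (MonoidAlgebra O M) :=
  PComplete.of_basis (MonoidAlgebra.basis M O) h

/-! ### Lattices, completeness and the Frobenius congruence for Iwasawa algebras of `Γ^(p^e)` -/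

namespace Iw

variable {O K 𝒢 : Type*} [CommRing O] [CommRing K] [Group 𝒢] [TopologicalSpace 𝒢]

theorem proj_const (a : O) (U : OpenNormalSubgroup 𝒢) :
    proj U (const O 𝒢 a) = MonoidAlgebra.single 1 a := rfl

theorem natCast_cancel {M : Type*} [Monoid M] [Algebra ℚ K] {p n : ℕ} (hp : p ≠ 0)
    {x y : MonoidAlgebra K M} (h : (p : MonoidAlgebra K M) ^ n * x = p ^ n * y) : x = y := by
  have h1 : ∀ z : MonoidAlgebra K M,
      (algebraMap ℚ (MonoidAlgebra K M) (1 / p ^ n)) * (p ^ n * z) = z := by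
    intro z
    rw [← mul_assoc, ← map_natCast (algebraMap ℚ (MonoidAlgebra K M)), ← map_pow, ← map_mul,
      one_div_mul_cancel (by positivity), map_one, one_mul]
  rw [← h1 x, h, h1]

theorem exists_proj_mul [IsMulCommutative 𝒢] [Algebra ℚ K] {p n : ℕ} (hp : p ≠ 0) (x : Iw K 𝒢) :
    ∃ y : Iw K 𝒢, x = p ^ n * y := by
  refine ⟨algebraMap ℚ _ (1 / p ^ n) * x, ?_⟩
  rw [← mul_assoc, ← map_natCast (algebraMap ℚ (Iw K 𝒢)), ← map_pow, ← map_mul,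
      mul_one_div_cancel (by positivity), map_one, one_mul]

end Iw

namespace Setup

variable {p : ℕ} [Fact p.Prime] {𝒢 : Type*} [Group 𝒢] [TopologicalSpace 𝒢]
  [IsTopologicalGroup 𝒢] (S : Setup p 𝒢)

variable {O K : Type*} [CommRing O] [CommRing K] [Algebra ℚ K]

/-- The lattice of the elements of `lim_U K[Γ^(p^e)/U]` with integral component at `U`. -/
def latSub (i : O →+* K) (U : OpenNormalSubgroup S.Z) : Subring (Iw K S.Z) :=
  (MonoidAlgebra.mapRingHom (S.Z ⧸ U.toSubgroup) i).range.comap (Iw.proj U)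

variable {S}
variable {i : O →+* K} {U : OpenNormalSubgroup S.Z}

/-- Division by `p ^ n` is possible in the whole limit ring, and is unique at the level `U`; so the
condition only concerns the component at `U`. -/
theorem mem_powSub_latSub {n : ℕ} {x : Iw K S.Z} : x ∈ powSub p (S.latSub i U) n ↔
    Iw.proj U x ∈ powSub p (MonoidAlgebra.mapRingHom (S.Z ⧸ U.toSubgroup) i).range n := by
  have hp0 : p ≠ 0 := (Fact.out : p.Prime).ne_zero
  constructor
  · rintro ⟨r, hr, rfl⟩
    exact ⟨Iw.proj U r, hr, by rw [map_mul, map_pow, map_natCast]⟩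
  · rintro ⟨a, ha, hx⟩
    obtain ⟨y, rfl⟩ := Iw.exists_proj_mul (n := n) hp0 x
    rw [map_mul, map_pow, map_natCast] at hx
    have := Iw.natCast_cancel hp0 hx
    exact ⟨y, by
      change Iw.proj U y ∈ (MonoidAlgebra.mapRingHom (S.Z ⧸ U.toSubgroup) i).range
      rwa [this], rfl⟩

theorem mapDomain_map_mapDomain {O O' A B C : Type*} [CommRing O] [CommRing O'] [Monoid A]
    [Monoid B] [Monoid C] (g : A →* B) (f : O →+* O') (h : B →* C) (y : MonoidAlgebra O A) :
    MonoidAlgebra.mapDomainRingHom O' h (MonoidAlgebra.mapRingHom _ f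
      (MonoidAlgebra.mapDomainRingHom O g y)) =
    MonoidAlgebra.mapDomainRingHom O' (h.comp g) (MonoidAlgebra.mapRingHom _ f y) := by
  induction y using MonoidAlgebra.induction_linear with
  | zero => simp
  | add a b ha hb => simp only [map_add, ha, hb]
  | single k r => simp

omit [Algebra ℚ K] in
theorem proj_iwMap (r : Iw O S.Z) : Iw.proj U (Iw.map i (MonoidHom.id _) continuous_id r) =
    MonoidAlgebra.mapRingHom _ i (Iw.proj U r) := by
  rw [Iw.proj_map]
  have hle : U.toSubgroup ≤
      (Iw.comap (MonoidHom.id _) continuous_id U : OpenNormalSubgroup S.Z).toSubgroup := le_rfl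
  rw [← Iw.proj_compat r U _ hle]
  refine (mapDomain_map_mapDomain _ _ _ _).trans ?_
  refine Eq.trans (congrArg (fun h => MonoidAlgebra.mapDomainRingHom K h
    (MonoidAlgebra.mapRingHom _ i (Iw.proj U r))) (?_ : _ = MonoidHom.id _)) ?_
  · ext k
    rfl
  · simp

/-- Thanks to this `φ` induces an endomorphism of the single level `U`, and every lattice `latSub`
is stable under `φ`. -/
theorem powHom_le (U : OpenNormalSubgroup S.Z) :
    U.toSubgroup ≤ (Iw.comap S.powHom S.continuous_powHom U).toSubgroup :=
  fun _ hz => U.toSubgroup.pow_mem hz p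

omit [Algebra ℚ K] in
theorem proj_iwFrob (f : K →+* K) (r : Iw K S.Z) :
    Iw.proj U (Iw.map f S.powHom S.continuous_powHom r) =
    MonoidAlgebra.mapDomainRingHom K
      (QuotientGroup.map U.toSubgroup U.toSubgroup S.powHom (powHom_le U))
      (MonoidAlgebra.mapRingHom _ f (Iw.proj U r)) := by
  rw [Iw.proj_map, ← Iw.proj_compat r U _ (powHom_le U)]
  refine (mapDomain_map_mapDomain _ _ _ _).trans ?_
  refine congrArg (fun h => MonoidAlgebra.mapDomainRingHom K h
    (MonoidAlgebra.mapRingHom _ f (Iw.proj U r))) ?_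
  ext k
  rfl

variable (σ : O →+* O) (σK : K →+* K) (hi : ∀ a, σK (i a) = i (σ a))

theorem iwLog_good (hO : PComplete p O) (U : OpenNormalSubgroup S.Z) :
    (S.iwLog σ σK i hi).Good (S.latSub i U) where
  j_mem r := ⟨Iw.proj U r, (proj_iwMap r).symm⟩
  φ_mem r := by
    rintro ⟨a, ha⟩
    refine ⟨MonoidAlgebra.mapDomainRingHom O
      (QuotientGroup.map U.toSubgroup U.toSubgroup S.powHom (powHom_le U))
      (MonoidAlgebra.mapRingHom _ σ a), ?_⟩
    refine Eq.trans ?_ (proj_iwFrob (U := U) σK r).symm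
    rw [← ha]
    generalize a = y
    induction y using MonoidAlgebra.induction_linear with
    | zero => simp
    | add a b ha hb => simp only [map_add, ha, hb]
    | single k r => simp [hi]
  pinv m hm := by
    obtain ⟨a, ha⟩ := (hO.pInv : PInv p i.range) m hm
    refine ⟨MonoidAlgebra.single 1 a, ?_⟩
    rw [MonoidAlgebra.mapRingHom_single, ha]
    rfl

theorem iwLog_nice (hO : PComplete p O) (hi' : Function.Injective i)
    (hfin : ∀ U : OpenNormalSubgroup S.Z, Finite (S.Z ⧸ U.toSubgroup)) :
    (S.iwLog σ σK i hi).Nice where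
  good := by
    rintro _ ⟨U, rfl⟩
    exact ⟨S.latSub i U, rfl, iwLog_good σ σK hi hO U⟩
  separated r hr := by
    ext1 U
    have := hfin U
    rw [map_zero]
    refine (hO.monoidAlgebra (M := S.Z ⧸ U.toSubgroup)).range_separated
      (i := MonoidAlgebra.mapRingHom _ i) (MonoidAlgebra.map_injective _ hi') fun n => ?_
    exact mem_powSub_latSub.1 (hr (S.latSub i U) ⟨U, rfl⟩ n)

theorem iwLog_complete (hO : PComplete p O) (hi' : Function.Injective i)
    (hfin : ∀ U : OpenNormalSubgroup S.Z, Finite (S.Z ⧸ U.toSubgroup)) :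
    (S.iwLog σ σK i hi).Complete := by
  intro s hs
  have hinj : ∀ U : OpenNormalSubgroup S.Z, Function.Injective
      (MonoidAlgebra.mapRingHom (S.Z ⧸ U.toSubgroup) i) :=
    fun U => MonoidAlgebra.map_injective _ hi'
  have hl : ∀ U : OpenNormalSubgroup S.Z, ∃ ℓ, ∀ n, ∃ N, ∀ m ≥ N, Iw.proj U (s m) - ℓ ∈
      powSub p (MonoidAlgebra.mapRingHom (S.Z ⧸ U.toSubgroup) i).range n := by
    intro U
    have := hfin U
    refine (hO.monoidAlgebra (M := S.Z ⧸ U.toSubgroup)).range_lim (hinj U)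
      (fun m => Iw.proj U (s m)) fun n => ?_
    obtain ⟨N, hN⟩ := hs (S.latSub i U) ⟨U, rfl⟩ n
    refine ⟨N, fun m hm => ?_⟩
    have := mem_powSub_latSub.1 (hN m hm)
    rwa [map_sub] at this
  choose ℓ hℓ using hl
  -- The transition maps preserve integrality, hence `p`-adic limits, and limits at the level `V`
  -- are unique; so the levelwise limits are compatible.
  have hc : ℓ ∈ iwSubring K S.Z := by
    intro U V hUV
    have := hfin V
    refine sub_eq_zero.1 ((hO.monoidAlgebra (M := S.Z ⧸ V.toSubgroup)).range_separated
      (hinj V) fun n => ?_)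
    obtain ⟨N, hN⟩ := hℓ U n
    obtain ⟨N', hN'⟩ := hℓ V n
    have h1 := hN (N + N') (by omega)
    have h2 := hN' (N + N') (by omega)
    have h3 := powSub_map (f := MonoidAlgebra.mapDomainRingHom K
      (QuotientGroup.map U.toSubgroup V.toSubgroup (MonoidHom.id S.Z) hUV))
      (B' := (MonoidAlgebra.mapRingHom (S.Z ⧸ V.toSubgroup) i).range) (by
        rintro _ ⟨a, rfl⟩
        refine ⟨MonoidAlgebra.mapDomainRingHom O
          (QuotientGroup.map U.toSubgroup V.toSubgroup (MonoidHom.id S.Z) hUV) a, ?_⟩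
        exact congrArg (fun f => f a) (MonoidAlgebra.mapRingHom_comp_mapDomainRingHom i
          (QuotientGroup.map U.toSubgroup V.toSubgroup (MonoidHom.id S.Z) hUV))) h1
    rw [map_sub, Iw.proj_compat _ U V hUV] at h3
    have := sub_mem h2 h3
    rwa [sub_sub_sub_cancel_left] at this
  refine ⟨(show Iw K S.Z from ⟨ℓ, hc⟩), ?_⟩
  rintro _ ⟨U, rfl⟩ n
  obtain ⟨N, hN⟩ := hℓ U n
  refine ⟨N, fun m hm => ?_⟩
  refine (mem_powSub_latSub (n := n)).2 ?_
  have := neg_mem (hN m hm)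
  rw [neg_sub] at this
  rw [map_sub]
  exact this

omit [Algebra ℚ K] in
theorem iw_torsionFree [IsDomain O] (hp : (p : O) ≠ 0) (r : Iw O S.Z)
    (hr : (p : Iw O S.Z) * r = 0) : r = 0 := by
  ext1 U
  ext q
  have := congrArg (fun x => (Iw.proj U x).coeff q) hr
  simp only [map_mul, map_natCast] at this
  rw [Iw.natCast_mul_coeff] at this
  exact (mul_eq_zero.1 this).resolve_left hp

/-- Modulo `p` both terms are additive in `y`, which leaves the elements `r k` with `k` in the
group; there it is the congruence for `σ`. -/
theorem dvd_monoidAlgebra_frob {O A : Type*} [CommRing O] [IsDomain O] [CommGroup A] {p : ℕ}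
    [Fact p.Prime] {σ : O →+* O} (hσ : ∀ a, (p : O) ∣ σ a - a ^ p) (f : A →* A)
    (hf : ∀ a, f a = a ^ p) (y : MonoidAlgebra O A) : (p : MonoidAlgebra O A) ∣
      MonoidAlgebra.mapDomainRingHom O f (MonoidAlgebra.mapRingHom _ σ y) - y ^ p := by
  induction y using MonoidAlgebra.induction_linear with
  | zero => simp [zero_pow (Fact.out : p.Prime).ne_zero]
  | add a b ha hb =>
    obtain ⟨r, hr⟩ := exists_add_pow_prime_eq (Fact.out : p.Prime) a b
    rw [hr, map_add, map_add]
    have := (ha.add hb).sub ((Dvd.intro _ rfl : (p : MonoidAlgebra O A) ∣ p * (a * b * r)))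
    convert this using 1
    ring
  | single k r =>
    rw [MonoidAlgebra.mapRingHom_single, MonoidAlgebra.mapDomainRingHom_apply,
      MonoidAlgebra.mapDomain_single, MonoidAlgebra.single_pow, hf, ← MonoidAlgebra.single_sub]
    obtain ⟨c, hc⟩ := hσ r
    refine ⟨MonoidAlgebra.single (k ^ p) c, ?_⟩
    rw [hc, ← nsmul_eq_mul, ← nsmul_eq_mul, MonoidAlgebra.smul_single]

theorem iwCoef_frob [IsDomain O] (hp : (p : O) ≠ 0) {σ : O →+* O}
    (hσ : ∀ a, (p : O) ∣ σ a - a ^ p) (r : Iw O S.Z) :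
    ∃ s, (S.iwCoef σ).φ r = r ^ p + p * s := by
  have h : (p : Iw O S.Z) ∣ (S.iwCoef σ).φ r - r ^ p := by
    refine Iw.natCast_dvd_of_proj hp _ fun U => ?_
    rw [map_sub, map_pow]
    have e : Iw.proj U ((S.iwCoef σ).φ r) = _ := proj_iwFrob (U := U) σ r
    rw [e]
    have hq : ∀ a b : S.Z ⧸ U.toSubgroup, a * b = b * a := by
      intro a b
      induction a using QuotientGroup.induction_on with | H a => ?_
      induction b using QuotientGroup.induction_on with | H b => ?_
      rw [← QuotientGroup.mk_mul, mul_comm', QuotientGroup.mk_mul]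
    let _ : CommGroup (S.Z ⧸ U.toSubgroup) := { mul_comm := hq }
    refine dvd_monoidAlgebra_frob hσ (QuotientGroup.map U.toSubgroup U.toSubgroup S.powHom
      (powHom_le U)) (fun a => ?_) _
    induction a using QuotientGroup.induction_on with | H a => ?_
    rfl
  obtain ⟨s, hs⟩ := h
  exact ⟨s, by rw [← hs]; ring⟩

end Setup

/-! ### The Jacobson radical of `Λ_O(𝒢)` -/

section Augmentation

variable {p : ℕ} [Fact p.Prime] {O k : Type*} [CommRing O] [IsDomain O] [Field k] [CharP k p]

/-- The augmentation. -/
def augHom (k M : Type*) [Field k] [Monoid M] : MonoidAlgebra k M →+* k :=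
  (MonoidAlgebra.lift k k M (1 : M →* k)).toRingHom

theorem augHom_single {M : Type*} [Monoid M] (m : M) (r : k) :
    augHom k M (MonoidAlgebra.single m r) = r := by
  refine (MonoidAlgebra.lift_single (1 : M →* k) m r).trans ?_
  simp

theorem augHom_mapDomain {M N : Type*} [Monoid M] [Monoid N] (h : M →* N) (x : MonoidAlgebra k M) :
    augHom k N (MonoidAlgebra.mapDomainRingHom k h x) = augHom k M x := by
  induction x using MonoidAlgebra.induction_linear with
  | zero => simp
  | add a b ha hb => simp only [map_add, ha, hb]
  | single m r =>
    rw [MonoidAlgebra.mapDomainRingHom_apply, MonoidAlgebra.mapDomain_single, augHom_single,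
      augHom_single]

/-- The nilpotency of the augmentation ideal of `k[H]` in matrix rings, `H` a finite `p`-group. -/
theorem exists_matrix_pow_eq_zero_of_augHom {H : Type*} [Group H] [Finite H] (hH : IsPGroup p H) :
    ∃ N : ℕ, ∀ {n : ℕ} (M : Matrix (Fin n) (Fin n) (MonoidAlgebra k H)),
      (∀ i j, augHom k H (M i j) = 0) → M ^ N = 0 := by
  let _ := ZMod.algebra k p
  let f : H →* MonoidAlgebra k H := MonoidAlgebra.of k H
  have h1 : ∀ x : MonoidAlgebra k H,
      x - MonoidAlgebra.single 1 (augHom k H x) ∈ augSub (p := p) f := by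
    intro x
    induction x using MonoidAlgebra.induction_linear with
    | zero => simp
    | add a b ha hb =>
      have := add_mem ha hb
      rwa [sub_add_sub_comm, ← MonoidAlgebra.single_add, ← map_add] at this
    | single h r =>
      have := mul_sub_one_mem_augSub (p := p) f (MonoidAlgebra.single 1 r) h
      have e : (MonoidAlgebra.single 1 r : MonoidAlgebra k H) * (f h - 1) =
          MonoidAlgebra.single h r - MonoidAlgebra.single 1 r := by
        rw [mul_sub, mul_one, MonoidAlgebra.of_apply, MonoidAlgebra.single_mul_single, one_mul,
          mul_one]
      rwa [augHom_single, ← e]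
  obtain ⟨N, hN⟩ := exists_matrix_pow_eq_zero (p := p) hH f fun h a => by
    have := h1 ((f h - 1) * a)
    have e : augHom k H ((f h - 1) * a) = 0 := by
      rw [map_mul, map_sub, MonoidAlgebra.of_apply, augHom_single, map_one, sub_self, zero_mul]
    rwa [e, MonoidAlgebra.single_zero, sub_zero] at this
  refine ⟨N, fun M hM => hN M fun i j => ?_⟩
  have := h1 (M i j)
  rwa [hM, MonoidAlgebra.single_zero, sub_zero] at this

variable {q : O →+* k} (hq : ∀ a, q a = 0 → (p : O) ∣ a)
include hq

theorem natCast_dvd_of_map_eq_zero {M : Type*} [Monoid M] (x : MonoidAlgebra O M)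
    (hx : MonoidAlgebra.mapRingHom M q x = 0) : (p : MonoidAlgebra O M) ∣ x := by
  refine Iw.natCast_dvd p x fun m => hq _ ?_
  have := congrArg (fun y => y.coeff m) hx
  simpa using this

omit hq

variable {𝒢 : Type*} [Group 𝒢] [TopologicalSpace 𝒢]

/-- The whole group as an open normal subgroup. -/
def topNormal (𝒢 : Type*) [Group 𝒢] [TopologicalSpace 𝒢] : OpenNormalSubgroup 𝒢 where
  toSubgroup := ⊤
  isOpen' := isOpen_univ
  isNormal' := inferInstance

/-- The augmentation `Λ_O(𝒢) → k`. -/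
def iwAug (𝒢 : Type*) [Group 𝒢] [TopologicalSpace 𝒢] (q : O →+* k) : Iw O 𝒢 →+* k :=
  ((augHom k _).comp (MonoidAlgebra.mapRingHom _ q)).comp (Iw.proj (topNormal 𝒢))

theorem augHom_proj (V : OpenNormalSubgroup 𝒢) (x : Iw O 𝒢) :
    augHom k _ (MonoidAlgebra.mapRingHom _ q (Iw.proj V x)) = iwAug 𝒢 q x := by
  rw [iwAug, RingHom.comp_apply, RingHom.comp_apply, ← Iw.proj_compat x V (topNormal 𝒢) le_top]
  let g : 𝒢 ⧸ V.toSubgroup →* 𝒢 ⧸ (topNormal 𝒢).toSubgroup :=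
    QuotientGroup.map V.toSubgroup (topNormal 𝒢).toSubgroup (MonoidHom.id 𝒢) le_top
  have e := congrArg (fun f => f (Iw.proj V x))
    (MonoidAlgebra.mapRingHom_comp_mapDomainRingHom q g)
  exact ((congrArg (augHom k _) e).trans (augHom_mapDomain g _)).symm

theorem iwAug_surjective (hq' : Function.Surjective q) : Function.Surjective (iwAug 𝒢 q) := by
  intro a
  obtain ⟨a, rfl⟩ := hq' a
  refine ⟨Iw.const O 𝒢 a, ?_⟩
  rw [← augHom_proj (topNormal 𝒢), Iw.proj_const, MonoidAlgebra.mapRingHom_single, augHom_single]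

/-- Ring homomorphisms carry inverses to inverses, so the inverses at the finite levels form a
compatible family. -/
theorem isUnit_of_proj (x : Iw O 𝒢) (hx : ∀ V, IsUnit (Iw.proj V x)) : IsUnit x := by
  choose u hu using hx
  have hc : (fun V : OpenNormalSubgroup 𝒢 =>
      (↑(u V)⁻¹ : MonoidAlgebra O (𝒢 ⧸ V.toSubgroup))) ∈ iwSubring O 𝒢 := by
    intro U V hUV
    let f := MonoidAlgebra.mapDomainRingHom O
      (QuotientGroup.map U.toSubgroup V.toSubgroup (MonoidHom.id 𝒢) hUV)
    have e : Units.map f.toMonoidHom (u U) = u V := by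
      ext1
      change f (u U) = u V
      rw [hu, hu]
      exact Iw.proj_compat x U V hUV
    change f (↑(u U)⁻¹) = ↑(u V)⁻¹
    rw [← e, ← map_inv]
    rfl
  let y : Iw O 𝒢 := (⟨_, hc⟩ : iwSubring O 𝒢)
  have hy : ∀ V, Iw.proj V y = ↑(u V)⁻¹ := fun _ => rfl
  refine ⟨⟨x, y, ?_, ?_⟩, rfl⟩
  · ext1 V
    rw [map_mul, map_one, hy, ← hu, Units.mul_inv]
  · ext1 V
    rw [map_mul, map_one, hy, ← hu, Units.inv_mul]

section

variable (hG : ∀ V : OpenNormalSubgroup 𝒢, Finite (𝒢 ⧸ V.toSubgroup) ∧ IsPGroup p (𝒢 ⧸ V.toSubgroup))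
include hq hG

/-- At a finite level the group is a finite `p`-group, whose augmentation ideal over `k` is
nilpotent. The exponent depends on `V`, but neither on the matrix nor on its size. -/
theorem exists_natCast_dvd_matrix_pow (V : OpenNormalSubgroup 𝒢) : ∃ N : ℕ, ∀ {n : ℕ}
    (M : Matrix (Fin n) (Fin n) (Iw O 𝒢)), (∀ i j, iwAug 𝒢 q (M i j) = 0) →
      ∀ i j, (p : MonoidAlgebra O (𝒢 ⧸ V.toSubgroup)) ∣ Iw.proj V ((M ^ N) i j) := by
  obtain ⟨h1, h2⟩ := hG V
  obtain ⟨N, hN⟩ := exists_matrix_pow_eq_zero_of_augHom (p := p) (k := k) h2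
  refine ⟨N, fun M hM i j => natCast_dvd_of_map_eq_zero hq _ ?_⟩
  let f := (MonoidAlgebra.mapRingHom (𝒢 ⧸ V.toSubgroup) q).comp (Iw.proj V)
  have := hN (f.mapMatrix M) fun i j => (augHom_proj V _).trans (hM i j)
  rw [← map_pow] at this
  exact congrFun (congrFun this i) j

theorem isUnit_one_add_of_iwAug (hO : PComplete p O) (x : Iw O 𝒢) (hx : iwAug 𝒢 q x = 0) :
    IsUnit (1 + x) := by
  refine isUnit_of_proj _ fun V => ?_
  obtain ⟨N, hN⟩ := exists_natCast_dvd_matrix_pow hq hG V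
  have := (hG V).1
  have h1 := hN (Matrix.scalar (Fin 1) x) (fun i j => by
    rw [Matrix.scalar_apply, Matrix.diagonal_apply]
    split_ifs
    exacts [hx, map_zero _]) 0 0
  rw [← map_pow, Matrix.scalar_apply, Matrix.diagonal_apply_eq, map_pow] at h1
  rw [map_add, map_one]
  obtain ⟨d, hd⟩ := h1
  set a := Iw.proj V x
  -- This element is congruent to `1` modulo `p`, and the geometric sum shows that `1 + a` divides
  -- it.
  have h2 : IsUnit (1 - (-a) ^ N) := by
    rw [neg_pow, hd, ← mul_assoc, ((Nat.cast_commute p _).eq).symm, mul_assoc, sub_eq_add_neg,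
      ← mul_neg]
    exact (hO.monoidAlgebra (M := 𝒢 ⧸ V.toSubgroup)).isUnit_one_add _
  have e1 := mul_neg_geom_sum (-a) N
  have e2 := geom_sum_mul_neg (-a) N
  rw [sub_neg_eq_add] at e1 e2
  have hc : Commute (1 + a) (∑ i ∈ Finset.range N, (-a) ^ i) := e1.trans e2.symm
  rw [← e1] at h2
  exact (hc.isUnit_mul_iff.1 h2).1

/-- The augmentation maps onto a field, so it kills the radical; conversely `1 + y x` is a unit for
every `y` as soon as the augmentation of `x` vanishes. -/
theorem mem_jacobson_iff_iwAug (hq' : Function.Surjective q) (hO : PComplete p O) (x : Iw O 𝒢) :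
    x ∈ Ring.jacobson (Iw O 𝒢) ↔ iwAug 𝒢 q x = 0 := by
  constructor
  · intro hx
    have hs : RingHomSurjective (iwAug 𝒢 q) := ⟨iwAug_surjective hq'⟩
    have := Ring.map_jacobson_le (f := iwAug 𝒢 q) (Submodule.mem_map_of_mem hx)
    rw [IsSemisimpleRing.jacobson_eq_bot] at this
    exact this
  · intro hx
    rw [← Ideal.jacobson_bot, Ideal.mem_jacobson_iff]
    intro y
    obtain ⟨u, hu⟩ := isUnit_one_add_of_iwAug hq hG hO (y * x) (by rw [map_mul, hx, mul_zero])
    refine ⟨(↑u⁻¹ : Iw O 𝒢), ?_⟩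
    have : (↑u⁻¹ : Iw O 𝒢) * y * x + ↑u⁻¹ - 1 = ↑u⁻¹ * (1 + y * x) - 1 := by noncomm_ring
    rw [this, ← hu, Units.inv_mul, sub_self]
    exact zero_mem _

end

end Augmentation

/-! ### The formula for `Λ_O(𝒢)` -/

namespace Setup

variable {p : ℕ} [Fact p.Prime] {𝒢 : Type*} [Group 𝒢] [TopologicalSpace 𝒢]
  [IsTopologicalGroup 𝒢] (S : Setup p 𝒢)

theorem finite_quotient [CompactSpace 𝒢] (V : OpenNormalSubgroup 𝒢) :
    Finite (𝒢 ⧸ V.toSubgroup) :=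
  Subgroup.quotient_finite_of_isOpen _ V.isOpen'

-- Let `p ^ a m`, with `p ∤ m`, be the order of the quotient. Since `m` is invertible in `ℤ_p`,
-- every element of `Γ` is an `m`-th power, so the image of `Γ` is killed by `p ^ a`; and a
-- `p`-power of any element of `𝒢` lies in `Γ^(p^e)`.
include S in
theorem isPGroup_quotient [CompactSpace 𝒢] (V : OpenNormalSubgroup 𝒢) :
    IsPGroup p (𝒢 ⧸ V.toSubgroup) := by
  have := finite_quotient V
  have h0 : Nat.card (𝒢 ⧸ V.toSubgroup) ≠ 0 := Nat.card_pos.ne'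
  obtain ⟨a, m, hm, hN⟩ := Nat.exists_eq_pow_mul_and_not_dvd h0 p (Fact.out : p.Prime).ne_one
  obtain ⟨u, hu⟩ := (pComplete_padicInt p).isUnit_natCast
    (((Fact.out : p.Prime).coprime_iff_not_dvd).2 hm)
  have key : ∀ z : Multiplicative ℤ_[p], (QuotientGroup.mk (S.s z) : 𝒢 ⧸ V.toSubgroup) ^ p ^ a = 1 := by
    intro z
    have hz : z = (Multiplicative.ofAdd ((↑u⁻¹ : ℤ_[p]) * z.toAdd)) ^ m := by
      rw [← ofAdd_nsmul, nsmul_eq_mul, ← hu, ← mul_assoc, Units.mul_inv, one_mul, ofAdd_toAdd]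
    rw [hz, map_pow, QuotientGroup.mk_pow, ← pow_mul, mul_comm m, ← hN, pow_card_eq_one']
  intro x
  induction x using QuotientGroup.induction_on with | H x => ?_
  obtain ⟨b, hb⟩ := isPGroup_G (S := S) (QuotientGroup.mk x)
  rw [← QuotientGroup.mk_pow, QuotientGroup.eq_one_iff] at hb
  obtain ⟨z, hz⟩ := S.mem_Z.1 hb
  refine ⟨b + a, ?_⟩
  rw [pow_add, pow_mul, ← QuotientGroup.mk_pow, ← hz]
  exact key _

variable [CompactSpace 𝒢] [T2Space 𝒢]

theorem finite_quotient_Z (U : OpenNormalSubgroup S.Z) : Finite (S.Z ⧸ U.toSubgroup) :=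
  have := finite_quotient (S.mapZ U)
  Finite.of_injective _ (S.transl_injective 1 U)

variable {O K : Type*} [CommRing O] [CommRing K]

theorem proj_iwasawaEquiv_coeff (x : Iw O 𝒢) (U : OpenNormalSubgroup S.Z) (z : S.Z) (g : S.G) :
    (Iw.proj U (S.iwasawaEquiv O x g)).coeff (QuotientGroup.mk z) =
      (Iw.proj (S.mapZ U) x).coeff (QuotientGroup.mk ((z : 𝒢) * S.lift g)) := by
  have hV : (S.mapZ U).toSubgroup ≤ S.Z := by
    rintro _ ⟨w, -, rfl⟩
    exact w.2
  have h := S.proj_fromTw_coeff O (S.iwasawaEquiv O x) (S.mapZ U) hV z g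
  rw [show S.fromTw O (S.iwasawaEquiv O x) = x from (S.iwasawaEquiv O).symm_apply_apply x] at h
  rw [h]
  have aux : ∀ W : OpenNormalSubgroup S.Z, W = U →
      (Iw.proj U (S.iwasawaEquiv O x g)).coeff (QuotientGroup.mk z) =
        (Iw.proj W (S.iwasawaEquiv O x g)).coeff (QuotientGroup.mk z) := by
    rintro _ rfl; rfl
  apply aux
  ext w
  exact S.mem_mapZ U w

theorem map_sub_one_pow {A B : Type*} [Ring A] [Ring B] (ε : A ≃+* B) {n : ℕ}
    (u : Matrix (Fin n) (Fin n) A) (N : ℕ) (r s : Fin n) :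
    ((u.map ε - 1) ^ N) r s = ε (((u - 1) ^ N) r s) := by
  have : u.map ε - 1 = ε.toRingHom.mapMatrix (u - 1) := by
    rw [map_sub, map_one]
    rfl
  rw [this, ← map_pow]
  rfl

/-- The proposition for `Λ_O(𝒢)`. -/
theorem formula_iwasawa [IsDomain O] [Algebra ℚ K] (hO : PComplete p O) (hp : (p : O) ≠ 0)
    {k : Type*} [Field k] [Finite k] [CharP k p] {q : O →+* k} (hq : ∀ a, q a = 0 → (p : O) ∣ a)
    (hq' : Function.Surjective q) {σ : O →+* O} {σK : K →+* K} {i : O →+* K}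
    (hi : ∀ a, σK (i a) = i (σ a)) (hi' : Function.Injective i)
    (hσ : ∀ a, (p : O) ∣ σ a - a ^ p) (ω : ∀ P : S.Cyc, P.1 →* Multiplicative (ZMod p))
    (hω : ∀ P : S.Cyc, P.1 ≠ ⊥ → ω P ≠ 1) (x : K1 (Iw O 𝒢)) :
    letI c := S.iwCoef σ
    letI E := S.iwLog σ σK i hi
    letI ε : Iw O 𝒢 ≃+* S.RG c.ι := S.iwasawaEquiv O
    (∃! L, E.IsIntegralLog ε x L) ∧ ∀ L, E.IsIntegralLog ε x L → ∀ P : S.Cyc,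
      E.HasLog (c.alpha (ω P) (c.theta ε P x) / c.u (fun C => c.alpha (ω C) (c.theta ε C x)) P :
        (S.RP c.ι P)ˣ).val (p • S.beta E.coef.ι P L) := by
  have hG : ∀ V : OpenNormalSubgroup 𝒢,
      Finite (𝒢 ⧸ V.toSubgroup) ∧ IsPGroup p (𝒢 ⧸ V.toSubgroup) :=
    fun V => ⟨finite_quotient V, S.isPGroup_quotient V⟩
  have hjac := mem_jacobson_iff_iwAug hq hG hq' hO
  refine formula_of_jacobson (iwLog_nice σ σK hi hO hi' (finite_quotient_Z S))
    (iwLog_complete σ σK hi hO hi' (finite_quotient_Z S)) (iw_torsionFree hp)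
    (iwCoef_frob hp hσ) ω hω (S.iwasawaEquiv O) ?_ ?_ x
  · intro n u hu B hBl hB
    obtain ⟨U, hU⟩ := hBl
    obtain rfl : S.latSub i U = B := Subring.toAddSubgroup_injective hU
    -- An open subgroup `U` of the open central subgroup `Γ^(p^e)` is open and normal in `𝒢`, and
    -- the coefficients at the level `U` of the components in `R[G]^τ` are coefficients in `O[𝒢/U]`.
    obtain ⟨N, hN⟩ := exists_natCast_dvd_matrix_pow hq hG (S.mapZ U)
    refine ⟨N, fun r s => ?_⟩
    have h1 := hN (u.1 - 1) (fun r s => (hjac _).1 (hu r s)) r s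
    have e := map_sub_one_pow (S.iwasawaEquiv O) u.1 N r s
    refine (congrArg (fun y => (S.iwLog σ σK i hi).mapRG y ∈ powSub p hB.subG 1) e).mpr ?_
    refine TwGrp.mem_powSub_coefSub.2 fun g => (mem_powSub_latSub (n := 1)).2 ?_
    change Iw.proj U (Iw.map i (MonoidHom.id _) continuous_id _) ∈ _
    rw [proj_iwMap]
    obtain ⟨d, hd⟩ : (p : MonoidAlgebra O (S.Z ⧸ U.toSubgroup)) ∣
        Iw.proj U (S.iwasawaEquiv O (((u.1 - 1) ^ N) r s) g) := by
      refine Iw.natCast_dvd p _ fun z => ?_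
      induction z using QuotientGroup.induction_on with | H z => ?_
      rw [proj_iwasawaEquiv_coeff]
      obtain ⟨d, hd⟩ := h1
      rw [hd, Iw.natCast_mul_coeff]
      exact dvd_mul_right _ _
    exact mem_powSub_range.2 ⟨d, by rw [hd, pow_one]⟩
  · intro n u
    let f : GL (Fin n) (Iw O 𝒢) →* GL (Fin n) k := Units.map (iwAug 𝒢 q).mapMatrix.toMonoidHom
    have hf : Finite (GL (Fin n) k) := inferInstance
    -- The residue field is finite, so raising to the order of `GL_n(k)` makes every invertible
    -- matrix trivial under the augmentation.
    refine ⟨Nat.card (GL (Fin n) k), Nat.card_pos, fun r s => (hjac _).2 ?_⟩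
    have h1 : f (u ^ Nat.card (GL (Fin n) k)) = 1 := by rw [map_pow, pow_card_eq_one']
    have h2 : (iwAug 𝒢 q).mapMatrix ((u ^ Nat.card (GL (Fin n) k)).1 - 1) = 0 := by
      rw [map_sub, map_one]
      exact sub_eq_zero.2 (congrArg Units.val h1)
    exact congrFun (congrFun h2 r) s

end Setup

theorem PComplete.eq_zero_of_nsmul {p : ℕ} [Fact p.Prime] {A : Type*} [CommRing A]
    (h : PComplete p A) {m : ℕ} (hm : m ≠ 0) {x : A} (hx : m • x = 0) : x = 0 := by
  obtain ⟨a, m', hm', rfl⟩ := Nat.exists_eq_pow_mul_and_not_dvd hm p (Fact.out : p.Prime).ne_one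
  have hu := h.isUnit_natCast (((Fact.out : p.Prime).coprime_iff_not_dvd).2 hm')
  rw [nsmul_eq_mul, Nat.cast_mul, Nat.cast_pow, mul_assoc] at hx
  have h1 : ∀ (a : ℕ) (y : A), (p : A) ^ a * y = 0 → y = 0 := by
    intro a
    induction a with
    | zero => intro y hy; rwa [pow_zero, one_mul] at hy
    | succ a ih =>
      intro y hy
      rw [pow_succ, mul_assoc] at hy
      exact h.torsionFree _ (ih _ hy)
  exact hu.mul_right_eq_zero.1 (h1 a _ hx)

/-! ### The completed localisation -/

section PLoc

variable {p : ℕ} {B : Type*} [CommRing B]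

theorem PLoc.torsionFree (hB : ∀ r : B, (p : B) * r = 0 → r = 0) (r : PLoc p B)
    (hr : (p : PLoc p B) * r = 0) : r = 0 := by
  obtain ⟨a, s, rfl⟩ := IsLocalization.exists_mk'_eq (Submonoid.closure {t : B | ¬ (p : B) ∣ t}) r
  rw [← map_natCast (algebraMap B (PLoc p B)), ← IsLocalization.mk'_one (M := Submonoid.closure
    {t : B | ¬ (p : B) ∣ t}), ← IsLocalization.mk'_mul, IsLocalization.mk'_eq_zero_iff] at hr
  obtain ⟨m, hm⟩ := hr
  rw [IsLocalization.mk'_eq_zero_iff]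
  exact ⟨m, hB _ (by rw [← hm]; ring)⟩

/-- The numerator is then itself not divisible by `p`, hence belongs to the inverted elements. -/
theorem PLoc.isUnit (r : PLoc p B) (hr : ¬ (p : PLoc p B) ∣ r) : IsUnit r := by
  obtain ⟨a, s, rfl⟩ := IsLocalization.exists_mk'_eq (Submonoid.closure {t : B | ¬ (p : B) ∣ t}) r
  rw [IsLocalization.mk'_eq_mul_mk'_one] at hr ⊢
  have ha : ¬ (p : B) ∣ a := by
    rintro ⟨b, rfl⟩
    apply hr
    rw [map_mul, map_natCast, mul_assoc]
    exact dvd_mul_right _ _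
  refine (IsLocalization.map_units (PLoc p B) (⟨a, Submonoid.subset_closure ha⟩ :
    Submonoid.closure {t : B | ¬ (p : B) ∣ t})).mul ?_
  refine IsUnit.of_mul_eq_one (algebraMap B (PLoc p B) s) ?_
  rw [IsLocalization.mk'_spec, map_one]

/-- For `r = a / s` the difference multiplied by the unit `s ^ p f(s)` is `f(a) s ^ p - a ^ p f(s)`,
which is divisible by `p` by the congruences for `a` and `s`. -/
theorem PLoc.map_frob {f : B →+* B} (hf : ∀ t, ¬ (p : B) ∣ t → ¬ (p : B) ∣ f t)
    (hφ : ∀ r, (p : B) ∣ f r - r ^ p) (r : PLoc p B) :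
    (p : PLoc p B) ∣ PLoc.map p f hf r - r ^ p := by
  obtain ⟨a, s, rfl⟩ := IsLocalization.exists_mk'_eq (Submonoid.closure {t : B | ¬ (p : B) ∣ t}) r
  have h1 := fun x => IsLocalization.map_eq (M := Submonoid.closure {t : B | ¬ (p : B) ∣ t})
    (S := PLoc p B) (Q := PLoc p B) (T := Submonoid.closure {t : B | ¬ (p : B) ∣ t}) (g := f) (by
      rw [Submonoid.closure_le]
      exact fun t ht => Submonoid.subset_closure (hf t ht)) x
  set A := algebraMap B (PLoc p B) with hA
  set r := IsLocalization.mk' (PLoc p B) a s with hr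
  have hs : IsUnit (A s) := IsLocalization.map_units _ s
  have e : r * A s = A a := IsLocalization.mk'_spec _ a s
  have e1 : PLoc.map p f hf r * A (f s) = A (f a) := by
    rw [← h1 s, ← h1 a, ← e]
    exact (map_mul (PLoc.map p f hf) _ _).symm
  have hs' : IsUnit (A (f s)) := by
    rw [← h1 s]
    exact hs.map (PLoc.map p f hf)
  obtain ⟨c, hc⟩ := hφ a
  obtain ⟨d, hd⟩ := hφ s
  have hc' := congrArg A hc
  have hd' := congrArg A hd
  rw [map_sub, map_pow, map_mul, map_natCast, sub_eq_iff_eq_add] at hc' hd'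
  have key : (PLoc.map p f hf r - r ^ p) * (A s ^ p * A (f s)) =
      p * (A c * A s ^ p - A a ^ p * A d) := by
    have e2 : r ^ p * A s ^ p = A a ^ p := by rw [← mul_pow, e]
    calc _ = PLoc.map p f hf r * A (f s) * A s ^ p - r ^ p * A s ^ p * A (f s) := by ring
      _ = _ := by rw [e1, e2, hc', hd']; ring
  exact ((hs.pow p).mul hs').dvd_mul_right.1 (key ▸ dvd_mul_right _ _)

variable (p B) in
theorem PComp.exists_eq_add (x : PComp p B) :
    ∃ (b : B) (y : PComp p B), x = algebraMap B (PComp p B) b + p * y := by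
  obtain ⟨b, hb⟩ := Ideal.Quotient.mk_surjective (AdicCompletion.evalₐ (Ideal.span {(p : B)}) 1 x)
  have h : x - algebraMap B (PComp p B) b ∈
      (AdicCompletion.eval (Ideal.span {(p : B)}) B 1).ker := by
    have h1 : AdicCompletion.evalₐ (Ideal.span {(p : B)}) 1 (x - algebraMap B (PComp p B) b) = 0 := by
      rw [map_sub, AlgHom.commutes, ← hb]
      exact sub_self _
    rw [LinearMap.mem_ker, ← AdicCompletion.factor_evalₐ_eq_eval _ _ (by simp), h1, map_zero]
  rw [← AdicCompletion.pow_smul_top_eq_ker_eval (Submodule.fg_span_singleton _),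
    mem_span_pow_smul_top] at h
  obtain ⟨y, hy⟩ := h
  exact ⟨b, y, by rw [← sub_eq_iff_eq_add', hy, nsmul_eq_mul, pow_one]⟩

/-- Modulo `p ^ (n + 1)` the relation `p x = 0` lets one factor `p` be cancelled in `B`, so `x`
vanishes modulo `p ^ n`. -/
theorem PComp.torsionFree (hB : ∀ r : B, (p : B) * r = 0 → r = 0) (x : PComp p B)
    (hx : (p : PComp p B) * x = 0) : x = 0 := by
  apply AdicCompletion.ext_evalₐ
  intro n
  obtain ⟨r, rfl⟩ := AdicCompletion.mk_surjective (Ideal.span {(p : B)}) B x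
  have h := congrArg (AdicCompletion.evalₐ (Ideal.span {(p : B)}) (n + 1)) hx
  rw [map_mul, map_natCast, map_zero, AdicCompletion.evalₐ_mk] at h
  rw [map_zero, AdicCompletion.evalₐ_mk, ← AdicCompletion.Ideal.mk_eq_mk (Ideal.span {(p : B)})
    (Nat.le_succ n) r]
  rw [← map_natCast (Ideal.Quotient.mk (Ideal.span {(p : B)} ^ (n + 1))), ← map_mul,
    Ideal.Quotient.eq_zero_iff_mem, Ideal.span_singleton_pow, Ideal.mem_span_singleton] at h
  rw [Ideal.Quotient.eq_zero_iff_mem, Ideal.span_singleton_pow, Ideal.mem_span_singleton]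
  obtain ⟨c, hc⟩ := h
  refine ⟨c, sub_eq_zero.1 (hB _ ?_)⟩
  rw [mul_sub, hc]
  ring

theorem PComp.pComplete (hB : ∀ r : B, (p : B) * r = 0 → r = 0) : PComplete p (PComp p B) :=
  PComplete.of_isAdicComplete
    (AdicCompletion.isAdicComplete (Submodule.fg_span_singleton (p : B))) (PComp.torsionFree hB)

theorem PComp.isUnit (hB : ∀ r : B, (p : B) * r = 0 → r = 0)
    (hu : ∀ r : B, ¬ (p : B) ∣ r → IsUnit r) (x : PComp p B) (hx : ¬ (p : PComp p B) ∣ x) :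
    IsUnit x := by
  obtain ⟨b, y, rfl⟩ := PComp.exists_eq_add p B x
  have hb : IsUnit (algebraMap B (PComp p B) b) := by
    refine (hu b fun h => hx ?_).map _
    obtain ⟨c, rfl⟩ := h
    rw [map_mul, map_natCast, ← mul_add]
    exact dvd_mul_right _ _
  obtain ⟨u, hu⟩ := hb
  rw [← hu]
  have : (u : PComp p B) + p * y = u * (1 + p * (↑u⁻¹ * y)) := by
    linear_combination (-(p * y : PComp p B)) * u.mul_inv
  rw [this]
  exact u.isUnit.mul ((PComp.pComplete hB).isUnit_one_add _)

theorem dvd_pow_sub_pow_of_dvd {A : Type*} [CommRing A] {d x y : A} (h : d ∣ x - y) (n : ℕ) :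
    d ∣ x ^ n - y ^ n := h.trans (sub_dvd_pow_sub_pow x y n)

theorem PComp.map_frob {f : B →+* B} (hφ : ∀ r, (p : B) ∣ f r - r ^ p) (x : PComp p B) :
    ∃ s, PComp.map p f x = x ^ p + p * s := by
  obtain ⟨b, y, rfl⟩ := PComp.exists_eq_add p B x
  rw [map_add, map_mul, map_natCast, PComp.map_of]
  obtain ⟨s, hs⟩ : (p : PComp p B) ∣ algebraMap B (PComp p B) (f b) -
      (algebraMap B (PComp p B) b + p * y) ^ p := by
    have h1 : (p : PComp p B) ∣ algebraMap B (PComp p B) (f b) - algebraMap B (PComp p B) b ^ p := by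
      obtain ⟨c, hc⟩ := hφ b
      exact ⟨algebraMap B (PComp p B) c, by rw [← map_pow, ← map_sub, hc, map_mul, map_natCast]⟩
    have h2 := dvd_pow_sub_pow_of_dvd (d := (p : PComp p B)) (x := algebraMap B (PComp p B) b)
      (y := algebraMap B (PComp p B) b + p * y) (by simp) p
    have := dvd_add h1 h2
    rwa [sub_add_sub_cancel] at this
  refine ⟨s + PComp.map p f y, ?_⟩
  linear_combination hs

end PLoc

/-! ### Coefficient rings whose lattice is the image of `R` -/

namespace Setup

variable {p : ℕ} [Fact p.Prime] {𝒢 : Type*} [Group 𝒢] [TopologicalSpace 𝒢] {S : Setup p 𝒢}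
variable {R R' : Type*} [CommRing R] [CommRing R'] [Algebra ℚ R'] {c : S.Coef R}
  {E : LogRing c R'}

/-- The topology of `R'` is the `p`-adic topology defined by the lattice `R`. -/
structure LogRing.Adic (E : LogRing c R') : Prop where
  lattices : E.lattices = {E.j.range.toAddSubgroup}
  injective : Function.Injective E.j
  complete : PComplete p R

variable (hE : E.Adic)
include hE

theorem LogRing.Adic.good : E.Good E.j.range where
  j_mem r := ⟨r, rfl⟩
  φ_mem := by
    rintro _ ⟨r, rfl⟩
    exact ⟨_, (E.φ_j r).symm⟩
  pinv := hE.complete.pInv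

theorem LogRing.Adic.nice : E.Nice where
  good L hL := by
    rw [hE.lattices] at hL
    exact ⟨E.j.range, hL.symm, hE.good⟩
  separated r hr := hE.complete.range_separated hE.injective fun n =>
    hr E.j.range (by rw [hE.lattices]; rfl) n

theorem LogRing.Adic.isComplete : E.Complete := by
  intro s hs
  obtain ⟨ℓ, hℓ⟩ := hE.complete.range_lim hE.injective s fun n =>
    hs E.j.range (by rw [hE.lattices]; rfl) n
  refine ⟨ℓ, fun L hL n => ?_⟩
  rw [hE.lattices] at hL
  obtain rfl := hL
  obtain ⟨N, hN⟩ := hℓ n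
  refine ⟨N, fun m hm => ?_⟩
  have := neg_mem (hN m hm)
  rwa [neg_sub] at this

theorem LogRing.Adic.matNil {n N : ℕ} {X : Matrix (Fin n) (Fin n) (S.RG c.ι)}
    (hX : ∀ i j, (p : S.RG c.ι) ∣ (X ^ N) i j) : E.MatNil X := by
  intro B hBl hB
  refine ⟨N, fun i j => ?_⟩
  obtain ⟨y, hy⟩ := hX i j
  refine ⟨E.mapRG y, fun _ => hB.j_mem _, ?_⟩
  rw [hy, map_mul, map_natCast, pow_one]

end Setup

/-! ### The completed localisation as coefficient ring -/

namespace Setup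

variable {p : ℕ} [Fact p.Prime] {𝒢 : Type*} [Group 𝒢] [TopologicalSpace 𝒢]
  [IsTopologicalGroup 𝒢] {S : Setup p 𝒢} {O : Type*} [CommRing O] [IsDomain O]
  {σ : O →+* O} (hp : Prime (p : O)) (hσ : ∀ a, (p : O) ∣ σ a - a ^ p)

include hp in
theorem hatRing_pComplete : PComplete p (S.HatRing O) :=
  PComp.pComplete (PLoc.torsionFree (iw_torsionFree hp.ne_zero))

include hp in
theorem hatRing_isUnit (x : S.HatRing O) (hx : ¬ (p : S.HatRing O) ∣ x) : IsUnit x :=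
  PComp.isUnit (PLoc.torsionFree (iw_torsionFree hp.ne_zero)) PLoc.isUnit x hx

theorem hatCoef_frob (x : S.HatRing O) : ∃ s, (S.hatCoef σ hp hσ).φ x = x ^ p + p * s := by
  refine PComp.map_frob (fun r => PLoc.map_frob _ (fun r => ?_) r) x
  obtain ⟨s, hs⟩ := iwCoef_frob hp.ne_zero hσ r
  exact ⟨s, by rw [hs, add_sub_cancel_left]⟩

theorem hatLog_adic : (S.hatLog σ hp hσ).Adic where
  lattices := rfl
  injective := by
    have hR := hatRing_pComplete (S := S) hp
    -- Integers prime to `p` are units and `p` is not a zero divisor. Thus the ring is torsion free,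
    -- hence flat, over `ℤ`, and embeds into its tensor product with `ℚ`.
    have h : Module.IsTorsionFree ℤ (S.HatRing O) := by
      refine Module.isTorsionFree_iff_smul_eq_zero.2 fun m x hmx => ?_
      refine or_iff_not_imp_left.2 fun hm => hR.eq_zero_of_nsmul (Int.natAbs_ne_zero.2 hm) ?_
      rcases Int.natAbs_eq m with h | h
      · rw [h, natCast_zsmul] at hmx
        exact hmx
      · rw [h, neg_smul, natCast_zsmul, neg_eq_zero] at hmx
        exact hmx
    have hf : Module.Flat ℤ (S.HatRing O) := inferInstance
    exact Algebra.TensorProduct.includeRight_injective (algebraMap ℤ ℚ).injective_int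
  complete := hatRing_pComplete hp

end Setup

/-! ### Elimination -/

section Elimination

variable {D M : Type*} [CommRing D] [CommGroup M]

theorem K1.mk_stab {A : Type*} [Ring A] {n m : ℕ} (h : n ≤ m) (g : GL (Fin n) A) :
    K1.mk (stab A n m h g) = K1.mk g :=
  congrArg Abelianization.of (DirectLimit.mk_apply (F := fun n : ℕ => GL (Fin n) A)
    (f := fun n m h => stab A n m h) n m g h)

theorem exists_isUnit_of_sum (hD : ∀ x y : D, IsUnit (x + y) → IsUnit x ∨ IsUnit y) {ι : Type*} (s : Finset ι) (f : ι → D) (h : IsUnit (∑ i ∈ s, f i)) :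
    (∃ i ∈ s, IsUnit (f i)) ∨ Subsingleton D := by
  induction s using Finset.induction_on with
  | empty => exact Or.inr (subsingleton_of_zero_eq_one (by simpa using h))
  | insert a s ha ih =>
    rw [Finset.sum_insert ha] at h
    rcases hD _ _ h with h | h
    · exact Or.inl ⟨a, by simp, h⟩
    · rcases ih h with ⟨i, hi, h⟩ | h
      · exact Or.inl ⟨i, by simp [hi], h⟩
      · exact Or.inr h

/-- Invertible block matrices. -/
abbrev BlockGL (n : ℕ) (D : Type*) [CommRing D] : Type _ :=
  (Matrix (Fin n ⊕ Fin 1) (Fin n ⊕ Fin 1) D)ˣ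

variable {n : ℕ}

/-- The block matrix `[1 x; 0 1]`. -/
def upBlock (x : Matrix (Fin n) (Fin 1) D) : BlockGL n D where
  val := Matrix.fromBlocks 1 x 0 1
  inv := Matrix.fromBlocks 1 (-x) 0 1
  val_inv := by simp [Matrix.fromBlocks_multiply]
  inv_val := by simp [Matrix.fromBlocks_multiply]

/-- The block matrix `[1 0; y 1]`. -/
def loBlock (y : Matrix (Fin 1) (Fin n) D) : BlockGL n D where
  val := Matrix.fromBlocks 1 0 y 1
  inv := Matrix.fromBlocks 1 0 (-y) 1
  val_inv := by simp [Matrix.fromBlocks_multiply]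
  inv_val := by simp [Matrix.fromBlocks_multiply]

theorem loBlock_mul_toBlocks (y : Matrix (Fin 1) (Fin n) D) (g : BlockGL n D) :
    (loBlock y * g).1.toBlocks₂₂ = y * g.1.toBlocks₁₂ + g.1.toBlocks₂₂ := by
  change (Matrix.fromBlocks 1 0 y 1 * g.1 :
    Matrix (Fin n ⊕ Fin 1) (Fin n ⊕ Fin 1) D).toBlocks₂₂ = _
  conv_lhs => rw [← Matrix.fromBlocks_toBlocks g.1]
  rw [Matrix.fromBlocks_multiply, Matrix.toBlocks_fromBlocks₂₂, Matrix.one_mul]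

theorem upBlock_mul_toBlocks (x : Matrix (Fin n) (Fin 1) D) (g : BlockGL n D) :
    (upBlock x * g).1.toBlocks₁₂ = g.1.toBlocks₁₂ + x * g.1.toBlocks₂₂ := by
  change (Matrix.fromBlocks 1 x 0 1 * g.1 :
    Matrix (Fin n ⊕ Fin 1) (Fin n ⊕ Fin 1) D).toBlocks₁₂ = _
  conv_lhs => rw [← Matrix.fromBlocks_toBlocks g.1]
  rw [Matrix.fromBlocks_multiply, Matrix.toBlocks_fromBlocks₁₂, Matrix.one_mul]

/-- The block matrix `[t 0; 0 1]`. -/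
def scBlock (n : ℕ) (t : Dˣ) : BlockGL n D where
  val := Matrix.fromBlocks ((t : D) • 1) 0 0 1
  inv := Matrix.fromBlocks ((↑t⁻¹ : D) • 1) 0 0 1
  val_inv := by simp [Matrix.fromBlocks_multiply, smul_smul]
  inv_val := by simp [Matrix.fromBlocks_multiply, smul_smul]

section

variable (t : Dˣ) (ht : IsUnit ((t : D) - 1)) (Ψ : BlockGL n D →* M)
include ht

/-- With `(t - 1) y = x`, the block `x` is the commutator of `diag (t, 1)` and the block `y`, so it
dies in a commutative group. A unit `t` with `t - 1` invertible gives this without enlarging the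
matrices. -/
theorem map_upBlock (x : Matrix (Fin n) (Fin 1) D) : Ψ (upBlock x) = 1 := by
  obtain ⟨s, hs⟩ := ht
  let y := (↑s⁻¹ : D) • x
  have e : scBlock n t * upBlock y = upBlock x * upBlock y * scBlock n t := by
    ext1
    have : (t : D) • y = x + y := by
      have h1 : ((t : D) - 1) • y = x := by rw [← hs, smul_smul, Units.mul_inv, one_smul]
      rw [← h1, sub_smul, one_smul, sub_add_cancel]
    simp [scBlock, upBlock, Matrix.fromBlocks_multiply, this, add_comm]
  have e2 := congrArg Ψ e
  rw [map_mul, map_mul, map_mul, mul_comm, mul_assoc] at e2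
  exact (right_eq_mul.1 e2)

theorem map_loBlock (x : Matrix (Fin 1) (Fin n) D) : Ψ (loBlock x) = 1 := by
  obtain ⟨s, hs⟩ := ht
  let y := (↑s⁻¹ : D) • x
  have e : loBlock y * scBlock n t = scBlock n t * (loBlock x * loBlock y) := by
    ext1
    have : (t : D) • y = x + y := by
      have h1 : ((t : D) - 1) • y = x := by rw [← hs, smul_smul, Units.mul_inv, one_smul]
      rw [← h1, sub_smul, one_smul, sub_add_cancel]
    simp [scBlock, loBlock, Matrix.fromBlocks_multiply, this, add_comm]
  have e2 := congrArg Ψ e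
  rw [map_mul, map_mul, map_mul, mul_comm, mul_right_inj] at e2
  exact (right_eq_mul.1 e2)

/-- A block matrix with lower right entry `1`. -/
theorem exists_block_of_one (g : BlockGL n D) (hg : g.1.toBlocks₂₂ = 1) :
    ∃ (A : GL (Fin n) D) (g' : BlockGL n D), g'.1 = Matrix.fromBlocks A.1 0 0 1 ∧ Ψ g = Ψ g' := by
  let b := g.1.toBlocks₁₂
  let c := g.1.toBlocks₂₁
  let a := g.1.toBlocks₁₁
  let g' := upBlock (-b) * g * loBlock (-c)
  have e : g'.1 = Matrix.fromBlocks (a - b * c) 0 0 1 := by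
    change (Matrix.fromBlocks 1 (-b) 0 1 * g.1 * Matrix.fromBlocks 1 0 (-c) 1 :
      Matrix (Fin n ⊕ Fin 1) (Fin n ⊕ Fin 1) D) = _
    rw [← Matrix.fromBlocks_toBlocks g.1, hg]
    simp [Matrix.fromBlocks_multiply, a, b, c, sub_eq_add_neg]
  have hu : IsUnit (a - b * c) := by
    rw [Matrix.isUnit_iff_isUnit_det]
    have := (Matrix.isUnit_iff_isUnit_det g'.1).1 g'.isUnit
    rwa [e, Matrix.det_fromBlocks_zero₂₁, Matrix.det_one, mul_one] at this
  obtain ⟨A, hA⟩ := hu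
  refine ⟨A, g', by rw [e, hA], ?_⟩
  rw [map_mul, map_mul, map_upBlock t ht Ψ, map_loBlock t ht Ψ, one_mul, mul_one]

variable (hD : ∀ x y : D, IsUnit (x + y) → IsUnit x ∨ IsUnit y)
include hD

theorem exists_block (hn : 0 < n) (g : BlockGL n D) :
    ∃ (A : GL (Fin n) D) (g' : BlockGL n D), g'.1 = Matrix.fromBlocks A.1 0 0 1 ∧ Ψ g = Ψ g' := by
  have key : ∀ (g : BlockGL n D) (i : Fin n), IsUnit (g.1.toBlocks₁₂ i 0) →
      ∃ (A : GL (Fin n) D) (g' : BlockGL n D),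
        g'.1 = Matrix.fromBlocks A.1 0 0 1 ∧ Ψ g = Ψ g' := by
    intro g i hi
    obtain ⟨v, hv⟩ := hi
    let y : Matrix (Fin 1) (Fin n) D := Matrix.of fun _ j =>
      if j = i then (1 - g.1.toBlocks₂₂ 0 0) * ↑v⁻¹ else 0
    obtain ⟨A, g', h1, h2⟩ := exists_block_of_one t ht Ψ (loBlock y * g) (by
      rw [loBlock_mul_toBlocks]
      ext r s
      obtain rfl : r = 0 := Subsingleton.elim _ _
      obtain rfl : s = 0 := Subsingleton.elim _ _
      rw [Matrix.add_apply, Matrix.mul_apply, Finset.sum_eq_single i]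
      · simp [y, ← hv]
      · intro j _ hj
        simp [y, hj]
      · simp)
    exact ⟨A, g', h1, by rw [← h2, map_mul, map_loBlock t ht Ψ, one_mul]⟩
  -- The product `g⁻¹ g` has corner entry `1`, a sum of products with the entries of the last
  -- column; locality makes one of these entries a unit.
  have hcol : IsUnit (∑ i, (↑g⁻¹ : Matrix (Fin n ⊕ Fin 1) (Fin n ⊕ Fin 1) D) (Sum.inr 0) i *
      g.1 i (Sum.inr 0)) := by
    rw [← Matrix.mul_apply, Units.inv_mul, Matrix.one_apply_eq]
    exact isUnit_one
  rcases exists_isUnit_of_sum hD _ _ hcol with ⟨i, -, hi⟩ | h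
  · have hi := isUnit_of_mul_isUnit_right hi
    rcases i with i | i
    · exact key g i hi
    · obtain rfl : i = 0 := Subsingleton.elim _ _
      obtain ⟨v, hv⟩ := hi
      have hv' : (v : D) = g.1.toBlocks₂₂ 0 0 := hv
      -- If the known unit is the corner entry, this operation puts `1` into the upper part of the
      -- column, which is nonempty by `hn`, and reduces to the other case.
      let x : Matrix (Fin n) (Fin 1) D := Matrix.of fun j _ =>
        (1 - g.1.toBlocks₁₂ j 0) * ↑v⁻¹
      obtain ⟨A, g', h1, h2⟩ := key (upBlock x * g) ⟨0, hn⟩ (by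
        rw [upBlock_mul_toBlocks, Matrix.add_apply, Matrix.mul_apply, Fin.sum_univ_one, ← hv']
        simp [x])
      exact ⟨A, g', h1, by rw [← h2, map_mul, map_upBlock t ht Ψ, one_mul]⟩
  · exact key g ⟨0, hn⟩ (isUnit_of_subsingleton _)

end

theorem stabMat_castAdd (A : Matrix (Fin n) (Fin n) D) (i j : Fin n) :
    stabMat n (n + 1) A (Fin.castAdd 1 i) (Fin.castAdd 1 j) = A i j := by
  rw [stabMat, Matrix.add_apply, Matrix.mul_apply, Finset.sum_eq_single j]
  · rw [Matrix.mul_apply, Finset.sum_eq_single i]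
    · simp [incl, Matrix.one_apply, Fin.ext_iff]
    · intro b _ hb
      have : (i : ℕ) ≠ b := fun e => hb (Fin.ext e.symm)
      simp [incl, this]
    · simp
  · intro b _ hb
    have : (b : ℕ) ≠ j := fun e => hb (Fin.ext e)
    simp [incl, this]
  · simp

theorem stabMat_succ (A : Matrix (Fin n) (Fin n) D) : stabMat n (n + 1) A =
    Matrix.reindex finSumFinEquiv finSumFinEquiv (Matrix.fromBlocks A 0 0 1) := by
  have hl : ∀ (k : Fin n) (i : Fin 1), (k : ℕ) ≠ n + i := fun k i => by
    have := k.2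
    omega
  ext i j
  obtain ⟨i, rfl⟩ := finSumFinEquiv.surjective i
  obtain ⟨j, rfl⟩ := finSumFinEquiv.surjective j
  rw [Matrix.reindex_apply, Matrix.submatrix_apply, Equiv.symm_apply_apply, Equiv.symm_apply_apply]
  rcases i with i | i <;> rcases j with j | j
  · exact stabMat_castAdd A i j
  · have h1 : ∀ x, (incl D n (n + 1)) x (Fin.natAdd n j) = 0 := fun x => by
      simp only [incl, Matrix.of_apply, Fin.val_natAdd]
      exact if_neg (hl _ _)
    simp only [finSumFinEquiv_apply_left, finSumFinEquiv_apply_right, Matrix.fromBlocks_apply₁₂,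
      stabMat, Matrix.add_apply, Matrix.mul_apply, h1, mul_zero, Finset.sum_const_zero, add_zero,
      Matrix.zero_apply]
    exact Matrix.one_apply_ne fun e => hl i j (congrArg Fin.val e)
  · have h1 : ∀ x, (incl D (n + 1) n) (Fin.natAdd n i) x = 0 := fun x => by
      simp only [incl, Matrix.of_apply, Fin.val_natAdd]
      exact if_neg (hl _ _).symm
    simp only [finSumFinEquiv_apply_left, finSumFinEquiv_apply_right, Matrix.fromBlocks_apply₂₁,
      stabMat, Matrix.add_apply, Matrix.mul_apply, h1, zero_mul, Finset.sum_const_zero, add_zero,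
      Matrix.zero_apply]
    exact Matrix.one_apply_ne fun e => hl j i (congrArg Fin.val e).symm
  · have h1 : ∀ x, (incl D (n + 1) n) (Fin.natAdd n i) x = 0 := fun x => by
      simp only [incl, Matrix.of_apply, Fin.val_natAdd]
      exact if_neg (hl _ _).symm
    obtain rfl : i = j := Subsingleton.elim _ _
    simp only [finSumFinEquiv_apply_right, Matrix.fromBlocks_apply₂₂,
      stabMat, Matrix.add_apply, Matrix.mul_apply, h1, zero_mul, Finset.sum_const_zero, add_zero,
      Matrix.one_apply_eq]

theorem map_stabMat {A B : Type*} [Ring A] [Ring B] (f : A →+* B) (n m : ℕ)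
    (a : Matrix (Fin n) (Fin n) A) : (stabMat n m a).map f = stabMat n m (a.map f) := by
  have h1 : ∀ k l, (incl A k l).map f = incl B k l := by
    intro k l
    ext i j
    simp only [incl, Matrix.map_apply, Matrix.of_apply]
    split_ifs <;> simp
  rw [stabMat, Matrix.map_add f (map_add f), Matrix.map_mul, Matrix.map_mul, h1, h1,
    Matrix.map_sub f (map_sub f), Matrix.map_one f (map_zero f) (map_one f),
    Matrix.map_one f (map_zero f) (map_one f)]
  rfl

/-- Homomorphisms from the groups `GLₙ(D)` to a commutative group which are compatible with
stabilisation are determined by their restriction to the units. -/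
theorem exists_unit_of_stab (t : Dˣ) (ht : IsUnit ((t : D) - 1))
    (hD : ∀ x y : D, IsUnit (x + y) → IsUnit x ∨ IsUnit y) (ψ : ∀ n, GL (Fin n) D →* M)
    (hψ : ∀ n g, ψ (n + 1) (stab D n (n + 1) (Nat.le_succ n) g) = ψ n g) (n : ℕ)
    (g : GL (Fin n) D) : ∃ d : Dˣ, ψ n g = ψ 1 (Units.map
      (Matrix.scalar (Fin 1) : D →+* Matrix (Fin 1) (Fin 1) D).toMonoidHom d) := by
  induction n with
  | zero =>
    refine ⟨1, ?_⟩
    rw [map_one, map_one, Subsingleton.elim g 1, map_one]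
  | succ n ih =>
    rcases Nat.eq_zero_or_pos n with rfl | hn
    · have hg : IsUnit (g.1 0 0) := by
        have := (Matrix.isUnit_iff_isUnit_det g.1).1 g.isUnit
        rwa [Matrix.det_fin_one] at this
      obtain ⟨d, hd⟩ := hg
      refine ⟨d, congrArg (ψ 1) ?_⟩
      ext i j
      obtain rfl : i = 0 := Subsingleton.elim (α := Fin 1) _ _
      obtain rfl : j = 0 := Subsingleton.elim (α := Fin 1) _ _
      change g.1 0 0 = Matrix.scalar (Fin 1) (d : D) 0 0
      rw [← hd]
      simp
    · let e : Matrix (Fin n ⊕ Fin 1) (Fin n ⊕ Fin 1) D ≃+* Matrix (Fin (n + 1)) (Fin (n + 1)) D :=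
        Matrix.reindexRingEquiv D finSumFinEquiv
      let E : BlockGL n D ≃* GL (Fin (n + 1)) D := Units.mapEquiv e.toMulEquiv
      obtain ⟨A, g', h1, h2⟩ := exists_block t ht ((ψ (n + 1)).comp E.toMonoidHom) hD hn (E.symm g)
      obtain ⟨d, hd⟩ := ih A
      refine ⟨d, ?_⟩
      rw [← hd, ← hψ n A]
      have h3 : E g' = stab D n (n + 1) (Nat.le_succ n) A := by
        ext1
        change Matrix.reindex finSumFinEquiv finSumFinEquiv g'.1 = stabMat n (n + 1) A.1
        rw [h1, stabMat_succ]
      rw [← h3]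
      have h4 : ψ (n + 1) (E (E.symm g)) = ψ (n + 1) (E g') := h2
      rw [E.apply_symm_apply] at h4
      exact h4

end Elimination

/-! ### Twisted group rings over `p`-adically complete coefficients -/

theorem PComplete.twGrp {p : ℕ} {G R : Type*} [Group G] [Finite G] [CommRing R] {τ : Cocycle G R}
    (h : PComplete p R) : PComplete p (TwGrp τ) := by
  have := Fintype.ofFinite G
  have hmul : ∀ (n : ℕ) (x : TwGrp τ) (g : G), ((p : TwGrp τ) ^ n * x) g = (p : R) ^ n * x g := by
    intro n x g
    rw [← Nat.cast_pow, TwGrp.natCast_mul_apply, Nat.cast_pow]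
  have hdvd : ∀ (n : ℕ) (x : TwGrp τ), (p : TwGrp τ) ^ n ∣ x ↔ ∀ g, (p : R) ^ n ∣ x g := by
    intro n x
    constructor
    · rintro ⟨y, rfl⟩ g
      exact ⟨y g, hmul n y g⟩
    · intro hx
      choose y hy using hx
      exact ⟨(y : G → R), TwGrp.ext fun g => (hy g).trans (hmul n y g).symm⟩
  refine ⟨fun r hr => ?_, fun r hr => ?_, fun s hs => ?_⟩
  · ext g
    refine h.torsionFree _ ?_
    have := TwGrp.natCast_mul_apply p r g
    rw [hr] at this
    exact this.symm
  · ext g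
    exact h.separated _ fun n => (hdvd n r).1 (hr n) g
  · have h1 : ∀ g, ∃ r, ∀ n, ∃ N, ∀ m ≥ N, (p : R) ^ n ∣ s m g - r := by
      intro g
      refine h.lim (fun m => s m g) fun n => ?_
      obtain ⟨N, hN⟩ := hs n
      exact ⟨N, fun m hm => (hdvd n _).1 (hN m hm) g⟩
    choose r hr using h1
    refine ⟨(r : G → R), fun n => ?_⟩
    choose N hN using fun g => hr g n
    refine ⟨∑ g, N g, fun m hm => (hdvd n _).2 fun g => ?_⟩
    exact hN g m ((Finset.single_le_sum (fun _ _ => Nat.zero_le _) (Finset.mem_univ g)).trans hm)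

theorem TwGrp.induction_single {G R : Type*} [Group G] [Finite G] [CommRing R] {τ : Cocycle G R}
    {C : TwGrp τ → Prop} (h0 : C 0) (ha : ∀ x y, C x → C y → C (x + y))
    (hs : ∀ g r, C (TwGrp.single τ g r)) (x : TwGrp τ) : C x := by
  have := Fintype.ofFinite G
  rw [TwGrp.eq_sum_single x]
  exact Finset.sum_induction _ C ha h0 fun g _ => hs g _

namespace Setup

variable {p : ℕ} [Fact p.Prime] {𝒢 : Type*} [Group 𝒢] [TopologicalSpace 𝒢] {S : Setup p 𝒢}

/-! ### The projection to `Γ` -/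

/-- Replacing a distinguished lift by its `Γ`-part does not change `π`, so the result is
distinguished. Hence the projection to `Γ` respects factor sets, and `gammaRet` is a ring
homomorphism. -/
theorem lift_projGamma (g : S.G) : S.lift (S.projGamma g) = S.s (S.π (S.lift g)) := by
  have e : S.projGamma g = QuotientGroup.mk (S.s (S.π (S.lift g))) := by
    conv_lhs => rw [← S.mk_lift g]
    rfl
  obtain ⟨k, hk, hπ⟩ := S.π_lift_lt g
  rw [e, S.lift_mk hk]
  rw [S.π_s, hπ]

theorem projGamma_mem (g : S.G) : S.projGamma g ∈ S.gammaBar.1 := by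
  rw [← S.mk_lift g]
  exact ⟨S.π (S.lift g), rfl⟩

theorem projGamma_of_mem {g : S.G} (hg : g ∈ S.gammaBar.1) : S.projGamma g = g := by
  obtain ⟨z, rfl⟩ := hg
  change (QuotientGroup.mk (S.s (S.π (S.s z))) : S.G) = QuotientGroup.mk (S.s z)
  rw [S.π_s]

theorem factorSet_projGamma (g h : S.G) :
    S.factorSet (S.projGamma g) (S.projGamma h) = S.factorSet g h := by
  ext1
  have h1 := S.s_π_of_mem_Z (S.factorSet g h).2
  have h2 : (S.factorSet g h : 𝒢) = S.lift g * S.lift h * (S.lift (g * h))⁻¹ := rfl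
  rw [← h1, h2]
  change S.lift (S.projGamma g) * S.lift (S.projGamma h) *
    (S.lift (S.projGamma g * S.projGamma h))⁻¹ = _
  rw [← map_mul, lift_projGamma, lift_projGamma, lift_projGamma]
  simp only [map_mul, map_inv]

variable {R : Type*} [CommRing R] (ι : S.Z →* Rˣ)

/-- The retraction `R[G]^τ → R[Γ / Γ^(p^e)]^τ`. -/
def gammaRet : S.RG ι →+* S.RP ι S.gammaBar :=
  TwGrp.liftHom (TwGrp.C _) (fun g => TwGrp.single _ ⟨S.projGamma g, projGamma_mem g⟩ 1)
    (fun r g => mul_comm _ _)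
    (by
      have : (⟨S.projGamma 1, projGamma_mem 1⟩ : S.gammaBar.1) = 1 := Subtype.ext (map_one _)
      rw [this]
      rfl)
    (fun g h => by
      rw [TwGrp.single_mul_single, TwGrp.C_mul_single]
      have : (⟨S.projGamma (g * h), projGamma_mem (g * h)⟩ : S.gammaBar.1) =
        ⟨S.projGamma g, projGamma_mem g⟩ * ⟨S.projGamma h, projGamma_mem h⟩ :=
        Subtype.ext (map_mul _ _ _)
      rw [this]
      congr 1
      rw [one_mul, one_mul, mul_one]
      change (ι (S.factorSet (S.projGamma g) (S.projGamma h)) : R) = ι (S.factorSet g h)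
      rw [factorSet_projGamma])

theorem gammaRet_single (g : S.G) (r : R) : gammaRet ι (TwGrp.single _ g r) =
    TwGrp.single _ ⟨S.projGamma g, projGamma_mem g⟩ r := by
  refine (TwGrp.liftHom_single _ _ _ _ _ g r).trans ?_
  rw [TwGrp.C_mul_single, mul_one]

theorem gammaRet_apply [Fintype S.G] (a : S.RG ι) (k : S.gammaBar.1) :
    gammaRet ι a k = ∑ g : S.G, if S.projGamma g = k then a g else 0 := by
  conv_lhs => rw [TwGrp.eq_sum_single a, map_sum]
  rw [TwGrp.sum_apply]
  refine Finset.sum_congr rfl fun g _ => ?_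
  rw [gammaRet_single, TwGrp.single_apply]
  by_cases hk : S.projGamma g = k
  · rw [if_pos hk, if_pos (Subtype.ext hk.symm)]
  · rw [if_neg hk, if_neg fun e => hk (congrArg Subtype.val e).symm]

theorem mem_augKer {a : S.RG ι} : a ∈ S.augKer ι ↔ gammaRet ι a = 0 := by
  have := Fintype.ofFinite S.G
  constructor
  · intro h
    ext k
    rw [gammaRet_apply, ← finsum_eq_sum_of_fintype]
    exact h k
  · intro h k
    rw [finsum_eq_sum_of_fintype]
    by_cases hk : k ∈ S.gammaBar.1
    · rw [← gammaRet_apply ι a ⟨k, hk⟩, h]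
      rfl
    · refine Finset.sum_eq_zero fun g _ => if_neg ?_
      rintro rfl
      exact hk (projGamma_mem g)

theorem gammaRet_ofSubgroup (y : S.RP ι S.gammaBar) :
    gammaRet ι (TwGrp.ofSubgroup (S.cocycle ι) S.gammaBar.1 y) = y := by
  induction y using TwGrp.induction_single with
  | h0 => simp
  | ha x y hx hy => rw [map_add, map_add, hx, hy]
  | hs g r =>
    refine (congrArg (gammaRet ι) (TwGrp.ofSubgroup_single S.gammaBar.1 g r)).trans ?_
    rw [gammaRet_single]
    congr 1
    exact Subtype.ext (projGamma_of_mem g.2)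

/-! ### Nilpotency of `J` modulo `p` -/

/-- Elements of `H` are their own distinguished lifts, so `τ` is trivial on `H` and `h ↦ h̄` is
multiplicative. -/
theorem lift_mk_ker {h : 𝒢} (hh : h ∈ S.π.ker) : S.lift (QuotientGroup.mk h) = h := by
  refine S.lift_mk (k := 0) (pow_pos (Fact.out : p.Prime).pos _) ?_
  rw [(MonoidHom.mem_ker).1 hh]
  simp

instance finite_ker_π : Finite S.π.ker := S.finite_ker

/-- The homomorphism `H → R[G]^τ`, `h ↦ h̄`. -/
def kerHom : S.π.ker →* S.RG ι where
  toFun h := TwGrp.single _ (QuotientGroup.mk (h : 𝒢)) 1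
  map_one' := rfl
  map_mul' h h' := by
    rw [TwGrp.single_mul_single]
    have : S.factorSet (QuotientGroup.mk (h : 𝒢)) (QuotientGroup.mk (h' : 𝒢)) = 1 := by
      ext1
      change S.lift _ * S.lift _ * (S.lift (QuotientGroup.mk ((h : 𝒢) * h')))⁻¹ = 1
      rw [lift_mk_ker h.2, lift_mk_ker h'.2, lift_mk_ker (mul_mem h.2 h'.2), mul_inv_cancel]
    change _ = TwGrp.single _ (QuotientGroup.mk ((h : 𝒢) * h')) (1 * 1 * (ι (S.factorSet _ _) : R))
    rw [this, map_one]
    simp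

theorem kerHom_apply (h : S.π.ker) :
    kerHom ι h = TwGrp.single _ (QuotientGroup.mk (h : 𝒢)) 1 := rfl

variable [Algebra (ZMod p) (S.RG ι)]

/-- Normality of `H` gives `(h̄ - 1) ḡ = ḡ (h̄' - 1)` with `h' = g̃⁻¹ h g̃`, so the left ideal
generated by the `h̄ - 1` is two-sided. -/
theorem kerHom_mul_mem (h : S.π.ker) (a : S.RG ι) :
    (kerHom ι h - 1) * a ∈ augSub (p := p) (kerHom ι) := by
  induction a using TwGrp.induction_single with
  | h0 => rw [mul_zero]; exact zero_mem _
  | ha x y hx hy => rw [mul_add]; exact add_mem hx hy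
  | hs g r =>
    have hk : (S.lift g)⁻¹ * h * S.lift g ∈ S.π.ker := by
      have := (inferInstance : S.π.ker.Normal).conj_mem h h.2 (S.lift g)⁻¹
      rwa [inv_inv] at this
    have e : (kerHom ι h - 1) * TwGrp.single _ g r =
        TwGrp.single _ g r * (kerHom ι ⟨_, hk⟩ - 1) := by
      rw [sub_mul, mul_sub, one_mul, mul_one, kerHom_apply, kerHom_apply, TwGrp.single_mul_single,
        TwGrp.single_mul_single]
      congr 1
      have e1 : (QuotientGroup.mk ((S.lift g)⁻¹ * h * S.lift g) : S.G) =
          g⁻¹ * QuotientGroup.mk (h : 𝒢) * g := by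
        rw [QuotientGroup.mk_mul, QuotientGroup.mk_mul, QuotientGroup.mk_inv, S.mk_lift]
      rw [e1]
      have e2 : g * (g⁻¹ * QuotientGroup.mk (h : 𝒢) * g) = QuotientGroup.mk (h : 𝒢) * g := by group
      rw [e2]
      congr 1
      change 1 * r * (ι (S.factorSet _ _) : R) = r * 1 * (ι (S.factorSet _ _) : R)
      rw [S.factorSet_conj, one_mul, mul_one]
    rw [e]
    exact mul_sub_one_mem_augSub _ _ _

/-- Each `ḡ` is the product, without twist, of the symbol of its projection to `Γ` and of an `h̄`
with `h ∈ H`; so an element differs from its retraction by terms in the ideal generated by the `h̄ -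
1`. -/
theorem mem_augSub_of_gammaRet (a : S.RG ι) (ha : gammaRet ι a = 0) :
    a ∈ augSub (p := p) (kerHom ι) := by
  have h1 : ∀ a : S.RG ι, a - TwGrp.ofSubgroup (S.cocycle ι) S.gammaBar.1 (gammaRet ι a) ∈
      augSub (p := p) (kerHom ι) := by
    intro a
    induction a using TwGrp.induction_single with
    | h0 => rw [map_zero, map_zero, sub_zero]; exact zero_mem _
    | ha x y hx hy => rw [map_add, map_add, add_sub_add_comm]; exact add_mem hx hy
    | hs g r =>
      have hk : (S.lift (S.projGamma g))⁻¹ * S.lift g ∈ S.π.ker := by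
        rw [MonoidHom.mem_ker, map_mul, map_inv, lift_projGamma, S.π_s, inv_mul_cancel]
      have := mul_sub_one_mem_augSub (p := p) (kerHom ι) (TwGrp.single _ (S.projGamma g) r) ⟨_, hk⟩
      refine (congrArg (· ∈ augSub (p := p) (kerHom ι)) ?_).mp this
      rw [mul_sub, mul_one, kerHom_apply, TwGrp.single_mul_single, gammaRet_single]
      refine congrArg₂ _ ?_ (TwGrp.ofSubgroup_single (τ := S.cocycle ι) S.gammaBar.1
        ⟨S.projGamma g, projGamma_mem g⟩ r).symm
      have e1 : (QuotientGroup.mk ((S.lift (S.projGamma g))⁻¹ * S.lift g) : S.G) =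
          (S.projGamma g)⁻¹ * g := by
        rw [QuotientGroup.mk_mul, QuotientGroup.mk_inv, S.mk_lift, S.mk_lift]
      have e2 : S.factorSet (S.projGamma g)
          (QuotientGroup.mk ((S.lift (S.projGamma g))⁻¹ * S.lift g)) = 1 := by
        ext1
        change S.lift _ * S.lift _ * (S.lift _)⁻¹ = 1
        rw [lift_mk_ker hk, e1, mul_inv_cancel_left, mul_inv_cancel_left, mul_inv_cancel]
      change TwGrp.single _ (_ * _) (r * 1 * (ι (S.factorSet _ _) : R)) = _
      rw [e2, e1, map_one, mul_inv_cancel_left]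
      simp
  have := h1 a
  rwa [ha, map_zero, sub_zero] at this

end Setup

theorem TwGrp.dvd_of_forall_dvd {G R : Type*} [Group G] [Finite G] [CommRing R] {τ : Cocycle G R}
    {k : ℕ} {x : TwGrp τ} (h : ∀ g, (k : R) ∣ x g) : (k : TwGrp τ) ∣ x := by
  choose y hy using h
  exact ⟨(y : G → R), TwGrp.ext fun g => (hy g).trans (TwGrp.natCast_mul_apply k _ g).symm⟩

namespace Setup

variable {p : ℕ} [Fact p.Prime] {𝒢 : Type*} [Group 𝒢] [TopologicalSpace 𝒢] {S : Setup p 𝒢}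
  {R : Type*} [CommRing R]

/-- Modulo `p`, the kernel `J` of `R[G]^τ → R[Γ / Γ^(p^e)]^τ` is nilpotent. -/
theorem exists_matrix_pow_dvd (ι : S.Z →* Rˣ) : ∃ N : ℕ, ∀ {n : ℕ}
    (M : Matrix (Fin n) (Fin n) (S.RG ι)), (∀ i j, M i j ∈ S.augKer ι) →
      ∀ i j, (p : S.RG ι) ∣ (M ^ N) i j := by
  let I := Ideal.span {(p : R)}
  let ι' : S.Z →* (R ⧸ I)ˣ := (Units.map (Ideal.Quotient.mk I).toMonoidHom).comp ι
  let f : S.RG ι →+* S.RG ι' := TwGrp.mapCoef (Ideal.Quotient.mk I) fun _ _ => rfl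
  have hp0 : (p : S.RG ι') = 0 := by
    ext g
    have h0 : (p : R ⧸ I) = 0 := by
      rw [← map_natCast (Ideal.Quotient.mk I), Ideal.Quotient.eq_zero_iff_mem]
      exact Ideal.subset_span rfl
    have := TwGrp.natCast_mul_apply p (1 : S.RG ι') g
    rw [mul_one, h0, zero_mul] at this
    exact this
  obtain ⟨r, hr⟩ := CharP.exists (S.RG ι')
  let _ : Algebra (ZMod p) (S.RG ι') := ZMod.algebra' _ r ((CharP.cast_eq_zero_iff _ r p).1 hp0)
  obtain ⟨N, hN⟩ := exists_matrix_pow_eq_zero S.isPGroup_ker (kerHom ι') (kerHom_mul_mem ι')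
  refine ⟨N, fun {n} M hM i j => ?_⟩
  have h1 := hN (f.mapMatrix M) fun i j => mem_augSub_of_gammaRet ι' _ (by
    have e : gammaRet ι' (f (M i j)) = TwGrp.mapCoef (Ideal.Quotient.mk I) (fun _ _ => rfl)
        (gammaRet ι (M i j)) := by
      generalize M i j = a
      induction a using TwGrp.induction_single with
      | h0 => simp
      | ha x y hx hy => simp only [map_add, hx, hy]
      | hs g r =>
        refine (congrArg (gammaRet ι') (TwGrp.mapCoef_single _ _ g r)).trans ?_
        rw [gammaRet_single, gammaRet_single]
        exact (TwGrp.mapCoef_single _ _ _ r).symm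
    exact e.trans (by rw [(mem_augKer ι).1 (hM i j), map_zero]))
  rw [← map_pow] at h1
  have h2 : f ((M ^ N) i j) = 0 := congrFun (congrFun h1 i) j
  refine TwGrp.dvd_of_forall_dvd fun g => ?_
  rw [← Ideal.mem_span_singleton, ← Ideal.Quotient.eq_zero_iff_mem]
  exact congrFun h2 g

/-! ### Powers in `R[P]^τ` -/

/-- The element `g̃ ^ m * (g ^ m)~⁻¹` of `Γ^(p^e)`. -/
def liftPow (g : S.G) (m : ℕ) : S.Z :=
  ⟨S.lift g ^ m * (S.lift (g ^ m))⁻¹,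
    S.mem_Z_of_mk_eq (by rw [QuotientGroup.mk_pow, S.mk_lift, S.mk_lift])⟩

theorem liftPow_succ (g : S.G) (m : ℕ) :
    liftPow g (m + 1) = liftPow g m * S.factorSet (g ^ m) g := by
  ext1
  change S.lift g ^ (m + 1) * (S.lift (g ^ (m + 1)))⁻¹ = S.lift g ^ m * (S.lift (g ^ m))⁻¹ *
    (S.lift (g ^ m) * S.lift g * (S.lift (g ^ m * g))⁻¹)
  rw [pow_succ g, pow_succ (S.lift g)]
  group

theorem single_pow (ι : S.Z →* Rˣ) {P : S.Cyc} (g : P.1) (r : R) (m : ℕ) :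
    (TwGrp.single ((S.cocycle ι).restrict P.1) g r : S.RP ι P) ^ m =
      TwGrp.single _ (g ^ m) (r ^ m * (ι (liftPow (g : S.G) m) : R)) := by
  induction m with
  | zero =>
    have : liftPow (g : S.G) 0 = 1 := by ext1; simp [liftPow, S.lift_one]
    rw [this, map_one, pow_zero, pow_zero, pow_zero, Units.val_one, mul_one]
    rfl
  | succ m ih =>
    rw [pow_succ, ih, TwGrp.single_mul_single, liftPow_succ, map_mul, Units.val_mul, pow_succ g,
      pow_succ r]
    congr 1
    change _ * _ * (ι (S.factorSet ((g : S.G) ^ m) g) : R) = _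
    ring

/-- Both sides are additive modulo `p`, and on `r ḡ` the claim reduces to `φ(r) ≡ r ^ p`, since `φ`
sends `ḡ` exactly to `ḡ ^ p`. It makes `y ^ p / φ(y)` congruent to `1` modulo `p`. -/
theorem frob_congr (c : S.Coef R) (hφ : ∀ r, ∃ s, c.φ r = r ^ p + p * s) (P : S.Cyc)
    (x : S.RP c.ι P) : ∃ y, c.frob P x = x ^ p + p * y := by
  induction x using TwGrp.induction_single with
  | h0 => exact ⟨0, by rw [map_zero, zero_pow (Fact.out : p.Prime).ne_zero, mul_zero, add_zero]⟩
  | ha x y hx hy =>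
    obtain ⟨a, ha⟩ := hx
    obtain ⟨b, hb⟩ := hy
    obtain ⟨d, hd⟩ := exists_add_pow_prime_eq (Fact.out : p.Prime) x y
    refine ⟨a + b - x * y * d, ?_⟩
    rw [map_add, ha, hb, hd]
    ring
  | hs g r =>
    obtain ⟨s, hs⟩ := hφ r
    refine ⟨TwGrp.single _ (g ^ p) (s * (c.ι (S.powZ (g : S.G)) : R)), ?_⟩
    refine (ver_single c P P _ g r).trans ?_
    rw [single_pow, ← map_natCast (TwGrp.C ((S.cocycle c.ι).restrict P.1)), TwGrp.C_mul_single,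
      ← TwGrp.single_add, hs]
    refine congrArg (TwGrp.single ((S.cocycle c.ι).restrict P.1) (g ^ p)) ?_
    change _ = r ^ p * (c.ι (S.powZ (g : S.G)) : R) + _
    ring

/-- For `x` in `R[P]^τ`, with `P` of order `p ^ N`, the element `x ^ (p ^ N)` is congruent to a
scalar modulo `p`. -/
theorem exists_pow_eq_C_add (ι : S.Z →* Rˣ) {P : S.Cyc} {N : ℕ} (hN : ∀ g : P.1, g ^ p ^ N = 1)
    (x : S.RP ι P) : ∃ (r : R) (y : S.RP ι P),
      x ^ p ^ N = TwGrp.C ((S.cocycle ι).restrict P.1) r + p * y := by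
  induction x using TwGrp.induction_single with
  | h0 => exact ⟨0, 0, by
      rw [map_zero, zero_pow (pow_ne_zero _ (Fact.out : p.Prime).ne_zero), mul_zero, add_zero]⟩
  | ha x y hx hy =>
    obtain ⟨r, a, ha⟩ := hx
    obtain ⟨s, b, hb⟩ := hy
    obtain ⟨d, hd⟩ := exists_add_pow_prime_pow_eq (Fact.out : p.Prime) x y N
    refine ⟨r + s, a + b + x * y * d, ?_⟩
    rw [hd, ha, hb, map_add]
    ring
  | hs g r =>
    refine ⟨r ^ p ^ N * (ι (liftPow (g : S.G) (p ^ N)) : R), 0, ?_⟩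
    rw [single_pow, hN, mul_zero, add_zero]
    rfl

theorem exists_pow_eq_one (P : S.Cyc) : ∃ N : ℕ, ∀ g : P.1, g ^ p ^ N = 1 := by
  have h : IsPGroup p P.1 := S.isPGroup_G.to_subgroup P.1
  obtain ⟨N, hN⟩ := (IsPGroup.iff_card).1 h
  exact ⟨N, fun g => by rw [← hN, pow_card_eq_one']⟩

section

variable (hR : PComplete p R) {ι : S.Z →* Rˣ} {P : S.Cyc} {N : ℕ}

theorem subsingleton_of_isUnit_p (hD : PComplete p (S.RP ι P)) (h : IsUnit (p : S.RP ι P)) :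
    Subsingleton (S.RP ι P) := by
  obtain ⟨u, hu⟩ := h
  have := hD.isUnit_one_add (-↑u⁻¹)
  rw [← hu, mul_neg, Units.mul_inv, add_neg_cancel, isUnit_zero_iff] at this
  exact subsingleton_of_zero_eq_one this

include hR in
/-- A unit of `R[P]^τ` is, up to taking a power, the product of a scalar and of a unit which is
congruent to `1` modulo `p`. -/
theorem pow_dvd_or_exists_units (hloc : ∀ r : R, ¬ (p : R) ∣ r → IsUnit r)
    (hN : ∀ g : P.1, g ^ p ^ N = 1) (x : S.RP ι P) :
    (p : S.RP ι P) ∣ x ^ p ^ N ∨ ∃ (r : Rˣ) (v : (S.RP ι P)ˣ),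
      (∃ w, (v : S.RP ι P) = 1 + p * w) ∧ 
      x ^ p ^ N = TwGrp.C ((S.cocycle ι).restrict P.1) (r : R) * v := by
  obtain ⟨r, y, hy⟩ := exists_pow_eq_C_add ι hN x
  by_cases hr : (p : R) ∣ r
  · left
    rw [hy]
    refine dvd_add ?_ (dvd_mul_right _ _)
    have := map_dvd (TwGrp.C ((S.cocycle ι).restrict P.1)) hr
    rwa [map_natCast] at this
  · right
    obtain ⟨u, rfl⟩ := hloc r hr
    obtain ⟨v, hv⟩ := (PComplete.twGrp hR : PComplete p (S.RP ι P)).isUnit_one_add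
      (TwGrp.C _ ((↑u⁻¹ : R)) * y)
    refine ⟨u, v, ⟨_, hv⟩, ?_⟩
    rw [hv, hy, mul_add, mul_one, mul_left_comm, ← mul_assoc (TwGrp.C _ (u : R)), ← map_mul,
      Units.mul_inv, map_one, one_mul]

-- An element which is not a unit has its `p ^ N`-th power divisible by `p`, and this power is
-- additive modulo `p`. If neither summand of a unit were a unit, `p` would be invertible and the
-- ring would be zero.
include hR in
theorem isUnit_or_isUnit_of_add (hloc : ∀ r : R, ¬ (p : R) ∣ r → IsUnit r) (x y : S.RP ι P)
    (h : IsUnit (x + y)) : IsUnit x ∨ IsUnit y := by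
  obtain ⟨N, hN⟩ := exists_pow_eq_one P
  have hq : p ^ N ≠ 0 := pow_ne_zero _ (Fact.out : p.Prime).ne_zero
  have key : ∀ x : S.RP ι P, IsUnit x ∨ (p : S.RP ι P) ∣ x ^ p ^ N := by
    intro x
    rcases pow_dvd_or_exists_units hR hloc hN x with h | ⟨r, v, -, h⟩
    · exact Or.inr h
    · left
      rw [← isUnit_pow_iff hq, h]
      exact (r.isUnit.map _).mul v.isUnit
  rcases key x with hx | hx
  · exact Or.inl hx
  rcases key y with hy | hy
  · exact Or.inr hy
  obtain ⟨d, hd⟩ := exists_add_pow_prime_pow_eq (Fact.out : p.Prime) x y N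
  have h1 : IsUnit (p : S.RP ι P) := by
    refine isUnit_of_dvd_unit ?_ (h.pow (p ^ N))
    rw [hd, mul_assoc, mul_assoc]
    exact dvd_add (dvd_add hx hy) (dvd_mul_right _ _)
  have := subsingleton_of_isUnit_p (PComplete.twGrp hR) h1
  exact Or.inl (isUnit_of_subsingleton x)

include hR in
theorem exists_units_pow_eq (hloc : ∀ r : R, ¬ (p : R) ∣ r → IsUnit r)
    (hN : ∀ g : P.1, g ^ p ^ N = 1) (x : (S.RP ι P)ˣ) : ∃ (r : Rˣ) (v : (S.RP ι P)ˣ),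
      (∃ w, (v : S.RP ι P) = 1 + p * w) ∧
      x ^ p ^ N = Units.map (TwGrp.C ((S.cocycle ι).restrict P.1)).toMonoidHom r * v := by
  rcases pow_dvd_or_exists_units hR hloc hN (x : S.RP ι P) with h | ⟨r, v, hv, h⟩
  · have h1 : IsUnit (p : S.RP ι P) := isUnit_of_dvd_unit h (x.isUnit.pow _)
    have := subsingleton_of_isUnit_p (PComplete.twGrp hR) h1
    exact ⟨1, 1, ⟨0, Subsingleton.elim _ _⟩, Units.ext (Subsingleton.elim _ _)⟩
  · exact ⟨r, v, hv, Units.ext h⟩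

end

end Setup

namespace Setup

variable {p : ℕ} [Fact p.Prime] {𝒢 : Type*} [Group 𝒢] [TopologicalSpace 𝒢] {S : Setup p 𝒢}

/-! ### The decomposition `x = u y` -/

section

variable [IsTopologicalGroup 𝒢]

theorem exists_notMem_openNormal (S : Setup p 𝒢) :
    ∃ (z : S.Z) (U : OpenNormalSubgroup S.Z), z ∉ U.toSubgroup := by
  have hdiv : ∀ (n : ℕ) (x : ℤ_[p]), (p : ℤ_[p]) ^ n ∣ x ↔ ‖x‖ ≤ (p : ℝ) ^ (-n : ℤ) := fun n x => by
    rw [PadicInt.norm_le_pow_iff_mem_span_pow, Ideal.mem_span_singleton]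
  let V0 : Subgroup S.Z :=
    { carrier := {z | (p : ℤ_[p]) ^ (S.e + 1) ∣ (S.π z).toAdd}
      mul_mem' := fun {a b} ha hb => by
        rw [Set.mem_ofPred_eq, Subgroup.coe_mul, map_mul, toAdd_mul]; exact dvd_add ha hb
      one_mem' := by simp
      inv_mem' := fun {a} ha => by
        rw [Set.mem_ofPred_eq, Subgroup.coe_inv, map_inv, toAdd_inv]; exact (dvd_neg).2 ha }
  have hV0 : IsOpen (V0 : Set S.Z) := by
    have hc : Continuous fun z : S.Z => (S.π z).toAdd :=
      continuous_toAdd.comp (S.continuous_π.comp continuous_subtype_val)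
    have := (IsUltrametricDist.isOpen_closedBall (0 : ℤ_[p])
      (r := (p : ℝ) ^ (-(S.e + 1 : ℕ) : ℤ)) (zpow_pos (by
        exact_mod_cast (Fact.out : p.Prime).pos) _).ne').preimage hc
    convert this using 1
    ext z
    simp only [Set.mem_preimage, mem_closedBall_zero_iff]
    exact hdiv _ _
  refine ⟨⟨S.s (Multiplicative.ofAdd 1 ^ p ^ S.e), S.mem_Z.2 ⟨_, rfl⟩⟩,
    { toSubgroup := V0, isOpen' := hV0,
      isNormal' := ⟨fun n hn g => by rwa [mul_comm' g n, mul_inv_cancel_right]⟩ }, ?_⟩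
  intro h
  change (p : ℤ_[p]) ^ (S.e + 1) ∣ (S.π (S.s _)).toAdd at h
  have hp0 : (p : ℤ_[p]) ≠ 0 := by exact_mod_cast (Fact.out : p.Prime).ne_zero
  rw [S.π_s, toAdd_pow, toAdd_ofAdd, nsmul_one, Nat.cast_pow, pow_succ] at h
  have h2 := (mul_dvd_mul_iff_left (pow_ne_zero S.e hp0)).1 (h.trans (dvd_of_eq (mul_one _).symm))
  exact PadicInt.prime_p.not_isUnit (isUnit_of_dvd_one h2)

variable {O : Type*} [CommRing O] [IsDomain O] {σ : O →+* O} (hp : Prime (p : O))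
  (hσ : ∀ a, (p : O) ∣ σ a - a ^ p)

/-- For `z` outside an open subgroup `U`, the element `z - 1` has the coefficient `1` at level `U`,
so `p` does not divide it and the localisation inverts it. This provides the scalar needed in the
elimination. -/
theorem exists_isUnit_hat_sub_one :
    ∃ z : S.Z, IsUnit (((S.hatCoef σ hp hσ).ι z : S.HatRing O) - 1) := by
  obtain ⟨z, U, hz⟩ := exists_notMem_openNormal S
  refine ⟨z, ?_⟩
  have h1 : ¬ (p : Iw O S.Z) ∣ (Iw.of O z : Iw O S.Z) - 1 := by
    rintro ⟨y, hy⟩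
    have h := congrArg (fun a => (Iw.proj U a).coeff (QuotientGroup.mk z)) hy
    simp only [map_sub, map_mul, map_natCast, map_one, Iw.natCast_mul_coeff, Iw.proj_of] at h
    refine hp.not_isUnit (isUnit_of_dvd_one ⟨_, Eq.trans ?_ h⟩)
    rw [MonoidAlgebra.one_def, MonoidAlgebra.coeff_sub, Finsupp.sub_apply,
      MonoidAlgebra.coeff_single, MonoidAlgebra.coeff_single, Finsupp.single_apply,
      Finsupp.single_apply, if_pos rfl, if_neg, sub_zero]
    intro e
    exact hz ((QuotientGroup.eq_one_iff z).1 e.symm)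
  have h2 : IsUnit (algebraMap (Iw O S.Z) (PLoc p (Iw O S.Z)) ((Iw.of O z : Iw O S.Z) - 1)) :=
    IsLocalization.map_units (M := Submonoid.closure {t : Iw O S.Z | ¬ (p : Iw O S.Z) ∣ t}) _
      ⟨_, Submonoid.subset_closure h1⟩
  have h3 := h2.map (algebraMap (PLoc p (Iw O S.Z)) (PComp p (PLoc p (Iw O S.Z))))
  rw [map_sub, map_sub, map_one, map_one] at h3
  exact h3

end

variable {R : Type*} [CommRing R]

/-- The homomorphism `R[P]^τˣ → K₁(R[G]^τ)`. -/
def unitHom (ι : S.Z →* Rˣ) (P : S.Cyc) : (S.RP ι P)ˣ →* K1 (S.RG ι) :=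
  MonoidHom.mk' (fun y => K1.ofUnit
    (Units.map (TwGrp.ofSubgroup (S.cocycle ι) P.1).toMonoidHom y)) fun a b => by
      rw [map_mul, K1.ofUnit, map_mul, K1.mk_mul]
      rfl

theorem unitHom_eq (ι : S.Z →* Rˣ) (P : S.Cyc) (y : (S.RP ι P)ˣ) : unitHom ι P y =
    K1.ofUnit (Units.map (TwGrp.ofSubgroup (S.cocycle ι) P.1).toMonoidHom y) := rfl

/-- Dividing a matrix `g` by its image `k` under the retraction to `R[Γ/Γ^(p^e)]^τ` gives a matrix
congruent to `1` modulo `J`; elimination over this local ring shows that `k` has the same class in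
`K₁` as a unit. -/
theorem exists_decomposition (hR : PComplete p R) (hloc : ∀ r : R, ¬ (p : R) ∣ r → IsUnit r)
    {ι : S.Z →* Rˣ} (ht : ∃ z, IsUnit ((ι z : R) - 1)) (x : K1 (S.RG ι)) :
    ∃ (n : ℕ) (u : GL (Fin n) (S.RG ι)) (y : (S.RP ι S.gammaBar)ˣ),
      (∀ i j, (u.1 - 1) i j ∈ S.augKer ι) ∧ K1.mk u * unitHom ι S.gammaBar y = x := by
  obtain ⟨n, g, rfl⟩ := K1.exists_mk x
  obtain ⟨z, hz⟩ := ht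
  let f := TwGrp.ofSubgroup (S.cocycle ι) S.gammaBar.1
  let ψ : ∀ n, GL (Fin n) (S.RP ι S.gammaBar) →* K1 (S.RG ι) := fun n =>
    MonoidHom.mk' (fun g => K1.mk (Units.map f.mapMatrix.toMonoidHom g)) fun a b => by
      rw [map_mul, K1.mk_mul]
  let t : (S.RP ι S.gammaBar)ˣ :=
    Units.map (TwGrp.C ((S.cocycle ι).restrict S.gammaBar.1)).toMonoidHom (ι z)
  have ht : IsUnit ((t : S.RP ι S.gammaBar) - 1) := by
    have := hz.map (TwGrp.C ((S.cocycle ι).restrict S.gammaBar.1))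
    rw [map_sub, map_one] at this
    exact this
  let h : GL (Fin n) (S.RP ι S.gammaBar) := Units.map (gammaRet ι).mapMatrix.toMonoidHom g
  obtain ⟨d, hd⟩ := exists_unit_of_stab t ht (isUnit_or_isUnit_of_add hR hloc) ψ (fun n g => by
    have : Units.map f.mapMatrix.toMonoidHom (stab _ n (n + 1) (Nat.le_succ n) g) =
        stab _ n (n + 1) (Nat.le_succ n) (Units.map f.mapMatrix.toMonoidHom g) :=
      Units.ext (map_stabMat f n (n + 1) g.1)
    refine Eq.trans (congrArg K1.mk this) (K1.mk_stab _ _)) n h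
  let k : GL (Fin n) (S.RG ι) := Units.map f.mapMatrix.toMonoidHom h
  refine ⟨n, g * k⁻¹, d, fun i j => ?_, ?_⟩
  · rw [mem_augKer]
    have hk : Units.map (gammaRet ι).mapMatrix.toMonoidHom k = h := by
      ext1
      refine Matrix.ext fun i j => ?_
      exact gammaRet_ofSubgroup ι (h.1 i j)
    have h1 : Units.map (gammaRet ι).mapMatrix.toMonoidHom (g * k⁻¹) = 1 := by
      rw [map_mul, map_inv, hk]
      exact mul_inv_cancel h
    have h1' : ((g * k⁻¹).1.map (gammaRet ι) : Matrix (Fin n) (Fin n) (S.RP ι S.gammaBar)) = 1 :=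
      congrArg Units.val h1
    have h2 : gammaRet ι ((g * k⁻¹).1 i j) =
        (1 : Matrix (Fin n) (Fin n) (S.RP ι S.gammaBar)) i j := by
      rw [← h1', Matrix.map_apply]
    rw [Matrix.sub_apply, map_sub, h2, sub_eq_zero, Matrix.one_apply, Matrix.one_apply]
    split_ifs <;> simp
  · have h1 : unitHom ι S.gammaBar d = K1.mk k := by
      refine Eq.trans ?_ hd.symm
      rw [unitHom_eq, K1.ofUnit]
      refine congrArg K1.mk (Units.ext (Matrix.ext fun i j => ?_))
      obtain rfl : i = j := Subsingleton.elim _ _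
      change Matrix.scalar (Fin 1) (f d) i i = f (Matrix.scalar (Fin 1) (d : S.RP ι S.gammaBar) i i)
      simp
    rw [h1, ← K1.mk_mul, inv_mul_cancel_right]

end Setup

namespace Setup

variable {p : ℕ} [Fact p.Prime] {𝒢 : Type*} [Group 𝒢] [TopologicalSpace 𝒢] {S : Setup p 𝒢}

/-! ### The image of `R[P]^τ` in `R[Conj(G)]^τ` -/

section Conj

variable {R : Type*} [CommRing R]

theorem toConj_single (τ : Cocycle S.G R) (g : S.G) (r : R) (d : ConjClasses S.G) :
    S.toConj (TwGrp.single τ g r) d = if ConjClasses.mk g = d then r else 0 := by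
  have := Fintype.ofFinite S.G
  refine (finsum_eq_sum_of_fintype _).trans ?_
  rw [Finset.sum_eq_single g]
  · rw [TwGrp.single_apply, if_pos rfl]
  · intro h _ hh
    rw [TwGrp.single_apply, if_neg hh, ite_self]
  · simp

theorem cycToConj_single (ι : S.Z →* Rˣ) (P : S.Cyc) (g : P.1) (r : R) :
    S.cycToConj P (TwGrp.single ((S.cocycle ι).restrict P.1) g r : S.RP ι P) =
      S.toConj (TwGrp.single (S.cocycle ι) (g : S.G) r) :=
  congrArg S.toConj (TwGrp.ofSubgroup_single P.1 g r)

theorem cycToConj_apply (ι : S.Z →* Rˣ) (P : S.Cyc) [Fintype P.1] (b : S.RP ι P)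
    (d : ConjClasses S.G) :
    S.cycToConj P b d = ∑ g : P.1, if ConjClasses.mk (g : S.G) = d then b g else 0 := by
  have h : cycHom ι P b = ∑ g : P.1, cycHom ι P (TwGrp.single _ g (b g)) := by
    rw [← map_sum, ← TwGrp.eq_sum_single]
  refine (congrFun h d).trans ?_
  rw [Finset.sum_apply]
  exact Finset.sum_congr rfl fun g _ =>
    (congrFun (cycToConj_single ι P g (b g)) d).trans (toConj_single _ _ _ _)

theorem frobConj_cycToConj (c : S.Coef R) (P : S.Cyc) (b : S.RP c.ι P) :
    S.frobConj c (S.cycToConj P b) = S.cycToConj P (c.frob P b) := by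
  have := Fintype.ofFinite (ConjClasses S.G)
  change frobConjHom c (cycHom c.ι P b) = cycHom c.ι P (c.frob P b)
  induction b using TwGrp.induction_single with
  | h0 => simp only [map_zero]
  | ha x y hx hy => simp only [map_add, hx, hy]
  | hs g r =>
    have e1 : cycHom c.ι P (TwGrp.single _ g r) = S.toConj (TwGrp.single (S.cocycle c.ι) g r) :=
      cycToConj_single c.ι P g r
    have e2 : cycHom c.ι P (c.frob P (TwGrp.single _ g r)) = S.toConj (TwGrp.single (S.cocycle c.ι)
        ((g : S.G) ^ p) (c.φ r * (c.ι (S.powZ (g : S.G)) : R))) :=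
      (congrArg (cycHom c.ι P) (ver_single c P P _ g r)).trans (cycToConj_single c.ι P _ _)
    rw [e1, e2]
    funext d
    rw [toConj_single]
    refine (finsum_eq_sum_of_fintype _).trans ?_
    rw [Finset.sum_eq_single (ConjClasses.mk (g : S.G))]
    · have hg : IsConj (Quotient.out (ConjClasses.mk (g : S.G)) : S.G) (g : S.G) := by
        rw [← ConjClasses.mk_eq_mk_iff_isConj]; exact Quotient.out_eq _
      have hp : ConjClasses.mk ((Quotient.out (ConjClasses.mk (g : S.G)) : S.G) ^ p) =
          ConjClasses.mk ((g : S.G) ^ p) := by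
        rw [ConjClasses.mk_eq_mk_iff_isConj]
        exact hg.pow p
      rw [hp, toConj_single, if_pos rfl, S.powZ_eq_of_isConj hg]
    · intro k _ hk
      rw [toConj_single, if_neg (Ne.symm hk), map_zero, zero_mul, ite_self]
    · simp

end Conj

/-! ### Scalars -/

section Scalar

variable {R : Type*} [CommRing R]

theorem regRep_C (ι : S.Z →* Rˣ) (P : S.Cyc) [Fintype (S.G ⧸ P.1)] (r : R) :
    TwGrp.regRep (S.cocycle ι) P.1 (TwGrp.C _ r) =
      Matrix.diagonal fun _ => TwGrp.C ((S.cocycle ι).restrict P.1) r := by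
  ext1 i j
  have h1 : TwGrp.ofSubgroup (S.cocycle ι) P.1 (TwGrp.C ((S.cocycle ι).restrict P.1) r) =
      TwGrp.C (S.cocycle ι) r := TwGrp.ofSubgroup_single (τ := S.cocycle ι) P.1 1 r
  change TwGrp.coord P.1 (TwGrp.single (S.cocycle ι) (TwGrp.rep P.1 i) 1 * TwGrp.C _ r) j = _
  rw [TwGrp.single_mul_C, mul_comm, ← TwGrp.C_mul_single, ← h1, TwGrp.coord_mul,
    TwGrp.coord_single_rep, Matrix.diagonal_apply]
  split_ifs
  · rw [mul_one]
  · rw [mul_zero]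

theorem tr_toConj_C [Algebra ℚ R] (ι : S.Z →* Rˣ) (P : S.Cyc) (r : R) :
    S.tr ι P (S.toConj (TwGrp.C (S.cocycle ι) r)) =
      Nat.card (S.G ⧸ P.1) • TwGrp.C ((S.cocycle ι).restrict P.1) r := by
  have := Fintype.ofFinite (S.G ⧸ P.1)
  have := Fintype.ofFinite S.G
  rw [← S.trace_regRep, regRep_C, Matrix.trace_diagonal, Finset.sum_const, Finset.card_univ,
    Nat.card_eq_fintype_card]

/-- A scalar is supported at `1̄`, and `1` generates `P` only if `P` is trivial. -/
theorem beta_toConj_C [Algebra ℚ R] (ι : S.Z →* Rˣ) (P : S.Cyc) (r : R) :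
    S.beta ι P (S.toConj (TwGrp.C (S.cocycle ι) r)) =
      if P.1 = ⊥ then Nat.card (S.G ⧸ P.1) • TwGrp.C ((S.cocycle ι).restrict P.1) r else 0 := by
  rw [beta, tr_toConj_C]
  split_ifs with hP
  · exact eta_bot hP _
  · ext g
    rw [eta_apply]
    by_cases hg : Subgroup.zpowers g = ⊤
    · rw [if_pos hg, TwGrp.nsmul_apply, TwGrp.C_apply, if_neg, smul_zero]
      · rfl
      · rintro rfl
        rw [Subgroup.zpowers_one_eq_bot] at hg
        refine hP (le_bot_iff.1 fun x hx => ?_)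
        have : (⟨x, hx⟩ : P.1) ∈ (⊥ : Subgroup P.1) := hg ▸ Subgroup.mem_top _
        exact congrArg Subtype.val (Subgroup.mem_bot.1 this)
    · rw [if_neg hg]
      rfl

/-- The scalar units of `R[P]^τ`. -/
def unitC (ι : S.Z →* Rˣ) (P : S.Cyc) : Rˣ →* (S.RP ι P)ˣ :=
  Units.map (TwGrp.C ((S.cocycle ι).restrict P.1)).toMonoidHom

theorem unitC_val (ι : S.Z →* Rˣ) (P : S.Cyc) (r : Rˣ) :
    (unitC ι P r : S.RP ι P) = TwGrp.C ((S.cocycle ι).restrict P.1) (r : R) := rfl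

variable (c : S.Coef R)

theorem theta_unitHom_C (P Q : S.Cyc) (r : Rˣ) :
    c.theta (RingEquiv.refl _) P (unitHom c.ι Q (unitC c.ι Q r)) =
      unitC c.ι P r ^ Nat.card (S.G ⧸ P.1) := by
  have := Fintype.ofFinite (S.G ⧸ P.1)
  ext1
  rw [unitHom_eq, K1.ofUnit, theta_mk, Units.val_pow_eq_pow_val, unitC_val]
  have h1 : TwGrp.ofSubgroup (S.cocycle c.ι) Q.1 (TwGrp.C ((S.cocycle c.ι).restrict Q.1) (r : R)) =
      TwGrp.C (S.cocycle c.ι) (r : R) := TwGrp.ofSubgroup_single (τ := S.cocycle c.ι) Q.1 1 (r : R)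
  have h2 : matRep c.ι P 1 ((Matrix.scalar (Fin 1) (TwGrp.C (S.cocycle c.ι) (r : R))).map
      (RingEquiv.refl (S.RG c.ι))) =
      Matrix.diagonal fun _ => TwGrp.C ((S.cocycle c.ι).restrict P.1) (r : R) := by
    ext1 i j
    have hij : i.1 = j.1 := Subsingleton.elim _ _
    rw [matRep_apply, Matrix.map_apply, ← hij, Matrix.scalar_apply, Matrix.diagonal_apply_eq]
    refine (congrFun (congrFun (regRep_C c.ι P (r : R)) i.2) j.2).trans ?_
    rw [Matrix.diagonal_apply, Matrix.diagonal_apply]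
    exact if_congr ⟨fun h => Prod.ext hij h, fun h => congrArg Prod.snd h⟩ rfl rfl
  refine Eq.trans ?_ ((congrArg Matrix.det h2).trans ?_)
  · refine congrArg (fun a => (matRep c.ι P 1 ((Matrix.scalar (Fin 1) a).map
      (RingEquiv.refl (S.RG c.ι)))).det) h1
  · rw [Matrix.det_diagonal, Finset.prod_const, Finset.card_univ, Fintype.card_prod,
      Fintype.card_fin, one_mul, Nat.card_eq_fintype_card]

theorem gradNorm_C {ι : S.Z →* Rˣ} {P : S.Cyc} (ω : P.1 →* Multiplicative (ZMod p)) (r : R) :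
    gradNorm ι ω (TwGrp.C ((S.cocycle ι).restrict P.1) r) =
      TwGrp.C ((S.cocycle ι).restrict P.1) r ^ p := by
  have h : gradRep ι ω (TwGrp.C ((S.cocycle ι).restrict P.1) r) =
      Matrix.diagonal fun _ => TwGrp.C ((S.cocycle ι).restrict P.1) r := by
    ext i j g
    change part ω (i - j) _ g = _
    rw [part_apply, Matrix.diagonal_apply, TwGrp.C_apply]
    by_cases hij : i = j
    · subst hij
      rw [sub_self, if_pos rfl, TwGrp.C_apply]
      split_ifs with h1 h2 h2
      · rfl
      · rfl
      · subst h2; simp at h1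
      · rfl
    · rw [if_neg hij]
      split_ifs with h1 h2
      · subst h2
        refine absurd h1.symm ?_
        rw [map_one, toAdd_one, sub_eq_zero]
        exact hij
      · rfl
      · rfl
  rw [gradNorm_apply, h, Matrix.det_diagonal, Finset.prod_const, Finset.card_univ, ZMod.card]

theorem alphaHom_C {P : S.Cyc} (ω : P.1 →* Multiplicative (ZMod p)) (r : Rˣ) :
    c.alphaHom ω (unitC c.ι P r) =
      if P.1 = ⊥ then unitC c.ι P (r ^ p / Units.map c.φ.toMonoidHom r) else 1 := by
  have h := alphaHom_mul c ω (unitC c.ι P r)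
  split_ifs at h ⊢ with hP
  · rw [map_div, eq_div_iff_mul_eq', map_pow]
    ext1
    refine Eq.trans ?_ h
    exact congrArg ((c.alphaHom ω (unitC c.ι P r) : S.RP c.ι P) * ·) (frob_C c P (r : R)).symm
  · rw [unitC_val, gradNorm_C] at h
    have h2 : c.alphaHom ω (unitC c.ι P r) * unitC c.ι P r ^ p = unitC c.ι P r ^ p := Units.ext h
    exact mul_eq_right.1 h2

/-- For `C ≠ 1` a scalar has norm `r ^ p` along the character, so `α_C` is trivial on it. The
subgroups above `P` are nontrivial, so `u_P` is trivial as well. -/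
theorem xi_C (ω : ∀ P : S.Cyc, P.1 →* Multiplicative (ZMod p)) (P : S.Cyc) (r : Rˣ)
    (k : S.Cyc → ℕ) :
    c.xi ω P (fun C => unitC c.ι C r ^ k C) =
      if P.1 = ⊥ then unitC c.ι P (r ^ p / Units.map c.φ.toMonoidHom r) ^ k P else 1 := by
  have := Fintype.ofFinite (Cyc.Above P)
  have h1 : c.uHom P (fun C => c.alphaHom (ω C) (unitC c.ι C r ^ k C)) = 1 := by
    rw [uHom_apply]
    refine Finset.prod_eq_one fun P' _ => ?_
    have hP' : P'.1.1 ≠ ⊥ := by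
      intro h
      apply P'.2.2
      apply Subtype.ext
      rw [h]
      apply SetLike.coe_injective
      rw [← P'.2.1, h]
      simp
    rw [map_pow, alphaHom_C, if_neg hP', one_pow, map_one]
  have h2 : c.xi ω P (fun C => unitC c.ι C r ^ k C) = c.alphaHom (ω P) (unitC c.ι P r ^ k P) /
      c.uHom P (fun C => c.alphaHom (ω C) (unitC c.ι C r ^ k C)) := rfl
  rw [h2, h1, div_one, map_pow, alphaHom_C]
  split_ifs
  · rfl
  · exact one_pow _

end Scalar

end Setup

namespace Setup

variable {p : ℕ} [Fact p.Prime] {𝒢 : Type*} [Group 𝒢] [TopologicalSpace 𝒢] {S : Setup p 𝒢}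
  {R R' : Type*} [CommRing R] [CommRing R'] [Algebra ℚ R'] {c : S.Coef R} {E : LogRing c R'}

/-! ### Rules for logarithms -/

section Rules

variable (hE : E.Nice) {P : S.Cyc}
include hE

theorem LogRing.Nice.hasLog_mul {x y : S.RP c.ι P} {a b : S.RP E.coef.ι P}
    (hx : ∃ z, x = 1 + p * z) (hy : ∃ z, y = 1 + p * z) (ha : E.HasLog x a) (hb : E.HasLog y b) :
    E.HasLog (x * y) (a + b) := by
  rw [hE.hasLog_iff] at ha hb ⊢
  intro B hBl hB
  rw [map_mul]
  exact (ha B hBl hB).mul (hB.pinv_sub P) (hB.topUni_of_congr hx) (hB.topUni_of_congr hy)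
    (hb B hBl hB)

theorem LogRing.Nice.hasLog_pow {x : S.RP c.ι P} {a : S.RP E.coef.ι P}
    (hx : ∃ z, x = 1 + p * z) (ha : E.HasLog x a) (k : ℕ) : E.HasLog (x ^ k) (k • a) := by
  rw [hE.hasLog_iff] at ha ⊢
  intro B hBl hB
  rw [map_pow]
  exact (ha B hBl hB).pow (hB.pinv_sub P) (hB.topUni_of_congr hx) k

theorem LogRing.Nice.hasLog_root {x : S.RP c.ι P} {a : S.RP E.coef.ι P} {k : ℕ} (hk : k ≠ 0)
    (hx : ∃ z, x = 1 + p * z) (ha : E.HasLog (x ^ k) (k • a)) : E.HasLog x a := by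
  rw [hE.hasLog_iff] at ha ⊢
  intro B hBl hB
  have := ha B hBl hB
  rw [map_pow] at this
  exact LogTo.root (hB.pinv_sub P) hk (hB.topUni_of_congr hx) this

theorem LogRing.Nice.hasLog_one : E.HasLog (1 : S.RP c.ι P) 0 := by
  rw [hE.hasLog_iff]
  intro B hBl hB
  rw [map_one]
  exact logTo_one

theorem LogRing.Nice.hasLog_frob {x : S.RP c.ι P} {a : S.RP E.coef.ι P} (ha : E.HasLog x a) :
    E.HasLog (c.frob P x) (E.coef.frob P a) := by
  rw [hE.hasLog_iff] at ha ⊢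
  intro B hBl hB
  have e : E.mapRP P (c.frob P x) = E.coef.frob P (E.mapRP P x) := mapRP_ver E P P _ _
  rw [e]
  exact (ha B hBl hB).map _ (hB.ver_mem P P _)

theorem LogRing.Nice.hasLog_div {x y : (S.RP c.ι P)ˣ} {a b : S.RP E.coef.ι P}
    (hx : ∃ z, (x : S.RP c.ι P) = 1 + p * z) (hy : ∃ z, (y : S.RP c.ι P) = 1 + p * z)
    (ha : E.HasLog (x : S.RP c.ι P) a) (hb : E.HasLog (y : S.RP c.ι P) b) :
    E.HasLog ((x / y : (S.RP c.ι P)ˣ) : S.RP c.ι P) (a - b) := by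
  have hxy := mem_oneUnits.1 (div_mem (mem_oneUnits.2 hx) (mem_oneUnits.2 hy))
  rw [hE.hasLog_iff] at ha hb ⊢
  intro B hBl hB
  refine LogTo.of_mul (hB.pinv_sub P) (hB.topUni_of_congr hy) (hB.topUni_of_congr hxy)
    (hb B hBl hB) ?_
  rw [← map_mul, ← Units.val_mul, mul_div_cancel]
  exact ha B hBl hB

end Rules

/-! ### Convergence -/

theorem LogRing.TendsTo.zero : E.TendsTo (fun _ => 0) 0 :=
  fun L _ _ => ⟨0, fun _ _ => ⟨0, L.zero_mem, by simp⟩⟩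

theorem LogRing.TendsTo.add {s t : ℕ → R'} {a b : R'} (hs : E.TendsTo s a) (ht : E.TendsTo t b) :
    E.TendsTo (fun m => s m + t m) (a + b) := by
  intro L hL n
  obtain ⟨N, hN⟩ := hs L hL n
  obtain ⟨N', hN'⟩ := ht L hL n
  refine ⟨N + N', fun m hm => ?_⟩
  obtain ⟨r, hr, h⟩ := hN m (by omega)
  obtain ⟨r', hr', h'⟩ := hN' m (by omega)
  exact ⟨r + r', L.add_mem hr hr', by rw [add_sub_add_comm, h, h', mul_add]⟩

theorem LogRing.TendsTo.sum {I : Type*} (t : Finset I) {s : I → ℕ → R'} {a : I → R'}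
    (h : ∀ i, E.TendsTo (s i) (a i)) : E.TendsTo (fun m => ∑ i ∈ t, s i m) (∑ i ∈ t, a i) := by
  induction t using Finset.induction_on with
  | empty => simpa using LogRing.TendsTo.zero
  | insert i t hi ih =>
    simp only [Finset.sum_insert hi]
    exact (h i).add ih

theorem hasLog_C_iff (P Q : S.Cyc) (r : R) {a : S.RP E.coef.ι P}
    (h : E.HasLog (TwGrp.C ((S.cocycle c.ι).restrict P.1) r : S.RP c.ι P) a) :
    E.HasLog (TwGrp.C ((S.cocycle c.ι).restrict Q.1) r : S.RP c.ι Q)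
      (TwGrp.C ((S.cocycle E.coef.ι).restrict Q.1) (a 1)) := by
  have e : ∀ (P : S.Cyc) (i : ℕ) (g : P.1),
      ((TwGrp.C ((S.cocycle c.ι).restrict P.1) r - 1 : S.RP c.ι P) ^ i) g =
        if g = 1 then (r - 1) ^ i else 0 := by
    intro P i g
    rw [← map_one (TwGrp.C ((S.cocycle c.ι).restrict P.1)), ← map_sub, ← map_pow, TwGrp.C_apply]
    by_cases hg : g = 1
    · rw [if_pos hg, if_pos hg]
    · rw [if_neg hg, if_neg hg]
  intro g
  have h1 := h 1
  simp only [e, if_true] at h1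
  simp only [e, TwGrp.C_apply]
  split_ifs
  · exact h1
  · simpa using LogRing.TendsTo.zero

theorem hasTrLog_ofSubgroup {P : S.Cyc} {x : S.RP c.ι P} {a : S.RP E.coef.ι P}
    (h : E.HasLog x a) :
    E.HasTrLog (Matrix.scalar (Fin 1) (TwGrp.ofSubgroup (S.cocycle c.ι) P.1 x))
      (S.cycToConj P a) := by
  have := Fintype.ofFinite P.1
  intro d
  have e1 : ∀ i : ℕ, S.toConj (Matrix.trace ((Matrix.scalar (Fin 1)
      (TwGrp.ofSubgroup (S.cocycle c.ι) P.1 x) - 1) ^ i)) d =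
      ∑ g : P.1, if ConjClasses.mk (g : S.G) = d then ((x - 1) ^ i) g else 0 := by
    intro i
    rw [← cycToConj_apply c.ι P]
    refine congrFun (congrArg S.toConj ?_) d
    rw [← map_one (Matrix.scalar (Fin 1)), ← map_sub, ← map_pow,
      ← map_one (TwGrp.ofSubgroup (S.cocycle c.ι) P.1), ← map_sub, ← map_pow]
    simp
  simp only [e1]
  rw [cycToConj_apply]
  have e2 : ∀ m : ℕ, ∑ i ∈ Finset.Icc 1 m, ((-1) ^ (i + 1) / (i : ℚ)) •
      E.j (∑ g : P.1, if ConjClasses.mk (g : S.G) = d then ((x - 1) ^ i) g else 0) =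
      ∑ g : P.1, if ConjClasses.mk (g : S.G) = d then
        ∑ i ∈ Finset.Icc 1 m, ((-1) ^ (i + 1) / (i : ℚ)) • E.j (((x - 1) ^ i) g) else 0 := by
    intro m
    simp only [map_sum, Finset.smul_sum]
    rw [Finset.sum_comm]
    refine Finset.sum_congr rfl fun g _ => ?_
    split_ifs
    · rfl
    · simp
  simp only [e2]
  refine LogRing.TendsTo.sum _ fun g => ?_
  split_ifs
  · exact h g
  · exact LogRing.TendsTo.zero

/-! ### The formula for the units of `R[P]^τ` -/

/-- The homomorphism `x ↦ α_P(θ_P(x)) / u_P(α(θ(x)))` on `K₁(R[G]^τ)`. -/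
def Coef.xiTheta (c : S.Coef R) (ω : ∀ P : S.Cyc, P.1 →* Multiplicative (ZMod p)) (P : S.Cyc) :
    K1 (S.RG c.ι) →* (S.RP c.ι P)ˣ :=
  (c.xi ω P).comp (MonoidHom.pi fun C => c.theta (RingEquiv.refl _) C)

theorem xiTheta_apply (ω : ∀ P : S.Cyc, P.1 →* Multiplicative (ZMod p)) (P : S.Cyc)
    (x : K1 (S.RG c.ι)) :
    c.xiTheta ω P x = c.xi ω P fun C => c.theta (RingEquiv.refl _) C x := rfl

variable (hE : E.Nice) (hR : ∀ r : R, (p : R) * r = 0 → r = 0)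
  (hφ : ∀ r, ∃ s, c.φ r = r ^ p + p * s) (ω : ∀ P : S.Cyc, P.1 →* Multiplicative (ZMod p))
  (hω : ∀ P : S.Cyc, P.1 ≠ ⊥ → ω P ≠ 1)

theorem unitC_div_congr (hφ : ∀ r, ∃ s, c.φ r = r ^ p + p * s) (r : Rˣ) :
    ∃ w, ((r ^ p / Units.map c.φ.toMonoidHom r : Rˣ) : R) = 1 + p * w := by
  obtain ⟨s, hs⟩ := hφ r
  have h : ((Units.map c.φ.toMonoidHom r : Rˣ) : R) = r ^ p + p * s := hs
  refine ⟨-(s * ↑(Units.map c.φ.toMonoidHom r)⁻¹), ?_⟩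
  rw [div_eq_mul_inv, Units.val_mul, Units.val_pow_eq_pow_val, eq_sub_of_add_eq h.symm, sub_mul,
    Units.mul_inv]
  ring

-- A scalar unit need not have a logarithm, but both sides depend only on `r ^ p / φ(r)`, which is
-- congruent to `1` modulo `p`. For `P ≠ 1` both are trivial; for `P = 1` both carry the index of
-- `P` in `G`.
include hE hφ in
theorem hasLog_xi_unitC (P Q : S.Cyc) (r : Rˣ) {a : S.RP E.coef.ι Q}
    (ha : E.HasLog (unitC c.ι Q (r ^ p / Units.map c.φ.toMonoidHom r) : S.RP c.ι Q) a) :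
    E.HasLog (c.xiTheta ω P (unitHom c.ι Q (unitC c.ι Q r)) : S.RP c.ι P)
      (S.beta E.coef.ι P (S.cycToConj Q a)) := by
  have ha' : a = TwGrp.C ((S.cocycle E.coef.ι).restrict Q.1) (a 1) :=
    hE.hasLog_unique ha (hasLog_C_iff Q Q _ ha)
  have h1 : S.cycToConj Q a = S.toConj (TwGrp.C (S.cocycle E.coef.ι) (a 1)) := by
    conv_lhs => rw [ha']
    exact cycToConj_single E.coef.ι Q 1 (a 1)
  have h2 : c.xiTheta ω P (unitHom c.ι Q (unitC c.ι Q r)) =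
      c.xi ω P fun C => unitC c.ι C r ^ Nat.card (S.G ⧸ C.1) := by
    rw [xiTheta_apply]
    exact congrArg (c.xi ω P) (funext fun C => theta_unitHom_C c C Q r)
  rw [h1, h2, beta_toConj_C, xi_C]
  split_ifs
  · rw [Units.val_pow_eq_pow_val]
    refine hE.hasLog_pow ?_ (hasLog_C_iff Q P _ ha) _
    obtain ⟨w, hw⟩ := unitC_div_congr hφ r
    refine ⟨TwGrp.C _ w, ?_⟩
    refine (congrArg (TwGrp.C ((S.cocycle c.ι).restrict P.1)) hw).trans ?_
    rw [map_add, map_one, map_mul, map_natCast]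
  · exact hE.hasLog_one

theorem nsmul_sub_one_div_smul {M : Type*} [AddCommGroup M] [Module ℚ M] (a b : M) :
    p • (a - (1 / p : ℚ) • b) = p • a - b := by
  have hp : (p : ℚ) ≠ 0 := by exact_mod_cast (Fact.out : p.Prime).ne_zero
  rw [smul_sub, ← Nat.cast_smul_eq_nsmul ℚ p ((1 / p : ℚ) • _), smul_smul, mul_one_div_cancel hp,
    one_smul]

-- A unit congruent to `1` modulo `p` has a logarithm `a`, so the general formula applies. As `φ`
-- commutes with the passage to conjugacy classes (`frobConj_cycToConj`), the result is expressed by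
-- `p a - φ(a)`, the logarithm of `v ^ p / φ(v)`.
include hE hR hφ hω in
theorem hasLog_xi_unit_of_congr (P Q : S.Cyc) (v : (S.RP c.ι Q)ˣ)
    (hv : ∃ w, (v : S.RP c.ι Q) = 1 + p * w) {a : S.RP E.coef.ι Q}
    (ha : E.HasLog (v : S.RP c.ι Q) a) :
    E.HasLog (c.xiTheta ω P (unitHom c.ι Q v) : S.RP c.ι P)
      (S.beta E.coef.ι P (S.cycToConj Q (p • a - E.coef.frob Q a))) := by
  let u : GL (Fin 1) (S.RG c.ι) := Units.map (Matrix.scalar (Fin 1)).toMonoidHom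
    (Units.map (TwGrp.ofSubgroup (S.cocycle c.ι) Q.1).toMonoidHom v)
  have h1 : u.1.map (RingEquiv.refl (S.RG c.ι)) =
      Matrix.scalar (Fin 1) (TwGrp.ofSubgroup (S.cocycle c.ι) Q.1 (v : S.RP c.ι Q)) := rfl
  have h2 := hasLog_xi_of_pow hE hR hφ ω hω (RingEquiv.refl (S.RG c.ι)) (unitHom c.ι Q v) one_ne_zero
    u (pow_one _).symm (fun B hBl hB => ⟨1, fun i j => ?_⟩)
    (ℓ := S.cycToConj Q a) (by
      rw [h1, one_smul]
      exact hasTrLog_ofSubgroup ha) P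
  · refine (congrArg (E.HasLog _) ?_).mp h2
    refine (map_nsmul (betaHom E.coef.ι P) p _).symm.trans ?_
    rw [nsmul_sub_one_div_smul, frobConj_cycToConj]
    refine congrArg (betaHom E.coef.ι P) ?_
    exact (map_sub (cycHom E.coef.ι Q) (p • a) _).trans
      (congrArg (· - _) (map_nsmul (cycHom E.coef.ι Q) p a)) |>.symm
  · obtain ⟨w, hw⟩ := hv
    obtain rfl : i = j := Subsingleton.elim _ _
    have h3 : ((u.1.map (RingEquiv.refl (S.RG c.ι)) - 1 :
        Matrix (Fin 1) (Fin 1) (S.RG c.ι)) ^ 1) i i =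
        p * TwGrp.ofSubgroup (S.cocycle c.ι) Q.1 w := by
      rw [pow_one, h1, hw, Matrix.sub_apply, Matrix.one_apply_eq, map_add, map_one, map_mul,
        map_natCast]
      simp
    refine (congrArg (fun y => E.mapRG y ∈ powSub p hB.subG 1) h3).mpr ?_
    refine ⟨E.mapRG (TwGrp.ofSubgroup (S.cocycle c.ι) Q.1 w), fun _ => hB.j_mem _, ?_⟩
    rw [map_mul, map_natCast, pow_one]

end Setup

/-! ### The formula for the completed localisation -/

namespace Setup

variable {p : ℕ} [Fact p.Prime] {𝒢 : Type*} [Group 𝒢] [TopologicalSpace 𝒢] {S : Setup p 𝒢}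
  {R R' : Type*} [CommRing R] [CommRing R'] [Algebra ℚ R'] {c : S.Coef R} {E : LogRing c R'}
  (hφ : ∀ r, ∃ s, c.φ r = r ^ p + p * s)

include hφ in
theorem pow_div_frob_congr {P : S.Cyc} (y : (S.RP c.ι P)ˣ) :
    ∃ w, ((y ^ p / Units.map (c.frob P).toMonoidHom y : (S.RP c.ι P)ˣ) : S.RP c.ι P) =
      1 + p * w := by
  obtain ⟨s, hs⟩ := frob_congr c hφ P (y : S.RP c.ι P)
  have h : ((Units.map (c.frob P).toMonoidHom y : (S.RP c.ι P)ˣ) : S.RP c.ι P) = y ^ p + p * s := hs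
  refine ⟨-(s * ↑(Units.map (c.frob P).toMonoidHom y)⁻¹), ?_⟩
  rw [div_eq_mul_inv, Units.val_mul, Units.val_pow_eq_pow_val, eq_sub_of_add_eq h.symm, sub_mul,
    Units.mul_inv]
  ring

/-- The homomorphism `y ↦ y ^ p / φ(y)` on the units of `R[P]^τ`. -/
def powDivFrob (c : S.Coef R) (P : S.Cyc) : (S.RP c.ι P)ˣ →* (S.RP c.ι P)ˣ :=
  powMonoidHom p / Units.map (c.frob P).toMonoidHom

theorem powDivFrob_apply (P : S.Cyc) (y : (S.RP c.ι P)ˣ) :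
    powDivFrob c P y = y ^ p / Units.map (c.frob P).toMonoidHom y := rfl

theorem powDivFrob_C (P : S.Cyc) (r : Rˣ) : powDivFrob c P (unitC c.ι P r) =
    unitC c.ι P (r ^ p / Units.map c.φ.toMonoidHom r) := by
  rw [powDivFrob_apply, map_div, map_pow]
  refine congrArg (unitC c.ι P r ^ p / ·) (Units.ext ?_)
  exact frob_C c P (r : R)

variable (hE : E.Adic) (hloc : ∀ r : R, ¬ (p : R) ∣ r → IsUnit r)
  (ω : ∀ P : S.Cyc, P.1 →* Multiplicative (ZMod p)) (hω : ∀ P : S.Cyc, P.1 ≠ ⊥ → ω P ≠ 1)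
include hφ hE hloc hω

/-- The formula for the classes of the units of `R[Q]^τ`. -/
theorem hasLog_xi_unitHom (P Q : S.Cyc) (y : (S.RP c.ι Q)ˣ) {μ : S.RP E.coef.ι Q}
    (hμ : E.HasLog (powDivFrob c Q y : S.RP c.ι Q) μ) :
    E.HasLog (c.xiTheta ω P (unitHom c.ι Q y) : S.RP c.ι P)
      (S.beta E.coef.ι P (S.cycToConj Q μ)) := by
  have hN := hE.nice
  have hc := hE.isComplete
  have hR := hE.complete.torsionFree
  obtain ⟨N, hQ⟩ := exists_pow_eq_one Q
  have hq : p ^ N ≠ 0 := pow_ne_zero _ (Fact.out : p.Prime).ne_zero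
  -- The formula is known for the scalar `r` and for `v ≡ 1` modulo `p`; the `p ^ N`-th root is
  -- taken at the end, on values congruent to `1` modulo `p`.
  obtain ⟨r, v, hv, hy⟩ := exists_units_pow_eq hE.complete hloc hQ y
  have hy' : y ^ p ^ N = unitC c.ι Q r * v := hy
  obtain ⟨a, ha⟩ := hN.exists_hasLog hc hv
  obtain ⟨b, hb⟩ := hN.exists_hasLog hc (pow_div_frob_congr hφ (unitC c.ι Q r))
  have hb' : E.HasLog (powDivFrob c Q (unitC c.ι Q r) : S.RP c.ι Q) b := hb
  have hvf : ∃ w, ((Units.map (c.frob Q).toMonoidHom v : (S.RP c.ι Q)ˣ) : S.RP c.ι Q) =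
      1 + p * w := by
    obtain ⟨w, hw⟩ := hv
    refine ⟨c.frob Q w, (congrArg (c.frob Q) hw).trans ?_⟩
    rw [map_add, map_one, map_mul, map_natCast]
  have hvp : ∃ w, ((v ^ p : (S.RP c.ι Q)ˣ) : S.RP c.ι Q) = 1 + p * w :=
    mem_oneUnits.1 (pow_mem (mem_oneUnits.2 hv) p)
  have h1 : E.HasLog (powDivFrob c Q v : S.RP c.ι Q) (p • a - E.coef.frob Q a) :=
    hN.hasLog_div hvp hvf (hN.hasLog_pow hv ha p) (hN.hasLog_frob ha)
  -- The map `y ↦ y ^ p / φ(y)` is multiplicative and limits are unique, so the given `μ` is tied to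
  -- the logarithms of the two factors.
  have h2 : p ^ N • μ = b + (p • a - E.coef.frob Q a) := by
    refine hN.hasLog_unique (hN.hasLog_pow (pow_div_frob_congr hφ y) hμ (p ^ N)) ?_
    have := hN.hasLog_mul (pow_div_frob_congr hφ (unitC c.ι Q r)) (pow_div_frob_congr hφ v) hb' h1
    refine (congrArg (fun z : S.RP c.ι Q => E.HasLog z _) ?_).mp this
    have h3 : powDivFrob c Q (unitC c.ι Q r) * powDivFrob c Q v = powDivFrob c Q y ^ p ^ N := by
      rw [← map_mul, ← hy', map_pow]
    exact congrArg Units.val h3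
  rw [powDivFrob_C] at hb'
  have h4 := hasLog_xi_unitC hN hφ ω P Q r hb'
  have h5 := hasLog_xi_unit_of_congr hN hR hφ ω hω P Q v hv ha
  have h6 := hN.hasLog_mul (xi_congr c hR hφ ω P _) (xi_congr c hR hφ ω P _) h4 h5
  refine hN.hasLog_root hq (xi_congr c hR hφ ω P _) ?_
  have h7 : c.xiTheta ω P (unitHom c.ι Q (unitC c.ι Q r)) * c.xiTheta ω P (unitHom c.ι Q v) =
      c.xiTheta ω P (unitHom c.ι Q y) ^ p ^ N := by
    rw [← map_mul, ← map_mul, ← hy', map_pow, map_pow]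
  have h8 : S.beta E.coef.ι P (S.cycToConj Q b) +
      S.beta E.coef.ι P (S.cycToConj Q (p • a - E.coef.frob Q a)) =
      p ^ N • S.beta E.coef.ι P (S.cycToConj Q μ) := by
    let F := (betaHom E.coef.ι P).comp (cycHom E.coef.ι Q)
    change F b + F _ = p ^ N • F μ
    rw [← map_add, ← h2, map_nsmul]
  rw [← h8]
  exact (congrArg (fun z : (S.RP c.ι P)ˣ => E.HasLog (z : S.RP c.ι P) _) h7).mp h6

/-- `ξ_P` is multiplicative: on `u` the general formula applies because `J` is nilpotent modulo `p`,
and on `y` the formula for units does, which contributes the last term of `L`. -/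
theorem hasLog_xi_of_isIntegralLog' {x : K1 (S.RG c.ι)} {L : S.ConjMod R'}
    (hL : E.IsIntegralLog' x L) (P : S.Cyc) :
    E.HasLog (c.xiTheta ω P x : S.RP c.ι P) (p • S.beta E.coef.ι P L) := by
  have hN := hE.nice
  have hR := hE.complete.torsionFree
  obtain ⟨n, u, y, ℓ, μ, hu, hx, hℓ, hμ, rfl⟩ := hL
  obtain ⟨N, hJ⟩ := exists_matrix_pow_dvd c.ι
  have h1 := hasLog_xi_of_pow hN hR hφ ω hω (RingEquiv.refl (S.RG c.ι)) (K1.mk u) one_ne_zero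
    u (pow_one _).symm (hE.matNil (hJ (u.1 - 1) hu)) (ℓ := ℓ) (by
      rw [one_smul]
      exact hℓ) P
  have h2 := hasLog_xi_unitHom hφ hE hloc ω hω P S.gammaBar y hμ
  have h3 := hN.hasLog_mul (xi_congr c hR hφ ω P _) (xi_congr c hR hφ ω P _) h1 h2
  have h4 : c.xiTheta ω P (K1.mk u) * c.xiTheta ω P (unitHom c.ι S.gammaBar y) =
      c.xiTheta ω P x := by
    rw [← map_mul, unitHom_eq, hx]
  have h5 : p • S.beta E.coef.ι P (ℓ - (1 / p : ℚ) • S.frobConj E.coef ℓ +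
      (1 / p : ℚ) • S.cycToConj S.gammaBar μ) =
      p • S.beta E.coef.ι P (ℓ - (1 / p : ℚ) • S.frobConj E.coef ℓ) +
        S.beta E.coef.ι P (S.cycToConj S.gammaBar μ) := by
    change p • betaHom E.coef.ι P _ = p • betaHom E.coef.ι P _ + betaHom E.coef.ι P _
    rw [map_add, smul_add, ← map_nsmul _ p ((1 / p : ℚ) • _)]
    refine congrArg (_ + betaHom E.coef.ι P ·) ?_
    have hp : (p : ℚ) ≠ 0 := by exact_mod_cast (Fact.out : p.Prime).ne_zero
    rw [← Nat.cast_smul_eq_nsmul ℚ, smul_smul, mul_one_div_cancel hp, one_smul]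
  rw [h5]
  exact (congrArg (fun z : (S.RP c.ι P)ˣ => E.HasLog (z : S.RP c.ι P) _) h4).mp h3

/-- The formula over a `p`-adically complete coefficient ring with maximal ideal `(p)`. -/
theorem formula_of_adic (ht : ∃ z, IsUnit ((c.ι z : R) - 1)) (x : K1 (S.RG c.ι)) :
    (∃! L, E.IsIntegralLog' x L) ∧
    ∀ L, E.IsIntegralLog' x L → ∀ P : S.Cyc,
      E.HasLog
        (c.alpha (ω P) (c.theta (RingEquiv.refl (S.RG c.ι)) P x) /
          c.u (fun C => c.alpha (ω C) (c.theta (RingEquiv.refl (S.RG c.ι)) C x)) P :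
          (S.RP c.ι P)ˣ).val
        (p • S.beta E.coef.ι P L) := by
  have hN := hE.nice
  have hc := hE.isComplete
  have key : ∀ L, E.IsIntegralLog' x L → ∀ P : S.Cyc,
      E.HasLog (c.xiTheta ω P x : S.RP c.ι P) (p • S.beta E.coef.ι P L) :=
    fun L hL P => hasLog_xi_of_isIntegralLog' hφ hE hloc ω hω hL P
  refine ⟨?_, fun L hL P => ?_⟩
  · obtain ⟨n, u, y, hu, hx⟩ := exists_decomposition hE.complete hloc ht x
    obtain ⟨N, hJ⟩ := exists_matrix_pow_dvd c.ι
    obtain ⟨ℓ, hℓ⟩ := hN.exists_hasTrLog hc (hE.matNil (hJ (u.1 - 1) hu))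
    obtain ⟨μ, hμ⟩ := hN.exists_hasLog hc (pow_div_frob_congr hφ y)
    have hL : E.IsIntegralLog' x _ := ⟨n, u, y, ℓ, μ, hu, hx, hℓ, hμ, rfl⟩
    -- The formula shows in particular that `L` does not depend on the decomposition `x = u y`.
    exact ⟨_, hL, fun L' hL' => eq_of_hasLog_xi hN ω (key L' hL') (key _ hL)⟩
  · rw [alpha_div_u hE.complete.torsionFree ω
      (fun C => c.theta (RingEquiv.refl (S.RG c.ι)) C x) P]
    exact key L hL P

end Setup

end Iwasawa

end

/-! ### The proposition for both coefficient rings -/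

open Iwasawa in
theorem mainTheorem6 (p : ℕ) [Fact p.Prime]
    -- `K` is a finite unramified extension of `ℚ_p`, with ring of integers `O` and Frobenius `σ`
    (K : Type*) [Field K] [CharZero K] [Algebra ℚ_[p] K] [FiniteDimensional ℚ_[p] K]
    [Algebra ℤ_[p] K] [IsScalarTower ℤ_[p] ℚ_[p] K]
    (hp : Prime (p : IntRing p K)) (σ : K →ₐ[ℚ_[p]] K)
    (hσ : ∀ a : IntRing p K, (p : IntRing p K) ∣ frobInt σ a - a ^ p)
    -- the group `𝒢`
    {𝒢 : Type*} [Group 𝒢] [TopologicalSpace 𝒢] [IsTopologicalGroup 𝒢] [CompactSpace 𝒢] [T2Space 𝒢]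
    (S : Setup p 𝒢)
    -- the chosen non-trivial characters `ω_P` of order `p`
    (ω : ∀ P : S.Cyc, P.1 →* Multiplicative (ZMod p)) (hω : ∀ P : S.Cyc, P.1 ≠ ⊥ → ω P ≠ 1) :
    -- the formula for `Λ_O(𝒢)`
    (letI c := S.iwCoef (frobInt σ)
     letI E := S.iwLog (K := K) (frobInt σ) σ.toRingHom (algebraMap (IntRing p K) K) (fun _ => rfl)
     letI ε : Iw (IntRing p K) 𝒢 ≃+* S.RG c.ι := S.iwasawaEquiv (IntRing p K)
     (∀ (P : S.Cyc) (x : (S.RP c.ι P)ˣ), ∃! y, c.IsAlpha (ω P) x y) ∧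
     ∀ x : K1 (Iw (IntRing p K) 𝒢),
      (∃! L, E.IsIntegralLog ε x L) ∧
      ∀ L, E.IsIntegralLog ε x L → ∀ P : S.Cyc,
        E.HasLog
          (c.alpha (ω P) (c.theta ε P x) / c.u (fun C => c.alpha (ω C) (c.theta ε C x)) P :
            (S.RP c.ι P)ˣ).val
          (p • S.beta E.coef.ι P L)) ∧
    -- the formula for the `p`-adic completion of `Λ_O(𝒢)_S`
    (letI c := S.hatCoef (frobInt σ) hp hσ
     letI E := S.hatLog (frobInt σ) hp hσ
     letI ε := RingEquiv.refl (S.RG c.ι)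
     (∀ (P : S.Cyc) (x : (S.RP c.ι P)ˣ), ∃! y, c.IsAlpha (ω P) x y) ∧
     ∀ x : K1 (S.RG c.ι),
      (∃! L, E.IsIntegralLog' x L) ∧
      ∀ L, E.IsIntegralLog' x L → ∀ P : S.Cyc,
        E.HasLog
          (c.alpha (ω P) (c.theta ε P x) / c.u (fun C => c.alpha (ω C) (c.theta ε C x)) P :
            (S.RP c.ι P)ˣ).val
          (p • S.beta E.coef.ι P L)) := by
  have hO := pComplete_intRing p K
  have hp0 : (p : IntRing p K) ≠ 0 := hp.ne_zero
  refine ⟨⟨fun P x => Setup.existsUnique_isAlpha _ (Setup.iw_torsionFree hp0) (ω P) x, ?_⟩,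
    ⟨fun P x => Setup.existsUnique_isAlpha _ (Setup.hatLog_adic hp hσ).complete.torsionFree
      (ω P) x, ?_⟩⟩
  · have hk := finite_intRing_quotient p K
    have hprime : (Ideal.span {(p : IntRing p K)}).IsPrime :=
      (Ideal.span_singleton_prime hp0).2 hp
    -- Since `p` is prime in `O`, the finite ring `O/p` is a domain, hence a field; it plays the
    -- role of the residue field.
    let _ : Field (IntRing p K ⧸ Ideal.span {(p : IntRing p K)}) :=
      (Finite.isDomain_to_isField _).toField
    have hchar : CharP (IntRing p K ⧸ Ideal.span {(p : IntRing p K)}) p := by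
      refine (CharP.charP_iff_prime_eq_zero Fact.out).2 ?_
      rw [← map_natCast (Ideal.Quotient.mk _), Ideal.Quotient.eq_zero_iff_mem]
      exact Ideal.mem_span_singleton_self _
    exact Setup.formula_iwasawa S hO hp0 (K := K) (σ := frobInt σ)
      (σK := σ.toRingHom) (i := algebraMap (IntRing p K) K) (q := Ideal.Quotient.mk (Ideal.span {(p : IntRing p K)}))
      (fun a ha => Ideal.mem_span_singleton.1 (Ideal.Quotient.eq_zero_iff_mem.1 ha))
      Ideal.Quotient.mk_surjective (fun _ => rfl) Subtype.val_injective hσ ω hω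
  · exact Setup.formula_of_adic (Setup.hatCoef_frob hp hσ) (Setup.hatLog_adic hp hσ)
      (Setup.hatRing_isUnit hp) ω hω (Setup.exists_isUnit_hat_sub_one hp hσ)
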